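/- Let $G=(V,E)$ be a finite simple undirected graph with $n\ge 2$ vertices and $m$ edges. A vertex cut of $G$ is a partition $(L,S,R)$ of $V$ with $L,R\neq\emptyset$ and no edge between $L$ and $R$, where the sides are named so that $|L|\le|R|$; its size is $|S|$. For a natural number $k$, put $V_{\mathrm{low}}=\{v\in V:\deg(v)\le 8k\}$. A vertex cut $(L,S,R)$ is a $k$-scratch if $|S|<k$, $|L|\le k/(100\log_2 n)$ and $|S\cap V_{\mathrm{low}}|\ge 300|L|\ln n$; it is a $k$-non-scratch if $|S|<k$ and it is not a $k$-scratch. For every constant $a$ there are a randomized algorithm (a fixed program for a word RAM with fair coin flips and words of $O(\log(n+k))$ bits, which may call an arbitrary correct procedure for integral $s$-$t$ maximum flow in simple undirected graphs with unit vertex capacities, $s,t$ non-adjacent) and constants $C,d$ such that, for every $G$ given by adjacency lists and every $k$ with $m\le nk$: 1. for every outcome of the coin flips the algorithm halts and, if $G$ has a vertex cut at all (that is, $G$ is not complete), returns a vertex cut of $G$; 2. if $G$ has a $k$-non-scratch, then the returned vertex cut has size less than $k$ with probability at least $1-n^{-a}$; 3. for every outcome of the coin flips, the total number of vertices and edges of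 the graphs on which maximum flow is called is at most $C\,m\log_2^5 n$, and the additional time (outside the maximum flow calls) is at most $C\,(m+1)\log_2^d n$. -/

import Mathlib

/-! ## Vertex cuts, scratches and non-scratches -/

section Cuts

variable {V : Type*} [Fintype V] [DecidableEq V]

/-- `(L, S, R)` is a vertex cut of `G`: a partition of the vertex set with `L` and `R` non-empty and
no edge between `L` and `R`, where the two sides are named so that `|L| ≤ |R|`. -/
structure IsVertexCut (G : SimpleGraph V) (L S R : Finset V) : Prop where
  disjoint_LS : Disjoint L S
  disjoint_LR : Disjoint L R
  disjoint_SR : Disjoint S R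
  cover : L ∪ S ∪ R = Finset.univ
  nonempty_L : L.Nonempty
  nonempty_R : R.Nonempty
  no_edge : ∀ x ∈ L, ∀ y ∈ R, ¬ G.Adj x y
  card_le : L.card ≤ R.card

/-- The vertices of degree at most `8k`. -/
def lowDegree (G : SimpleGraph V) [DecidableRel G.Adj] (k : ℕ) : Finset V :=
  Finset.univ.filter fun v => G.degree v ≤ 8 * k

/-- A `k`-scratch. -/
def IsScratch (G : SimpleGraph V) [DecidableRel G.Adj] (k : ℕ) (L S R : Finset V) : Prop :=
  IsVertexCut G L S R ∧ S.card < k ∧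
    (L.card : ℝ) ≤ k / (100 * Real.logb 2 (Fintype.card V)) ∧
    300 * (L.card : ℝ) * Real.log (Fintype.card V) ≤ ((S ∩ lowDegree G k).card : ℝ)

/-- A `k`-non-scratch: a vertex cut of size less than `k` that is not a `k`-scratch. -/
def IsNonScratch (G : SimpleGraph V) [DecidableRel G.Adj] (k : ℕ) (L S R : Finset V) : Prop :=
  IsVertexCut G L S R ∧ S.card < k ∧ ¬ IsScratch G k L S R

end Cuts

/-! ## Maximum flow in undirected graphs with unit vertex capacities -/

/-- An `s`-`t` flow instance: `N` vertices `0, …, N - 1` and `M` undirected edges, the `i`-th one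
joining `tail i` and `head i`. -/
structure FlowInstance where
  N : ℕ
  M : ℕ
  tail : Fin M → ℕ
  head : Fin M → ℕ
  s : ℕ
  t : ℕ

namespace FlowInstance

/-- The edges form a simple graph on the `N` vertices, and `s`, `t` are distinct non-adjacent
vertices of it. -/
structure Valid (I : FlowInstance) : Prop where
  s_lt : I.s < I.N
  t_lt : I.t < I.N
  s_ne_t : I.s ≠ I.t
  tail_lt : ∀ i, I.tail i < I.N
  head_lt : ∀ i, I.head i < I.N
  no_loop : ∀ i, I.tail i ≠ I.head i
  simple : ∀ i j, s(I.tail i, I.head i) = s(I.tail j, I.head j) → i = j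
  not_adj : ∀ i, s(I.tail i, I.head i) ≠ s(I.s, I.t)

/-- Flow entering `x`. A positive value `f i` is flow from `tail i` to `head i`, a negative one is
flow from `head i` to `tail i`. -/
def inflow (I : FlowInstance) (f : Fin I.M → ℤ) (x : ℕ) : ℤ :=
  ∑ i, ((if I.head i = x then max (f i) 0 else 0) + (if I.tail i = x then max (-f i) 0 else 0))

/-- Flow leaving `x`. -/
def outflow (I : FlowInstance) (f : Fin I.M → ℤ) (x : ℕ) : ℤ :=
  ∑ i, ((if I.tail i = x then max (f i) 0 else 0) + (if I.head i = x then max (-f i) 0 else 0))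

/-- Integral `s`-`t` flows in which every vertex other than `s`, `t` has capacity one. (As `s` and
`t` are not adjacent, the bound on the single edges follows from the vertex capacities.) -/
structure IsFlow (I : FlowInstance) (f : Fin I.M → ℤ) : Prop where
  edge : ∀ i, |f i| ≤ 1
  conservation : ∀ x < I.N, x ≠ I.s → x ≠ I.t → I.inflow f x = I.outflow f x
  capacity : ∀ x < I.N, x ≠ I.s → x ≠ I.t → I.inflow f x ≤ 1

def value (I : FlowInstance) (f : Fin I.M → ℤ) : ℤ :=
  I.outflow f I.s - I.inflow f I.s

def IsMaxFlow (I : FlowInstance) (f : Fin I.M → ℤ) : Prop :=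
  I.IsFlow f ∧ ∀ g, I.IsFlow g → I.value g ≤ I.value f

end FlowInstance

/-- A procedure that assigns to each flow instance a function on its edges. -/
abbrev FlowOracle : Type := (I : FlowInstance) → Fin I.M → ℤ

/-- The procedure returns some maximum flow on each valid instance. -/
def FlowOracle.Correct (O : FlowOracle) : Prop :=
  ∀ I : FlowInstance, I.Valid → I.IsMaxFlow (O I)

/-! ## A randomized word RAM with access to a maximum flow procedure

A program is a finite text. It works on variables and on zero-initialized arrays, all of which hold
words, that is, natural numbers below `2 ^ w`. -/

namespace RAM

inductive BinOp
  | add | sub | mul | div | mod | lt | eq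

/-- The value of an operation before reduction to a word; `sub` is truncated at `0`. -/
def BinOp.apply : BinOp → ℕ → ℕ → ℕ
  | .add, a, b => a + b
  | .sub, a, b => a - b
  | .mul, a, b => a * b
  | .div, a, b => a / b
  | .mod, a, b => a % b
  | .lt, a, b => if a < b then 1 else 0
  | .eq, a, b => if a = b then 1 else 0

inductive Expr
  | const (c : ℕ)
  | var (x : ℕ)
  | read (a : ℕ) (i : Expr)
  | bin (op : BinOp) (e₁ e₂ : Expr)

/-- The number of elementary operations in the evaluation of an expression. -/
def Expr.cost : Expr → ℕ
  | .const _ => 1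
  | .var _ => 1
  | .read _ i => i.cost + 1
  | .bin _ e₁ e₂ => e₁.cost + e₂.cost + 1

inductive Prog
  | skip
  /-- set a variable -/
  | assign (x : ℕ) (e : Expr)
  /-- write the value of `e` into cell `i` of array `a` -/
  | store (a : ℕ) (i e : Expr)
  | seq (p q : Prog)
  | ite (e : Expr) (p q : Prog)
  | loop (e : Expr) (p : Prog)
  /-- set a variable to a fair random bit -/
  | flip (x : ℕ)
  /-- call the maximum flow procedure on the instance with `eN` vertices, source `es`, sink `et` and
  `eM` edges whose ends are listed in the arrays `aTail` and `aHead`; the flow goes to `aFlow` -/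
  | maxflow (eN eM es et : Expr) (aTail aHead aFlow : ℕ)

/-- Memory, together with the number of random bits used so far, the time spent so far outside the
maximum flow calls, and the total number of vertices and edges of the calls made so far. -/
structure State where
  vars : ℕ → ℕ
  mem : ℕ → ℕ → ℕ
  coins : ℕ
  time : ℕ
  flowSize : ℕ

/-- Evaluation with words of `w` bits. -/
def Expr.eval (w : ℕ) (σ : State) : Expr → ℕ
  | .const c => c % 2 ^ w
  | .var x => σ.vars x
  | .read a i => σ.mem a (i.eval w σ)
  | .bin op e₁ e₂ => op.apply (e₁.eval w σ) (e₂.eval w σ) % 2 ^ w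

def State.tick (σ : State) (c : ℕ) : State := { σ with time := σ.time + c }

def State.setVar (σ : State) (x v : ℕ) : State := { σ with vars := Function.update σ.vars x v }

def State.setCell (σ : State) (a i v : ℕ) : State :=
  { σ with mem := Function.update σ.mem a (Function.update (σ.mem a) i v) }

/-- The flow instance described by the memory. -/
def instanceOf (w : ℕ) (σ : State) (eN eM es et : Expr) (aTail aHead : ℕ) : FlowInstance where
  N := eN.eval w σ
  M := eM.eval w σ
  tail i := σ.mem aTail i
  head i := σ.mem aHead i
  s := es.eval w σ
  t := et.eval w σ

/-- The word that reports the flow on one edge: `0` for no flow, `1` for flow from the tail to the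
head, `2` for flow from the head to the tail. -/
def flowWord (z : ℤ) : ℕ := if z = 0 then 0 else if 0 < z then 1 else 2

/-- The state after the maximum flow procedure has reported its answer in array `aFlow`. -/
def State.report (σ : State) (O : FlowOracle) (I : FlowInstance) (aFlow : ℕ) : State :=
  { σ with
    mem := Function.update σ.mem aFlow
      (fun i => if h : i < I.M then flowWord (O I ⟨i, h⟩) else σ.mem aFlow i)
    flowSize := σ.flowSize + I.N + I.M }

/-- `Exec w O ω p σ σ'`: with words of `w` bits, maximum flow procedure `O` and random bits `ω`, the
program `p` started in `σ` halts in `σ'`. A program that calls `O` on an invalid instance does not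
halt properly. -/
inductive Exec (w : ℕ) (O : FlowOracle) (ω : ℕ → Bool) : Prog → State → State → Prop
  | skip (σ : State) : Exec w O ω .skip σ σ
  | assign (σ : State) (x : ℕ) (e : Expr) :
      Exec w O ω (.assign x e) σ ((σ.setVar x (e.eval w σ)).tick (e.cost + 1))
  | store (σ : State) (a : ℕ) (i e : Expr) :
      Exec w O ω (.store a i e) σ
        ((σ.setCell a (i.eval w σ) (e.eval w σ)).tick (i.cost + e.cost + 1))
  | seq (p q : Prog) (σ τ υ : State) :
      Exec w O ω p σ τ → Exec w O ω q τ υ → Exec w O ω (.seq p q) σ υ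
  | iteTrue (e : Expr) (p q : Prog) (σ τ : State) :
      e.eval w σ ≠ 0 → Exec w O ω p (σ.tick (e.cost + 1)) τ → Exec w O ω (.ite e p q) σ τ
  | iteFalse (e : Expr) (p q : Prog) (σ τ : State) :
      e.eval w σ = 0 → Exec w O ω q (σ.tick (e.cost + 1)) τ → Exec w O ω (.ite e p q) σ τ
  | loopTrue (e : Expr) (p : Prog) (σ τ υ : State) :
      e.eval w σ ≠ 0 → Exec w O ω p (σ.tick (e.cost + 1)) τ →
      Exec w O ω (.loop e p) τ υ → Exec w O ω (.loop e p) σ υ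
  | loopFalse (e : Expr) (p : Prog) (σ : State) :
      e.eval w σ = 0 → Exec w O ω (.loop e p) σ (σ.tick (e.cost + 1))
  | flip (σ : State) (x : ℕ) :
      Exec w O ω (.flip x) σ
        (({ σ with coins := σ.coins + 1 }.setVar x (ω σ.coins).toNat).tick 1)
  | maxflow (σ : State) (eN eM es et : Expr) (aTail aHead aFlow : ℕ) :
      (instanceOf w σ eN eM es et aTail aHead).Valid →
      Exec w O ω (.maxflow eN eM es et aTail aHead aFlow) σ
        ((σ.report O (instanceOf w σ eN eM es et aTail aHead) aFlow).tick
          (eN.cost + eM.cost + es.cost + et.cost + 1))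

/-- The final state is determined by the program, the start, the oracle and the random bits. -/
theorem Exec.deterministic {w : ℕ} {O : FlowOracle} {ω : ℕ → Bool} {p : Prog} {σ τ τ' : State}
    (h : Exec w O ω p σ τ) (h' : Exec w O ω p σ τ') : τ = τ' := by
  induction h generalizing τ' with
  | skip => cases h'; rfl
  | assign => cases h'; rfl
  | store => cases h'; rfl
  | seq p q σ τ υ _ _ ih₁ ih₂ =>
    cases h' with
    | seq _ _ _ _ _ h₁ h₂ => cases ih₁ h₁; exact ih₂ h₂
  | iteTrue e p q σ τ hc _ ih =>
    cases h' with
    | iteTrue _ _ _ _ _ _ h => exact ih h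
    | iteFalse _ _ _ _ _ h₀ _ => exact absurd h₀ hc
  | iteFalse e p q σ τ hc _ ih =>
    cases h' with
    | iteTrue _ _ _ _ _ h₀ _ => exact absurd hc h₀
    | iteFalse _ _ _ _ _ _ h => exact ih h
  | loopTrue e p σ τ υ hc _ _ ih₁ ih₂ =>
    cases h' with
    | loopTrue _ _ _ _ _ _ h₁ h₂ => cases ih₁ h₁; exact ih₂ h₂
    | loopFalse _ _ _ h₀ => exact absurd h₀ hc
  | loopFalse e p σ hc =>
    cases h' with
    | loopTrue _ _ _ _ _ h₀ _ _ => exact absurd hc h₀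
    | loopFalse => rfl
  | flip => cases h'; rfl
  | maxflow => cases h'; rfl

/-- Independent fair random bits. -/
noncomputable def coinMeasure : MeasureTheory.Measure (ℕ → Bool) :=
  MeasureTheory.Measure.infinitePi fun _ => (PMF.uniformOfFintype Bool).toMeasure

/-- The arrays `off`, `adj` hold adjacency lists of `G`: the neighbours of `v`, each exactly once and
in any order, are the entries `adj i` with `off v ≤ i < off (v + 1)`. -/
structure IsAdjacencyList {n : ℕ} (G : SimpleGraph (Fin n)) (off adj : ℕ → ℕ) : Prop where
  off_zero : off 0 = 0
  off_mono : ∀ v : Fin n, off v ≤ off (v + 1)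
  entry_lt : ∀ i < off n, adj i < n
  mem_iff : ∀ v u : Fin n, G.Adj v u ↔ ∃ i, off v ≤ i ∧ i < off (v + 1) ∧ adj i = u
  entry_inj : ∀ v : Fin n, ∀ i j, off v ≤ i → i < off (v + 1) → off v ≤ j → j < off (v + 1) →
    adj i = adj j → i = j
  off_junk : ∀ i, n < i → off i = 0
  adj_junk : ∀ i, off n ≤ i → adj i = 0

/-- The start of a computation on a graph with `n` vertices and parameter `k`: variables `0` and `1`
hold `n` and `k`, arrays `0` and `1` hold the adjacency lists. -/
def initState (n k : ℕ) (off adj : ℕ → ℕ) : State where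
  vars x := if x = 0 then n else if x = 1 then k else 0
  mem a := if a = 0 then off else if a = 1 then adj else fun _ => 0
  coins := 0
  time := 0
  flowSize := 0

/-- The output is read from array `2`: an entry `1` puts a vertex into `L`. -/
def State.outL (σ : State) (n : ℕ) : Finset (Fin n) :=
  Finset.univ.filter fun v => σ.mem 2 v = 1

/-- An entry `2` puts a vertex into `S`. -/
def State.outS (σ : State) (n : ℕ) : Finset (Fin n) :=
  Finset.univ.filter fun v => σ.mem 2 v = 2

/-- Any other entry puts a vertex into `R`. -/
def State.outR (σ : State) (n : ℕ) : Finset (Fin n) :=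
  Finset.univ.filter fun v => σ.mem 2 v ≠ 1 ∧ σ.mem 2 v ≠ 2

end RAM

/-! ## A program logic for the word RAM -/

namespace RAM

/-! Let ℓ be the binary logarithm of n, rounded up. A non-scratch (L, S, R) is balanced with respect
to W = V or to W = V_low: L ⊆ W, |S ∩ W| ≤ 300ℓ|L| and |L| ≤ |R ∩ W| (`IsNonScratch.cases`). If L is
large, |S| < k is enough for W = V. If L is small, S has few vertices of low degree because the cut
is no scratch. All neighbours of a vertex of L lie in L ∪ S, so L consists of vertices of low
degree. As m ≤ nk, at least three quarters of all vertices have low degree, so R gets its share.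

Keep each vertex of W with probability p = 2^(-lev), where 2^lev is about 604ℓ|L| up to a factor 2.
Fix D ⊆ R ∩ W with |D| = |L|. With probability of order 1/ℓ², exactly one vertex x of L, exactly one
of D and none of S ∩ W are kept (`le_blockMeasure_isolating`). Neither |L| nor the right W is known,
so the rounds run cyclically through both choices of W and 14ℓ levels. Each combination recurs of
order (a+1)ℓ³ times with disjoint blocks of coins, and all of its rounds fail with probability at
most exp(-(a+1)ℓ) ≤ n^(-a) (`coinMeasure_goodRound`).

In a good round, L isolates the terminal x: it contains no other terminal, its boundary contains
none, and some terminal lies on the other side. A cut that is as small is found for all terminals at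
once by isolating cuts. The terminals are first thinned to an independent set. For each bit of the
vertex names, one minimum vertex cut separates the terminals with bit 1 from those with bit 0.
Outside these ℓ separators every vertex is labelled by the sides that it is on, and the vertices
with label x form the region of x. By submodularity of vertex boundaries an isolating set of x can
be shrunk into this region without enlarging its boundary (`bdry_submodular`, `Isolates.split`,
`RegionInv.succ`).

One last flow cuts all regions simultaneously. Each region, together with private copies of its
outer boundary vertices, forms a piece; all centres are contracted to the source, and all copies are
joined to the sink. The minimum cut of the union is minimum in every piece
(`card_bdry_pieceSide_le`, `card_piece_le`). A piece with fewer than k cut vertices yields a vertex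
cut of size below k (`run_extractCut`). The instances of one round have total size O(ℓ(n + m)). As
there are O(ℓ⁴) rounds and n ≤ 2m once isolated vertices are excluded, the total is O(m ℓ⁵).

Minimum vertex cuts come from maximum flows by a search of the residual network with split vertices.
If the sink were reachable, a shortest residual path would augment the flow (`exists_aug`,
`Aug.improve`), so the reached part gives a cut whose size is the flow value
(`IsMaxFlow.exists_minCut`).

Every outcome yields a vertex cut, since an isolated vertex or a vertex that misses another one is
cut off before the rounds start, and a round overwrites the output only by a cut of size below k.

The program itself is treated by a small Hoare-style calculus: `Run` asserts a time-bounded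
execution, `run_go` executes loop-free code symbolically, `run_loop` and `run_for` handle loops, and
`Exec.frame` tells what stays unchanged. -/

/-- A state of the machine without the clock. -/
structure Cfg where
  v : ℕ → ℕ
  m : ℕ → ℕ → ℕ
  c : ℕ
  f : ℕ

namespace Cfg

def st (κ : Cfg) (T : ℕ) : State := ⟨κ.v, κ.m, κ.c, T, κ.f⟩

def setV (κ : Cfg) (x a : ℕ) : Cfg := { κ with v := Function.update κ.v x a }

def setM (κ : Cfg) (a i b : ℕ) : Cfg :=
  { κ with m := Function.update κ.m a (Function.update (κ.m a) i b) }

def toss (κ : Cfg) (ω : ℕ → Bool) (x : ℕ) : Cfg :=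
  ⟨Function.update κ.v x (ω κ.c).toNat, κ.m, κ.c + 1, κ.f⟩

@[simp] theorem setV_v (κ : Cfg) (x a y : ℕ) : (κ.setV x a).v y = if y = x then a else κ.v y := by
  simp [setV, Function.update_apply]
@[simp] theorem setV_m (κ : Cfg) (x a : ℕ) : (κ.setV x a).m = κ.m := rfl
@[simp] theorem setV_c (κ : Cfg) (x a : ℕ) : (κ.setV x a).c = κ.c := rfl
@[simp] theorem setV_f (κ : Cfg) (x a : ℕ) : (κ.setV x a).f = κ.f := rfl
@[simp] theorem setM_v (κ : Cfg) (a i b : ℕ) : (κ.setM a i b).v = κ.v := rfl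
@[simp] theorem setM_c (κ : Cfg) (a i b : ℕ) : (κ.setM a i b).c = κ.c := rfl
@[simp] theorem setM_f (κ : Cfg) (a i b : ℕ) : (κ.setM a i b).f = κ.f := rfl
@[simp] theorem setM_m (κ : Cfg) (a i b a' j : ℕ) :
    (κ.setM a i b).m a' j = if a' = a ∧ j = i then b else κ.m a' j := by
  by_cases h : a' = a
  · subst h; simp [setM, Function.update_apply]
  · simp [setM, h]
@[simp] theorem toss_v (κ : Cfg) (ω : ℕ → Bool) (x y : ℕ) :
    (κ.toss ω x).v y = if y = x then (ω κ.c).toNat else κ.v y := by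
  simp [toss, Function.update_apply]
@[simp] theorem toss_m (κ : Cfg) (ω : ℕ → Bool) (x : ℕ) : (κ.toss ω x).m = κ.m := rfl
@[simp] theorem toss_c (κ : Cfg) (ω : ℕ → Bool) (x : ℕ) : (κ.toss ω x).c = κ.c + 1 := rfl
@[simp] theorem toss_f (κ : Cfg) (ω : ℕ → Bool) (x : ℕ) : (κ.toss ω x).f = κ.f := rfl
@[simp] theorem ite_v (p : Prop) [Decidable p] (κ κ' : Cfg) (x : ℕ) :
    (if p then κ else κ').v x = if p then κ.v x else κ'.v x := by split_ifs <;> rfl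
@[simp] theorem ite_c (p : Prop) [Decidable p] (κ κ' : Cfg) :
    (if p then κ else κ').c = if p then κ.c else κ'.c := by split_ifs <;> rfl

end Cfg

/-- The value of an expression when no operation overflows. -/
@[simp] def Expr.val (κ : Cfg) : Expr → ℕ
  | .const c => c
  | .var x => κ.v x
  | .read a i => κ.m a (i.val κ)
  | .bin op e₁ e₂ => op.apply (e₁.val κ) (e₂.val κ)

@[simp] def BinOp.Fits (W : ℕ) : BinOp → ℕ → ℕ → Prop
  | .add, a, b => a + b < W
  | .mul, a, b => a * b < W
  | .sub, a, _ => a < W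
  | .div, a, _ => a < W
  | .mod, a, _ => a < W
  | .lt, _, _ => True
  | .eq, _, _ => True

/-- No operation in the evaluation of the expression reaches `W`. -/
@[simp] def Expr.Fits (W : ℕ) (κ : Cfg) : Expr → Prop
  | .const c => c < W
  | .var _ => True
  | .read _ i => i.Fits W κ
  | .bin op e₁ e₂ => e₁.Fits W κ ∧ e₂.Fits W κ ∧ op.Fits W (e₁.val κ) (e₂.val κ)

attribute [simp] BinOp.apply

/-- The bound W depends on the graph and not on w, so overflow is excluded by one comparison W ≤ 2^w
at the very end. Comparisons return 0 or 1, hence 1 < W. -/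
theorem Expr.eval_eq_val {w W : ℕ} (hW : W ≤ 2 ^ w) (h1 : 1 < W) (κ : Cfg) (T : ℕ) (e : Expr)
    (h : e.Fits W κ) : e.eval w (κ.st T) = e.val κ := by
  induction e with
  | const c => exact Nat.mod_eq_of_lt (lt_of_lt_of_le h hW)
  | var x => rfl
  | read a i ih => simp only [Expr.eval, Expr.val, ih h]; rfl
  | bin op e₁ e₂ ih₁ ih₂ =>
    simp only [Expr.eval, Expr.val, ih₁ h.1, ih₂ h.2.1]
    apply Nat.mod_eq_of_lt
    have h3 := h.2.2
    cases op <;> simp only [BinOp.Fits] at h3 <;> simp only [BinOp.apply]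
    · omega
    · omega
    · omega
    · exact lt_of_le_of_lt (Nat.div_le_self _ _) (lt_of_lt_of_le h3 hW)
    · exact lt_of_le_of_lt (Nat.mod_le _ _) (lt_of_lt_of_le h3 hW)
    · split_ifs <;> omega
    · split_ifs <;> omega

/-- The program leads from `κ` to `κ'` within time `t`. -/
def Run (w : ℕ) (O : FlowOracle) (ω : ℕ → Bool) (p : Prog) (κ : Cfg) (t : ℕ) (κ' : Cfg) : Prop :=
  ∀ T, ∃ T' ≤ T + t, Exec w O ω p (κ.st T) (κ'.st T')

namespace Prog

/-- Upper bound for the running time of a program without loops. -/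
def cost : Prog → ℕ
  | .skip => 0
  | .assign _ e => e.cost + 1
  | .store _ i e => i.cost + e.cost + 1
  | .seq p q => p.cost + q.cost
  | .ite e p q => e.cost + 1 + max p.cost q.cost
  | .loop _ _ => 0
  | .flip _ => 1
  | .maxflow _ _ _ _ _ _ _ => 0

/-- The variables that the program may change. -/
def wv : Prog → List ℕ
  | .skip => []
  | .assign x _ => [x]
  | .store _ _ _ => []
  | .seq p q => p.wv ++ q.wv
  | .ite _ p q => p.wv ++ q.wv
  | .loop _ p => p.wv
  | .flip x => [x]
  | .maxflow _ _ _ _ _ _ _ => []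

/-- The arrays that the program may change. -/
def wa : Prog → List ℕ
  | .skip => []
  | .assign _ _ => []
  | .store a _ _ => [a]
  | .seq p q => p.wa ++ q.wa
  | .ite _ p q => p.wa ++ q.wa
  | .loop _ p => p.wa
  | .flip _ => []
  | .maxflow _ _ _ _ _ _ a => [a]

def noFlip : Prog → Bool
  | .seq p q => p.noFlip && q.noFlip
  | .ite _ p q => p.noFlip && q.noFlip
  | .loop _ p => p.noFlip
  | .flip _ => false
  | _ => true

def noFlow : Prog → Bool
  | .seq p q => p.noFlow && q.noFlow
  | .ite _ p q => p.noFlow && q.noFlow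
  | .loop _ p => p.noFlow
  | .maxflow _ _ _ _ _ _ _ => false
  | _ => true

/-- The effect of a program without loops and maximum flow calls. -/
@[simp] def go (ω : ℕ → Bool) : Prog → Cfg → Cfg
  | .skip, κ => κ
  | .assign x e, κ => κ.setV x (e.val κ)
  | .store a i e, κ => κ.setM a (i.val κ) (e.val κ)
  | .seq p q, κ => q.go ω (p.go ω κ)
  | .ite e p q, κ => if e.val κ ≠ 0 then p.go ω κ else q.go ω κ
  | .loop _ _, κ => κ
  | .flip x, κ => κ.toss ω x
  | .maxflow _ _ _ _ _ _ _, κ => κ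

/-- The program has no loops and maximum flow calls, and no operation reaches `W`. -/
@[simp] def Safe (W : ℕ) (ω : ℕ → Bool) : Prog → Cfg → Prop
  | .skip, _ => True
  | .assign _ e, κ => e.Fits W κ
  | .store _ i e, κ => i.Fits W κ ∧ e.Fits W κ
  | .seq p q, κ => p.Safe W ω κ ∧ q.Safe W ω (p.go ω κ)
  | .ite e p q, κ => e.Fits W κ ∧ (e.val κ ≠ 0 → p.Safe W ω κ) ∧ (e.val κ = 0 → q.Safe W ω κ)
  | .loop _ _, _ => False
  | .flip _, _ => True
  | .maxflow _ _ _ _ _ _ _, _ => False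

end Prog

/-- Only the listed variables and arrays have changed. -/
structure Frame (vs as : List ℕ) (κ κ' : Cfg) : Prop where
  v : ∀ x, x ∉ vs → κ'.v x = κ.v x
  m : ∀ a, a ∉ as → κ'.m a = κ.m a

theorem Frame.refl (vs as : List ℕ) (κ : Cfg) : Frame vs as κ κ := ⟨fun _ _ => rfl, fun _ _ => rfl⟩

theorem Frame.trans {vs as : List ℕ} {κ κ' κ'' : Cfg} (h : Frame vs as κ κ')
    (h' : Frame vs as κ' κ'') : Frame vs as κ κ'' :=
  ⟨fun x hx => (h'.v x hx).trans (h.v x hx), fun a ha => (h'.m a ha).trans (h.m a ha)⟩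

theorem Frame.mono {vs as vs' as' : List ℕ} {κ κ' : Cfg} (h : Frame vs as κ κ')
    (hv : ∀ x ∈ vs, x ∈ vs') (ha : ∀ a ∈ as, a ∈ as') : Frame vs' as' κ κ' :=
  ⟨fun x hx => h.v x fun h' => hx (hv x h'), fun a h1 => h.m a fun h' => h1 (ha a h')⟩

/-- The write sets are computed from the program text. For concrete programs, "this variable is
untouched" therefore becomes a decidable membership question, which is how values are carried from
one phase to the next. -/
theorem Exec.frame {w : ℕ} {O : FlowOracle} {ω : ℕ → Bool} {p : Prog} {σ τ : State}
    (h : Exec w O ω p σ τ) :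
    (∀ x, x ∉ p.wv → τ.vars x = σ.vars x) ∧ (∀ a, a ∉ p.wa → τ.mem a = σ.mem a) ∧
      (p.noFlip = true → τ.coins = σ.coins) ∧ (p.noFlow = true → τ.flowSize = σ.flowSize) := by
  induction h with
  | skip => simp
  | assign σ x e =>
    refine ⟨fun y hy => ?_, fun _ _ => rfl, fun _ => rfl, fun _ => rfl⟩
    simp only [Prog.wv, List.mem_singleton] at hy
    simp [State.tick, State.setVar, hy]
  | store σ b i e =>
    refine ⟨fun _ _ => rfl, fun y hy => ?_, fun _ => rfl, fun _ => rfl⟩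
    simp only [Prog.wa, List.mem_singleton] at hy
    simp [State.tick, State.setCell, hy]
  | seq p q σ τ υ _ _ ih₁ ih₂ =>
    simp only [Prog.wv, Prog.wa, Prog.noFlip, Prog.noFlow, List.mem_append, not_or,
      Bool.and_eq_true]
    exact ⟨fun x hx => (ih₂.1 x hx.2).trans (ih₁.1 x hx.1),
      fun x hx => (ih₂.2.1 x hx.2).trans (ih₁.2.1 x hx.1),
      fun hx => (ih₂.2.2.1 hx.2).trans (ih₁.2.2.1 hx.1),
      fun hx => (ih₂.2.2.2 hx.2).trans (ih₁.2.2.2 hx.1)⟩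
  | iteTrue e p q σ τ _ _ ih =>
    simp only [Prog.wv, Prog.wa, Prog.noFlip, Prog.noFlow, List.mem_append, not_or,
      Bool.and_eq_true]
    exact ⟨fun x hx => ih.1 x hx.1, fun x hx => ih.2.1 x hx.1, fun hx => ih.2.2.1 hx.1,
      fun hx => ih.2.2.2 hx.1⟩
  | iteFalse e p q σ τ _ _ ih =>
    simp only [Prog.wv, Prog.wa, Prog.noFlip, Prog.noFlow, List.mem_append, not_or,
      Bool.and_eq_true]
    exact ⟨fun x hx => ih.1 x hx.2, fun x hx => ih.2.1 x hx.2, fun hx => ih.2.2.1 hx.2,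
      fun hx => ih.2.2.2 hx.2⟩
  | loopTrue e p σ τ υ _ _ _ ih₁ ih₂ =>
    exact ⟨fun x hx => (ih₂.1 x hx).trans (ih₁.1 x hx),
      fun x hx => (ih₂.2.1 x hx).trans (ih₁.2.1 x hx),
      fun hx => (ih₂.2.2.1 hx).trans (ih₁.2.2.1 hx),
      fun hx => (ih₂.2.2.2 hx).trans (ih₁.2.2.2 hx)⟩
  | loopFalse => exact ⟨fun _ _ => rfl, fun _ _ => rfl, fun _ => rfl, fun _ => rfl⟩
  | flip σ x =>
    refine ⟨fun y hy => ?_, fun _ _ => rfl, fun h => by simp [Prog.noFlip] at h, fun _ => rfl⟩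
    simp only [Prog.wv, List.mem_singleton] at hy
    simp [State.tick, State.setVar, hy]
  | maxflow σ eN eM es et aT aH aF _ =>
    refine ⟨fun _ _ => rfl, fun y hy => ?_, fun _ => rfl, fun h => by simp [Prog.noFlow] at h⟩
    simp only [Prog.wa, List.mem_singleton] at hy
    simp [State.tick, State.report, hy]

section Rules

variable {w W : ℕ} {O : FlowOracle} {ω : ℕ → Bool}

theorem Run.frame {p : Prog} {κ κ' : Cfg} {t : ℕ} (h : Run w O ω p κ t κ') :
    Frame p.wv p.wa κ κ' := by
  obtain ⟨T', _, h'⟩ := h 0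
  exact ⟨h'.frame.1, h'.frame.2.1⟩

theorem Run.coins {p : Prog} {κ κ' : Cfg} {t : ℕ} (h : Run w O ω p κ t κ')
    (hp : p.noFlip = true) : κ'.c = κ.c := by
  obtain ⟨T', _, h'⟩ := h 0
  exact h'.frame.2.2.1 hp

theorem Run.flow {p : Prog} {κ κ' : Cfg} {t : ℕ} (h : Run w O ω p κ t κ')
    (hp : p.noFlow = true) : κ'.f = κ.f := by
  obtain ⟨T', _, h'⟩ := h 0
  exact h'.frame.2.2.2 hp

theorem Run.mono {p : Prog} {κ κ' : Cfg} {t t' : ℕ} (h : Run w O ω p κ t κ') (ht : t ≤ t') :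
    Run w O ω p κ t' κ' := fun T => by
  obtain ⟨T', hT, h'⟩ := h T
  exact ⟨T', by omega, h'⟩

theorem Run.seq {p q : Prog} {κ κ' κ'' : Cfg} {t t' : ℕ} (h : Run w O ω p κ t κ')
    (h' : Run w O ω q κ' t' κ'') : Run w O ω (.seq p q) κ (t + t') κ'' := fun T => by
  obtain ⟨T₁, hT₁, h₁⟩ := h T
  obtain ⟨T₂, hT₂, h₂⟩ := h' T₁
  exact ⟨T₂, by omega, .seq _ _ _ _ _ h₁ h₂⟩

theorem run_skip (κ : Cfg) : Run w O ω .skip κ 0 κ := fun T => ⟨T, by omega, .skip _⟩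

theorem run_ite (hW : W ≤ 2 ^ w) (h1 : 1 < W) {e : Expr} {p q : Prog} {κ κ' : Cfg} {t : ℕ}
    (he : e.Fits W κ) (hp : e.val κ ≠ 0 → Run w O ω p κ t κ')
    (hq : e.val κ = 0 → Run w O ω q κ t κ') :
    Run w O ω (.ite e p q) κ (t + (e.cost + 1)) κ' := fun T => by
  have hev := e.eval_eq_val hW h1 κ T he
  by_cases h : e.val κ = 0
  · obtain ⟨T', hT', h'⟩ := hq h (T + (e.cost + 1))
    exact ⟨T', by omega, .iteFalse _ _ _ _ _ (by rw [hev, h]) h'⟩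
  · obtain ⟨T', hT', h'⟩ := hp h (T + (e.cost + 1))
    exact ⟨T', by omega, .iteTrue _ _ _ _ _ (by rw [hev]; exact h) h'⟩

/-- Reduces loop-free code to simplification: `go` computes the final memory, `Safe` collects the
overflow conditions, and the cost is syntactic. -/
theorem run_go (hW : W ≤ 2 ^ w) (h1 : 1 < W) (p : Prog) (κ : Cfg) (h : p.Safe W ω κ) :
    Run w O ω p κ p.cost (p.go ω κ) := by
  induction p generalizing κ with
  | skip => exact run_skip κ
  | assign x e =>
    intro T
    refine ⟨T + (e.cost + 1), le_rfl, ?_⟩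
    have := Exec.assign (w := w) (O := O) (ω := ω) (κ.st T) x e
    rw [e.eval_eq_val hW h1 κ T h] at this
    exact this
  | store a i e =>
    intro T
    refine ⟨T + (i.cost + e.cost + 1), le_rfl, ?_⟩
    have := Exec.store (w := w) (O := O) (ω := ω) (κ.st T) a i e
    rw [e.eval_eq_val hW h1 κ T h.2, i.eval_eq_val hW h1 κ T h.1] at this
    exact this
  | seq p q ih₁ ih₂ => exact (ih₁ κ h.1).seq (ih₂ _ h.2)
  | ite e p q ih₁ ih₂ =>
    refine (run_ite (t := max p.cost q.cost) hW h1 h.1 (fun hc => ?_) fun hc => ?_).mono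
      (by simp only [Prog.cost]; omega)
    · simp only [Prog.go, if_pos hc]
      exact (ih₁ κ (h.2.1 hc)).mono (le_max_left _ _)
    · simp only [Prog.go, hc, ne_eq, not_true_eq_false, if_false]
      exact (ih₂ κ (h.2.2 hc)).mono (le_max_right _ _)
  | loop => exact h.elim
  | flip x =>
    intro T
    exact ⟨T + 1, le_rfl, Exec.flip (w := w) (O := O) (ω := ω) (κ.st T) x⟩
  | maxflow => exact h.elim

/-- A loop with an invariant that is indexed by a bound for the number of remaining rounds. -/
theorem run_loop (hW : W ≤ 2 ^ w) (h1 : 1 < W) {e : Expr} {p : Prog} {c : ℕ} {κ : Cfg}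
    (Inv : ℕ → Cfg → Prop)
    (he : ∀ j τ, Inv j τ → Frame p.wv p.wa κ τ → e.Fits W τ)
    (hs : ∀ j τ, Inv j τ → Frame p.wv p.wa κ τ → e.val τ ≠ 0 →
      ∃ τ' j', j' < j ∧ Run w O ω p τ c τ' ∧ Inv j' τ')
    (j : ℕ) (h0 : Inv j κ) :
    ∃ τ j', Run w O ω (.loop e p) κ ((j + 1) * (c + e.cost + 1)) τ ∧ Inv j' τ ∧ e.val τ = 0 := by
  -- The frame relative to the first state is carried through the induction, so the hypotheses on
  -- the body may use values that the loop never writes.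
  suffices H : ∀ j τ, Inv j τ → Frame p.wv p.wa κ τ →
      ∃ τ' j', Run w O ω (.loop e p) τ ((j + 1) * (c + e.cost + 1)) τ' ∧ Inv j' τ' ∧
        e.val τ' = 0 from H j κ h0 (Frame.refl _ _ _)
  intro j
  induction j using Nat.strong_induction_on with
  | _ j ih =>
    intro τ hI hF
    by_cases hc : e.val τ = 0
    · refine ⟨τ, j, fun T => ⟨T + (e.cost + 1), ?_, ?_⟩, hI, hc⟩
      · nlinarith
      · exact .loopFalse _ _ _ (by rw [e.eval_eq_val hW h1 τ T (he _ _ hI hF), hc])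
    · obtain ⟨τ₁, j₁, hj₁, hr₁, hI₁⟩ := hs j τ hI hF hc
      obtain ⟨τ₂, j₂, hr₂, hI₂, hc₂⟩ := ih j₁ hj₁ τ₁ hI₁ (hF.trans hr₁.frame)
      refine ⟨τ₂, j₂, fun T => ?_, hI₂, hc₂⟩
      obtain ⟨T₁, hT₁, hx₁⟩ := hr₁ (T + (e.cost + 1))
      obtain ⟨T₂, hT₂, hx₂⟩ := hr₂ T₁
      refine ⟨T₂, ?_, .loopTrue _ _ _ _ _
        (by rw [e.eval_eq_val hW h1 τ T (he _ _ hI hF)]; exact hc) hx₁ hx₂⟩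
      have : (j₁ + 2) * (c + e.cost + 1) ≤ (j + 1) * (c + e.cost + 1) :=
        Nat.mul_le_mul_right _ (by omega)
      nlinarith

end Rules

/-- `for x < e do body` -/
def forLoop (x : ℕ) (e : Expr) (body : Prog) : Prog :=
  .seq (.assign x (.const 0))
    (.loop (.bin .lt (.var x) e) (.seq body (.assign x (.bin .add (.var x) (.const 1)))))

section Rules

variable {w W : ℕ} {O : FlowOracle} {ω : ℕ → Bool}

/-- `Inv i` speaks about the state in which the counter already equals i. The bound `e` is evaluated
anew before each round, so it has to keep the value N under the invariant. -/
theorem run_for (hW : W ≤ 2 ^ w) (h1 : 1 < W) {x : ℕ} {e : Expr} {body : Prog} {c N : ℕ} {κ : Cfg}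
    (Inv : ℕ → Cfg → Prop) (hN : N < W) (h0 : Inv 0 (κ.setV x 0))
    (hb : ∀ i τ, Inv i τ → Frame (forLoop x e body).wv (forLoop x e body).wa κ τ → τ.v x = i →
      e.val τ = N ∧ e.Fits W τ)
    (hx : x ∉ body.wv)
    (hs : ∀ i τ, i < N → Inv i τ → Frame (forLoop x e body).wv (forLoop x e body).wa κ τ →
      τ.v x = i → ∃ τ', Run w O ω body τ c τ' ∧ Inv (i + 1) (τ'.setV x (i + 1))) :
    ∃ τ, Run w O ω (forLoop x e body) κ ((N + 1) * (c + e.cost + 9)) τ ∧ Inv N τ ∧ τ.v x = N := by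
  have hinit : Run w O ω (.assign x (.const 0)) κ 2 (κ.setV x 0) :=
    run_go hW h1 _ _ (by simp only [Prog.Safe, Expr.Fits]; omega)
  have key := run_loop (w := w) (W := W) (O := O) (ω := ω) hW h1
    (e := .bin .lt (.var x) e) (p := .seq body (.assign x (.bin .add (.var x) (.const 1))))
    (c := c + 4) (κ := κ.setV x 0)
    (fun j τ => τ.v x ≤ N ∧ j = N - τ.v x ∧ Inv (τ.v x) τ ∧
      Frame (forLoop x e body).wv (forLoop x e body).wa κ τ)
    (fun j τ hI hF => ⟨trivial, (hb _ τ hI.2.2.1 hI.2.2.2 rfl).2, trivial⟩)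
    (fun j τ hI hF hc => ?_) N
    ⟨by simp, by simp, by simpa using h0, hinit.frame.mono (by simp [forLoop, Prog.wv])
      (by simp [Prog.wa])⟩
  · obtain ⟨τ, j, hr, ⟨hle, -, hI, hF⟩, hc⟩ := key
    have hv := (hb _ τ hI hF rfl).1
    have hlt : ¬ τ.v x < N := by simpa [hv] using hc
    have hxN : τ.v x = N := by omega
    refine ⟨τ, (hinit.seq hr).mono ?_, hxN ▸ hI, hxN⟩
    simp only [Expr.cost]
    nlinarith
  · obtain ⟨hle, hj, hI, hF'⟩ := hI
    have hv := (hb _ τ hI hF' rfl).1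
    have hlt : τ.v x < N := by simpa [hv] using hc
    obtain ⟨τ', hr, hI'⟩ := hs _ τ hlt hI hF' rfl
    have hxx : τ'.v x = τ.v x := hr.frame.v x hx
    have hinc : Run w O ω (.assign x (.bin .add (.var x) (.const 1))) τ' 4
        (τ'.setV x (τ.v x + 1)) := by
      have := run_go (O := O) (ω := ω) hW h1 (.assign x (.bin .add (.var x) (.const 1))) τ'
        ⟨trivial, h1, by simp only [BinOp.Fits, Expr.val]; omega⟩
      simp only [Prog.go, Expr.val, BinOp.apply, hxx] at this
      exact this
    refine ⟨τ'.setV x (τ.v x + 1), N - (τ.v x + 1), by omega, hr.seq hinc, ?_, ?_, ?_, ?_⟩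
    · simp only [Cfg.setV_v, if_true]; omega
    · simp
    · simpa using hI'
    · refine hF'.trans ((hr.seq hinc).frame.mono ?_ ?_)
      · intro y hy; simp only [forLoop, Prog.wv, List.mem_append] at hy ⊢; tauto
      · intro y hy; simp only [forLoop, Prog.wa, List.mem_append] at hy ⊢; tauto

/-- A counting loop whose body has neither loops nor maximum flow calls. -/
theorem run_for_go (hW : W ≤ 2 ^ w) (h1 : 1 < W) {x : ℕ} {e : Expr} {body : Prog} {N : ℕ} {κ : Cfg}
    (Inv : ℕ → Cfg → Prop) (hN : N < W) (h0 : Inv 0 (κ.setV x 0))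
    (hb : ∀ τ, Frame (forLoop x e body).wv (forLoop x e body).wa κ τ →
      e.val τ = N ∧ e.Fits W τ)
    (hx : x ∉ body.wv)
    (hs : ∀ i τ, i < N → Inv i τ → Frame (forLoop x e body).wv (forLoop x e body).wa κ τ →
      τ.v x = i → body.Safe W ω τ ∧ Inv (i + 1) ((body.go ω τ).setV x (i + 1))) :
    ∃ τ, Run w O ω (forLoop x e body) κ ((N + 1) * (body.cost + e.cost + 9)) τ ∧ Inv N τ ∧
      τ.v x = N :=
  run_for hW h1 Inv hN h0 (fun _ τ _ hF _ => hb τ hF) hx fun i τ hi hI hF hv =>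
    ⟨_, run_go hW h1 _ _ (hs i τ hi hI hF hv).1, (hs i τ hi hI hF hv).2⟩

end Rules

end RAM

/-! ## Minimum vertex cuts from maximum flows -/

namespace FlowInstance

variable (I : FlowInstance) (f : Fin I.M → ℤ)

def Adj (u v : ℕ) : Prop :=
  ∃ i, (I.tail i = u ∧ I.head i = v) ∨ (I.tail i = v ∧ I.head i = u)

/-- Some flow enters `v`. -/
def Entered (v : ℕ) : Prop := ∃ i, (I.head i = v ∧ 0 < f i) ∨ (I.tail i = v ∧ f i < 0)

/-- The arcs of the residual network. Vertex `v` is split into an entrance `2 * v` and an exit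
`2 * v + 1`. -/
inductive Res : ℕ → ℕ → Prop
  | fwd (i) : Res (2 * I.tail i + 1) (2 * I.head i)
  | bwd (i) : Res (2 * I.head i + 1) (2 * I.tail i)
  | cancelFwd (i) : 0 < f i → Res (2 * I.head i) (2 * I.tail i + 1)
  | cancelBwd (i) : f i < 0 → Res (2 * I.tail i) (2 * I.head i + 1)
  | pass (v) : v < I.N → ¬ I.Entered f v → Res (2 * v) (2 * v + 1)
  | back (v) : v < I.N → I.Entered f v → Res (2 * v + 1) (2 * v)

def Reach (p : ℕ) : Prop := Relation.ReflTransGen (I.Res f) (2 * I.s + 1) p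

def ind (p : Prop) [Decidable p] : ℤ := if p then 1 else 0

def net (x : ℕ) : ℤ := ∑ i, f i * (ind (I.tail i = x) - ind (I.head i = x))

theorem outflow_sub_inflow (x : ℕ) : I.outflow f x - I.inflow f x = I.net f x := by
  unfold outflow inflow net
  rw [← Finset.sum_sub_distrib]
  refine Finset.sum_congr rfl fun i _ => ?_
  unfold ind
  rcases le_total (f i) 0 with h | h
  · rw [max_eq_right h, max_eq_left (by omega : (0 : ℤ) ≤ -f i)]
    split_ifs <;> ring
  · rw [max_eq_left h, max_eq_right (by omega : -f i ≤ (0 : ℤ))]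
    split_ifs <;> ring

variable {I f}

theorem inflow_eq_zero {x : ℕ} (h : ¬ I.Entered f x) : I.inflow f x = 0 := by
  unfold Entered at h
  push Not at h
  refine Finset.sum_eq_zero fun i _ => ?_
  have := h i
  split_ifs with h1 h2 h2
  · have := (h i).1 h1; have := (h i).2 h2; omega
  · have := (h i).1 h1; omega
  · have := (h i).2 h2; omega
  · rfl

theorem inflow_term_nonneg (x : ℕ) (i : Fin I.M) :
    0 ≤ ((if I.head i = x then max (f i) 0 else 0) + (if I.tail i = x then max (-f i) 0 else 0)) := by
  split_ifs <;> positivity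

theorem outflow_term_nonneg (x : ℕ) (i : Fin I.M) :
    0 ≤ ((if I.tail i = x then max (f i) 0 else 0) + (if I.head i = x then max (-f i) 0 else 0)) := by
  split_ifs <;> positivity

theorem one_le_inflow {x : ℕ} (h : I.Entered f x) : 1 ≤ I.inflow f x := by
  obtain ⟨i, hi⟩ := h
  refine le_trans ?_ (Finset.single_le_sum (fun i _ => inflow_term_nonneg (f := f) x i)
    (Finset.mem_univ i))
  rcases hi with ⟨h1, h2⟩ | ⟨h1, h2⟩
  · rw [if_pos h1]; split_ifs <;> omega
  · rw [if_pos h1]; split_ifs <;> omega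

theorem le_inflow_head (i : Fin I.M) : f i ≤ I.inflow f (I.head i) := by
  refine le_trans ?_ (Finset.single_le_sum (fun i _ => inflow_term_nonneg (f := f) _ i)
    (Finset.mem_univ i))
  rw [if_pos rfl]; split_ifs <;> omega

theorem le_inflow_tail (i : Fin I.M) : - f i ≤ I.inflow f (I.tail i) := by
  refine le_trans ?_ (Finset.single_le_sum (fun i _ => inflow_term_nonneg (f := f) _ i)
    (Finset.mem_univ i))
  rw [if_pos (rfl : I.tail i = I.tail i)]; split_ifs <;> omega

theorem le_outflow_tail (i : Fin I.M) : f i ≤ I.outflow f (I.tail i) := by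
  refine le_trans ?_ (Finset.single_le_sum (fun i _ => outflow_term_nonneg (f := f) _ i)
    (Finset.mem_univ i))
  rw [if_pos rfl]; split_ifs <;> omega

theorem le_outflow_head (i : Fin I.M) : - f i ≤ I.outflow f (I.head i) := by
  refine le_trans ?_ (Finset.single_le_sum (fun i _ => outflow_term_nonneg (f := f) _ i)
    (Finset.mem_univ i))
  rw [if_pos (rfl : I.head i = I.head i)]; split_ifs <;> omega

/-! ### Augmentation -/

variable (I f) in
def Steps : ℕ → ℕ → Prop
  | 0, p => p = 2 * I.s + 1
  | d + 1, p => ∃ q, Steps d q ∧ I.Res f q p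

variable (I f) in
/-- A unit of additional flow from the exit of `s` to the node `p` along the residual network,
supported on nodes at distance at most `d`. -/
structure Aug (d p : ℕ) (δ ε : Fin I.M → ℤ) (θ : ℕ → ℤ) : Prop where
  δ_le : ∀ i, δ i ≤ 1
  le_δ : ∀ i, -ind (0 < f i) ≤ δ i
  ε_le : ∀ i, ε i ≤ 1
  le_ε : ∀ i, -ind (f i < 0) ≤ ε i
  θ_le : ∀ x, θ x ≤ 1
  θ_le' : ∀ x, I.Entered f x → θ x ≤ 0
  out : ∀ x, ∑ i, (ind (I.tail i = x) * δ i + ind (I.head i = x) * ε i) - θ x =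
    ind (x = I.s) - ind (p = 2 * x + 1)
  inn : ∀ x, θ x - ∑ i, (ind (I.head i = x) * δ i + ind (I.tail i = x) * ε i) =
    - ind (p = 2 * x)
  δ_supp : ∀ i, δ i ≠ 0 → (∃ j ≤ d, I.Steps f j (2 * I.tail i + 1)) ∧
    ∃ j ≤ d, I.Steps f j (2 * I.head i)
  ε_supp : ∀ i, ε i ≠ 0 → (∃ j ≤ d, I.Steps f j (2 * I.head i + 1)) ∧
    ∃ j ≤ d, I.Steps f j (2 * I.tail i)
  θ_supp : ∀ x, θ x ≠ 0 → (∃ j ≤ d, I.Steps f j (2 * x)) ∧ ∃ j ≤ d, I.Steps f j (2 * x + 1)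

theorem ind_nonneg (p : Prop) [Decidable p] : 0 ≤ ind p := by unfold ind; split_ifs <;> simp
theorem ind_pos {p : Prop} [Decidable p] (h : p) : ind p = 1 := if_pos h
theorem ind_neg {p : Prop} [Decidable p] (h : ¬ p) : ind p = 0 := if_neg h

theorem sum_bump_left (a b δ ε : Fin I.M → ℤ) (i : Fin I.M) (c : ℤ) :
    ∑ j, (a j * Function.update δ i (δ i + c) j + b j * ε j) =
      ∑ j, (a j * δ j + b j * ε j) + a i * c := by
  rw [← sub_eq_iff_eq_add', ← Finset.sum_sub_distrib, Finset.sum_eq_single i]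
  · simp; ring
  · intro j _ hj; simp [hj]
  · simp

theorem sum_bump_right (a b δ ε : Fin I.M → ℤ) (i : Fin I.M) (c : ℤ) :
    ∑ j, (a j * δ j + b j * Function.update ε i (ε i + c) j) =
      ∑ j, (a j * δ j + b j * ε j) + b i * c := by
  rw [← sub_eq_iff_eq_add', ← Finset.sum_sub_distrib, Finset.sum_eq_single i]
  · simp; ring
  · intro j _ hj; simp [hj]
  · simp

/-- Induction along a shortest residual path: the augmentation to the last node is the one to its
predecessor plus the last arc. Minimality of the distance ensures that this arc has not been used
before, so its unit capacity is respected. -/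
theorem exists_aug (d : ℕ) : ∀ p, I.Steps f d p → (∀ j < d, ¬ I.Steps f j p) →
    ∃ δ ε θ, I.Aug f d p δ ε θ := by
  induction d with
  | zero =>
    intro p hp _
    refine ⟨0, 0, 0, ?_⟩
    simp only [Steps] at hp
    constructor <;> intro x <;> simp only [Pi.zero_apply, mul_zero, add_zero,
      Finset.sum_const_zero, sub_zero, ne_eq, not_true_eq_false, false_imp_iff, zero_le_one,
      Left.neg_nonpos_iff, ind_nonneg, le_refl, implies_true]
    · unfold ind; split_ifs <;> omega
    · rw [ind_neg (by omega)]; rfl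
  | succ d ih =>
    intro p hp hmin
    obtain ⟨q, hq, hres⟩ := hp
    have hqmin : ∀ j < d, ¬ I.Steps f j q := fun j hj h => hmin (j + 1) (by omega) ⟨q, h, hres⟩
    obtain ⟨δ, ε, θ, A⟩ := ih q hq hqmin
    -- The support conditions place both ends of every used arc at distance at most d, whereas p is
    -- at distance d + 1. Hence the arc into p still carries the value 0.
    have hnew : ¬ ∃ j ≤ d, I.Steps f j p := fun ⟨j, hj, h⟩ => hmin j (by omega) h
    have hp' : I.Steps f (d + 1) p := ⟨q, hq, hres⟩
    have hδs : ∀ i, δ i ≠ 0 → (∃ j ≤ d + 1, I.Steps f j (2 * I.tail i + 1)) ∧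
        ∃ j ≤ d + 1, I.Steps f j (2 * I.head i) := fun i hi => by
      obtain ⟨⟨j, hj, h⟩, j', hj', h'⟩ := A.δ_supp i hi
      exact ⟨⟨j, by omega, h⟩, j', by omega, h'⟩
    have hεs : ∀ i, ε i ≠ 0 → (∃ j ≤ d + 1, I.Steps f j (2 * I.head i + 1)) ∧
        ∃ j ≤ d + 1, I.Steps f j (2 * I.tail i) := fun i hi => by
      obtain ⟨⟨j, hj, h⟩, j', hj', h'⟩ := A.ε_supp i hi
      exact ⟨⟨j, by omega, h⟩, j', by omega, h'⟩
    have hθs : ∀ x, θ x ≠ 0 → (∃ j ≤ d + 1, I.Steps f j (2 * x)) ∧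
        ∃ j ≤ d + 1, I.Steps f j (2 * x + 1) := fun i hi => by
      obtain ⟨⟨j, hj, h⟩, j', hj', h'⟩ := A.θ_supp i hi
      exact ⟨⟨j, by omega, h⟩, j', by omega, h'⟩
    have bumpδ : ∀ (i : Fin I.M) (c : ℤ), δ i = 0 → c ≤ 1 → -ind (0 < f i) ≤ c →
        ((∃ j ≤ d + 1, I.Steps f j (2 * I.tail i + 1)) ∧
          ∃ j ≤ d + 1, I.Steps f j (2 * I.head i)) →
        (∀ x, ind (I.tail i = x) * c + ind (p = 2 * x + 1) = ind (q = 2 * x + 1)) →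
        (∀ x, ind (I.head i = x) * c - ind (p = 2 * x) = - ind (q = 2 * x)) →
        ∃ δ ε θ, I.Aug f (d + 1) p δ ε θ := by
      intro i c h0 hc hc' hs h1 h2
      refine ⟨Function.update δ i (δ i + c), ε, θ, ?_, ?_, A.ε_le, A.le_ε, A.θ_le, A.θ_le', ?_, ?_,
        ?_, hεs, hθs⟩
      · intro j
        rcases eq_or_ne j i with rfl | h
        · simpa [h0] using hc
        · simpa [h] using A.δ_le j
      · intro j
        rcases eq_or_ne j i with rfl | h
        · simpa [h0] using hc'
        · simpa [h] using A.le_δ j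
      · intro x
        rw [sum_bump_left (fun i => ind (I.tail i = x))]
        linarith [A.out x, h1 x]
      · intro x
        rw [sum_bump_left (fun i => ind (I.head i = x))]
        linarith [A.inn x, h2 x]
      · intro j hj
        rcases eq_or_ne j i with rfl | h
        · exact hs
        · exact hδs j (by simpa [h] using hj)
    have bumpε : ∀ (i : Fin I.M) (c : ℤ), ε i = 0 → c ≤ 1 → -ind (f i < 0) ≤ c →
        ((∃ j ≤ d + 1, I.Steps f j (2 * I.head i + 1)) ∧
          ∃ j ≤ d + 1, I.Steps f j (2 * I.tail i)) →
        (∀ x, ind (I.head i = x) * c + ind (p = 2 * x + 1) = ind (q = 2 * x + 1)) →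
        (∀ x, ind (I.tail i = x) * c - ind (p = 2 * x) = - ind (q = 2 * x)) →
        ∃ δ ε θ, I.Aug f (d + 1) p δ ε θ := by
      intro i c h0 hc hc' hs h1 h2
      refine ⟨δ, Function.update ε i (ε i + c), θ, A.δ_le, A.le_δ, ?_, ?_, A.θ_le, A.θ_le', ?_, ?_,
        hδs, ?_, hθs⟩
      · intro j
        rcases eq_or_ne j i with rfl | h
        · simpa [h0] using hc
        · simpa [h] using A.ε_le j
      · intro j
        rcases eq_or_ne j i with rfl | h
        · simpa [h0] using hc'
        · simpa [h] using A.le_ε j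
      · intro x
        rw [sum_bump_right _ (fun i => ind (I.head i = x))]
        linarith [A.out x, h1 x]
      · intro x
        rw [sum_bump_right _ (fun i => ind (I.tail i = x))]
        linarith [A.inn x, h2 x]
      · intro j hj
        rcases eq_or_ne j i with rfl | h
        · exact hs
        · exact hεs j (by simpa [h] using hj)
    have bumpθ : ∀ (v : ℕ) (c : ℤ), θ v = 0 → c ≤ 1 → (I.Entered f v → c ≤ 0) →
        ((∃ j ≤ d + 1, I.Steps f j (2 * v)) ∧ ∃ j ≤ d + 1, I.Steps f j (2 * v + 1)) →
        (∀ x, ind (v = x) * c - ind (p = 2 * x + 1) = - ind (q = 2 * x + 1)) →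
        (∀ x, ind (v = x) * c + ind (p = 2 * x) = ind (q = 2 * x)) →
        ∃ δ ε θ, I.Aug f (d + 1) p δ ε θ := by
      intro v c h0 hc hc' hs h1 h2
      have hup : ∀ x, Function.update θ v (θ v + c) x = θ x + ind (v = x) * c := by
        intro x
        rcases eq_or_ne x v with rfl | h
        · simp [ind]
        · simp [ind, h, h.symm]
      refine ⟨δ, ε, Function.update θ v (θ v + c), A.δ_le, A.le_δ, A.ε_le, A.le_ε, ?_, ?_, ?_, ?_,
        hδs, hεs, ?_⟩
      · intro x
        rcases eq_or_ne x v with rfl | h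
        · simpa [h0] using hc
        · simpa [h] using A.θ_le x
      · intro x hx
        rcases eq_or_ne x v with rfl | h
        · simpa [h0] using hc' hx
        · simpa [h] using A.θ_le' x hx
      · intro x
        rw [hup]
        linarith [A.out x, h1 x]
      · intro x
        rw [hup]
        linarith [A.inn x, h2 x]
      · intro x hx
        rcases eq_or_ne x v with rfl | h
        · exact hs
        · exact hθs x (by simpa [h] using hx)
    have pd : ∃ j ≤ d + 1, I.Steps f j p := ⟨d + 1, le_rfl, hp'⟩
    have qd : ∃ j ≤ d + 1, I.Steps f j q := ⟨d, by omega, hq⟩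
    cases hres with
    | fwd i =>
      refine bumpδ i 1 (by by_contra h; exact hnew (A.δ_supp i h).2) le_rfl
        (by have := ind_nonneg (0 < f i); omega) ⟨qd, pd⟩ (fun x => ?_) fun x => ?_ <;>
      · unfold ind; split_ifs <;> omega
    | bwd i =>
      refine bumpε i 1 (by by_contra h; exact hnew (A.ε_supp i h).2) le_rfl
        (by have := ind_nonneg (f i < 0); omega) ⟨qd, pd⟩ (fun x => ?_) fun x => ?_ <;>
      · unfold ind; split_ifs <;> omega
    | cancelFwd i hi =>
      refine bumpδ i (-1) (by by_contra h; exact hnew (A.δ_supp i h).1) (by norm_num)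
        (by rw [ind_pos hi]) ⟨pd, qd⟩ (fun x => ?_) fun x => ?_ <;>
      · unfold ind; split_ifs <;> omega
    | cancelBwd i hi =>
      refine bumpε i (-1) (by by_contra h; exact hnew (A.ε_supp i h).1) (by norm_num)
        (by rw [ind_pos hi]) ⟨pd, qd⟩ (fun x => ?_) fun x => ?_ <;>
      · unfold ind; split_ifs <;> omega
    | pass v _ hv =>
      refine bumpθ v 1 (by by_contra h; exact hnew (A.θ_supp v h).2) le_rfl
        (fun h => absurd h hv) ⟨qd, pd⟩ (fun x => ?_) fun x => ?_ <;>
      · unfold ind; split_ifs <;> omega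
    | back v _ hv =>
      refine bumpθ v (-1) (by by_contra h; exact hnew (A.θ_supp v h).1) (by norm_num)
        (fun _ => by norm_num) ⟨pd, qd⟩ (fun x => ?_) fun x => ?_ <;>
      · unfold ind; split_ifs <;> omega

/-- The new flow is f + δ - ε, where δ and ε are the additional flow in the direction of the edge
and against it. The entrance or exit of t being reached means one more unit leaves s. -/
theorem Aug.improve (hI : I.Valid) (hf : I.IsFlow f) {d p : ℕ} {δ ε : Fin I.M → ℤ} {θ : ℕ → ℤ}
    (A : I.Aug f d p δ ε θ) (hp : p = 2 * I.t ∨ p = 2 * I.t + 1) :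
    ∃ g, I.IsFlow g ∧ I.value f < I.value g := by
  have hst := hI.s_ne_t
  -- Adding the balance equations at the exit and the entrance of x cancels θ, the flow through x.
  have hnet : ∀ x, I.net (fun i => f i + δ i - ε i) x =
      I.net f x + (ind (x = I.s) - ind (p = 2 * x + 1) - ind (p = 2 * x)) := by
    intro x
    have h := congrArg₂ (· + ·) (A.out x) (A.inn x)
    rw [show ind (x = I.s) - ind (p = 2 * x + 1) - ind (p = 2 * x) =
      ind (x = I.s) - ind (p = 2 * x + 1) + -ind (p = 2 * x) by ring, ← h]
    unfold net
    rw [show ∀ a b c : ℤ, a - b + (b - c) = a - c by intros; ring, ← Finset.sum_sub_distrib,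
      ← Finset.sum_add_distrib]
    exact Finset.sum_congr rfl fun i _ => by ring
  have hcons : ∀ x < I.N, x ≠ I.s → x ≠ I.t →
      I.inflow (fun i => f i + δ i - ε i) x = I.outflow (fun i => f i + δ i - ε i) x := by
    intro x hx hs ht
    have h1 := I.outflow_sub_inflow (fun i => f i + δ i - ε i) x
    have h2 := I.outflow_sub_inflow f x
    rw [hnet, ind_neg hs, ind_neg (by omega), ind_neg (by omega)] at h1
    have h3 := hf.conservation x hx hs ht
    linarith
  have hcap : ∀ x < I.N, x ≠ I.s → x ≠ I.t →
      I.inflow (fun i => f i + δ i - ε i) x ≤ 1 := by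
    intro x hx hs ht
    -- Only an inequality, since flows in opposite directions on one edge cancel and lower the
    -- inflow. The right-hand sum equals θ x, which is at most 1, and at most 0 if x already carries
    -- flow.
    have h1 : I.inflow (fun i => f i + δ i - ε i) x ≤ I.inflow f x +
        ∑ i, (ind (I.head i = x) * δ i + ind (I.tail i = x) * ε i) := by
      unfold inflow
      rw [← Finset.sum_add_distrib]
      refine Finset.sum_le_sum fun i _ => ?_
      have h1 := A.le_δ i
      have h2 := A.le_ε i
      unfold ind at h1 h2 ⊢
      by_cases ha : I.head i = x <;> by_cases hb : I.tail i = x <;>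
        simp only [ha, hb, if_true, if_false, one_mul, zero_mul] <;> split_ifs at h1 h2 <;> omega
    have h2 := A.inn x
    rw [ind_neg (by omega)] at h2
    by_cases he : I.Entered f x
    · have := A.θ_le' x he
      have := hf.capacity x hx hs ht
      linarith
    · have := A.θ_le x
      have := inflow_eq_zero he
      linarith
  refine ⟨fun i => f i + δ i - ε i, ⟨fun i => ?_, hcons, hcap⟩, ?_⟩
  · have h1 := le_inflow_head (f := fun i => f i + δ i - ε i) i
    have h2 := le_inflow_tail (f := fun i => f i + δ i - ε i) i
    have h3 := le_outflow_head (f := fun i => f i + δ i - ε i) i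
    have h4 := le_outflow_tail (f := fun i => f i + δ i - ε i) i
    rw [abs_le]
    have hl := hI.no_loop i
    have hna := hI.not_adj i
    have hna1 : ¬ (I.tail i = I.s ∧ I.head i = I.t) := fun h => hna (by rw [h.1, h.2])
    have hna2 : ¬ (I.tail i = I.t ∧ I.head i = I.s) := fun h => hna (by rw [h.1, h.2, Sym2.eq_swap])
    -- As s and t are not adjacent, one end of the edge is an inner vertex. Its inflow and outflow
    -- agree and are at most 1, which bounds the edge.
    by_cases ht : I.tail i = I.s ∨ I.tail i = I.t
    · have hh : I.head i ≠ I.s ∧ I.head i ≠ I.t := by omega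
      have e1 := hcons _ (hI.head_lt i) hh.1 hh.2
      have e2 := hcap _ (hI.head_lt i) hh.1 hh.2
      constructor <;> linarith
    · push Not at ht
      have e1 := hcons _ (hI.tail_lt i) ht.1 ht.2
      have e2 := hcap _ (hI.tail_lt i) ht.1 ht.2
      constructor <;> linarith
  · unfold value
    rw [outflow_sub_inflow, outflow_sub_inflow, hnet, ind_pos rfl, ind_neg (by omega),
      ind_neg (by omega)]
    omega

theorem Reach.steps {p : ℕ} (h : I.Reach f p) : ∃ d, I.Steps f d p := by
  induction h with
  | refl => exact ⟨0, rfl⟩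
  | tail _ h ih => obtain ⟨d, hd⟩ := ih; exact ⟨d + 1, _, hd, h⟩

theorem IsMaxFlow.not_reach (hI : I.Valid) (hf : I.IsMaxFlow f) {p : ℕ}
    (hp : p = 2 * I.t ∨ p = 2 * I.t + 1) : ¬ I.Reach f p := by
  intro h
  classical
  have hs := h.steps
  obtain ⟨δ, ε, θ, A⟩ := exists_aug (Nat.find hs) p (Nat.find_spec hs) fun j hj => Nat.find_min hs hj
  obtain ⟨g, hg, hlt⟩ := A.improve hI hf.1 hp
  exact absurd (hf.2 g hg) (not_le.2 hlt)

/-! ### Duality -/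

/-- `C` separates the vertex set `Y` from the rest, and `s` from `t`. -/
structure Separates (I : FlowInstance) (Y C : Finset ℕ) : Prop where
  s_mem : I.s ∈ Y
  t_notMem : I.t ∉ Y
  t_notMem' : I.t ∉ C
  closed : ∀ u v, I.Adj u v → u ∈ Y → v ∈ Y ∨ v ∈ C

/-- Sum the net outflow over Y: conservation leaves only the term of s, and exchanging the sums
leaves only edges that cross the border of Y. -/
theorem value_eq_crossing (hf : I.IsFlow f) {Y : Finset ℕ} (hs : I.s ∈ Y)
    (ht : I.t ∉ Y) (hY : ∀ v ∈ Y, v < I.N) :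
    I.value f = ∑ i, f i * (ind (I.tail i ∈ Y) - ind (I.head i ∈ Y)) := by
  have h1 : ∑ x ∈ Y, I.net f x = I.value f := by
    unfold value
    rw [outflow_sub_inflow]
    refine Finset.sum_eq_single I.s (fun x hx hxs => ?_) (fun h => absurd hs h)
    rw [← outflow_sub_inflow,
      hf.conservation x (hY x hx) hxs (fun h => ht (h ▸ hx)), sub_self]
  rw [← h1]
  unfold net
  rw [Finset.sum_comm]
  refine Finset.sum_congr rfl fun i _ => ?_
  rw [← Finset.mul_sum, Finset.sum_sub_distrib]
  simp [ind]

/-- Weak duality: flow that leaves Y has to enter a vertex of C outside Y, and each of these admits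
one unit. -/
theorem Separates.value_le (hI : I.Valid) (hf : I.IsFlow f) {Y C : Finset ℕ}
    (h : I.Separates Y C) : I.value f ≤ C.card := by
  -- `Separates` neither forbids numbers that are no vertices nor an overlap of Y and C, so both
  -- sets are trimmed.
  set Y' := Y.filter (· < I.N) with hY'
  set C' := (C \ Y).filter (· < I.N) with hC'
  rw [value_eq_crossing hf (Y := Y') (by simp [hY', h.s_mem, hI.s_lt]) (by simp [hY', h.t_notMem])
    (by simp [hY'])]
  have h1 : ∑ c ∈ C', I.inflow f c ≤ C.card := by
    refine (Finset.sum_le_card_nsmul C' _ 1 fun c hc => ?_).trans ?_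
    · simp only [hC', Finset.mem_filter, Finset.mem_sdiff] at hc
      exact hf.capacity c hc.2 (fun h' => hc.1.2 (h' ▸ h.s_mem))
        fun h' => h.t_notMem' (h' ▸ hc.1.1)
    · simp only [nsmul_eq_mul, mul_one, Nat.cast_le]
      exact Finset.card_le_card ((Finset.filter_subset _ _).trans Finset.sdiff_subset)
  refine le_trans ?_ h1
  unfold inflow
  rw [Finset.sum_comm]
  refine Finset.sum_le_sum fun i _ => ?_
  rw [Finset.sum_add_distrib]
  simp only [Finset.sum_ite_eq]
  have c1 := h.closed (I.tail i) (I.head i) ⟨i, Or.inl ⟨rfl, rfl⟩⟩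
  have c2 := h.closed (I.head i) (I.tail i) ⟨i, Or.inr ⟨rfl, rfl⟩⟩
  have l1 := hI.tail_lt i
  have l2 := hI.head_lt i
  by_cases a1 : I.tail i ∈ Y <;> by_cases a2 : I.head i ∈ Y <;>
    by_cases b1 : I.tail i ∈ C <;> by_cases b2 : I.head i ∈ C <;>
    simp [hY', hC', a1, a2, b1, b2, l1, l2, ind] at c1 c2 ⊢

/-- A vertex of C has a reachable entrance but an unreachable exit, so some flow enters it;
otherwise the arc `pass` would reach the exit. That flow comes from Y, and none returns to Y. Hence
|C| is at most the flow value, and weak duality makes C minimum. -/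
theorem IsMaxFlow.exists_minCut (hI : I.Valid) (hf : I.IsMaxFlow f) {Y C : Finset ℕ}
    (hY : ∀ v, v ∈ Y ↔ v < I.N ∧ I.Reach f (2 * v + 1))
    (hC : ∀ v, v ∈ C ↔ v < I.N ∧ I.Reach f (2 * v) ∧ ¬ I.Reach f (2 * v + 1)) :
    I.Separates Y C ∧ ∀ Y' C', I.Separates Y' C' → C.card ≤ C'.card := by
  have hsY : I.s ∈ Y := (hY _).2 ⟨hI.s_lt, .refl⟩
  have htY : I.t ∉ Y := fun h => hf.not_reach hI (Or.inr rfl) ((hY _).1 h).2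
  refine ⟨⟨hsY, htY, fun h => hf.not_reach hI (Or.inl rfl) ((hC _).1 h).2.1, ?_⟩, ?_⟩
  · rintro u v ⟨i, hi⟩ hu
    have hu' := ((hY u).1 hu).2
    have hv : v < I.N ∧ I.Reach f (2 * v) := by
      rcases hi with ⟨rfl, rfl⟩ | ⟨rfl, rfl⟩
      · exact ⟨hI.head_lt i, hu'.tail (.fwd i)⟩
      · exact ⟨hI.tail_lt i, hu'.tail (.bwd i)⟩
    by_cases h : I.Reach f (2 * v + 1)
    · exact Or.inl ((hY v).2 ⟨hv.1, h⟩)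
    · exact Or.inr ((hC v).2 ⟨hv.1, hv.2, h⟩)
  · intro Y' C' h'
    have hle : (C.card : ℤ) ≤ I.value f := by
      rw [value_eq_crossing hf.1 hsY htY (fun v hv => ((hY v).1 hv).1)]
      have h1 : (C.card : ℤ) ≤ ∑ c ∈ C, I.inflow f c := by
        rw [Finset.card_eq_sum_ones, Nat.cast_sum]
        refine Finset.sum_le_sum fun c hc => ?_
        obtain ⟨hc1, hc2, hc3⟩ := (hC c).1 hc
        have he : I.Entered f c := by
          by_contra he
          exact hc3 (hc2.tail (.pass c hc1 he))
        exact_mod_cast one_le_inflow he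
      refine h1.trans ?_
      unfold inflow
      rw [Finset.sum_comm]
      refine Finset.sum_le_sum fun i _ => ?_
      rw [Finset.sum_add_distrib]
      simp only [Finset.sum_ite_eq]
      have l1 := hI.tail_lt i
      have l2 := hI.head_lt i
      rcases lt_trichotomy (f i) 0 with hi | hi | hi
      · rw [max_eq_right hi.le, max_eq_left (by omega : (0 : ℤ) ≤ -f i)]
        -- Cancelling the flow on this edge is a residual arc, so the end that sends flow into C is
        -- in Y. For a receiver in Y the arc `back` first leads from its exit to its entrance.
        have e1 : I.tail i ∈ C → I.head i ∈ Y := fun h =>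
          (hY _).2 ⟨l2, ((hC _).1 h).2.1.tail (.cancelBwd i hi)⟩
        have e2 : I.tail i ∈ Y → I.head i ∈ Y := fun h =>
          (hY _).2 ⟨l2, (((hY _).1 h).2.tail (.back _ l1 ⟨i, Or.inr ⟨rfl, hi⟩⟩)).tail
            (.cancelBwd i hi)⟩
        have e3 : I.tail i ∈ C → I.tail i ∉ Y := fun h h' => ((hC _).1 h).2.2 ((hY _).1 h').2
        by_cases a1 : I.tail i ∈ Y <;> by_cases a2 : I.head i ∈ Y <;>
          by_cases b1 : I.tail i ∈ C <;> by_cases b2 : I.head i ∈ C <;>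
          simp [a1, a2, b1, b2, ind] at e1 e2 e3 ⊢ <;> omega
      · simp [hi]
      · rw [max_eq_left hi.le, max_eq_right (by omega : -f i ≤ (0 : ℤ))]
        have e1 : I.head i ∈ C → I.tail i ∈ Y := fun h =>
          (hY _).2 ⟨l1, ((hC _).1 h).2.1.tail (.cancelFwd i hi)⟩
        have e2 : I.head i ∈ Y → I.tail i ∈ Y := fun h =>
          (hY _).2 ⟨l1, (((hY _).1 h).2.tail (.back _ l2 ⟨i, Or.inl ⟨rfl, hi⟩⟩)).tail
            (.cancelFwd i hi)⟩
        have e3 : I.head i ∈ C → I.head i ∉ Y := fun h h' => ((hC _).1 h).2.2 ((hY _).1 h').2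
        by_cases a1 : I.tail i ∈ Y <;> by_cases a2 : I.head i ∈ Y <;>
          by_cases b1 : I.tail i ∈ C <;> by_cases b2 : I.head i ∈ C <;>
          simp [a1, a2, b1, b2, ind] at e1 e2 e3 ⊢ <;> omega
    have := h'.value_le hI hf.1
    exact_mod_cast hle.trans this

end FlowInstance

/-! ## Notation for programs -/

namespace RAM

prefix:max "𝓿" => Expr.var
prefix:max "𝓬" => Expr.const
infixl:65 "+ₑ" => Expr.bin BinOp.add
infixl:65 "-ₑ" => Expr.bin BinOp.sub
infixl:70 "*ₑ" => Expr.bin BinOp.mul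
infixl:70 "/ₑ" => Expr.bin BinOp.div
infixl:70 "%ₑ" => Expr.bin BinOp.mod
infix:50 "<ₑ" => Expr.bin BinOp.lt
infix:50 "=ₑ" => Expr.bin BinOp.eq
infix:45 "≔" => Prog.assign
infixr:40 ";;" => Prog.seq

notation "V_n" => 0
notation "V_k" => 1
notation "V_E" => 2
notation "V_ℓ" => 3
notation "V_pow" => 4
notation "V_q" => 5
notation "V_rounds" => 6
notation "V_round" => 7
notation "V_lev" => 8
notation "V_typ" => 9
notation "V_v" => 10
notation "V_e" => 11
notation "V_M" => 12
notation "V_N" => 13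
notation "V_s" => 14
notation "V_t" => 15
notation "V_A" => 16
notation "V_sp" => 17
notation "V_cur" => 18
notation "V_bit" => 19
notation "V_best" => 20
notation "V_cL" => 21
notation "V_cR" => 23
notation "V_coin" => 24
notation "V_x" => 26
notation "V_y" => 27
notation "V_a" => 28
notation "V_b" => 29

notation "A_off" => 0
notation "A_adj" => 1
notation "A_out" => 2
notation "A_src" => 3
notation "A_T" => 4
notation "A_own" => 5
notation "A_dead" => 6
notation "A_fA" => 7
notation "A_fB" => 8
notation "A_tail" => 9
notation "A_head" => 10
notation "A_flow" => 11
notation "A_hd" => 12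
notation "A_nxt" => 13
notation "A_to" => 14
notation "A_mark" => 15
notation "A_thr" => 16
notation "A_stack" => 17
notation "A_stamp" => 18
notation "A_cid" => 19
notation "A_cnt" => 20
notation "A_z" => 21
notation "A_frm" => 22

theorem go_frame (ω : ℕ → Bool) (p : Prog) (κ : Cfg) : Frame p.wv p.wa κ (p.go ω κ) := by
  induction p generalizing κ with
  | skip => exact .refl _ _ _
  | assign x e => exact ⟨fun y hy => by simp_all [Prog.wv], fun _ _ => rfl⟩
  | store a i e =>
    refine ⟨fun _ _ => rfl, fun b hb => ?_⟩
    simp only [Prog.wa, List.mem_singleton] at hb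
    simp [Cfg.setM, hb]
  | seq p q ih₁ ih₂ =>
    exact ((ih₁ κ).mono (by simp +contextual [Prog.wv]) (by simp +contextual [Prog.wa])).trans
      ((ih₂ _).mono (by simp +contextual [Prog.wv]) (by simp +contextual [Prog.wa]))
  | ite e p q ih₁ ih₂ =>
    simp only [Prog.go]
    split_ifs
    · exact (ih₁ κ).mono (by simp +contextual [Prog.wv]) (by simp +contextual [Prog.wa])
    · exact (ih₂ κ).mono (by simp +contextual [Prog.wv]) (by simp +contextual [Prog.wa])
  | loop => exact .refl _ _ _
  | flip x => exact ⟨fun y hy => by simp_all [Prog.wv], fun _ _ => rfl⟩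
  | maxflow => exact .refl _ _ _

section

variable {w W : ℕ} {O : FlowOracle} {ω : ℕ → Bool}

/-- A loop that sets the first `N` cells of an array. -/
theorem run_fill (hW : W ≤ 2 ^ w) (h1 : 1 < W) {x a N : ℕ} {e r : Expr} {κ : Cfg} (g : ℕ → ℕ)
    (hN : N < W)
    (hb : ∀ τ, Frame (forLoop x e (.store a (𝓿 x) r)).wv (forLoop x e (.store a (𝓿 x) r)).wa κ τ →
      e.val τ = N ∧ e.Fits W τ)
    (hs : ∀ i τ, i < N →
      Frame (forLoop x e (.store a (𝓿 x) r)).wv (forLoop x e (.store a (𝓿 x) r)).wa κ τ →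
      τ.v x = i → τ.m a i = κ.m a i → r.Fits W τ ∧ r.val τ = g i) :
    ∃ τ, Run w O ω (forLoop x e (.store a (𝓿 x) r)) κ ((N + 1) * (r.cost + e.cost + 11)) τ ∧
      (∀ i < N, τ.m a i = g i) ∧ ∀ i, N ≤ i → τ.m a i = κ.m a i := by
  obtain ⟨τ, hr, hI, -⟩ := run_for_go (w := w) (W := W) (O := O) (ω := ω) hW h1
    (κ := κ) (x := x) (e := e) (body := .store a (𝓿 x) r) (N := N)
    (fun i τ => (∀ j < i, τ.m a j = g j) ∧ ∀ j, i ≤ j → τ.m a j = κ.m a j) hN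
    ⟨by simp, by simp⟩ hb (by simp [Prog.wv]) (fun i τ hi hI hF hx => by
      obtain ⟨h2, h3⟩ := hs i τ hi hF hx (hI.2 i le_rfl)
      refine ⟨⟨trivial, h2⟩, fun j hj => ?_, fun j hj => ?_⟩
      · simp only [Prog.go, Cfg.setV_m, Cfg.setM_m, Expr.val, hx, h3, true_and]
        split_ifs with h
        · rw [h]
        · exact hI.1 j (by omega)
      · simp only [Prog.go, Cfg.setV_m, Cfg.setM_m, Expr.val, hx, h3, true_and]
        rw [if_neg (by omega)]
        exact hI.2 j (by omega))
  exact ⟨τ, hr.mono (Nat.mul_le_mul_left _ (by simp only [Prog.cost, Expr.cost]; omega)), hI.1,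
    hI.2⟩

end

/-! ## Linked lists of arcs -/

/-- Add an arc to the linked lists. -/
def addArc (a b : Expr) : Prog :=
  V_x ≔ a ;; V_y ≔ b ;; V_A ≔ 𝓿 V_A +ₑ 𝓬 1 ;;
  .store A_frm (𝓿 V_A) (𝓿 V_x) ;; .store A_to (𝓿 V_A) (𝓿 V_y) ;;
  .store A_nxt (𝓿 V_A) (.read A_hd (𝓿 V_x)) ;; .store A_hd (𝓿 V_x) (𝓿 V_A)

/-- The last of the arcs `1, …, A` that starts in `x`, or `0`. -/
def lastArc (frm : ℕ → ℕ) (A x : ℕ) : ℕ := Nat.findGreatest (fun c => 0 < c ∧ frm c = x) A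

/-- For each node the arcs that start there form a chain with decreasing numbers. Arcs are numbered
from 1, and 0 ends a chain. The array `A_frm` is never read by the programs and serves as a ghost
that specifies the chains. -/
structure Linked (NN : ℕ) (κ : Cfg) : Prop where
  hd : ∀ x < NN, κ.m A_hd x = lastArc (κ.m A_frm) (κ.v V_A) x
  nxt : ∀ c, c < κ.v V_A → κ.m A_nxt (c + 1) = lastArc (κ.m A_frm) c (κ.m A_frm (c + 1))
  frm_lt : ∀ c, c < κ.v V_A → κ.m A_frm (c + 1) < NN
  to_lt : ∀ c, c < κ.v V_A → κ.m A_to (c + 1) < NN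

def Arc (κ : Cfg) (x y : ℕ) : Prop :=
  ∃ c, c < κ.v V_A ∧ κ.m A_frm (c + 1) = x ∧ κ.m A_to (c + 1) = y

theorem lastArc_congr {frm frm' : ℕ → ℕ} {A x : ℕ} (h : ∀ c, 0 < c → c ≤ A → frm c = frm' c) :
    lastArc frm A x = lastArc frm' A x := by
  unfold lastArc
  induction A with
  | zero => rfl
  | succ A ih =>
    rw [Nat.findGreatest_succ, Nat.findGreatest_succ, ih fun c h1 h2 => h c h1 (by omega),
      h (A + 1) (by omega) le_rfl]

theorem lastArc_spec {frm : ℕ → ℕ} {A x : ℕ} (h : lastArc frm A x ≠ 0) :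
    lastArc frm A x ≤ A ∧ frm (lastArc frm A x) = x :=
  ⟨Nat.findGreatest_le _, (Nat.findGreatest_of_ne_zero (P := fun c => 0 < c ∧ frm c = x) rfl h).2⟩

theorem le_lastArc {frm : ℕ → ℕ} {A x c : ℕ} (h0 : 0 < c) (hc : c ≤ A) (h : frm c = x) :
    c ≤ lastArc frm A x := Nat.le_findGreatest hc ⟨h0, h⟩

section

variable {ω : ℕ → Bool} {κ : Cfg} {a b : Expr} {NN W : ℕ}

/-- The value of `b` is not affected by a change of the scratch variable `V_x`. -/
def Expr.Stable (κ : Cfg) (b : Expr) : Prop := ∀ z, b.val (κ.setV V_x z) = b.val κ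

theorem addArc_v : ((addArc a b).go ω κ).v V_A = κ.v V_A + 1 := by
  simp [addArc]

theorem addArc_frm (c : ℕ) : ((addArc a b).go ω κ).m A_frm c =
    if c = κ.v V_A + 1 then a.val κ else κ.m A_frm c := by
  simp [addArc]

theorem addArc_to (hb : b.Stable κ) (c : ℕ) : ((addArc a b).go ω κ).m A_to c =
    if c = κ.v V_A + 1 then b.val κ else κ.m A_to c := by
  simp [addArc, hb (a.val κ)]

theorem addArc_nxt (c : ℕ) : ((addArc a b).go ω κ).m A_nxt c =
    if c = κ.v V_A + 1 then κ.m A_hd (a.val κ) else κ.m A_nxt c := by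
  simp [addArc]

theorem addArc_hd (x : ℕ) : ((addArc a b).go ω κ).m A_hd x =
    if x = a.val κ then κ.v V_A + 1 else κ.m A_hd x := by
  simp [addArc]

/-- The new arc has the largest number, so it becomes the head of its chain. All older links refer
to `lastArc` with a smaller bound, which does not see it. -/
theorem addArc_linked (hb : b.Stable κ) (h : Linked NN κ) (ha : a.val κ < NN) (hb' : b.val κ < NN) :
    Linked NN ((addArc a b).go ω κ) := by
  have hfrm : ∀ A x, A ≤ κ.v V_A → lastArc (((addArc a b).go ω κ).m A_frm) A x =
      lastArc (κ.m A_frm) A x := fun A x hA => lastArc_congr fun c _ hc => by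
    rw [addArc_frm, if_neg (by omega)]
  refine ⟨fun x hx => ?_, fun c hc => ?_, fun c hc => ?_, fun c hc => ?_⟩
  · rw [addArc_hd, addArc_v, lastArc, Nat.findGreatest_succ]
    have := hfrm (κ.v V_A) x le_rfl
    unfold lastArc at this
    rw [this, addArc_frm, if_pos rfl, h.hd x hx]
    by_cases hxa : x = a.val κ
    · simp [hxa]
    · simp [hxa, Ne.symm hxa, lastArc]
  · rw [addArc_v] at hc
    rw [addArc_nxt, hfrm c _ (by omega), addArc_frm]
    by_cases hcA : c = κ.v V_A
    · rw [if_pos (by omega), if_pos (by omega), h.hd _ ha, hcA]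
    · rw [if_neg (by omega), if_neg (by omega), h.nxt c (by omega)]
  · rw [addArc_v] at hc
    rw [addArc_frm]
    split_ifs
    · exact ha
    · exact h.frm_lt c (by omega)
  · rw [addArc_v] at hc
    rw [addArc_to hb]
    split_ifs
    · exact hb'
    · exact h.to_lt c (by omega)

theorem addArc_arc (hb : b.Stable κ) (x y : ℕ) : Arc ((addArc a b).go ω κ) x y ↔
    Arc κ x y ∨ (x = a.val κ ∧ y = b.val κ) := by
  unfold Arc
  simp only [addArc_v, addArc_frm, addArc_to hb]
  constructor
  · rintro ⟨c, hc, h1, h2⟩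
    by_cases hcA : c = κ.v V_A
    · subst hcA
      simp only [if_true] at h1 h2
      exact Or.inr ⟨h1.symm, h2.symm⟩
    · rw [if_neg (by omega)] at h1 h2
      exact Or.inl ⟨c, by omega, h1, h2⟩
  · rintro (⟨c, hc, h1, h2⟩ | ⟨rfl, rfl⟩)
    · exact ⟨c, by omega, by rw [if_neg (by omega), h1], by rw [if_neg (by omega), h2]⟩
    · exact ⟨κ.v V_A, by omega, by simp, by simp⟩

theorem addArc_safe (h1 : 1 < W) (ha : a.Fits W κ) (hb : ∀ z, b.Fits W (κ.setV V_x z))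
    (hA : κ.v V_A + 1 < W) : (addArc a b).Safe W ω κ := by
  simp [addArc, ha, hb, h1, hA]

theorem addArc_frame : Frame [V_x, V_y, V_A] [A_frm, A_to, A_nxt, A_hd] κ ((addArc a b).go ω κ) :=
  go_frame ω (addArc a b) κ

end

end RAM

/-! ## The residual network -/

namespace RAM

/-- The arcs that come from edge `V_e` of the flow instance. -/
def edgeArcs : Prog :=
  addArc (𝓬 2 *ₑ .read A_tail (𝓿 V_e) +ₑ 𝓬 1) (𝓬 2 *ₑ .read A_head (𝓿 V_e)) ;;
  addArc (𝓬 2 *ₑ .read A_head (𝓿 V_e) +ₑ 𝓬 1) (𝓬 2 *ₑ .read A_tail (𝓿 V_e)) ;;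
  .ite (.read A_flow (𝓿 V_e) =ₑ 𝓬 1)
    (addArc (𝓬 2 *ₑ .read A_head (𝓿 V_e)) (𝓬 2 *ₑ .read A_tail (𝓿 V_e) +ₑ 𝓬 1) ;;
      .store A_thr (.read A_head (𝓿 V_e)) (𝓬 1))
    (.ite (.read A_flow (𝓿 V_e) =ₑ 𝓬 2)
      (addArc (𝓬 2 *ₑ .read A_tail (𝓿 V_e)) (𝓬 2 *ₑ .read A_head (𝓿 V_e) +ₑ 𝓬 1) ;;
        .store A_thr (.read A_tail (𝓿 V_e)) (𝓬 1))
      .skip)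

/-- The arc between the entrance and the exit of vertex `V_v`. -/
def vertexArc : Prog :=
  .ite (.read A_thr (𝓿 V_v))
    (addArc (𝓬 2 *ₑ 𝓿 V_v +ₑ 𝓬 1) (𝓬 2 *ₑ 𝓿 V_v))
    (addArc (𝓬 2 *ₑ 𝓿 V_v) (𝓬 2 *ₑ 𝓿 V_v +ₑ 𝓬 1))

/-- Edge `j`, given by its ends and its flow, contributes the arc from `x` to `y`. -/
def EdgeArc (tail head flow : ℕ → ℕ) (j x y : ℕ) : Prop :=
  (x = 2 * tail j + 1 ∧ y = 2 * head j) ∨ (x = 2 * head j + 1 ∧ y = 2 * tail j) ∨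
  (flow j = 1 ∧ x = 2 * head j ∧ y = 2 * tail j + 1) ∨
  (flow j = 2 ∧ x = 2 * tail j ∧ y = 2 * head j + 1)

def EdgeEnters (tail head flow : ℕ → ℕ) (j v : ℕ) : Prop :=
  (flow j = 1 ∧ head j = v) ∨ (flow j = 2 ∧ tail j = v)

section

variable {W : ℕ} {ω : ℕ → Bool}

theorem edgeArcs_go {κ : Cfg} {N i : ℕ} (hi : κ.v V_e = i) (hl : Linked (2 * N) κ)
    (ht : κ.m A_tail i < N) (hh : κ.m A_head i < N) :
    Linked (2 * N) (edgeArcs.go ω κ) ∧ (edgeArcs.go ω κ).v V_A ≤ κ.v V_A + 3 ∧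
    (∀ x y, Arc (edgeArcs.go ω κ) x y ↔
      Arc κ x y ∨ EdgeArc (κ.m A_tail) (κ.m A_head) (κ.m A_flow) i x y) ∧
    (∀ v, (edgeArcs.go ω κ).m A_thr v ≠ 0 ↔
      κ.m A_thr v ≠ 0 ∨ EdgeEnters (κ.m A_tail) (κ.m A_head) (κ.m A_flow) i v) := by
  set κ₁ := (addArc (𝓬 2 *ₑ .read A_tail (𝓿 V_e) +ₑ 𝓬 1) (𝓬 2 *ₑ .read A_head (𝓿 V_e))).go ω κ
    with hκ₁
  have f₁ : Frame [V_x, V_y, V_A] [A_frm, A_to, A_nxt, A_hd] κ κ₁ := addArc_frame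
  have l₁ : Linked (2 * N) κ₁ := addArc_linked (fun z => by simp) hl (by simp [hi]; omega)
    (by simp [hi]; omega)
  have v₁ : κ₁.v V_A = κ.v V_A + 1 := addArc_v
  have a₁ := addArc_arc (ω := ω) (κ := κ) (a := 𝓬 2 *ₑ .read A_tail (𝓿 V_e) +ₑ 𝓬 1)
    (b := 𝓬 2 *ₑ .read A_head (𝓿 V_e)) (fun z => by simp)
  rw [← hκ₁] at a₁
  set κ₂ := (addArc (𝓬 2 *ₑ .read A_head (𝓿 V_e) +ₑ 𝓬 1) (𝓬 2 *ₑ .read A_tail (𝓿 V_e))).go ω κ₁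
    with hκ₂
  have hi₁ : κ₁.v V_e = i := (f₁.v V_e (by decide)).trans hi
  have t₁ : κ₁.m A_tail = κ.m A_tail := f₁.m A_tail (by decide)
  have h₁ : κ₁.m A_head = κ.m A_head := f₁.m A_head (by decide)
  have f₂ : Frame [V_x, V_y, V_A] [A_frm, A_to, A_nxt, A_hd] κ κ₂ := f₁.trans addArc_frame
  have l₂ : Linked (2 * N) κ₂ := addArc_linked (fun z => by simp) l₁ (by simp [hi₁, h₁]; omega)
    (by simp [hi₁, t₁]; omega)
  have v₂ : κ₂.v V_A = κ.v V_A + 2 := by rw [hκ₂, addArc_v, v₁]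
  have a₂ := addArc_arc (ω := ω) (κ := κ₁) (a := 𝓬 2 *ₑ .read A_head (𝓿 V_e) +ₑ 𝓬 1)
    (b := 𝓬 2 *ₑ .read A_tail (𝓿 V_e)) (fun z => by simp)
  rw [← hκ₂] at a₂
  have hi₂ : κ₂.v V_e = i := (f₂.v V_e (by decide)).trans hi
  have t₂ : κ₂.m A_tail = κ.m A_tail := f₂.m A_tail (by decide)
  have h₂ : κ₂.m A_head = κ.m A_head := f₂.m A_head (by decide)
  have w₂ : κ₂.m A_flow = κ.m A_flow := f₂.m A_flow (by decide)
  have th₂ : κ₂.m A_thr = κ.m A_thr := f₂.m A_thr (by decide)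
  have hgo : edgeArcs.go ω κ = if κ.m A_flow i = 1 then
      ((addArc (𝓬 2 *ₑ .read A_head (𝓿 V_e)) (𝓬 2 *ₑ .read A_tail (𝓿 V_e) +ₑ 𝓬 1)).go ω κ₂).setM
        A_thr (κ.m A_head i) 1
      else if κ.m A_flow i = 2 then
      ((addArc (𝓬 2 *ₑ .read A_tail (𝓿 V_e)) (𝓬 2 *ₑ .read A_head (𝓿 V_e) +ₑ 𝓬 1)).go ω κ₂).setM
        A_thr (κ.m A_tail i) 1
      else κ₂ := by
    have g₁ : ∀ a b : Expr, ((addArc a b).go ω κ₂).m A_head (((addArc a b).go ω κ₂).v V_e) =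
        κ.m A_head i := fun a b => by
      rw [addArc_frame.m A_head (by decide), addArc_frame.v V_e (by decide), hi₂, h₂]
    have g₂ : ∀ a b : Expr, ((addArc a b).go ω κ₂).m A_tail (((addArc a b).go ω κ₂).v V_e) =
        κ.m A_tail i := fun a b => by
      rw [addArc_frame.m A_tail (by decide), addArc_frame.v V_e (by decide), hi₂, t₂]
    simp only [edgeArcs, Prog.go, ← hκ₁, ← hκ₂, Expr.val, BinOp.apply, hi₂, w₂, g₁, g₂]
    split_ifs <;> simp_all
  have setM_linked : ∀ (τ : Cfg) (u : ℕ), Linked (2 * N) τ → Linked (2 * N) (τ.setM A_thr u 1) :=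
    fun τ u h => ⟨by simpa [Cfg.setM] using h.hd, by simpa [Cfg.setM] using h.nxt,
      by simpa [Cfg.setM] using h.frm_lt, by simpa [Cfg.setM] using h.to_lt⟩
  have setM_arc : ∀ (τ : Cfg) (u x y : ℕ), Arc (τ.setM A_thr u 1) x y ↔ Arc τ x y := by
    intro τ u x y; simp [Arc, Cfg.setM]
  rw [hgo]
  split_ifs with c1 c2
  · refine ⟨setM_linked _ _ (addArc_linked (fun z => by simp) l₂ (by simp [hi₂, h₂]; omega)
      (by simp [hi₂, t₂]; omega)), ?_, fun x y => ?_, fun v => ?_⟩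
    · rw [Cfg.setM_v, addArc_v, v₂]
    · rw [setM_arc, addArc_arc (fun z => by simp), a₂, a₁]
      simp [EdgeArc, hi₂, t₂, h₂, hi₁, t₁, h₁, hi, c1, or_assoc]
    · rw [Cfg.setM_m, addArc_frame.m A_thr (by decide), th₂]
      by_cases hv : v = κ.m A_head i
      · simp [hv, EdgeEnters, c1]
      · simp [hv, EdgeEnters, c1, Ne.symm hv]
  · refine ⟨setM_linked _ _ (addArc_linked (fun z => by simp) l₂ (by simp [hi₂, t₂]; omega)
      (by simp [hi₂, h₂]; omega)), ?_, fun x y => ?_, fun v => ?_⟩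
    · rw [Cfg.setM_v, addArc_v, v₂]
    · rw [setM_arc, addArc_arc (fun z => by simp), a₂, a₁]
      simp [EdgeArc, hi₂, t₂, h₂, hi₁, t₁, h₁, hi, c2, or_assoc]
    · rw [Cfg.setM_m, addArc_frame.m A_thr (by decide), th₂]
      by_cases hv : v = κ.m A_tail i
      · simp [hv, EdgeEnters, c2]
      · simp [hv, EdgeEnters, c2, Ne.symm hv]
  · refine ⟨l₂, by omega, fun x y => ?_, fun v => ?_⟩
    · rw [a₂, a₁]
      simp [EdgeArc, hi₁, t₁, h₁, hi, c1, c2, or_assoc]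
    · simp [EdgeEnters, c1, c2, th₂]

theorem edgeArcs_safe {κ : Cfg} {N i : ℕ} (h2 : 2 < W) (hi : κ.v V_e = i)
    (ht : κ.m A_tail i < N) (hh : κ.m A_head i < N) (hN : 2 * N < W)
    (hA : κ.v V_A + 3 < W) : edgeArcs.Safe W ω κ := by
  have key : ∀ τ : Cfg, Frame [V_x, V_y, V_A] [A_frm, A_to, A_nxt, A_hd] κ τ →
      τ.v V_A ≤ κ.v V_A + 2 → ∀ a b : Expr,
      (a = 𝓬 2 *ₑ .read A_head (𝓿 V_e) ∨ a = 𝓬 2 *ₑ .read A_tail (𝓿 V_e) ∨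
       a = 𝓬 2 *ₑ .read A_head (𝓿 V_e) +ₑ 𝓬 1 ∨ a = 𝓬 2 *ₑ .read A_tail (𝓿 V_e) +ₑ 𝓬 1) →
      (b = 𝓬 2 *ₑ .read A_head (𝓿 V_e) ∨ b = 𝓬 2 *ₑ .read A_tail (𝓿 V_e) ∨
       b = 𝓬 2 *ₑ .read A_head (𝓿 V_e) +ₑ 𝓬 1 ∨ b = 𝓬 2 *ₑ .read A_tail (𝓿 V_e) +ₑ 𝓬 1) →
      (addArc a b).Safe W ω τ := by
    intro τ hF hv a b ha hb
    have e1 : τ.v V_e = i := (hF.v _ (by decide)).trans hi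
    have e2 : τ.m A_tail = κ.m A_tail := hF.m _ (by decide)
    have e3 : τ.m A_head = κ.m A_head := hF.m _ (by decide)
    refine addArc_safe (by omega) ?_ (fun z => ?_) (by omega)
    · rcases ha with rfl | rfl | rfl | rfl <;> simp [e1, e2, e3] <;> omega
    · rcases hb with rfl | rfl | rfl | rfl <;> simp [e1, e2, e3] <;> omega
  have k0 := Frame.refl [V_x, V_y, V_A] [A_frm, A_to, A_nxt, A_hd] κ
  simp only [edgeArcs, Prog.Safe, Expr.Fits, BinOp.Fits, h2, true_and, and_true, Expr.val,
    BinOp.apply]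
  have h1 : 1 < W := by omega
  refine ⟨key κ k0 (by omega) _ _ (by simp) (by simp),
    key _ (k0.trans addArc_frame) (by rw [addArc_v]; omega) _ _ (by simp) (by simp), h1,
    fun _ => ⟨key _ ((k0.trans addArc_frame).trans addArc_frame) (by rw [addArc_v, addArc_v])
      _ _ (by simp) (by simp), h1⟩,
    fun _ => ⟨fun _ => ⟨key _ ((k0.trans addArc_frame).trans addArc_frame) (by rw [addArc_v, addArc_v])
      _ _ (by simp) (by simp), h1⟩, fun _ => trivial⟩⟩

end

/-- Write down the residual network. -/
def buildResidual : Prog :=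
  V_A ≔ 𝓬 0 ;;
  forLoop V_v (𝓬 2 *ₑ 𝓿 V_N) (.store A_hd (𝓿 V_v) (𝓬 0)) ;;
  forLoop V_v (𝓿 V_N) (.store A_thr (𝓿 V_v) (𝓬 0)) ;;
  forLoop V_e (𝓿 V_M) edgeArcs ;;
  forLoop V_v (𝓿 V_N) vertexArc

section

variable {w W : ℕ} {O : FlowOracle} {ω : ℕ → Bool}

/-- Whether flow enters a vertex is known only after all edges have been read. Hence the arcs
between entrance and exit are added in a separate loop over the flags `A_thr`. -/
theorem run_buildResidual (hW : W ≤ 2 ^ w) {κ : Cfg} {N M : ℕ}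
    (hN : κ.v V_N = N) (hM : κ.v V_M = M) (hb : 3 * N + 3 * M + 3 < W)
    (ht : ∀ i < M, κ.m A_tail i < N) (hh : ∀ i < M, κ.m A_head i < N) :
    ∃ κ', Run w O ω buildResidual κ (400 * (N + M + 1)) κ' ∧ Linked (2 * N) κ' ∧
      κ'.v V_A ≤ 3 * M + N ∧
      ∀ x y, Arc κ' x y ↔ (∃ i < M, EdgeArc (κ.m A_tail) (κ.m A_head) (κ.m A_flow) i x y) ∨
        ∃ v < N, (x = 2 * v ∧ y = 2 * v + 1 ∧
            ¬ ∃ i < M, EdgeEnters (κ.m A_tail) (κ.m A_head) (κ.m A_flow) i v) ∨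
          (x = 2 * v + 1 ∧ y = 2 * v ∧
            ∃ i < M, EdgeEnters (κ.m A_tail) (κ.m A_head) (κ.m A_flow) i v) := by
  have h1 : 1 < W := by omega
  have r₀ : Run w O ω (V_A ≔ 𝓬 0) κ 2 (κ.setV V_A 0) := run_go hW h1 _ _ (by simp; omega)
  obtain ⟨κ₁, r₁, z₁, -⟩ := run_fill (w := w) (W := W) (O := O) (ω := ω) hW h1 (x := V_v)
    (a := A_hd) (e := 𝓬 2 *ₑ 𝓿 V_N) (r := 𝓬 0) (κ := κ.setV V_A 0) (N := 2 * N) (fun _ => 0)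
    (by omega)
    (fun τ hF => by
      have e1 := hF.v V_N (by decide)
      simp [e1, hN]; omega)
    (fun i τ _ _ _ _ => by simp; omega)
  have F₁ := r₁.frame
  obtain ⟨κ₂, r₂, z₂, -⟩ := run_fill (w := w) (W := W) (O := O) (ω := ω) hW h1 (x := V_v)
    (a := A_thr) (e := 𝓿 V_N) (r := 𝓬 0) (κ := κ₁) (N := N) (fun _ => 0)
    (by omega)
    (fun τ hF => by
      have e1 := hF.v V_N (by decide)
      have e2 := F₁.v V_N (by decide)
      simp [e1, e2, hN])
    (fun i τ _ _ _ _ => by simp; omega)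
  have F₂ := r₂.frame
  have A₂ : κ₂.v V_A = 0 := by
    rw [F₂.v V_A (by decide), F₁.v V_A (by decide)]; simp
  have N₂ : κ₂.v V_N = N := by
    rw [F₂.v V_N (by decide), F₁.v V_N (by decide)]; simp [hN]
  have M₂ : κ₂.v V_M = M := by
    rw [F₂.v V_M (by decide), F₁.v V_M (by decide)]; simp [hM]
  have T₂ : κ₂.m A_tail = κ.m A_tail := by
    rw [F₂.m A_tail (by decide), F₁.m A_tail (by decide)]; rfl
  have H₂ : κ₂.m A_head = κ.m A_head := by
    rw [F₂.m A_head (by decide), F₁.m A_head (by decide)]; rfl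
  have W₂ : κ₂.m A_flow = κ.m A_flow := by
    rw [F₂.m A_flow (by decide), F₁.m A_flow (by decide)]; rfl
  have D₂ : ∀ x < 2 * N, κ₂.m A_hd x = 0 := fun x hx => by
    rw [F₂.m A_hd (by decide), z₁ x hx]
  obtain ⟨κ₃, r₃, ⟨L₃, V₃, Ar₃, Th₃⟩, -⟩ := run_for_go (w := w) (W := W) (O := O) (ω := ω) hW h1
    (x := V_e) (e := 𝓿 V_M) (body := edgeArcs) (κ := κ₂) (N := M)
    (fun i τ => Linked (2 * N) τ ∧ τ.v V_A ≤ 3 * i ∧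
      (∀ x y, Arc τ x y ↔ ∃ j < i, EdgeArc (κ.m A_tail) (κ.m A_head) (κ.m A_flow) j x y) ∧
      ∀ v < N, τ.m A_thr v ≠ 0 ↔ ∃ j < i, EdgeEnters (κ.m A_tail) (κ.m A_head) (κ.m A_flow) j v)
    (by omega)
    ⟨⟨fun x hx => by simp [A₂, D₂ x hx, lastArc], by simp [A₂], by simp [A₂], by simp [A₂]⟩,
      by simp [A₂], by simp [Arc, A₂], fun v hv => by simp [z₂ v hv]⟩
    (fun τ hF => by simp [hF.v V_M (by decide), M₂])
    (by decide)
    (fun i τ hi hI hF hv => by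
      obtain ⟨hl, hA, hAr, hTh⟩ := hI
      have T₃ : τ.m A_tail = κ.m A_tail := (hF.m _ (by decide)).trans T₂
      have H₃ : τ.m A_head = κ.m A_head := (hF.m _ (by decide)).trans H₂
      have W₃ : τ.m A_flow = κ.m A_flow := (hF.m _ (by decide)).trans W₂
      have hti : τ.m A_tail i < N := by rw [T₃]; exact ht i hi
      have hhi : τ.m A_head i < N := by rw [H₃]; exact hh i hi
      refine ⟨edgeArcs_safe (by omega) hv hti hhi (by omega) (by omega), ?_⟩
      obtain ⟨g1, g2, g3, g4⟩ := edgeArcs_go (ω := ω) hv hl hti hhi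
      refine ⟨⟨g1.hd, g1.nxt, g1.frm_lt, g1.to_lt⟩, ?_, fun x y => ?_, fun v hv => ?_⟩
      · simp only [Cfg.setV_v]
        rw [if_neg (by decide)]
        omega
      · have : Arc ((edgeArcs.go ω τ).setV V_e (i + 1)) x y ↔ Arc (edgeArcs.go ω τ) x y := by
          simp [Arc]
        rw [this, g3, hAr, T₃, H₃, W₃]
        simp only [Nat.lt_succ_iff_lt_or_eq, or_and_right, exists_or, exists_eq_left]
      · rw [Cfg.setV_m, g4, hTh v hv, T₃, H₃, W₃]
        simp only [Nat.lt_succ_iff_lt_or_eq, or_and_right, exists_or, exists_eq_left])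
  have F₃ := r₃.frame
  have N₃ : κ₃.v V_N = N := (F₃.v _ (by decide)).trans N₂
  obtain ⟨κ₄, r₄, ⟨L₄, V₄, Ar₄⟩, -⟩ := run_for_go (w := w) (W := W) (O := O) (ω := ω) hW h1
    (x := V_v) (e := 𝓿 V_N) (body := vertexArc) (κ := κ₃) (N := N)
    (fun i τ => Linked (2 * N) τ ∧ τ.v V_A ≤ 3 * M + i ∧
      ∀ x y, Arc τ x y ↔ (∃ j < M, EdgeArc (κ.m A_tail) (κ.m A_head) (κ.m A_flow) j x y) ∨
        ∃ v < i, (x = 2 * v ∧ y = 2 * v + 1 ∧ κ₃.m A_thr v = 0) ∨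
          (x = 2 * v + 1 ∧ y = 2 * v ∧ κ₃.m A_thr v ≠ 0))
    (by omega)
    ⟨⟨L₃.hd, L₃.nxt, L₃.frm_lt, L₃.to_lt⟩, by simpa using V₃, fun x y => by
      have : Arc (κ₃.setV V_v 0) x y ↔ Arc κ₃ x y := by simp [Arc]
      rw [this, Ar₃]; simp⟩
    (fun τ hF => by simp [hF.v V_N (by decide), N₃])
    (by decide)
    (fun i τ hi hI hF hv => by
      obtain ⟨hl, hA, hAr⟩ := hI
      have th : τ.m A_thr = κ₃.m A_thr := hF.m _ (by decide)
      have hsafe : vertexArc.Safe W ω τ := by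
        refine ⟨trivial, fun _ => addArc_safe h1 ?_ (fun z => ?_) (by omega),
          fun _ => addArc_safe h1 ?_ (fun z => ?_) (by omega)⟩ <;> simp [hv] <;> omega
      refine ⟨hsafe, ?_⟩
      have hmain : Linked (2 * N) (vertexArc.go ω τ) ∧
          (vertexArc.go ω τ).v V_A ≤ τ.v V_A + 1 ∧
          ∀ x y, Arc (vertexArc.go ω τ) x y ↔ Arc τ x y ∨
            ((x = 2 * i ∧ y = 2 * i + 1 ∧ κ₃.m A_thr i = 0) ∨
              (x = 2 * i + 1 ∧ y = 2 * i ∧ κ₃.m A_thr i ≠ 0)) := by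
        simp only [vertexArc, Prog.go, Expr.val, hv, th]
        by_cases hc : κ₃.m A_thr i = 0
        · rw [if_neg (by simpa using hc)]
          refine ⟨addArc_linked (fun z => by simp) hl (by simp [hv]; omega) (by simp [hv]; omega),
            by rw [addArc_v], fun x y => ?_⟩
          rw [addArc_arc (fun z => by simp)]
          simp [hv, hc]
        · rw [if_pos hc]
          refine ⟨addArc_linked (fun z => by simp) hl (by simp [hv]; omega) (by simp [hv]; omega),
            by rw [addArc_v], fun x y => ?_⟩
          rw [addArc_arc (fun z => by simp)]
          simp [hv, hc]
      obtain ⟨g1, g2, g3⟩ := hmain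
      refine ⟨⟨g1.hd, g1.nxt, g1.frm_lt, g1.to_lt⟩, ?_, fun x y => ?_⟩
      · simp only [Cfg.setV_v]
        rw [if_neg (by decide)]
        omega
      · have : Arc ((vertexArc.go ω τ).setV V_v (i + 1)) x y ↔ Arc (vertexArc.go ω τ) x y := by
          simp [Arc]
        rw [this, g3, hAr, or_assoc]
        simp only [Nat.lt_succ_iff_lt_or_eq, or_and_right, exists_or, exists_eq_left])
  refine ⟨κ₄, (r₀.seq (r₁.seq (r₂.seq (r₃.seq r₄)))).mono ?_, L₄, V₄, fun x y => ?_⟩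
  · have c1 : edgeArcs.cost ≤ 200 := by decide
    have c2 : vertexArc.cost ≤ 100 := by decide
    simp only [Expr.cost]
    have := Nat.mul_le_mul_left (M + 1) (show edgeArcs.cost + 1 + 9 ≤ 210 by omega)
    have := Nat.mul_le_mul_left (N + 1) (show vertexArc.cost + 1 + 9 ≤ 110 by omega)
    omega
  · rw [Ar₄]
    refine or_congr Iff.rfl ⟨?_, ?_⟩
    · rintro ⟨v, hv, h⟩
      refine ⟨v, hv, ?_⟩
      rwa [← Th₃ v hv, not_ne_iff]
    · rintro ⟨v, hv, h⟩
      refine ⟨v, hv, ?_⟩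
      rwa [← Th₃ v hv, not_ne_iff] at h

end

end RAM

/-! ## Graph search -/

namespace RAM

/-- A node that has been visited and taken from the stack. -/
def Popped (mark stack : ℕ → ℕ) (sp x : ℕ) : Prop := mark x ≠ 0 ∧ ∀ i < sp, stack i ≠ x

/-- Chains run downwards, so from `cur` on exactly the arcs with the same start and a number up to
`cur` are still to be scanned. -/
def Pending (frm : ℕ → ℕ) (cur c : ℕ) : Prop := cur ≠ 0 ∧ frm cur = frm c ∧ c ≤ cur

/-- The invariant of the search from `s₀` among `NN` nodes with arcs `1, …, A`. -/
structure SearchInv (frm tto : ℕ → ℕ) (A NN s₀ : ℕ) (mark stack : ℕ → ℕ) (sp cur : ℕ) : Prop where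
  start : mark s₀ ≠ 0
  reach : ∀ x < NN, mark x ≠ 0 →
    Relation.ReflTransGen (fun x y => ∃ c < A, frm (c + 1) = x ∧ tto (c + 1) = y) s₀ x
  stack_lt : ∀ i < sp, stack i < NN ∧ mark (stack i) ≠ 0
  stack_inj : ∀ i < sp, ∀ j < sp, stack i = stack j → i = j
  done : ∀ c < A, Popped mark stack sp (frm (c + 1)) →
    mark (tto (c + 1)) ≠ 0 ∨ Pending frm cur (c + 1)
  cur : cur ≠ 0 → cur ≤ A ∧ Popped mark stack sp (frm cur)

open Classical in
/-- A bound for the remaining number of rounds of the search. -/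
noncomputable def searchRest (frm : ℕ → ℕ) (A NN : ℕ) (mark stack : ℕ → ℕ) (sp cur : ℕ) : ℕ :=
  ((Finset.range A).filter fun c => ¬ Popped mark stack sp (frm (c + 1)) ∨
    Pending frm cur (c + 1)).card +
  ((Finset.range NN).filter fun x => ¬ Popped mark stack sp x).card

section

variable {frm tto mark stack mark' stack' : ℕ → ℕ} {A NN s₀ sp cur : ℕ}

theorem searchRest_le : searchRest frm A NN mark stack sp cur ≤ A + NN := by
  classical
  unfold searchRest
  exact add_le_add ((Finset.card_filter_le _ _).trans (by simp))
    ((Finset.card_filter_le _ _).trans (by simp))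

theorem SearchInv.sp_le (h : SearchInv frm tto A NN s₀ mark stack sp cur) : sp ≤ NN := by
  have : ((Finset.range sp).image stack).card = sp := by
    rw [Finset.card_image_of_injOn, Finset.card_range]
    intro i hi j hj hij
    exact h.stack_inj i (by simpa using hi) j (by simpa using hj) hij
  rw [← this, ← Finset.card_range NN]
  refine Finset.card_le_card fun x hx => ?_
  simp only [Finset.mem_image, Finset.mem_range] at hx ⊢
  obtain ⟨i, hi, rfl⟩ := hx
  exact (h.stack_lt i hi).1

/-- The popped node leaves the second count of `searchRest`. Its arcs stay in the first one,
changing from "start not popped" to "pending". -/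
theorem SearchInv.pop (h : SearchInv frm tto A NN s₀ mark stack sp 0) (hsp : 0 < sp) :
    SearchInv frm tto A NN s₀ mark stack (sp - 1) (lastArc frm A (stack (sp - 1))) ∧
    searchRest frm A NN mark stack (sp - 1) (lastArc frm A (stack (sp - 1))) <
      searchRest frm A NN mark stack sp 0 := by
  classical
  have hmono : ∀ x, Popped mark stack sp x → Popped mark stack (sp - 1) x := fun x hx =>
    ⟨hx.1, fun i hi => hx.2 i (by omega)⟩
  have hback : ∀ x, Popped mark stack (sp - 1) x → x ≠ stack (sp - 1) → Popped mark stack sp x :=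
    fun x hx hne => ⟨hx.1, fun i hi => by
      rcases Nat.lt_or_ge i (sp - 1) with h' | h'
      · exact hx.2 i h'
      · rw [show i = sp - 1 by omega]; exact hne.symm⟩
  have htop : Popped mark stack (sp - 1) (stack (sp - 1)) :=
    ⟨(h.stack_lt (sp - 1) (by omega)).2, fun i hi he => by
      have := h.stack_inj i (by omega) (sp - 1) (by omega) he
      omega⟩
  have hpend : ∀ c, ¬ Pending frm 0 c := fun c hc => hc.1 rfl
  refine ⟨⟨h.start, h.reach, fun i hi => h.stack_lt i (by omega),
    fun i hi j hj => h.stack_inj i (by omega) j (by omega), fun c hc hp => ?_, fun hne => ?_⟩, ?_⟩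
  · by_cases hx : frm (c + 1) = stack (sp - 1)
    · right
      have hle := le_lastArc (by omega) (by omega : c + 1 ≤ A) hx
      have hne : lastArc frm A (stack (sp - 1)) ≠ 0 := by omega
      exact ⟨hne, by rw [(lastArc_spec hne).2, hx], hle⟩
    · exact (h.done c hc (hback _ hp hx)).imp_right fun h' => absurd h' (hpend _)
  · exact ⟨(lastArc_spec hne).1, by rw [(lastArc_spec hne).2]; exact htop⟩
  · unfold searchRest
    refine add_lt_add_of_le_of_lt (Finset.card_le_card ?_) (Finset.card_lt_card ?_)
    · intro c hc
      simp only [Finset.mem_filter, Finset.mem_range] at hc ⊢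
      refine ⟨hc.1, Or.inl ?_⟩
      rcases hc.2 with h' | h'
      · exact fun h'' => h' (hmono _ h'')
      · intro h''
        have e := h'.2.1
        rw [(lastArc_spec h'.1).2] at e
        exact h''.2 (sp - 1) (by omega) e
    · refine ⟨fun x hx => ?_, fun hsub => ?_⟩
      · simp only [Finset.mem_filter, Finset.mem_range] at hx ⊢
        exact ⟨hx.1, fun h' => hx.2 (hmono _ h')⟩
      · have : stack (sp - 1) ∈ (Finset.range NN).filter fun x => ¬ Popped mark stack sp x := by
          simp only [Finset.mem_filter, Finset.mem_range]
          exact ⟨(h.stack_lt _ (by omega)).1, fun h' => h'.2 (sp - 1) (by omega) rfl⟩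
        have := hsub this
        simp only [Finset.mem_filter, Finset.mem_range] at this
        exact this.2 htop

theorem pending_next {c : ℕ} (hc0 : 0 < c) (hcur : cur ≠ 0) :
    Pending frm (lastArc frm (cur - 1) (frm cur)) c ↔ Pending frm cur c ∧ c ≠ cur := by
  constructor
  · rintro ⟨h1, h2, h3⟩
    obtain ⟨h4, h5⟩ := lastArc_spec h1
    exact ⟨⟨hcur, by rw [← h5, h2], by omega⟩, by omega⟩
  · rintro ⟨⟨h1, h2, h3⟩, h4⟩
    have hle := le_lastArc hc0 (by omega : c ≤ cur - 1) h2.symm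
    have hne : lastArc frm (cur - 1) (frm cur) ≠ 0 := by omega
    exact ⟨hne, by rw [(lastArc_spec hne).2, h2], hle⟩

/-- Scanning an arc leaves the set of popped nodes unchanged, and the arc `cur` alone stops being
pending. -/
theorem SearchInv.next_lt (h : SearchInv frm tto A NN s₀ mark stack sp cur) (hcur : cur ≠ 0)
    {sp' : ℕ} (hp : ∀ x, Popped mark' stack' sp' x ↔ Popped mark stack sp x) :
    searchRest frm A NN mark' stack' sp' (lastArc frm (cur - 1) (frm cur)) <
      searchRest frm A NN mark stack sp cur := by
  classical
  obtain ⟨hA, hpop⟩ := h.cur hcur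
  unfold searchRest
  simp only [hp]
  refine add_lt_add_of_lt_of_le (Finset.card_lt_card ⟨fun c hc => ?_, fun hsub => ?_⟩) le_rfl
  · simp only [Finset.mem_filter, Finset.mem_range] at hc ⊢
    refine ⟨hc.1, hc.2.imp_right fun h' => ?_⟩
    exact ((pending_next (by omega) hcur).1 h').1
  · have : cur - 1 ∈ (Finset.range A).filter fun c => ¬ Popped mark stack sp (frm (c + 1)) ∨
        Pending frm cur (c + 1) := by
      simp only [Finset.mem_filter, Finset.mem_range]
      rw [show cur - 1 + 1 = cur by omega]
      exact ⟨by omega, Or.inr ⟨hcur, rfl, le_rfl⟩⟩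
    have := hsub this
    simp only [Finset.mem_filter, Finset.mem_range] at this
    rw [show cur - 1 + 1 = cur by omega] at this
    rcases this.2 with h' | h'
    · exact h' hpop
    · exact ((pending_next (by omega) hcur).1 h').2 rfl

theorem SearchInv.skip (h : SearchInv frm tto A NN s₀ mark stack sp cur) (hcur : cur ≠ 0)
    (hm : mark (tto cur) ≠ 0) :
    SearchInv frm tto A NN s₀ mark stack sp (lastArc frm (cur - 1) (frm cur)) := by
  obtain ⟨hA, hpop⟩ := h.cur hcur
  refine ⟨h.start, h.reach, h.stack_lt, h.stack_inj, fun c hc hp => ?_, fun hne => ?_⟩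
  · rcases h.done c hc hp with h' | h'
    · exact Or.inl h'
    · by_cases hcc : c + 1 = cur
      · rw [hcc]; exact Or.inl hm
      · exact Or.inr ((pending_next (by omega) hcur).2 ⟨h', hcc⟩)
  · obtain ⟨h4, h5⟩ := lastArc_spec hne
    rw [h5]
    exact ⟨by omega, hpop⟩

/-- A new node is marked and stacked at the same moment, so it does not count as popped. -/
theorem popped_push {y : ℕ} (hm : mark y = 0)
    (hmark : ∀ x, mark' x = if x = y then 1 else mark x)
    (hstack : ∀ i, stack' i = if i = sp then y else stack i) (x : ℕ) :
    Popped mark' stack' (sp + 1) x ↔ Popped mark stack sp x := by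
  unfold Popped
  rw [hmark]
  constructor
  · rintro ⟨h1, h2⟩
    have hxy : x ≠ y := fun he => by
      have := h2 sp (by omega)
      rw [hstack, if_pos rfl] at this
      exact this he.symm
    rw [if_neg hxy] at h1
    refine ⟨h1, fun i hi => ?_⟩
    have := h2 i (by omega)
    rwa [hstack, if_neg (by omega)] at this
  · rintro ⟨h1, h2⟩
    have hxy : x ≠ y := fun he => h1 (he ▸ hm)
    rw [if_neg hxy]
    refine ⟨h1, fun i hi => ?_⟩
    rw [hstack]
    split_ifs with h'
    · exact hxy.symm
    · exact h2 i (by omega)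

theorem SearchInv.push (h : SearchInv frm tto A NN s₀ mark stack sp cur) (hcur : cur ≠ 0)
    (hm : mark (tto cur) = 0) (hfrm : ∀ c < A, frm (c + 1) < NN) (hto : ∀ c < A, tto (c + 1) < NN)
    (hmark : ∀ x, mark' x = if x = tto cur then 1 else mark x)
    (hstack : ∀ i, stack' i = if i = sp then tto cur else stack i) :
    SearchInv frm tto A NN s₀ mark' stack' (sp + 1) (lastArc frm (cur - 1) (frm cur)) := by
  obtain ⟨hA, hpop⟩ := h.cur hcur
  have hmono : ∀ x, mark x ≠ 0 → mark' x ≠ 0 := fun x hx => by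
    rw [hmark]; split_ifs <;> simp [hx]
  have hpp := popped_push hm hmark hstack
  have htl : tto cur < NN := by simpa [show cur - 1 + 1 = cur by omega] using hto (cur - 1) (by omega)
  have hfl : frm cur < NN := by simpa [show cur - 1 + 1 = cur by omega] using hfrm (cur - 1) (by omega)
  refine ⟨hmono _ h.start, fun x hx hx' => ?_, fun i hi => ?_, fun i hi j hj hij => ?_,
    fun c hc hp => ?_, fun hne => ?_⟩
  · rw [hmark] at hx'
    split_ifs at hx' with hxy
    · subst hxy
      refine (h.reach (frm cur) hfl hpop.1).tail ⟨cur - 1, by omega, ?_, ?_⟩ <;>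
        rw [show cur - 1 + 1 = cur by omega]
    · exact h.reach x hx hx'
  · rw [hstack]
    split_ifs with h'
    · exact ⟨htl, by rw [hmark]; simp⟩
    · exact ⟨(h.stack_lt i (by omega)).1, hmono _ (h.stack_lt i (by omega)).2⟩
  · have hfresh : ∀ i < sp, stack i ≠ tto cur := fun i hi he => (h.stack_lt i hi).2 (he ▸ hm)
    rw [hstack, hstack] at hij
    split_ifs at hij with h1 h2 h2
    · omega
    · exact absurd hij.symm (hfresh j (by omega))
    · exact absurd hij (hfresh i (by omega))
    · exact h.stack_inj i (by omega) j (by omega) hij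
  · rcases h.done c hc ((hpp _).1 hp) with h' | h'
    · exact Or.inl (hmono _ h')
    · by_cases hcc : c + 1 = cur
      · left; rw [hcc, hmark]; simp
      · exact Or.inr ((pending_next (by omega) hcur).2 ⟨h', hcc⟩)
  · obtain ⟨h4, h5⟩ := lastArc_spec hne
    rw [h5]
    exact ⟨by omega, (hpp _).2 hpop⟩

/-- With an empty stack and nothing pending, every marked node has been popped and every arc from it
leads to a marked node, so the marked set is closed under arcs. -/
theorem SearchInv.final (h : SearchInv frm tto A NN s₀ mark stack 0 0) {x : ℕ} (hx : x < NN) :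
    mark x ≠ 0 ↔
      Relation.ReflTransGen (fun x y => ∃ c < A, frm (c + 1) = x ∧ tto (c + 1) = y) s₀ x := by
  refine ⟨h.reach x hx, fun hr => ?_⟩
  clear hx
  induction hr with
  | refl => exact h.start
  | tail _ hyz ih =>
    obtain ⟨c, hc, rfl, rfl⟩ := hyz
    rcases h.done c hc ⟨ih, by simp⟩ with h' | h'
    · exact h'
    · exact absurd rfl h'.1

end

def searchStep : Prog :=
  .ite (𝓬 0 <ₑ 𝓿 V_cur)
    (V_y ≔ .read A_to (𝓿 V_cur) ;; V_cur ≔ .read A_nxt (𝓿 V_cur) ;;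
      .ite (.read A_mark (𝓿 V_y)) .skip
        (.store A_mark (𝓿 V_y) (𝓬 1) ;; .store A_stack (𝓿 V_sp) (𝓿 V_y) ;;
          V_sp ≔ 𝓿 V_sp +ₑ 𝓬 1))
    (V_sp ≔ 𝓿 V_sp -ₑ 𝓬 1 ;; V_cur ≔ .read A_hd (.read A_stack (𝓿 V_sp)))

/-- Mark the nodes that can be reached from the exit of `V_s`. -/
def search : Prog :=
  forLoop V_v (𝓬 2 *ₑ 𝓿 V_N) (.store A_mark (𝓿 V_v) (𝓬 0)) ;;
  (.store A_mark (𝓬 2 *ₑ 𝓿 V_s +ₑ 𝓬 1) (𝓬 1) ;;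
    .store A_stack (𝓬 0) (𝓬 2 *ₑ 𝓿 V_s +ₑ 𝓬 1) ;; V_sp ≔ 𝓬 1 ;; V_cur ≔ 𝓬 0) ;;
  .loop ((𝓬 0 <ₑ 𝓿 V_sp) +ₑ (𝓬 0 <ₑ 𝓿 V_cur)) searchStep

section

variable {w W : ℕ} {O : FlowOracle} {ω : ℕ → Bool}

theorem run_search (hW : W ≤ 2 ^ w) {κ : Cfg} {N s : ℕ} (hN : κ.v V_N = N) (hs : κ.v V_s = s)
    (hsN : s < N) (hl : Linked (2 * N) κ) (hb : 2 * N + 3 < W) :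
    ∃ κ', Run w O ω search κ (200 * (κ.v V_A + N + 1)) κ' ∧
      ∀ x < 2 * N, κ'.m A_mark x ≠ 0 ↔ Relation.ReflTransGen (Arc κ) (2 * s + 1) x := by
  have h1 : 1 < W := by omega
  obtain ⟨κ₁, r₁, z₁, -⟩ := run_fill (w := w) (W := W) (O := O) (ω := ω) hW h1 (x := V_v)
    (a := A_mark) (e := 𝓬 2 *ₑ 𝓿 V_N) (r := 𝓬 0) (κ := κ) (N := 2 * N) (fun _ => 0)
    (by omega)
    (fun τ hF => by
      have e1 := hF.v V_N (by decide)
      simp [e1, hN]; omega)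
    (fun i τ _ _ _ _ => by simp; omega)
  have F₁ := r₁.frame
  have s₁ : κ₁.v V_s = s := (F₁.v _ (by decide)).trans hs
  have r₂ := run_go (O := O) (ω := ω) hW h1
    (.store A_mark (𝓬 2 *ₑ 𝓿 V_s +ₑ 𝓬 1) (𝓬 1) ;;
      .store A_stack (𝓬 0) (𝓬 2 *ₑ 𝓿 V_s +ₑ 𝓬 1) ;; V_sp ≔ 𝓬 1 ;; V_cur ≔ 𝓬 0) κ₁
    (by simp [s₁]; omega)
  set κ₂ := (.store A_mark (𝓬 2 *ₑ 𝓿 V_s +ₑ 𝓬 1) (𝓬 1) ;;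
      .store A_stack (𝓬 0) (𝓬 2 *ₑ 𝓿 V_s +ₑ 𝓬 1) ;; V_sp ≔ 𝓬 1 ;; V_cur ≔ 𝓬 0 : Prog).go ω κ₁
    with hκ₂
  have F₂ := r₂.frame
  have cur₂ : κ₂.v V_cur = 0 := by simp [hκ₂]
  have sp₂ : κ₂.v V_sp = 1 := by simp [hκ₂]
  have mark₂ : ∀ x, κ₂.m A_mark x = if x = 2 * s + 1 then 1 else κ₁.m A_mark x := by
    intro x; simp [hκ₂, s₁]
  have stack₂ : κ₂.m A_stack 0 = 2 * s + 1 := by simp [hκ₂, s₁]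
  have A₂ : κ₂.v V_A = κ.v V_A := (F₂.v _ (by decide)).trans (F₁.v _ (by decide))
  have frm₂ : κ₂.m A_frm = κ.m A_frm := (F₂.m _ (by decide)).trans (F₁.m _ (by decide))
  have to₂ : κ₂.m A_to = κ.m A_to := (F₂.m _ (by decide)).trans (F₁.m _ (by decide))
  have nxt₂ : κ₂.m A_nxt = κ.m A_nxt := (F₂.m _ (by decide)).trans (F₁.m _ (by decide))
  have hd₂ : κ₂.m A_hd = κ.m A_hd := (F₂.m _ (by decide)).trans (F₁.m _ (by decide))
  have inv₂ : SearchInv (κ.m A_frm) (κ.m A_to) (κ.v V_A) (2 * N) (2 * s + 1) (κ₂.m A_mark)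
      (κ₂.m A_stack) (κ₂.v V_sp) (κ₂.v V_cur) := by
    have hmark : ∀ x < 2 * N, κ₂.m A_mark x ≠ 0 → x = 2 * s + 1 := fun x hx hm => by
      rw [mark₂, z₁ x hx] at hm
      by_contra h
      exact hm (if_neg h)
    have hm0 : κ₂.m A_mark (2 * s + 1) ≠ 0 := by rw [mark₂]; simp
    rw [sp₂, cur₂]
    refine ⟨hm0, fun x hx hm => ?_, fun i hi => ?_, fun i hi j hj _ => by omega, fun c hc hp => ?_,
      fun h => absurd rfl h⟩
    · rw [hmark x hx hm]
    · rw [show i = 0 by omega, stack₂]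
      exact ⟨by omega, hm0⟩
    -- At the start only the source is marked, and it lies on the stack; thus no node is popped yet.
    · exfalso
      refine hp.2 0 (by omega) ?_
      rw [stack₂, hmark _ (hl.frm_lt c hc) hp.1]
  obtain ⟨κ₃, j, r₃, hI, hc⟩ := run_loop (w := w) (W := W) (O := O) (ω := ω) hW h1
    (e := (𝓬 0 <ₑ 𝓿 V_sp) +ₑ (𝓬 0 <ₑ 𝓿 V_cur)) (p := searchStep) (c := searchStep.cost) (κ := κ₂)
    (fun j τ => SearchInv (κ.m A_frm) (κ.m A_to) (κ.v V_A) (2 * N) (2 * s + 1) (τ.m A_mark)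
      (τ.m A_stack) (τ.v V_sp) (τ.v V_cur) ∧
      searchRest (κ.m A_frm) (κ.v V_A) (2 * N) (τ.m A_mark) (τ.m A_stack) (τ.v V_sp) (τ.v V_cur) ≤ j)
    (fun j τ _ _ => by
      simp only [Expr.Fits, BinOp.Fits, Expr.val, BinOp.apply, and_true]
      have key : ∀ (p : Prop) [Decidable p], (if p then 1 else 0) ≤ 1 := fun p _ => by
        split_ifs <;> omega
      exact ⟨by omega, by omega, lt_of_le_of_lt (add_le_add (key _) (key _)) (by omega)⟩)
    (fun j τ hI hF hc => by
      obtain ⟨hI, hj⟩ := hI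
      have to₃ : τ.m A_to = κ.m A_to := (hF.m _ (by decide)).trans to₂
      have nxt₃ : τ.m A_nxt = κ.m A_nxt := (hF.m _ (by decide)).trans nxt₂
      have hd₃ : τ.m A_hd = κ.m A_hd := (hF.m _ (by decide)).trans hd₂
      have hsp := hI.sp_le
      have hsafe : searchStep.Safe W ω τ := by
        simp only [searchStep, Prog.Safe, Expr.Fits, BinOp.Fits, Prog.go, Expr.val, and_true,
          true_and, BinOp.apply, Cfg.setM_v, Cfg.setV_v]
        refine ⟨by omega, fun _ => ⟨fun _ => trivial, fun _ => ⟨h1, h1, ?_⟩⟩, fun _ => ⟨h1, ?_⟩⟩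
        · simp; omega
        · omega
      suffices h : SearchInv (κ.m A_frm) (κ.m A_to) (κ.v V_A) (2 * N) (2 * s + 1)
          ((searchStep.go ω τ).m A_mark) ((searchStep.go ω τ).m A_stack)
          ((searchStep.go ω τ).v V_sp) ((searchStep.go ω τ).v V_cur) ∧
          searchRest (κ.m A_frm) (κ.v V_A) (2 * N) ((searchStep.go ω τ).m A_mark)
            ((searchStep.go ω τ).m A_stack) ((searchStep.go ω τ).v V_sp)
            ((searchStep.go ω τ).v V_cur) < searchRest (κ.m A_frm) (κ.v V_A) (2 * N) (τ.m A_mark)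
              (τ.m A_stack) (τ.v V_sp) (τ.v V_cur) from
        ⟨searchStep.go ω τ, _, lt_of_lt_of_le h.2 hj, run_go hW h1 _ _ hsafe, h.1, le_rfl⟩
      by_cases hcur : τ.v V_cur = 0
      · have hgo : searchStep.go ω τ = (τ.setV V_sp (τ.v V_sp - 1)).setV V_cur
            (κ.m A_hd (τ.m A_stack (τ.v V_sp - 1))) := by
          simp [searchStep, hcur, hd₃]
        have hpos : 0 < τ.v V_sp := by
          by_contra h
          simp [hcur, h] at hc
        rw [hcur] at hI ⊢
        rw [hgo]
        simp only [Cfg.setV_m, Cfg.setV_v, if_true]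
        rw [if_neg (by decide), hl.hd _ (hI.stack_lt _ (by omega)).1]
        exact hI.pop hpos
      · obtain ⟨hcA, -⟩ := hI.cur hcur
        have hnx : κ.m A_nxt (τ.v V_cur) = lastArc (κ.m A_frm) (τ.v V_cur - 1)
            (κ.m A_frm (τ.v V_cur)) := by
          have := hl.nxt (τ.v V_cur - 1) (by omega)
          rwa [show τ.v V_cur - 1 + 1 = τ.v V_cur by omega] at this
        have hpos : 0 < τ.v V_cur := by omega
        by_cases hm : τ.m A_mark (κ.m A_to (τ.v V_cur)) = 0
        · have hgo : searchStep.go ω τ = ((((τ.setV V_y (κ.m A_to (τ.v V_cur))).setV V_cur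
              (κ.m A_nxt (τ.v V_cur))).setM A_mark (κ.m A_to (τ.v V_cur)) 1).setM A_stack (τ.v V_sp)
              (κ.m A_to (τ.v V_cur))).setV V_sp (τ.v V_sp + 1) := by
            simp [searchStep, hpos, to₃, nxt₃, hm]
          rw [hgo]
          simp only [Cfg.setM_v, Cfg.setV_v, if_true, Cfg.setV_m, hnx]
          rw [if_neg (by decide)]
          have e1 : ∀ x, (((((τ.setV V_y (κ.m A_to (τ.v V_cur))).setV V_cur
              (lastArc (κ.m A_frm) (τ.v V_cur - 1) (κ.m A_frm (τ.v V_cur)))).setM A_mark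
              (κ.m A_to (τ.v V_cur)) 1).setM A_stack (τ.v V_sp) (κ.m A_to (τ.v V_cur))).m A_mark) x =
              if x = κ.m A_to (τ.v V_cur) then 1 else τ.m A_mark x := by intro x; simp
          have e2 : ∀ x, (((((τ.setV V_y (κ.m A_to (τ.v V_cur))).setV V_cur
              (lastArc (κ.m A_frm) (τ.v V_cur - 1) (κ.m A_frm (τ.v V_cur)))).setM A_mark
              (κ.m A_to (τ.v V_cur)) 1).setM A_stack (τ.v V_sp) (κ.m A_to (τ.v V_cur))).m A_stack) x =
              if x = τ.v V_sp then κ.m A_to (τ.v V_cur) else τ.m A_stack x := by intro x; simp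
          exact ⟨hI.push hcur hm hl.frm_lt hl.to_lt e1 e2,
            hI.next_lt hcur (popped_push hm e1 e2)⟩
        · have hgo : searchStep.go ω τ = (τ.setV V_y (κ.m A_to (τ.v V_cur))).setV V_cur
              (κ.m A_nxt (τ.v V_cur)) := by
            simp [searchStep, hpos, to₃, nxt₃, hm]
          rw [hgo]
          simp only [Cfg.setV_v, if_true, Cfg.setV_m, hnx]
          exact ⟨hI.skip hcur hm, hI.next_lt hcur fun x => Iff.rfl⟩)
    -- Each arc is scanned once and each node popped once, which bounds the rounds linearly.
    (κ.v V_A + 2 * N) ⟨inv₂, searchRest_le⟩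
  have hcur : κ₃.v V_cur = 0 := by
    by_contra h
    simp [Nat.pos_of_ne_zero h] at hc
  have hsp : κ₃.v V_sp = 0 := by
    by_contra h
    simp [Nat.pos_of_ne_zero h] at hc
  have hI := hI.1
  rw [hcur, hsp] at hI
  refine ⟨κ₃, (r₁.seq (r₂.seq (r₃.mono (t' := (κ.v V_A + 2 * N + 1) * 40)
    (Nat.mul_le_mul_left _ (by decide))))).mono ?_, fun x hx => hI.final hx⟩
  simp only [Expr.cost, Prog.cost]
  omega

/-! ## Minimum cuts -/

/-- Call the maximum flow procedure and mark the part of the residual network that can be reached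
from the source. -/
def minCut : Prog :=
  .maxflow (𝓿 V_N) (𝓿 V_M) (𝓿 V_s) (𝓿 V_t) A_tail A_head A_flow ;; buildResidual ;; search

/-- The marks describe a minimum cut of the instance. -/
structure MarkedCut (I : FlowInstance) (κ : Cfg) (Y C : Finset ℕ) : Prop where
  separates : I.Separates Y C
  min : ∀ Y' C', I.Separates Y' C' → C.card ≤ C'.card
  mem_Y : ∀ v < I.N, κ.m A_mark (2 * v + 1) ≠ 0 ↔ v ∈ Y
  mem_C : ∀ v < I.N, (κ.m A_mark (2 * v) ≠ 0 ∧ κ.m A_mark (2 * v + 1) = 0) ↔ v ∈ C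
  lt_of_mem_C : ∀ v ∈ C, v < I.N

/-- The flow instance in the memory. -/
def Cfg.inst (κ : Cfg) : FlowInstance where
  N := κ.v V_N
  M := κ.v V_M
  tail i := κ.m A_tail i
  head i := κ.m A_head i
  s := κ.v V_s
  t := κ.v V_t

/-- The arcs in the memory are exactly the residual arcs `Res` of the oracle's flow, with the words
1 and 2 in `A_flow` giving the sign. The marks therefore coincide with `Reach`, and duality applies.
-/
theorem run_minCut (hW : W ≤ 2 ^ w) (hO : O.Correct) {κ : Cfg} (hI : κ.inst.Valid)
    (hb : 3 * κ.v V_N + 3 * κ.v V_M + 3 < W) :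
    ∃ κ', Run w O ω minCut κ (1000 * (κ.v V_N + κ.v V_M + 1)) κ' ∧
      κ'.f = κ.f + κ.v V_N + κ.v V_M ∧ ∃ Y C, MarkedCut κ.inst κ' Y C := by
  classical
  set κ₁ : Cfg := ⟨κ.v, Function.update κ.m A_flow
      (fun i => if h : i < κ.inst.M then flowWord (O κ.inst ⟨i, h⟩) else κ.m A_flow i), κ.c,
      κ.f + κ.inst.N + κ.inst.M⟩ with hκ₁
  have r₁ : Run w O ω (.maxflow (𝓿 V_N) (𝓿 V_M) (𝓿 V_s) (𝓿 V_t) A_tail A_head A_flow) κ 5 κ₁ :=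
    fun T => ⟨T + 5, le_rfl, Exec.maxflow (κ.st T) (𝓿 V_N) (𝓿 V_M) (𝓿 V_s) (𝓿 V_t) A_tail A_head
      A_flow hI⟩
  have tail₁ : κ₁.m A_tail = κ.m A_tail := by simp [hκ₁]
  have head₁ : κ₁.m A_head = κ.m A_head := by simp [hκ₁]
  have flow₁ : ∀ i : Fin κ.inst.M, κ₁.m A_flow i = flowWord (O κ.inst i) := by
    intro i; simp [hκ₁]
  obtain ⟨κ₂, r₂, L₂, hA, Ar₂⟩ := run_buildResidual (O := O) (ω := ω) hW (κ := κ₁) (N := κ.v V_N)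
    (M := κ.v V_M) rfl rfl hb (fun i hi => by rw [tail₁]; exact hI.tail_lt ⟨i, hi⟩)
    (fun i hi => by rw [head₁]; exact hI.head_lt ⟨i, hi⟩)
  have F₂ := r₂.frame
  obtain ⟨κ₃, r₃, hm⟩ := run_search (O := O) (ω := ω) hW (κ := κ₂) (N := κ.v V_N) (s := κ.v V_s)
    (F₂.v _ (by decide)) (F₂.v _ (by decide)) hI.s_lt L₂ (by omega)
  have hent : ∀ v, (∃ i < κ.v V_M, EdgeEnters (κ₁.m A_tail) (κ₁.m A_head) (κ₁.m A_flow) i v) ↔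
      κ.inst.Entered (O κ.inst) v := by
    intro v
    constructor
    · rintro ⟨i, hi, h⟩
      refine ⟨⟨i, hi⟩, ?_⟩
      have hf := flow₁ ⟨i, hi⟩
      simp only at hf
      unfold EdgeEnters at h
      rw [hf, tail₁, head₁] at h
      unfold flowWord at h
      rcases h with ⟨h1, h2⟩ | ⟨h1, h2⟩
      · exact Or.inl ⟨h2, by split_ifs at h1 <;> omega⟩
      · exact Or.inr ⟨h2, by split_ifs at h1 <;> omega⟩
    · rintro ⟨i, h⟩
      refine ⟨i, i.2, ?_⟩
      unfold EdgeEnters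
      rw [flow₁ i, tail₁, head₁]
      unfold flowWord
      rcases h with ⟨h1, h2⟩ | ⟨h1, h2⟩
      · exact Or.inl ⟨by rw [if_neg (by omega), if_pos h2], h1⟩
      · exact Or.inr ⟨by rw [if_neg (by omega), if_neg (by omega)], h1⟩
  have hres : ∀ x y, Arc κ₂ x y ↔ κ.inst.Res (O κ.inst) x y := by
    intro x y
    rw [Ar₂]
    simp only [hent]
    constructor
    · rintro (⟨i, hi, h⟩ | ⟨v, hv, h⟩)
      · unfold EdgeArc at h
        rw [flow₁ ⟨i, hi⟩, tail₁, head₁] at h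
        unfold flowWord at h
        rcases h with ⟨rfl, rfl⟩ | ⟨rfl, rfl⟩ | ⟨h1, rfl, rfl⟩ | ⟨h1, rfl, rfl⟩
        · exact .fwd (I := κ.inst) ⟨i, hi⟩
        · exact .bwd (I := κ.inst) ⟨i, hi⟩
        · exact .cancelFwd (I := κ.inst) ⟨i, hi⟩ (by split_ifs at h1 <;> omega)
        · exact .cancelBwd (I := κ.inst) ⟨i, hi⟩ (by split_ifs at h1 <;> omega)
      · rcases h with ⟨rfl, rfl, h⟩ | ⟨rfl, rfl, h⟩
        · exact .pass v hv h
        · exact .back v hv h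
    · intro h
      have key : ∀ (i : Fin κ.inst.M), κ₁.m A_flow i = flowWord (O κ.inst i) := flow₁
      unfold flowWord at key
      cases h with
      | fwd i => exact Or.inl ⟨i, i.2, Or.inl ⟨by rw [tail₁]; rfl, by rw [head₁]; rfl⟩⟩
      | bwd i => exact Or.inl ⟨i, i.2, Or.inr (Or.inl ⟨by rw [head₁]; rfl, by rw [tail₁]; rfl⟩)⟩
      | cancelFwd i h =>
        exact Or.inl ⟨i, i.2, Or.inr (Or.inr (Or.inl
          ⟨by rw [key, if_neg (by omega), if_pos h], by rw [head₁]; rfl, by rw [tail₁]; rfl⟩))⟩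
      | cancelBwd i h =>
        exact Or.inl ⟨i, i.2, Or.inr (Or.inr (Or.inr
          ⟨by rw [key, if_neg (by omega), if_neg (by omega)], by rw [tail₁]; rfl,
            by rw [head₁]; rfl⟩))⟩
      | pass v hv h => exact Or.inr ⟨v, hv, Or.inl ⟨rfl, rfl, h⟩⟩
      | back v hv h => exact Or.inr ⟨v, hv, Or.inr ⟨rfl, rfl, h⟩⟩
  have hreach : ∀ x < 2 * κ.v V_N, κ₃.m A_mark x ≠ 0 ↔ κ.inst.Reach (O κ.inst) x := by
    intro x hx
    rw [hm x hx, show Arc κ₂ = κ.inst.Res (O κ.inst) from funext₂ fun x y => propext (hres x y)]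
    rfl
  refine ⟨κ₃, (r₁.seq (r₂.seq r₃)).mono (by omega), ?_,
    (Finset.range (κ.v V_N)).filter fun v => κ.inst.Reach (O κ.inst) (2 * v + 1),
    (Finset.range (κ.v V_N)).filter fun v => κ.inst.Reach (O κ.inst) (2 * v) ∧
      ¬ κ.inst.Reach (O κ.inst) (2 * v + 1), ?_⟩
  · rw [r₃.flow (by decide), r₂.flow (by decide)]
    rfl
  · obtain ⟨h3, h4⟩ := (hO κ.inst hI).exists_minCut hI
      (Y := (Finset.range (κ.v V_N)).filter fun v => κ.inst.Reach (O κ.inst) (2 * v + 1))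
      (C := (Finset.range (κ.v V_N)).filter fun v => κ.inst.Reach (O κ.inst) (2 * v) ∧
        ¬ κ.inst.Reach (O κ.inst) (2 * v + 1))
      (fun v => by simp only [Finset.mem_filter, Finset.mem_range]; rfl)
      (fun v => by simp only [Finset.mem_filter, Finset.mem_range]; rfl)
    refine ⟨h3, h4, fun v hv => ?_, fun v hv => ?_, fun v hv => ?_⟩
    · have hv' : v < κ.v V_N := hv
      rw [hreach _ (by omega)]
      simp [hv']
    · have hv' : v < κ.v V_N := hv
      rw [hreach _ (by omega), ← not_ne_iff (a := κ₃.m A_mark (2 * v + 1)), hreach _ (by omega)]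
      simp [hv']
    · simp only [Finset.mem_filter, Finset.mem_range] at hv
      exact hv.1

end

end RAM

/-! ## Isolating cuts -/

section Boundary

open Classical in
/-- The vertices below `n` outside `X` that have a neighbour in `X`. -/
noncomputable def bdry (n : ℕ) (r : ℕ → ℕ → Prop) (X : Finset ℕ) : Finset ℕ :=
  (Finset.range n).filter fun v => v ∉ X ∧ ∃ u ∈ X, r u v

variable {n : ℕ} {r : ℕ → ℕ → Prop}

theorem mem_bdry {X : Finset ℕ} {v : ℕ} : v ∈ bdry n r X ↔ v < n ∧ v ∉ X ∧ ∃ u ∈ X, r u v := by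
  simp [bdry]

/-- A pointwise count: a vertex in the boundary of X ∩ Q or of X ∪ Q is in that of X or of Q, and
one that is in both of the former is in both of the latter. -/
theorem bdry_submodular (X Q : Finset ℕ) :
    (bdry n r (X ∩ Q)).card + (bdry n r (X ∪ Q)).card ≤ (bdry n r X).card + (bdry n r Q).card := by
  rw [← Finset.card_union_add_card_inter, ← Finset.card_union_add_card_inter (bdry n r X)]
  refine add_le_add (Finset.card_le_card fun v hv => ?_) (Finset.card_le_card fun v hv => ?_)
  · simp only [Finset.mem_union, mem_bdry, Finset.mem_inter] at hv ⊢
    rcases hv with ⟨h1, h2, u, ⟨hu1, hu2⟩, hr⟩ | ⟨h1, h2, u, hu, hr⟩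
    · by_cases hX : v ∈ X
      · exact Or.inr ⟨h1, fun h => h2 ⟨hX, h⟩, u, hu2, hr⟩
      · exact Or.inl ⟨h1, hX, u, hu1, hr⟩
    · push Not at h2
      rcases hu with hu | hu
      · exact Or.inl ⟨h1, h2.1, u, hu, hr⟩
      · exact Or.inr ⟨h1, h2.2, u, hu, hr⟩
  · simp only [Finset.mem_union, mem_bdry, Finset.mem_inter] at hv ⊢
    obtain ⟨⟨h1, -, u, ⟨hu1, hu2⟩, hr⟩, -, h2, -⟩ := hv
    push Not at h2
    exact ⟨⟨h1, h2.1, u, hu1, hr⟩, h1, h2.2, u, hu2, hr⟩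

/-- `X` contains exactly the vertex `x` of `T`, and its boundary contains none. -/
structure Isolates (n : ℕ) (r : ℕ → ℕ → Prop) (T X : Finset ℕ) (x : ℕ) : Prop where
  lt : ∀ v ∈ X, v < n
  mem : x ∈ X
  mem_T : x ∈ T
  eq : ∀ y ∈ X, y ∈ T → y = x
  bdry_notMem : ∀ v ∈ bdry n r X, v ∉ T

end Boundary

/-! ### Splitting along one bit -/

section Split

/-- The edges of the graph in which the vertices of `A` are contracted to `n` and those of `T \ A`
to `n + 1`. -/
def splitAdj (n : ℕ) (r : ℕ → ℕ → Prop) (T A : Finset ℕ) (u v : ℕ) : Prop :=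
  (r u v ∧ u ∉ T ∧ v ∉ T) ∨ (u = n ∧ v ∉ T ∧ ∃ x ∈ A, r x v) ∨
    (v = n + 1 ∧ u ∉ T ∧ ∃ x ∈ T, x ∉ A ∧ r x u)

/-- `v` is on the side of `A`, respectively on the side of `T \ A`. -/
def OnSide (T A Y C : Finset ℕ) (b : Prop) (v : ℕ) : Prop :=
  (v ∈ T ∧ (v ∈ A ↔ b)) ∨ (v ∉ T ∧ ((b ∧ v ∈ Y) ∨ (¬ b ∧ v ∉ Y ∧ v ∉ C)))

variable {n : ℕ} {r : ℕ → ℕ → Prop} {T A Y C : Finset ℕ} {I : FlowInstance}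

/-- Two terminals are never adjacent. An edge with a non-terminal end survives the contraction,
possibly moved to a contracted vertex, where the separator forbids it. -/
theorem OnSide.no_edge (hs : I.s = n) (ht : I.t = n + 1)
    (hT : ∀ u ∈ T, ∀ v ∈ T, ¬ r u v) (hsym : ∀ u v, r u v → r v u)
    (hadj : ∀ u v, splitAdj n r T A u v → I.Adj u v)
    (hsep : I.Separates Y C) {u v : ℕ} (hu : OnSide T A Y C True u) (hv : OnSide T A Y C False v) :
    ¬ r u v := by
  intro huv
  simp only [OnSide, iff_true, true_and, not_true_eq_false, false_and, or_false, iff_false,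
    not_false_eq_true, false_or] at hu hv
  rcases hu with ⟨hu1, hu2⟩ | ⟨hu1, hu2⟩ <;> rcases hv with ⟨hv1, hv2⟩ | ⟨hv1, hv2⟩
  · exact hT u hu1 v hv1 huv
  · have := hsep.closed n v (hadj n v (Or.inr (Or.inl ⟨rfl, hv1, u, hu2, huv⟩)))
      (hs ▸ hsep.s_mem)
    tauto
  · have := hsep.closed u (n + 1) (hadj u (n + 1) (Or.inr (Or.inr ⟨rfl, hu1, v, hv1, hv2,
      hsym _ _ huv⟩))) hu2
    rw [← ht] at this
    exact this.elim hsep.t_notMem hsep.t_notMem'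
  · have := hsep.closed u v (hadj u v (Or.inl ⟨huv, hu1, hv1⟩)) hu2
    tauto

/-- The boundary of any set that picks exactly one class of terminals, and has no terminal in its
boundary, is a separator of the contracted instance. So it is no smaller than the minimum one. -/
theorem card_le_bdry (hs : I.s = n) (ht : I.t = n + 1) (hA : A ⊆ T) (hTn : ∀ v ∈ T, v < n)
    (hlt : ∀ u v, r u v → u < n ∧ v < n) (hsym : ∀ u v, r u v → r v u)
    (hadj : ∀ u v, I.Adj u v → splitAdj n r T A u v ∨ splitAdj n r T A v u)
    (hmin : ∀ Y' C', I.Separates Y' C' → C.card ≤ C'.card) (b : Prop) {Q : Finset ℕ}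
    (hQn : ∀ v ∈ Q, v < n) (hQT : ∀ v ∈ T, v ∈ Q ↔ (v ∈ A ↔ b))
    (hQb : ∀ v ∈ bdry n r Q, v ∉ T) : C.card ≤ (bdry n r Q).card := by
  classical
  have main : ∀ Q : Finset ℕ, (∀ v ∈ Q, v < n) → (∀ v ∈ T, v ∈ Q ↔ v ∈ A) →
      (∀ v ∈ bdry n r Q, v ∉ T) → C.card ≤ (bdry n r Q).card := by
    intro Q hQn hQT hQb
    -- Terminals have no edges in the contracted instance; n stands for all of A.
    refine hmin (insert n (Q \ T)) (bdry n r Q) ⟨by simp [hs], ?_, ?_, fun u v huv hu => ?_⟩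
    · rw [ht]
      simp only [Finset.mem_insert, Finset.mem_sdiff, not_or]
      exact ⟨by omega, fun h => by have := hQn _ h.1; omega⟩
    · rw [ht, mem_bdry]; omega
    · have hQ : ∀ u v, u ∈ Q → r u v → v ∉ T →
          v ∈ insert n (Q \ T) ∨ v ∈ bdry n r Q := by
        intro u v hu hr hv
        by_cases hvQ : v ∈ Q
        · left; simp [hvQ, hv]
        · right; exact mem_bdry.2 ⟨(hlt _ _ hr).2, hvQ, u, hu, hr⟩
      simp only [Finset.mem_insert, Finset.mem_sdiff] at hu
      rcases hadj u v huv with (⟨h1, h2, h3⟩ | ⟨h1, h2, x, hx, h3⟩ | ⟨h1, h2, x, hx, hx', h3⟩) |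
        (⟨h1, h2, h3⟩ | ⟨h1, h2, x, hx, h3⟩ | ⟨h1, h2, x, hx, hx', h3⟩)
      · have := (hlt _ _ h1).1
        exact hQ u v (by rcases hu with hu | hu; · omega
                         · exact hu.1) h1 h3
      · exact hQ x v ((hQT x (hA hx)).2 hx) h3 h2
      · exfalso
        have hun := (hlt _ _ h3).2
        have huQ : u ∈ Q := by rcases hu with hu | hu; · omega
                               · exact hu.1
        have hxQ : x ∉ Q := fun h => hx' ((hQT x hx).1 h)
        exact hQb x (mem_bdry.2 ⟨(hlt _ _ h3).1, hxQ, u, huQ, hsym _ _ h3⟩) hx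
      · have := (hlt _ _ h1).2
        exact hQ u v (by rcases hu with hu | hu; · omega
                         · exact hu.1) (hsym _ _ h1) h2
      · subst h1; simp
      · exfalso
        rcases hu with hu | hu
        · omega
        · have := hQn u hu.1; omega
  by_cases hb : b
  · exact main Q hQn (fun v hv => by rw [hQT v hv]; simp [hb]) hQb
  -- If Q picks the terminals outside A, the complement of Q and its boundary picks A, and its
  -- boundary is contained in that of Q.
  · have hsub : bdry n r ((Finset.range n).filter fun v => v ∉ Q ∧ v ∉ bdry n r Q) ⊆ bdry n r Q := by
      intro v hv
      obtain ⟨h1, h2, u, hu, h3⟩ := mem_bdry.1 hv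
      simp only [Finset.mem_filter, Finset.mem_range, not_and, not_not] at h2 hu
      by_cases hvQ : v ∈ Q
      · exact absurd (mem_bdry.2 ⟨hu.1, hu.2.1, v, hvQ, hsym _ _ h3⟩) hu.2.2
      · exact h2 h1 hvQ
    refine (main _ (by simp +contextual) (fun v hv => ?_) fun v hv => hQb v (hsub hv)).trans
      (Finset.card_le_card hsub)
    have h1 := hQT v hv
    simp only [hb, iff_false] at h1
    simp only [Finset.mem_filter, Finset.mem_range, h1, not_not]
    exact ⟨fun h => h.2.1, fun h => ⟨hTn v hv, h, fun h' => hQb v h' hv⟩⟩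

/-- Uncrossing: let Q be the side of x. Its boundary lies in the minimum separator C, while X ∪ Q
still picks the same class of terminals as Q, so |∂Q| ≤ |C| ≤ |∂(X ∪ Q)|. Submodularity then gives
|∂(X ∩ Q)| ≤ |∂X|. -/
theorem Isolates.split (hs : I.s = n) (ht : I.t = n + 1) (hA : A ⊆ T) (hTn : ∀ v ∈ T, v < n)
    (hT : ∀ u ∈ T, ∀ v ∈ T, ¬ r u v) (hlt : ∀ u v, r u v → u < n ∧ v < n)
    (hsym : ∀ u v, r u v → r v u)
    (hadj : ∀ u v, I.Adj u v ↔ splitAdj n r T A u v ∨ splitAdj n r T A v u)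
    (hsep : I.Separates Y C) (hmin : ∀ Y' C', I.Separates Y' C' → C.card ≤ C'.card)
    {X : Finset ℕ} {x : ℕ} (hX : Isolates n r T X x) :
    ∃ X' ⊆ X, Isolates n r T X' x ∧ (bdry n r X').card ≤ (bdry n r X).card ∧
      ∀ v ∈ X', OnSide T A Y C (x ∈ A) v := by
  classical
  set Q := (Finset.range n).filter fun v => OnSide T A Y C (x ∈ A) v with hQ
  have memQ : ∀ v, v ∈ Q ↔ v < n ∧ OnSide T A Y C (x ∈ A) v := by simp [hQ]
  have hQT : ∀ v ∈ T, v ∈ Q ↔ (v ∈ A ↔ x ∈ A) := fun v hv => by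
    simp [memQ, OnSide, hv, hTn v hv]
  have hx : x ∈ Q := (hQT x hX.mem_T).2 Iff.rfl
  have hbQ : ∀ v ∈ bdry n r Q, v ∉ T ∧ v ∈ C := by
    intro v hv
    obtain ⟨h1, h2, u, hu, h3⟩ := mem_bdry.1 hv
    rw [memQ] at h2 hu
    have h2' : ¬ OnSide T A Y C (x ∈ A) v := fun h => h2 ⟨h1, h⟩
    by_contra hcon
    have hopp : OnSide T A Y C (x ∉ A) v := by
      unfold OnSide at h2' ⊢
      by_cases hvT : v ∈ T <;> by_cases hxA : x ∈ A <;> simp_all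
    by_cases hxA : x ∈ A
    · have e1 : OnSide T A Y C True u := by simpa [hxA] using hu.2
      have e2 : OnSide T A Y C False v := by simpa [hxA] using hopp
      exact OnSide.no_edge hs ht hT hsym (fun u v h => (hadj u v).2 (Or.inl h)) hsep e1 e2 h3
    · have e1 : OnSide T A Y C False u := by simpa [hxA] using hu.2
      have e2 : OnSide T A Y C True v := by simpa [hxA] using hopp
      exact OnSide.no_edge hs ht hT hsym (fun u v h => (hadj u v).2 (Or.inl h)) hsep e2 e1
        (hsym _ _ h3)
  -- The only terminal of X is x, which is in Q anyway.
  have hunion : C.card ≤ (bdry n r (X ∪ Q)).card := by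
    refine card_le_bdry hs ht hA hTn hlt hsym (fun u v h => (hadj u v).1 h) hmin (x ∈ A)
      (fun v hv => ?_) (fun v hv => ?_) fun v hv => ?_
    · rcases Finset.mem_union.1 hv with h | h
      · exact hX.lt v h
      · exact ((memQ v).1 h).1
    · rw [Finset.mem_union, hQT v hv]
      refine ⟨fun h => h.elim (fun h => ?_) id, Or.inr⟩
      rw [hX.eq v h hv]
    · obtain ⟨h1, h2, u, hu, h3⟩ := mem_bdry.1 hv
      rw [Finset.mem_union, not_or] at h2
      rcases Finset.mem_union.1 hu with h | h
      · exact hX.bdry_notMem v (mem_bdry.2 ⟨h1, h2.1, u, h, h3⟩)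
      · exact (hbQ v (mem_bdry.2 ⟨h1, h2.2, u, h, h3⟩)).1
  have hle : (bdry n r Q).card ≤ C.card := Finset.card_le_card fun v hv => (hbQ v hv).2
  have hsm := bdry_submodular (n := n) (r := r) X Q
  refine ⟨X ∩ Q, Finset.inter_subset_left, ⟨fun v hv => hX.lt v (Finset.mem_inter.1 hv).1,
    Finset.mem_inter.2 ⟨hX.mem, hx⟩, hX.mem_T, fun y hy => hX.eq y (Finset.mem_inter.1 hy).1,
    fun v hv => ?_⟩, by omega, fun v hv => ((memQ v).1 (Finset.mem_inter.1 hv).2).2⟩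
  obtain ⟨h1, h2, u, hu, h3⟩ := mem_bdry.1 hv
  rw [Finset.mem_inter] at hu h2
  by_cases hvX : v ∈ X
  · exact (hbQ v (mem_bdry.2 ⟨h1, fun h => h2 ⟨hvX, h⟩, u, hu.2, h3⟩)).1
  · exact hX.bdry_notMem v (mem_bdry.2 ⟨h1, hvX, u, hu.1, h3⟩)

end Split

/-! ### Regions of the terminals -/

section Regions

/-- After the first `j` bits, `own` and `dead` describe the regions of the terminals. -/
structure RegionInv (n : ℕ) (r : ℕ → ℕ → Prop) (T : Finset ℕ) (j : ℕ) (own dead : ℕ → ℕ) :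
    Prop where
  terminal : ∀ v ∈ T, dead v = 0 ∧ own v = v % 2 ^ j
  lt : ∀ v < n, own v < 2 ^ j
  edge : ∀ u v, r u v → dead u = 0 → dead v = 0 → own u = own v
  shrink : ∀ X x, Isolates n r T X x → ∃ X' ⊆ X, Isolates n r T X' x ∧
    (bdry n r X').card ≤ (bdry n r X).card ∧ ∀ v ∈ X', dead v = 0 ∧ own v = x % 2 ^ j

variable {n : ℕ} {r : ℕ → ℕ → Prop} {T : Finset ℕ}

theorem RegionInv.zero : RegionInv n r T 0 (fun _ => 0) (fun _ => 0) :=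
  ⟨fun v _ => by simp [Nat.mod_one], by simp, by simp, fun X x h =>
    ⟨X, subset_rfl, h, le_rfl, by simp [Nat.mod_one]⟩⟩

theorem RegionInv.congr {own dead own' dead' : ℕ → ℕ} {j : ℕ} (h : RegionInv n r T j own dead)
    (hTn : ∀ v ∈ T, v < n) (hlt : ∀ u v, r u v → u < n ∧ v < n)
    (ho : ∀ v < n, own' v = own v) (hd : ∀ v < n, dead' v = dead v) :
    RegionInv n r T j own' dead' := by
  refine ⟨fun v hv => ?_, fun v hv => ?_, fun u v huv => ?_, fun X x hX => ?_⟩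
  · rw [ho v (hTn v hv), hd v (hTn v hv)]; exact h.terminal v hv
  · rw [ho v hv]; exact h.lt v hv
  · obtain ⟨h1, h2⟩ := hlt u v huv
    rw [ho u h1, ho v h2, hd u h1, hd v h2]; exact h.edge u v huv
  · obtain ⟨X', h1, h2, h3, h4⟩ := h.shrink X x hX
    exact ⟨X', h1, h2, h3, fun v hv => by
      rw [ho v (h2.lt v hv), hd v (h2.lt v hv)]; exact h4 v hv⟩

/-- Label and cut are combined: `own` collects one binary digit per cut, namely the side of the
vertex, and separator vertices become dead. A surviving edge stays within one side of each cut, and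
an isolating set is shrunk to the side of its terminal by `Isolates.split`. -/
theorem RegionInv.succ {own dead own' dead' : ℕ → ℕ} {j : ℕ} (h : RegionInv n r T j own dead)
    {A Y C : Finset ℕ} {I : FlowInstance} (hs : I.s = n) (ht : I.t = n + 1)
    (hA : ∀ v, v ∈ A ↔ v ∈ T ∧ v / 2 ^ j % 2 = 1) (hTn : ∀ v ∈ T, v < n)
    (hT : ∀ u ∈ T, ∀ v ∈ T, ¬ r u v) (hlt : ∀ u v, r u v → u < n ∧ v < n)
    (hsym : ∀ u v, r u v → r v u)
    (hadj : ∀ u v, I.Adj u v ↔ splitAdj n r T A u v ∨ splitAdj n r T A v u)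
    (hsep : I.Separates Y C) (hmin : ∀ Y' C', I.Separates Y' C' → C.card ≤ C'.card)
    (hown : ∀ v < n, (OnSide T A Y C True v ∧ own' v = own v + 2 ^ j ∧ dead' v = dead v) ∨
      (¬ OnSide T A Y C True v ∧ own' v = own v ∧
        (OnSide T A Y C False v ∧ dead' v = dead v ∨ ¬ OnSide T A Y C False v ∧ dead' v ≠ 0))) :
    RegionInv n r T (j + 1) own' dead' := by
  have hAT : A ⊆ T := fun v hv => ((hA v).1 hv).1
  have hexcl : ∀ v, OnSide T A Y C True v → ¬ OnSide T A Y C False v := by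
    intro v; unfold OnSide; tauto
  have hup : ∀ v < n, OnSide T A Y C True v → own' v = own v + 2 ^ j ∧ dead' v = dead v := by
    intro v hv h'
    rcases hown v hv with h'' | h''
    · exact h''.2
    · exact absurd h' h''.1
  have hdn : ∀ v < n, OnSide T A Y C False v → own' v = own v ∧ dead' v = dead v := by
    intro v hv h'
    rcases hown v hv with h'' | ⟨h1, h2, h3⟩
    · exact absurd h' (hexcl v h''.1)
    · exact ⟨h2, by tauto⟩
  have hside : ∀ v < n, dead' v = 0 → OnSide T A Y C True v ∨ OnSide T A Y C False v := by
    intro v hv h'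
    rcases hown v hv with h'' | ⟨h1, h2, h3⟩
    · exact Or.inl h''.1
    · rcases h3 with h3 | h3
      · exact Or.inr h3.1
      · exact absurd h' h3.2
  have hno := fun {u v : ℕ} => OnSide.no_edge (u := u) (v := v) hs ht hT hsym
    (fun u v h => (hadj u v).2 (Or.inl h)) hsep
  have hmod : ∀ v, v % 2 ^ (j + 1) = v % 2 ^ j + 2 ^ j * (v / 2 ^ j % 2) := fun v => Nat.mod_pow_succ
  have hbit : ∀ v ∈ T, (v ∈ A → v % 2 ^ (j + 1) = v % 2 ^ j + 2 ^ j) ∧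
      (v ∉ A → v % 2 ^ (j + 1) = v % 2 ^ j) := by
    intro v hv
    rw [hmod]
    have := Nat.mod_two_eq_zero_or_one (v / 2 ^ j)
    refine ⟨fun h => by rw [((hA v).1 h).2, mul_one], fun h => ?_⟩
    have : v / 2 ^ j % 2 = 0 := by
      rcases this with h' | h'
      · exact h'
      · exact absurd ((hA v).2 ⟨hv, h'⟩) h
    rw [this]; simp
  have hval : ∀ x ∈ T, ∀ v < n, OnSide T A Y C (x ∈ A) v → dead v = 0 → own v = x % 2 ^ j →
      dead' v = 0 ∧ own' v = x % 2 ^ (j + 1) := by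
    intro x hx v hv hsd hd ho
    by_cases hxA : x ∈ A
    · obtain ⟨h1, h2⟩ := hup v hv (by simpa [hxA] using hsd)
      exact ⟨by rw [h2, hd], by rw [h1, ho, (hbit x hx).1 hxA]⟩
    · obtain ⟨h1, h2⟩ := hdn v hv (by simpa [hxA] using hsd)
      exact ⟨by rw [h2, hd], by rw [h1, ho, (hbit x hx).2 hxA]⟩
  refine ⟨fun v hv => ?_, fun v hv => ?_, fun u v huv hu hv => ?_, fun X x hX => ?_⟩
  · obtain ⟨h1, h2⟩ := h.terminal v hv
    exact hval v hv v (hTn v hv) (Or.inl ⟨hv, Iff.rfl⟩) h1 h2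
  · have := h.lt v hv
    rw [pow_succ]
    rcases hown v hv with h' | h' <;> omega
  · obtain ⟨h1, h2⟩ := hlt u v huv
    rcases hside u h1 hu with hu' | hu' <;> rcases hside v h2 hv with hv' | hv'
    · obtain ⟨e1, e2⟩ := hup u h1 hu'
      obtain ⟨e3, e4⟩ := hup v h2 hv'
      rw [e1, e3, h.edge u v huv (e2 ▸ hu) (e4 ▸ hv)]
    · exact absurd huv (hno hu' hv')
    · exact absurd (hsym _ _ huv) (hno hv' hu')
    · obtain ⟨e1, e2⟩ := hdn u h1 hu'
      obtain ⟨e3, e4⟩ := hdn v h2 hv'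
      rw [e1, e3, h.edge u v huv (e2 ▸ hu) (e4 ▸ hv)]
  · obtain ⟨X₁, h1, h2, h3, h4⟩ := h.shrink X x hX
    obtain ⟨X₂, g1, g2, g3, g4⟩ := h2.split hs ht hAT hTn hT hlt hsym hadj hsep hmin
    exact ⟨X₂, g1.trans h1, g2, g3.trans h3, fun v hv =>
      hval x hX.mem_T v (g2.lt v hv) (g4 v hv) (h4 v (g1 hv)).1 (h4 v (g1 hv)).2⟩

end Regions

/-! ### Cuts within the regions -/

section Pieces

/-- The pairs `(src e, adj e)` with `e < E` list the neighbouring pairs of a graph on the vertices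
below `n`, sorted by the first component. -/
structure EdgeList (n E : ℕ) (src adj : ℕ → ℕ) : Prop where
  src_lt : ∀ e < E, src e < n
  adj_lt : ∀ e < E, adj e < n
  ne : ∀ e < E, src e ≠ adj e
  symm : ∀ e < E, ∃ e' < E, src e' = adj e ∧ adj e' = src e
  inj : ∀ e < E, ∀ e' < E, src e = src e' → adj e = adj e' → e = e'
  mono : ∀ e e', e ≤ e' → e' < E → src e ≤ src e'

def Nbr (E : ℕ) (src adj : ℕ → ℕ) (u v : ℕ) : Prop := ∃ e < E, src e = u ∧ adj e = v

/-- The first list entry with the same first component and the same region of the second one. -/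
def firstEntry (src adj own : ℕ → ℕ) (e : ℕ) : ℕ :=
  Nat.find (⟨e, rfl, rfl⟩ : ∃ e', src e' = src e ∧ own (adj e') = own (adj e))

/-- The name of vertex `c` of the region of `x`, whose centre `x` is contracted to `n`. -/
def ctr (n x c : ℕ) : ℕ := if c = x then n else c

/-- The edges of the disjoint union of all regions with their boundaries; the centres are contracted
to `n`, and the copies of boundary vertices are joined to `n + 1`. -/
def pieceAdj (n E : ℕ) (src adj own : ℕ → ℕ) (u v : ℕ) : Prop :=
  ∃ e < E, own (adj e) < n ∧
    ((own (src e) = own (adj e) ∧ u = ctr n (own (adj e)) (src e) ∧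
        v = ctr n (own (adj e)) (adj e)) ∨
     (own (src e) ≠ own (adj e) ∧ u = n + 2 + firstEntry src adj own e ∧ v = n + 1) ∨
     (own (src e) ≠ own (adj e) ∧ u = ctr n (own (adj e)) (adj e) ∧
        v = n + 2 + firstEntry src adj own e))

variable {n E : ℕ} {src adj own : ℕ → ℕ} {T Y C : Finset ℕ} {I : FlowInstance}

theorem EdgeList.nbr_symm (h : EdgeList n E src adj) {u v : ℕ} (huv : Nbr E src adj u v) :
    Nbr E src adj v u := by
  obtain ⟨e, he, rfl, rfl⟩ := huv
  obtain ⟨e', he', h1, h2⟩ := h.symm e he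
  exact ⟨e', he', h1, h2⟩

theorem EdgeList.nbr_lt (h : EdgeList n E src adj) {u v : ℕ} (huv : Nbr E src adj u v) :
    u < n ∧ v < n := by
  obtain ⟨e, he, rfl, rfl⟩ := huv
  exact ⟨h.src_lt e he, h.adj_lt e he⟩

theorem firstEntry_spec (e : ℕ) : src (firstEntry src adj own e) = src e ∧
    own (adj (firstEntry src adj own e)) = own (adj e) :=
  Nat.find_spec (⟨e, rfl, rfl⟩ : ∃ e', src e' = src e ∧ own (adj e') = own (adj e))

theorem firstEntry_le (e : ℕ) : firstEntry src adj own e ≤ e := Nat.find_min' _ ⟨rfl, rfl⟩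

theorem firstEntry_congr {e e' : ℕ} (h1 : src e = src e') (h2 : own (adj e) = own (adj e')) :
    firstEntry src adj own e = firstEntry src adj own e' := by
  unfold firstEntry
  congr 1
  funext c
  rw [h1, h2]

theorem firstEntry_idem (e : ℕ) : firstEntry src adj own (firstEntry src adj own e) =
    firstEntry src adj own e := firstEntry_congr (firstEntry_spec e).1 (firstEntry_spec e).2

open Classical in
/-- The vertices of the piece of `x`. -/
noncomputable def piece (n E : ℕ) (adj own : ℕ → ℕ) (x : ℕ) : Finset ℕ :=
  ((Finset.range n).filter fun v => own v = x ∧ v ≠ x) ∪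
    ((Finset.range E).filter fun e => own (adj e) = x).image (n + 2 + ·)

open Classical in
/-- The side of `x` in a cut of the pieces. -/
noncomputable def pieceSide (n : ℕ) (own : ℕ → ℕ) (Y : Finset ℕ) (x : ℕ) : Finset ℕ :=
  (Finset.range n).filter fun v => own v = x ∧ (v = x ∨ v ∈ Y)

theorem mem_piece {x v : ℕ} : v ∈ piece n E adj own x ↔
    (v < n ∧ own v = x ∧ v ≠ x) ∨ ∃ e < E, own (adj e) = x ∧ v = n + 2 + e := by
  simp only [piece, Finset.mem_union, Finset.mem_filter, Finset.mem_range, Finset.mem_image,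
    and_assoc]
  simp only [eq_comm]

theorem mem_pieceSide {x v : ℕ} : v ∈ pieceSide n own Y x ↔
    v < n ∧ own v = x ∧ (v = x ∨ v ∈ Y) := by
  simp [pieceSide]

/-- A boundary vertex inside the region is next to the source side but not on it, hence in C. A
boundary vertex outside the region has a copy next to both the source side and the sink, so this
copy is in C. -/
theorem card_bdry_pieceSide_le (h : EdgeList n E src adj) (hs : I.s = n) (ht : I.t = n + 1)
    (hadj : ∀ u v, I.Adj u v ↔ pieceAdj n E src adj own u v ∨ pieceAdj n E src adj own v u)
    (hsep : I.Separates Y C) {x : ℕ} (hx : x < n) :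
    (bdry n (Nbr E src adj) (pieceSide n own Y x)).card ≤ (C ∩ piece n E adj own x).card := by
  classical
  set B := bdry n (Nbr E src adj) (pieceSide n own Y x) with hB
  have hcY : ∀ c ∈ pieceSide n own Y x, ctr n x c ∈ Y := by
    intro c hc
    obtain ⟨h1, h2, h3⟩ := mem_pieceSide.1 hc
    unfold ctr
    split_ifs with h4
    · exact hs ▸ hsep.s_mem
    · exact h3.resolve_left h4
  have hB1 : ∀ v ∈ B, ∃ e < E, src e = v ∧ adj e ∈ pieceSide n own Y x ∧ v < n ∧
      v ∉ pieceSide n own Y x := by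
    intro v hv
    obtain ⟨h1, h2, u, hu, h3⟩ := mem_bdry.1 hv
    obtain ⟨e, he, rfl, rfl⟩ := h.nbr_symm h3
    exact ⟨e, he, rfl, hu, h1, h2⟩
  have hin : B.filter (fun v => own v = x) ⊆ C ∩ piece n E adj own x := by
    intro v hv
    obtain ⟨hv, hvx⟩ := Finset.mem_filter.1 hv
    obtain ⟨e, he, h1, h2, h3, h4⟩ := hB1 v hv
    have hne : v ≠ x := fun h' => h4 (mem_pieceSide.2 ⟨h3, hvx, Or.inl h'⟩)
    have hoa := (mem_pieceSide.1 h2).2.1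
    have hadj' : I.Adj (ctr n x (adj e)) v := by
      refine (hadj _ _).2 (Or.inr ⟨e, he, by omega, Or.inl ⟨by rw [h1, hvx, hoa], ?_, by rw [hoa]⟩⟩)
      rw [hoa, h1, ctr, if_neg hne]
    rw [Finset.mem_inter, mem_piece]
    refine ⟨(hsep.closed _ _ hadj' (hcY _ h2)).resolve_left fun h' => ?_, Or.inl ⟨h3, hvx, hne⟩⟩
    exact h4 (mem_pieceSide.2 ⟨h3, hvx, Or.inr h'⟩)
  -- The vertex is recovered from its copy as the source of the list entry that names the copy, so
  -- distinct boundary vertices use distinct copies.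
  have hout : B.filter (fun v => own v ≠ x) ⊆ ((C ∩ piece n E adj own x).filter (n + 1 < ·)).image
      (fun c => src (c - (n + 2))) := by
    intro v hv
    obtain ⟨hv, hvx⟩ := Finset.mem_filter.1 hv
    obtain ⟨e, he, h1, h2, h3, h4⟩ := hB1 v hv
    have hoa := (mem_pieceSide.1 h2).2.1
    have a1 : I.Adj (ctr n x (adj e)) (n + 2 + firstEntry src adj own e) :=
      (hadj _ _).2 (Or.inl ⟨e, he, by omega, Or.inr (Or.inr ⟨by rw [h1, hoa]; exact hvx,
        by rw [hoa], rfl⟩)⟩)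
    have a2 : I.Adj (n + 2 + firstEntry src adj own e) (n + 1) :=
      (hadj _ _).2 (Or.inl ⟨e, he, by omega, Or.inr (Or.inl ⟨by rw [h1, hoa]; exact hvx,
        rfl, rfl⟩)⟩)
    have hle : firstEntry src adj own e ≤ e := firstEntry_le e
    obtain ⟨s1, s2⟩ := firstEntry_spec (src := src) (adj := adj) (own := own) e
    refine Finset.mem_image.2 ⟨n + 2 + firstEntry src adj own e, Finset.mem_filter.2 ⟨?_, by omega⟩,
      by rw [Nat.add_sub_cancel_left, s1, h1]⟩
    rw [Finset.mem_inter, mem_piece]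
    refine ⟨(hsep.closed _ _ a1 (hcY _ h2)).resolve_left fun h' => ?_,
      Or.inr ⟨_, by omega, by rw [s2, hoa], rfl⟩⟩
    have := hsep.closed _ _ a2 h'
    rw [← ht] at this
    exact this.elim hsep.t_notMem hsep.t_notMem'
  have hin' : B.filter (fun v => own v = x) ⊆ (C ∩ piece n E adj own x).filter fun c => ¬ n + 1 < c := by
    intro v hv
    refine Finset.mem_filter.2 ⟨hin hv, ?_⟩
    obtain ⟨_, _, _, _, h3, _⟩ := hB1 v (Finset.mem_filter.1 hv).1
    omega
  have e1 := Finset.card_filter_add_card_filter_not (s := B) (fun v => own v = x)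
  have e2 := Finset.card_filter_add_card_filter_not (s := C ∩ piece n E adj own x) (fun c => n + 1 < c)
  have e3 := Finset.card_le_card hin'
  have e4 := (Finset.card_le_card hout).trans Finset.card_image_le
  simp only [ne_eq] at e4
  omega

/-- Exchange argument: pieces meet only in source and sink, so the part of a minimum cut in one
piece may be replaced by the cut that X induces there. The result still separates, hence it cannot
be smaller. -/
theorem card_piece_le (h : EdgeList n E src adj) (hs : I.s = n) (ht : I.t = n + 1)
    (hadj : ∀ u v, I.Adj u v ↔ pieceAdj n E src adj own u v ∨ pieceAdj n E src adj own v u)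
    (hsep : I.Separates Y C) (hmin : ∀ Y' C', I.Separates Y' C' → C.card ≤ C'.card)
    {x : ℕ} {X : Finset ℕ} (hXn : ∀ v ∈ X, v < n ∧ own v = x) (hxX : x ∈ X) :
    (C ∩ piece n E adj own x).card ≤ (bdry n (Nbr E src adj) X).card := by
  classical
  set B := bdry n (Nbr E src adj) X with hB
  -- The copies, in the piece of x, of the boundary vertices of X outside the region; requiring e to
  -- be its own first entry selects one entry per copy.
  set D := (Finset.range E).filter fun e => firstEntry src adj own e = e ∧ own (adj e) = x ∧
    own (src e) ≠ x ∧ src e ∈ B with hD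
  have hpn : n ∉ piece n E adj own x := by
    rw [mem_piece]; rintro (h' | ⟨e, _, _, h'⟩) <;> omega
  have hpt : n + 1 ∉ piece n E adj own x := by
    rw [mem_piece]; rintro (h' | ⟨e, _, _, h'⟩) <;> omega
  have hXp : ∀ v ∈ X, v ≠ x → v ∈ piece n E adj own x := fun v hv hne =>
    mem_piece.2 (Or.inl ⟨(hXn v hv).1, (hXn v hv).2, hne⟩)
  -- The centre x is erased from X because it is represented by the contracted vertex n, which stays
  -- in the old part Y.
  have key := hmin ((Y \ piece n E adj own x) ∪ X.erase x)
    ((C \ piece n E adj own x) ∪ (B.filter (fun v => own v = x) ∪ D.image (n + 2 + ·))) ?_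
  · have c1 : (D.image (n + 2 + ·)).card ≤ (B.filter fun v => ¬ own v = x).card := by
      rw [Finset.card_image_of_injective _ (fun a b hab => by simpa using hab)]
      refine Finset.card_le_card_of_injOn src (fun e he => ?_) fun e he e' he' hee => ?_
      · simp only [hD, Finset.coe_filter, Set.mem_ofPred_eq, Finset.mem_range] at he ⊢
        exact ⟨he.2.2.2.2, he.2.2.2.1⟩
      · simp only [hD, Finset.coe_filter, Set.mem_ofPred_eq, Finset.mem_range] at he he'
        rw [← he.2.1, ← he'.2.1]
        exact firstEntry_congr hee (by rw [he.2.2.1, he'.2.2.1])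
    have c2 := Finset.card_filter_add_card_filter_not (s := B) (fun v => own v = x)
    have c3 := Finset.card_union_le (C \ piece n E adj own x)
      (B.filter (fun v => own v = x) ∪ D.image (n + 2 + ·))
    have c4 := Finset.card_union_le (B.filter (fun v => own v = x)) (D.image (n + 2 + ·))
    have c5 := Finset.card_inter_add_card_sdiff C (piece n E adj own x)
    omega
  · refine ⟨?_, ?_, ?_, ?_⟩
    · rw [hs, Finset.mem_union, Finset.mem_sdiff]
      exact Or.inl ⟨hs ▸ hsep.s_mem, hpn⟩
    · rw [ht, Finset.mem_union, Finset.mem_sdiff, Finset.mem_erase]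
      rintro (h' | h')
      · exact hsep.t_notMem (ht ▸ h'.1)
      · have := (hXn _ h'.2).1; omega
    · rw [ht, Finset.mem_union, Finset.mem_sdiff, Finset.mem_union, Finset.mem_filter, mem_bdry,
        Finset.mem_image]
      rintro (h' | h' | ⟨e, _, h'⟩)
      · exact hsep.t_notMem' (ht ▸ h'.1)
      · omega
      · omega
    · intro u v huv hu
      -- the two ends of an edge of another piece
      have other : u ∉ piece n E adj own x → v ∉ piece n E adj own x → u ∉ X.erase x →
          v ∈ (Y \ piece n E adj own x) ∪ X.erase x ∨
          v ∈ (C \ piece n E adj own x) ∪ (B.filter (fun v => own v = x) ∪ D.image (n + 2 + ·)) := by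
        intro h1 h2 h3
        simp only [Finset.mem_union, Finset.mem_sdiff] at hu
        have := hsep.closed u v huv (hu.resolve_right h3).1
        simp only [Finset.mem_union, Finset.mem_sdiff]
        tauto
      have notX : ∀ {c}, c ∉ piece n E adj own x → c ∉ X.erase x := fun hc h' =>
        hc (hXp _ (Finset.mem_of_mem_erase h') (Finset.ne_of_mem_erase h'))
      have ctr_not : ∀ {c z}, c < n → own c = z → z ≠ x → ctr n z c ∉ piece n E adj own x := by
        intro c z hc hz hzx
        unfold ctr
        split_ifs
        · exact hpn
        · rw [mem_piece]; rintro (h' | ⟨e, _, _, h'⟩) <;> omega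
      have copy_not : ∀ {e}, own (adj e) ≠ x →
          n + 2 + firstEntry src adj own e ∉ piece n E adj own x := by
        intro e he
        rw [mem_piece]
        rintro (h' | ⟨e', _, h1, h'⟩)
        · omega
        · rw [show e' = firstEntry src adj own e by omega, (firstEntry_spec (src := src) (adj := adj) (own := own) e).2] at h1
          exact he h1
      have ctr_mem : ∀ {c}, c < n → ctr n x c ∈ (Y \ piece n E adj own x) ∪ X.erase x → own c = x →
          c ∈ X := by
        intro c hc h' ho
        unfold ctr at h'
        split_ifs at h' with hcx
        · exact hcx ▸ hxX
        · rw [Finset.mem_union, Finset.mem_sdiff, Finset.mem_erase] at h'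
          rcases h' with h' | h'
          · exact absurd (mem_piece.2 (Or.inl ⟨hc, ho, hcx⟩)) h'.2
          · exact h'.2
      have inner : ∀ {c d}, Nbr E src adj c d → own c = x → own d = x →
          ctr n x c ∈ (Y \ piece n E adj own x) ∪ X.erase x →
          ctr n x d ∈ (Y \ piece n E adj own x) ∪ X.erase x ∨
          ctr n x d ∈ (C \ piece n E adj own x) ∪
            (B.filter (fun v => own v = x) ∪ D.image (n + 2 + ·)) := by
        intro c d hcd hc hd h'
        obtain ⟨l1, l2⟩ := h.nbr_lt hcd
        have hcX := ctr_mem l1 h' hc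
        by_cases hdx : d = x
        · left
          rw [hdx, ctr, if_pos rfl, Finset.mem_union, Finset.mem_sdiff]
          exact Or.inl ⟨hs ▸ hsep.s_mem, hpn⟩
        · rw [ctr, if_neg hdx]
          by_cases hdX : d ∈ X
          · left
            rw [Finset.mem_union, Finset.mem_erase]
            exact Or.inr ⟨hdx, hdX⟩
          · right
            rw [Finset.mem_union, Finset.mem_union, Finset.mem_filter]
            exact Or.inr (Or.inl ⟨mem_bdry.2 ⟨l2, hdX, c, hcX, hcd⟩, hd⟩)
      have copy_out : ∀ {e}, e < E → own (adj e) = x →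
          n + 2 + firstEntry src adj own e ∉ (Y \ piece n E adj own x) ∪ X.erase x := by
        intro e he ho h'
        have hle : firstEntry src adj own e ≤ e := firstEntry_le e
        rw [Finset.mem_union, Finset.mem_sdiff, Finset.mem_erase] at h'
        rcases h' with h' | h'
        · exact h'.2 (mem_piece.2 (Or.inr ⟨_, by omega, by
            rw [(firstEntry_spec (src := src) (adj := adj) (own := own) e).2, ho], rfl⟩))
        · have := (hXn _ h'.2).1; omega
      have t_out : n + 1 ∉ (Y \ piece n E adj own x) ∪ X.erase x := by
        rw [Finset.mem_union, Finset.mem_sdiff, Finset.mem_erase]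
        rintro (h' | h')
        · exact hsep.t_notMem (ht ▸ h'.1)
        · have := (hXn _ h'.2).1; omega
      rcases (hadj u v).1 huv with ⟨e, he, hlt, hcase⟩ | ⟨e, he, hlt, hcase⟩
      · have la := h.adj_lt e he
        have ls := h.src_lt e he
        by_cases hox : own (adj e) = x
        · rcases hcase with ⟨h1, rfl, rfl⟩ | ⟨h1, rfl, rfl⟩ | ⟨h1, rfl, rfl⟩
          · rw [hox] at h1 hu ⊢
            exact inner ⟨e, he, rfl, rfl⟩ h1 hox hu
          · exact absurd hu (copy_out he hox)
          · rw [hox] at h1 hu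
            right
            have hX := ctr_mem la hu hox
            obtain ⟨s1, s2⟩ := firstEntry_spec (src := src) (adj := adj) (own := own) e
            have hle : firstEntry src adj own e ≤ e := firstEntry_le e
            rw [Finset.mem_union, Finset.mem_union, Finset.mem_image]
            refine Or.inr (Or.inr ⟨firstEntry src adj own e, ?_, rfl⟩)
            rw [hD, Finset.mem_filter, Finset.mem_range, s1, s2]
            refine ⟨by omega, firstEntry_idem e, hox, h1, mem_bdry.2 ⟨ls, fun h' => ?_, adj e, hX,
              h.nbr_symm ⟨e, he, rfl, rfl⟩⟩⟩
            exact h1 (hXn _ h').2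
        · rcases hcase with ⟨h1, rfl, rfl⟩ | ⟨h1, rfl, rfl⟩ | ⟨h1, rfl, rfl⟩
          · exact other (ctr_not ls h1 hox) (ctr_not la rfl hox) (notX (ctr_not ls h1 hox))
          · exact other (copy_not hox) hpt (notX (copy_not hox))
          · exact other (ctr_not la rfl hox) (copy_not hox) (notX (ctr_not la rfl hox))
      · have la := h.adj_lt e he
        have ls := h.src_lt e he
        by_cases hox : own (adj e) = x
        · rcases hcase with ⟨h1, rfl, rfl⟩ | ⟨h1, rfl, rfl⟩ | ⟨h1, rfl, rfl⟩
          · rw [hox] at h1 hu ⊢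
            exact inner (h.nbr_symm ⟨e, he, rfl, rfl⟩) hox h1 hu
          · exact absurd hu t_out
          · exact absurd hu (copy_out he hox)
        · rcases hcase with ⟨h1, rfl, rfl⟩ | ⟨h1, rfl, rfl⟩ | ⟨h1, rfl, rfl⟩
          · exact other (ctr_not la rfl hox) (ctr_not ls h1 hox) (notX (ctr_not la rfl hox))
          · exact other hpt (copy_not hox) (notX hpt)
          · exact other (copy_not hox) (ctr_not la rfl hox) (notX (copy_not hox))

end Pieces

/-! ## Writing down flow instances -/

namespace RAM

def addEdge (a b : Expr) : Prog :=
  .store A_tail (𝓿 V_M) a ;; .store A_head (𝓿 V_M) b ;; V_M ≔ 𝓿 V_M +ₑ 𝓬 1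

/-- The edges written so far. -/
structure EdgesAre (κ : Cfg) (es : List (ℕ × ℕ)) : Prop where
  len : κ.v V_M = es.length
  tail : ∀ i (h : i < es.length), κ.m A_tail i = es[i].1
  head : ∀ i (h : i < es.length), κ.m A_head i = es[i].2

section

variable {w W : ℕ} {O : FlowOracle} {ω : ℕ → Bool}

theorem Run.bound {p : Prog} {κ κ' : Cfg} {N c : ℕ} (h : Run w O ω p κ ((N + 1) * c) κ') (K : ℕ)
    (hc : c ≤ K) : Run w O ω p κ (K * (N + 1)) κ' :=
  h.mono (by rw [mul_comm]; exact Nat.mul_le_mul_right _ hc)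

theorem EdgesAre.addEdge {κ : Cfg} {es : List (ℕ × ℕ)} (h : EdgesAre κ es) {a b : Expr}
    (hb : ∀ i z, b.val (κ.setM A_tail i z) = b.val κ) :
    EdgesAre ((addEdge a b).go ω κ) (es ++ [(a.val κ, b.val κ)]) := by
  refine ⟨by simp [RAM.addEdge, h.len], fun i hi => ?_, fun i hi => ?_⟩
  · simp only [List.length_append, List.length_singleton] at hi
    rw [List.getElem_append]
    split_ifs with hlt
    · rw [← h.tail i hlt]
      simp [RAM.addEdge, h.len, hlt.ne]
    · obtain rfl : i = es.length := by omega
      simp [RAM.addEdge, h.len]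
  · simp only [List.length_append, List.length_singleton] at hi
    rw [List.getElem_append]
    split_ifs with hlt
    · rw [← h.head i hlt]
      simp [RAM.addEdge, h.len, hlt.ne]
    · obtain rfl : i = es.length := by omega
      simp [RAM.addEdge, h.len, hb]

theorem addEdge_safe {κ : Cfg} {a b : Expr} (h1 : 1 < W) (ha : a.Fits W κ)
    (hb : ∀ i z, b.Fits W (κ.setM A_tail i z)) (hM : κ.v V_M + 1 < W) :
    (addEdge a b).Safe W ω κ := by
  simp [addEdge, ha, hb, h1, hM]

theorem EdgesAre.setV {κ : Cfg} {es : List (ℕ × ℕ)} (h : EdgesAre κ es) {x a : ℕ}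
    (hx : V_M ≠ x) : EdgesAre (κ.setV x a) es :=
  ⟨by simp [hx, h.len], h.tail, h.head⟩

theorem EdgesAre.frame {κ κ' : Cfg} {es : List (ℕ × ℕ)} (h : EdgesAre κ es) {vs as : List ℕ}
    (hF : Frame vs as κ κ') (h1 : V_M ∉ vs) (h2 : A_tail ∉ as) (h3 : A_head ∉ as) :
    EdgesAre κ' es :=
  ⟨by rw [hF.v _ h1, h.len], by rw [hF.m _ h2]; exact h.tail, by rw [hF.m _ h3]; exact h.head⟩

theorem length_flatMap_range_le {α : Type*} {g : ℕ → List α} {N : ℕ}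
    (hg : ∀ i < N, (g i).length ≤ 2) : ((List.range N).flatMap g).length ≤ 2 * N := by
  induction N with
  | zero => simp
  | succ N ih =>
    rw [List.range_succ, List.flatMap_append, List.length_append]
    have := ih fun i hi => hg i (by omega)
    have := hg N (by omega)
    simp only [List.flatMap_cons, List.flatMap_nil, List.append_nil]
    omega

/-- A loop that writes the edges `g i` in round `i`. -/
theorem run_emit (hW : W ≤ 2 ^ w) (h1 : 1 < W) {x : ℕ} {e : Expr} {body : Prog} {N : ℕ} {κ : Cfg}
    {es : List (ℕ × ℕ)} (g : ℕ → List (ℕ × ℕ)) (hes : EdgesAre κ es)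
    (hb : ∀ τ, Frame (forLoop x e body).wv (forLoop x e body).wa κ τ → e.val τ = N ∧ e.Fits W τ)
    (hx : x ∉ body.wv) (hxM : V_M ≠ x) (hg : ∀ i < N, (g i).length ≤ 2)
    (hM : es.length + 2 * N + 2 < W)
    (hs : ∀ i τ, i < N → Frame (forLoop x e body).wv (forLoop x e body).wa κ τ → τ.v x = i →
      (τ.v V_M + 2 < W → body.Safe W ω τ) ∧
      ∀ es, EdgesAre τ es → EdgesAre (body.go ω τ) (es ++ g i)) :
    ∃ τ, Run w O ω (forLoop x e body) κ ((N + 1) * (body.cost + e.cost + 9)) τ ∧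
      EdgesAre τ (es ++ (List.range N).flatMap g) := by
  obtain ⟨τ, hr, hI, -⟩ := run_for_go (w := w) (W := W) (O := O) (ω := ω) hW h1
    (κ := κ) (x := x) (e := e) (body := body) (N := N)
    (fun i τ => EdgesAre τ (es ++ (List.range i).flatMap g)) (by omega)
    (by simpa using hes.setV hxM) hb hx (fun i τ hi hI hF hv => by
      obtain ⟨h2, h3⟩ := hs i τ hi hF hv
      refine ⟨h2 ?_, ?_⟩
      · rw [hI.len, List.length_append]
        have := length_flatMap_range_le (N := i) fun j hj => hg j (by omega)
        omega
      · rw [List.range_succ, List.flatMap_append, ← List.append_assoc]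
        simpa using (h3 _ hI).setV hxM)
  exact ⟨τ, hr, hI⟩

theorem nodup_flatMap_range {α β : Type*} {g : ℕ → List α} (σ : α → β) {N : ℕ}
    (h1 : ∀ i < N, ((g i).map σ).Nodup)
    (h2 : ∀ i < N, ∀ j < N, ∀ p ∈ g i, ∀ q ∈ g j, σ p = σ q → i = j) :
    (((List.range N).flatMap g).map σ).Nodup := by
  rw [List.map_flatMap, List.nodup_flatMap]
  refine ⟨fun i hi => h1 i (by simpa using hi), ?_⟩
  refine List.Nodup.pairwise_of_forall_ne List.nodup_range fun i hi j hj hij => ?_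
  simp only [Function.onFun, List.disjoint_left, List.mem_map]
  rintro y ⟨p, hp, rfl⟩ ⟨q, hq, he⟩
  exact hij (h2 i (by simpa using hi) j (by simpa using hj) p hp q hq he.symm)

theorem EdgesAre.valid {κ : Cfg} {es : List (ℕ × ℕ)} (h : EdgesAre κ es)
    (hs : κ.v V_s < κ.v V_N) (ht : κ.v V_t < κ.v V_N) (hst : κ.v V_s ≠ κ.v V_t)
    (hlt : ∀ p ∈ es, p.1 < κ.v V_N ∧ p.2 < κ.v V_N) (hne : ∀ p ∈ es, p.1 ≠ p.2)
    (hnd : (es.map fun p => s(p.1, p.2)).Nodup)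
    (hna : ∀ p ∈ es, s(p.1, p.2) ≠ s(κ.v V_s, κ.v V_t)) : κ.inst.Valid := by
  have hlen : κ.inst.M = es.length := h.len
  have htail : ∀ i : Fin κ.inst.M, κ.inst.tail i = (es[i.1]'(hlen ▸ i.2)).1 := fun i =>
    h.tail i.1 (hlen ▸ i.2)
  have hhead : ∀ i : Fin κ.inst.M, κ.inst.head i = (es[i.1]'(hlen ▸ i.2)).2 := fun i =>
    h.head i.1 (hlen ▸ i.2)
  have hmem : ∀ i : Fin κ.inst.M, (es[i.1]'(hlen ▸ i.2)) ∈ es := fun i => List.getElem_mem _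
  refine ⟨hs, ht, hst, fun i => ?_, fun i => ?_, fun i => ?_, fun i j hij => ?_, fun i => ?_⟩
  · rw [htail]; exact (hlt _ (hmem i)).1
  · rw [hhead]; exact (hlt _ (hmem i)).2
  · rw [htail, hhead]; exact hne _ (hmem i)
  · rw [htail, hhead, htail, hhead] at hij
    have hi : i.1 < (es.map fun p => s(p.1, p.2)).length := by simpa using hlen ▸ i.2
    have hj : j.1 < (es.map fun p => s(p.1, p.2)).length := by simpa using hlen ▸ j.2
    have := (hnd.getElem_inj_iff (hi := hi) (hj := hj)).1 (by simpa using hij)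
    exact Fin.ext this
  · rw [htail, hhead]; exact hna _ (hmem i)

theorem EdgesAre.adj_iff {κ : Cfg} {es : List (ℕ × ℕ)} (h : EdgesAre κ es) (u v : ℕ) :
    κ.inst.Adj u v ↔ (u, v) ∈ es ∨ (v, u) ∈ es := by
  have hlen : κ.inst.M = es.length := h.len
  constructor
  · rintro ⟨i, hi⟩
    have e1 : κ.inst.tail i = (es[i.1]'(hlen ▸ i.2)).1 := h.tail i.1 (hlen ▸ i.2)
    have e2 : κ.inst.head i = (es[i.1]'(hlen ▸ i.2)).2 := h.head i.1 (hlen ▸ i.2)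
    have hmem : (es[i.1]'(hlen ▸ i.2)) ∈ es := List.getElem_mem _
    rw [e1, e2] at hi
    rcases hi with ⟨rfl, rfl⟩ | ⟨rfl, rfl⟩
    · exact Or.inl hmem
    · exact Or.inr hmem
  · have key : ∀ p ∈ es, ∃ i : Fin κ.inst.M, κ.inst.tail i = p.1 ∧ κ.inst.head i = p.2 := by
      intro p hp
      obtain ⟨i, hi, rfl⟩ := List.getElem_of_mem hp
      exact ⟨⟨i, hlen ▸ hi⟩, h.tail i hi, h.head i hi⟩
    rintro (hp | hp)
    · obtain ⟨i, h1, h2⟩ := key _ hp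
      exact ⟨i, Or.inl ⟨h1, h2⟩⟩
    · obtain ⟨i, h1, h2⟩ := key _ hp
      exact ⟨i, Or.inr ⟨h1, h2⟩⟩

end

/-- The graph in the memory. -/
structure HasGraph (n E : ℕ) (src adj : ℕ → ℕ) (κ : Cfg) : Prop where
  n : κ.v V_n = n
  E : κ.v V_E = E
  src : κ.m A_src = src
  adj : κ.m A_adj = adj

theorem HasGraph.frame {n E : ℕ} {src adj : ℕ → ℕ} {κ κ' : Cfg} (h : HasGraph n E src adj κ)
    {vs as : List ℕ} (hF : Frame vs as κ κ') (h1 : V_n ∉ vs) (h2 : V_E ∉ vs) (h3 : A_src ∉ as)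
    (h4 : A_adj ∉ as) : HasGraph n E src adj κ' :=
  ⟨(hF.v _ h1).trans h.n, (hF.v _ h2).trans h.E, (hF.m _ h3).trans h.src, (hF.m _ h4).trans h.adj⟩

/-- The set of vertices with a non-zero entry. -/
def supp (n : ℕ) (t : ℕ → ℕ) : Finset ℕ := (Finset.range n).filter fun v => t v ≠ 0

theorem mem_supp {n : ℕ} {t : ℕ → ℕ} {v : ℕ} : v ∈ supp n t ↔ v < n ∧ t v ≠ 0 := by simp [supp]

/-! ## Splitting along one bit -/

/-- Flag the vertices next to terminals. -/
def flagNeighbours : Prog :=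
  forLoop V_v (𝓿 V_n) (.store A_fA (𝓿 V_v) (𝓬 0)) ;;
  forLoop V_v (𝓿 V_n) (.store A_fB (𝓿 V_v) (𝓬 0)) ;;
  forLoop V_e (𝓿 V_E)
    (.ite (.read A_T (.read A_adj (𝓿 V_e)))
      (.ite (.read A_adj (𝓿 V_e) /ₑ 𝓿 V_pow %ₑ 𝓬 2)
        (.store A_fA (.read A_src (𝓿 V_e)) (𝓬 1))
        (.store A_fB (.read A_src (𝓿 V_e)) (𝓬 1)))
      .skip)

/-- Each edge of the graph has two list entries; the comparison keeps one of them, so that the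
instance is simple. -/
def emitInner : Prog :=
  .ite (.read A_src (𝓿 V_e) <ₑ .read A_adj (𝓿 V_e))
    (.ite (.read A_T (.read A_src (𝓿 V_e))) .skip
      (.ite (.read A_T (.read A_adj (𝓿 V_e))) .skip
        (addEdge (.read A_src (𝓿 V_e)) (.read A_adj (𝓿 V_e)))))
    .skip

/-- A vertex may have many terminal neighbours of one class; thanks to the flags only one edge to
the contracted vertex is written. The terminals themselves remain as isolated vertices. -/
def emitOuter : Prog :=
  .ite (.read A_T (𝓿 V_v)) .skip
    (.ite (.read A_fA (𝓿 V_v)) (addEdge (𝓿 V_n) (𝓿 V_v)) .skip ;;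
      .ite (.read A_fB (𝓿 V_v)) (addEdge (𝓿 V_v) (𝓿 V_n +ₑ 𝓬 1)) .skip)

/-- A marked exit means the source side; a marked entrance with an unmarked exit means the
separator. Terminals were contracted, so their side is read from the bit of their name. -/
def updateRegion : Prog :=
  .ite (.read A_T (𝓿 V_v))
    (.ite (𝓿 V_v /ₑ 𝓿 V_pow %ₑ 𝓬 2)
      (.store A_own (𝓿 V_v) (.read A_own (𝓿 V_v) +ₑ 𝓿 V_pow)) .skip)
    (.ite (.read A_mark (𝓬 2 *ₑ 𝓿 V_v +ₑ 𝓬 1))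
      (.store A_own (𝓿 V_v) (.read A_own (𝓿 V_v) +ₑ 𝓿 V_pow))
      (.ite (.read A_mark (𝓬 2 *ₑ 𝓿 V_v)) (.store A_dead (𝓿 V_v) (𝓬 1)) .skip))

/-- Split the regions of the terminals along one bit of their names. -/
def splitBit : Prog :=
  flagNeighbours ;; V_M ≔ 𝓬 0 ;;
  forLoop V_e (𝓿 V_E) emitInner ;; forLoop V_v (𝓿 V_n) emitOuter ;;
  (V_N ≔ 𝓿 V_n +ₑ 𝓬 2 ;; V_s ≔ 𝓿 V_n ;; V_t ≔ 𝓿 V_n +ₑ 𝓬 1) ;;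
  minCut ;; forLoop V_v (𝓿 V_n) updateRegion ;; V_pow ≔ 𝓿 V_pow *ₑ 𝓬 2

section

variable {w W : ℕ} {O : FlowOracle} {ω : ℕ → Bool} {n E : ℕ} {src adj : ℕ → ℕ}

theorem run_flagNeighbours (hW : W ≤ 2 ^ w) {κ : Cfg} (hG : HasGraph n E src adj κ)
    (hL : EdgeList n E src adj) (hb : n + E + 3 < W) :
    ∃ κ', Run w O ω flagNeighbours κ (100 * (n + E + 1)) κ' ∧
      (∀ u < n, κ'.m A_fA u ≠ 0 ↔ ∃ x ∈ supp n (κ.m A_T), x / κ.v V_pow % 2 = 1 ∧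
        Nbr E src adj u x) ∧
      ∀ u < n, κ'.m A_fB u ≠ 0 ↔ ∃ x ∈ supp n (κ.m A_T), x / κ.v V_pow % 2 ≠ 1 ∧
        Nbr E src adj u x := by
  have h1 : 1 < W := by omega
  obtain ⟨κ₁, r₁, z₁, -⟩ := run_fill (w := w) (W := W) (O := O) (ω := ω) hW h1 (x := V_v)
    (a := A_fA) (e := 𝓿 V_n) (r := 𝓬 0) (κ := κ) (N := n) (fun _ => 0) (by omega)
    (fun τ hF => by simp [hF.v V_n (by decide), hG.n]) (fun i τ _ _ _ _ => by simp; omega)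
  have G₁ := hG.frame r₁.frame (by decide) (by decide) (by decide) (by decide)
  obtain ⟨κ₂, r₂, z₂, -⟩ := run_fill (w := w) (W := W) (O := O) (ω := ω) hW h1 (x := V_v)
    (a := A_fB) (e := 𝓿 V_n) (r := 𝓬 0) (κ := κ₁) (N := n) (fun _ => 0) (by omega)
    (fun τ hF => by simp [hF.v V_n (by decide), G₁.n]) (fun i τ _ _ _ _ => by simp; omega)
  have G₂ := G₁.frame r₂.frame (by decide) (by decide) (by decide) (by decide)
  have T₂ : κ₂.m A_T = κ.m A_T :=
    (r₂.frame.m _ (by decide)).trans (r₁.frame.m _ (by decide))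
  have P₂ : κ₂.v V_pow = κ.v V_pow :=
    (r₂.frame.v _ (by decide)).trans (r₁.frame.v _ (by decide))
  obtain ⟨κ₃, r₃, ⟨hA, hB⟩, -⟩ := run_for_go (w := w) (W := W) (O := O) (ω := ω) hW h1
    (x := V_e) (e := 𝓿 V_E) (κ := κ₂) (N := E)
    (body := (.ite (.read A_T (.read A_adj (𝓿 V_e)))
      (.ite (.read A_adj (𝓿 V_e) /ₑ 𝓿 V_pow %ₑ 𝓬 2)
        (.store A_fA (.read A_src (𝓿 V_e)) (𝓬 1))
        (.store A_fB (.read A_src (𝓿 V_e)) (𝓬 1)))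
      .skip))
    (fun i τ => (∀ u < n, τ.m A_fA u ≠ 0 ↔ ∃ e < i, src e = u ∧ κ.m A_T (adj e) ≠ 0 ∧
        adj e / κ.v V_pow % 2 = 1) ∧
      ∀ u < n, τ.m A_fB u ≠ 0 ↔ ∃ e < i, src e = u ∧ κ.m A_T (adj e) ≠ 0 ∧
        adj e / κ.v V_pow % 2 ≠ 1) (by omega)
    ⟨fun u hu => by
      have : κ₂.m A_fA = κ₁.m A_fA := r₂.frame.m _ (by decide)
      simp [this, z₁ u hu], fun u hu => by simp [z₂ u hu]⟩
    (fun τ hF => by simp [hF.v V_E (by decide), G₂.E]) (by decide)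
    (fun i τ hi hI hF hv => by
      have G₃ := G₂.frame hF (by decide) (by decide) (by decide) (by decide)
      have T₃ : τ.m A_T = κ.m A_T := (hF.m _ (by decide)).trans T₂
      have P₃ : τ.v V_pow = κ.v V_pow := (hF.v _ (by decide)).trans P₂
      have la := hL.adj_lt i hi
      constructor
      · have hdl : adj i / κ.v V_pow ≤ adj i := Nat.div_le_self _ _
        simp only [Prog.Safe, Expr.Fits, BinOp.Fits, Expr.val, BinOp.apply, hv, G₃.adj, P₃]
        refine ⟨trivial, fun _ => ⟨⟨⟨trivial, trivial, by omega⟩, by omega, by omega⟩,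
          fun _ => ⟨trivial, h1⟩, fun _ => ⟨trivial, h1⟩⟩, fun _ => trivial⟩
      · have hmod := Nat.mod_two_eq_zero_or_one (adj i / κ.v V_pow)
        simp only [Prog.go, Expr.val, BinOp.apply, hv, G₃.adj, G₃.src, T₃, P₃, Cfg.setV_m]
        simp only [Nat.lt_succ_iff_lt_or_eq, or_and_right, exists_or, exists_eq_left]
        by_cases c1 : κ.m A_T (adj i) = 0
        · simp only [c1, ne_eq, not_true_eq_false, if_false, false_and, and_false, or_false]
          exact hI
        · rcases hmod with c2 | c2
          · simp only [c1, c2, ne_eq, not_false_eq_true, if_true, not_true_eq_false, if_false,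
              Cfg.setM_m, true_and]
            refine ⟨fun u hu => ?_, fun u hu => ?_⟩
            · rw [← ne_eq, show ((if (A_fA : ℕ) = A_fB ∧ u = src i then 1 else τ.m A_fA u) =
                τ.m A_fA u) from if_neg (by simp), hI.1 u hu]
              simp
            · have := hI.2 u hu
              by_cases hus : u = src i
              · simp [hus]
              · simp only [hus, if_false, Ne.symm hus, false_and, or_false]
                exact this
          · simp only [c1, c2, ne_eq, not_false_eq_true, if_true, one_ne_zero,
              Cfg.setM_m, and_true, true_and, not_true_eq_false, and_false, or_false]
            refine ⟨fun u hu => ?_, fun u hu => ?_⟩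
            · have := hI.1 u hu
              by_cases hus : u = src i
              · simp [hus]
              · simp only [hus, if_false, Ne.symm hus, or_false]
                exact this
            · rw [← ne_eq, show ((if (A_fB : ℕ) = A_fA ∧ u = src i then 1 else τ.m A_fB u) =
                τ.m A_fB u) from if_neg (by simp), hI.2 u hu])
  refine ⟨κ₃, ((r₁.bound 20 (by decide)).seq ((r₂.bound 20 (by decide)).seq
    (r₃.bound 50 (by decide)))).mono (by omega), fun u hu => ?_, fun u hu => ?_⟩
  · rw [hA u hu]
    constructor
    · rintro ⟨e, he, h2, h3, h4⟩
      exact ⟨adj e, mem_supp.2 ⟨hL.adj_lt e he, h3⟩, h4, e, he, h2, rfl⟩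
    · rintro ⟨x, hx, h2, e, he, h3, rfl⟩
      exact ⟨e, he, h3, (mem_supp.1 hx).2, h2⟩
  · rw [hB u hu]
    constructor
    · rintro ⟨e, he, h2, h3, h4⟩
      exact ⟨adj e, mem_supp.2 ⟨hL.adj_lt e he, h3⟩, h4, e, he, h2, rfl⟩
    · rintro ⟨x, hx, h2, e, he, h3, rfl⟩
      exact ⟨e, he, h3, (mem_supp.1 hx).2, h2⟩

end

/-- The edges of the contracted graph that join two vertices outside `T`. -/
def innerEdges (src adj t : ℕ → ℕ) (e : ℕ) : List (ℕ × ℕ) :=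
  if src e < adj e ∧ t (src e) = 0 ∧ t (adj e) = 0 then [(src e, adj e)] else []

/-- The edges of the contracted graph between `v` and the two contracted vertices. -/
def outerEdges (n : ℕ) (t fA fB : ℕ → ℕ) (v : ℕ) : List (ℕ × ℕ) :=
  if t v ≠ 0 then [] else
    (if fA v ≠ 0 then [(n, v)] else []) ++ (if fB v ≠ 0 then [(v, n + 1)] else [])

theorem mem_innerEdges {src adj t : ℕ → ℕ} {e : ℕ} {p : ℕ × ℕ} : p ∈ innerEdges src adj t e ↔
    src e < adj e ∧ t (src e) = 0 ∧ t (adj e) = 0 ∧ p = (src e, adj e) := by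
  unfold innerEdges
  split_ifs with h
  · simp [h]
  · simp only [List.not_mem_nil, false_iff]; tauto

theorem mem_outerEdges {n : ℕ} {t fA fB : ℕ → ℕ} {v : ℕ} {p : ℕ × ℕ} :
    p ∈ outerEdges n t fA fB v ↔
      t v = 0 ∧ ((fA v ≠ 0 ∧ p = (n, v)) ∨ (fB v ≠ 0 ∧ p = (v, n + 1))) := by
  unfold outerEdges
  split_ifs <;> simp_all

def splitEdges (n E : ℕ) (src adj t fA fB : ℕ → ℕ) : List (ℕ × ℕ) :=
  (List.range E).flatMap (innerEdges src adj t) ++ (List.range n).flatMap (outerEdges n t fA fB)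

section

variable {n E : ℕ} {src adj t fA fB : ℕ → ℕ}

theorem mem_splitEdges {p : ℕ × ℕ} : p ∈ splitEdges n E src adj t fA fB ↔
    (∃ e < E, p ∈ innerEdges src adj t e) ∨ ∃ v < n, p ∈ outerEdges n t fA fB v := by
  simp [splitEdges, List.mem_flatMap]

/-- Inner pairs lie below n and are listed in increasing order of their ends only; an outer pair
contains n or n + 1 and determines its other end. -/
theorem splitEdges_nodup (hL : EdgeList n E src adj) :
    ((splitEdges n E src adj t fA fB).map fun p => s(p.1, p.2)).Nodup := by
  unfold splitEdges
  rw [List.map_append, List.nodup_append]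
  refine ⟨nodup_flatMap_range _ (fun e _ => ?_) (fun e he e' he' p hp q hq hpq => ?_),
    nodup_flatMap_range _ (fun v hv => ?_) (fun v hv v' hv' p hp q hq hpq => ?_), ?_⟩
  · unfold innerEdges; split_ifs <;> simp
  · obtain ⟨h1, -, -, rfl⟩ := mem_innerEdges.1 hp
    obtain ⟨h2, -, -, rfl⟩ := mem_innerEdges.1 hq
    rw [Sym2.eq_iff] at hpq
    rcases hpq with ⟨h3, h4⟩ | ⟨h3, h4⟩
    · exact hL.inj e he e' he' h3 h4
    · simp only at h3 h4; omega
  · unfold outerEdges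
    split_ifs <;> simp
    omega
  · obtain ⟨-, ⟨-, rfl⟩ | ⟨-, rfl⟩⟩ := mem_outerEdges.1 hp <;>
    obtain ⟨-, ⟨-, rfl⟩ | ⟨-, rfl⟩⟩ := mem_outerEdges.1 hq <;>
    simp only [Sym2.eq_iff] at hpq <;> omega
  · intro x hx y hy hxy
    simp only [List.mem_map, List.mem_flatMap, List.mem_range] at hx hy
    obtain ⟨p, ⟨e, he, hp⟩, rfl⟩ := hx
    obtain ⟨q, ⟨v, hv, hq⟩, rfl⟩ := hy
    obtain ⟨h1, -, -, rfl⟩ := mem_innerEdges.1 hp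
    have := hL.src_lt e he
    have := hL.adj_lt e he
    obtain ⟨-, ⟨-, rfl⟩ | ⟨-, rfl⟩⟩ := mem_outerEdges.1 hq <;>
    simp only [Sym2.eq_iff] at hxy <;> omega

theorem splitEdges_adj (hL : EdgeList n E src adj) {A : Finset ℕ} (hA : A ⊆ supp n t)
    (hfA : ∀ u < n, fA u ≠ 0 ↔ ∃ x ∈ A, Nbr E src adj u x)
    (hfB : ∀ u < n, fB u ≠ 0 ↔ ∃ x ∈ supp n t, x ∉ A ∧ Nbr E src adj u x) (u v : ℕ) :
    ((u, v) ∈ splitEdges n E src adj t fA fB ∨ (v, u) ∈ splitEdges n E src adj t fA fB) ↔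
      splitAdj n (Nbr E src adj) (supp n t) A u v ∨
      splitAdj n (Nbr E src adj) (supp n t) A v u := by
  have hsupp : ∀ v < n, v ∉ supp n t ↔ t v = 0 := fun v hv => by simp [mem_supp, hv]
  have fwd : ∀ u v, (u, v) ∈ splitEdges n E src adj t fA fB →
      splitAdj n (Nbr E src adj) (supp n t) A u v := by
    intro u v h
    rcases mem_splitEdges.1 h with ⟨e, he, hp⟩ | ⟨c, hc, hp⟩
    · obtain ⟨h1, h2, h3, h4⟩ := mem_innerEdges.1 hp
      simp only [Prod.mk.injEq] at h4
      obtain ⟨rfl, rfl⟩ := h4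
      exact Or.inl ⟨⟨e, he, rfl, rfl⟩, (hsupp _ (hL.src_lt e he)).2 h2,
        (hsupp _ (hL.adj_lt e he)).2 h3⟩
    · obtain ⟨h1, h2⟩ := mem_outerEdges.1 hp
      simp only [Prod.mk.injEq] at h2
      rcases h2 with ⟨h2, rfl, rfl⟩ | ⟨h2, rfl, rfl⟩
      · obtain ⟨x, hx, h3⟩ := (hfA _ hc).1 h2
        exact Or.inr (Or.inl ⟨rfl, (hsupp _ hc).2 h1, x, hx, hL.nbr_symm h3⟩)
      · obtain ⟨x, hx, h3, h4⟩ := (hfB _ hc).1 h2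
        exact Or.inr (Or.inr ⟨rfl, (hsupp _ hc).2 h1, x, hx, h3, hL.nbr_symm h4⟩)
  have bwd : ∀ u v, splitAdj n (Nbr E src adj) (supp n t) A u v →
      ((u, v) ∈ splitEdges n E src adj t fA fB ∨ (v, u) ∈ splitEdges n E src adj t fA fB) := by
    intro u v h
    rcases h with ⟨h1, h2, h3⟩ | ⟨rfl, h2, x, hx, h3⟩ | ⟨rfl, h2, x, hx, hx', h3⟩
    · have hl := hL.nbr_lt h1
      rw [hsupp _ hl.1] at h2
      rw [hsupp _ hl.2] at h3
      rcases Nat.lt_or_ge u v with huv | huv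
      · obtain ⟨e, he, rfl, rfl⟩ := h1
        exact Or.inl (mem_splitEdges.2 (Or.inl ⟨e, he, mem_innerEdges.2 ⟨huv, h2, h3, rfl⟩⟩))
      · obtain ⟨e, he, rfl, rfl⟩ := hL.nbr_symm h1
        have := hL.ne e he
        exact Or.inr (mem_splitEdges.2 (Or.inl ⟨e, he, mem_innerEdges.2 ⟨by omega, h3, h2, rfl⟩⟩))
    · have hl := (hL.nbr_lt h3).2
      exact Or.inl (mem_splitEdges.2 (Or.inr ⟨v, hl, mem_outerEdges.2 ⟨(hsupp _ hl).1 h2,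
        Or.inl ⟨(hfA v hl).2 ⟨x, hx, hL.nbr_symm h3⟩, rfl⟩⟩⟩))
    · have hl := (hL.nbr_lt h3).2
      exact Or.inl (mem_splitEdges.2 (Or.inr ⟨u, hl, mem_outerEdges.2 ⟨(hsupp _ hl).1 h2,
        Or.inr ⟨(hfB u hl).2 ⟨x, hx, hx', hL.nbr_symm h3⟩, rfl⟩⟩⟩))
  constructor
  · rintro (h | h)
    · exact Or.inl (fwd _ _ h)
    · exact Or.inr (fwd _ _ h)
  · rintro (h | h)
    · exact bwd _ _ h
    · exact (bwd _ _ h).symm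

end

section

variable {w W : ℕ} {O : FlowOracle} {ω : ℕ → Bool} {n E : ℕ} {src adj : ℕ → ℕ}

theorem run_emitInner (hW : W ≤ 2 ^ w) {κ : Cfg} (hG : HasGraph n E src adj κ)
    (hb : 2 * E + 3 < W) (hM : κ.v V_M = 0) :
    ∃ κ', Run w O ω (forLoop V_e (𝓿 V_E) emitInner) κ (100 * (E + 1)) κ' ∧
      EdgesAre κ' ((List.range E).flatMap (innerEdges src adj (κ.m A_T))) := by
  have h1 : 1 < W := by omega
  obtain ⟨κ₁, r₁, h⟩ := run_emit (O := O) (ω := ω) hW h1 (x := V_e) (e := 𝓿 V_E)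
    (body := emitInner) (N := E) (κ := κ) (es := []) (innerEdges src adj (κ.m A_T))
    ⟨by simpa using hM, by simp, by simp⟩
    (fun τ hF => by simp [hF.v V_E (by decide), hG.E]) (by decide) (by decide)
    (fun i _ => by unfold innerEdges; split_ifs <;> simp) (by simp; omega)
    (fun i τ hi hF hv => by
      have G₁ := hG.frame hF (by decide) (by decide) (by decide) (by decide)
      have T₁ : τ.m A_T = κ.m A_T := hF.m _ (by decide)
      constructor
      · intro hM
        refine ⟨⟨trivial, trivial, trivial⟩, fun _ => ⟨trivial, fun _ => trivial, fun _ =>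
          ⟨trivial, fun _ => trivial, fun _ => ?_⟩⟩, fun _ => trivial⟩
        exact addEdge_safe h1 trivial (fun _ _ => trivial) (by omega)
      · intro es hes
        have := hes.addEdge (ω := ω) (a := .read A_src (𝓿 V_e)) (b := .read A_adj (𝓿 V_e))
          (fun i z => by simp)
        simp only [Expr.val, hv, G₁.src, G₁.adj] at this
        simp only [emitInner, Prog.go, Expr.val, BinOp.apply, hv, G₁.src, G₁.adj, T₁, innerEdges]
        by_cases c1 : src i < adj i <;> by_cases c2 : κ.m A_T (src i) = 0 <;>
          by_cases c3 : κ.m A_T (adj i) = 0 <;> simp [c1, c2, c3] <;> assumption)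
  exact ⟨κ₁, r₁.bound 100 (by decide), by simpa using h⟩

theorem run_emitOuter (hW : W ≤ 2 ^ w) {κ : Cfg} {es : List (ℕ × ℕ)} (hn : κ.v V_n = n)
    (hes : EdgesAre κ es) (hb : es.length + 2 * n + 3 < W) :
    ∃ κ', Run w O ω (forLoop V_v (𝓿 V_n) emitOuter) κ (100 * (n + 1)) κ' ∧
      EdgesAre κ' (es ++ (List.range n).flatMap
        (outerEdges n (κ.m A_T) (κ.m A_fA) (κ.m A_fB))) := by
  have h1 : 1 < W := by omega
  obtain ⟨κ₁, r₁, h⟩ := run_emit (O := O) (ω := ω) hW h1 (x := V_v) (e := 𝓿 V_n)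
    (body := emitOuter) (N := n) (κ := κ) (es := es)
    (outerEdges n (κ.m A_T) (κ.m A_fA) (κ.m A_fB)) hes
    (fun τ hF => by simp [hF.v V_n (by decide), hn]) (by decide) (by decide)
    (fun i _ => by unfold outerEdges; split_ifs <;> simp) (by omega)
    (fun i τ hi hF hv => by
      have n₁ : τ.v V_n = n := (hF.v _ (by decide)).trans hn
      have T₁ : τ.m A_T = κ.m A_T := hF.m _ (by decide)
      have A₁ : τ.m A_fA = κ.m A_fA := hF.m _ (by decide)
      have B₁ : τ.m A_fB = κ.m A_fB := hF.m _ (by decide)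
      constructor
      · intro hM
        have hM' : ((if κ.m A_fA i ≠ 0 then (addEdge (𝓿 V_n) (𝓿 V_v)).go ω τ else τ)).v V_M + 1 < W ∧
            ((if κ.m A_fA i ≠ 0 then (addEdge (𝓿 V_n) (𝓿 V_v)).go ω τ else τ)).v V_n = n := by
          split_ifs
          · simp [addEdge, n₁]; omega
          · simp [n₁]; omega
        refine ⟨trivial, fun _ => trivial, fun _ => ⟨⟨trivial, fun _ => ?_, fun _ => trivial⟩,
          ⟨trivial, fun _ => ?_, fun _ => trivial⟩⟩⟩
        · exact addEdge_safe h1 trivial (fun _ _ => trivial) (by omega)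
        · simp only [Prog.go, Expr.val, hv, A₁]
          refine addEdge_safe h1 trivial (fun _ _ => ⟨trivial, h1, ?_⟩) hM'.1
          simp only [BinOp.Fits, Expr.val, Cfg.setM_v, hM'.2]
          omega
      · intro es hes
        have e1 := hes.addEdge (ω := ω) (a := 𝓿 V_n) (b := 𝓿 V_v) (fun i z => by simp)
        simp only [Expr.val, hv, n₁] at e1
        have e2 := hes.addEdge (ω := ω) (a := 𝓿 V_v) (b := 𝓿 V_n +ₑ 𝓬 1) (fun i z => by simp)
        simp only [Expr.val, hv, n₁, BinOp.apply] at e2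
        have f1 : ((addEdge (𝓿 V_n) (𝓿 V_v)).go ω τ).v V_v = i := by
          rw [(go_frame ω (addEdge (𝓿 V_n) (𝓿 V_v)) τ).v V_v (by decide), hv]
        have f2 : ((addEdge (𝓿 V_n) (𝓿 V_v)).go ω τ).v V_n = n := by
          rw [(go_frame ω (addEdge (𝓿 V_n) (𝓿 V_v)) τ).v V_n (by decide), n₁]
        have f3 : ((addEdge (𝓿 V_n) (𝓿 V_v)).go ω τ).m A_fB = κ.m A_fB := by
          rw [(go_frame ω (addEdge (𝓿 V_n) (𝓿 V_v)) τ).m A_fB (by decide), B₁]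
        have e3 := e1.addEdge (ω := ω) (a := 𝓿 V_v) (b := 𝓿 V_n +ₑ 𝓬 1) (fun i z => by simp)
        simp only [Expr.val, f1, f2, BinOp.apply] at e3
        simp only [emitOuter, Prog.go, Expr.val, hv, T₁, A₁, outerEdges]
        by_cases c1 : κ.m A_T i = 0 <;> by_cases c2 : κ.m A_fA i = 0 <;>
          by_cases c3 : κ.m A_fB i = 0 <;> simp [c1, c2, c3, B₁, hv, f1, f3] <;>
          first
          | assumption
          | simpa using e3)
  exact ⟨κ₁, r₁.bound 100 (by decide), h⟩

theorem run_updateRegion (hW : W ≤ 2 ^ w) {κ : Cfg} (hn : κ.v V_n = n)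
    (hb : 2 * n + 4 < W) (hown : ∀ v < n, κ.m A_own v + κ.v V_pow < W) :
    ∃ κ', Run w O ω (forLoop V_v (𝓿 V_n) updateRegion) κ (100 * (n + 1)) κ' ∧
      ∀ v < n,
        κ'.m A_own v = (if κ.m A_T v ≠ 0 then
          (if v / κ.v V_pow % 2 = 1 then κ.m A_own v + κ.v V_pow else κ.m A_own v)
          else if κ.m A_mark (2 * v + 1) ≠ 0 then κ.m A_own v + κ.v V_pow else κ.m A_own v) ∧
        κ'.m A_dead v = (if κ.m A_T v ≠ 0 then κ.m A_dead v
          else if κ.m A_mark (2 * v + 1) ≠ 0 then κ.m A_dead v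
          else if κ.m A_mark (2 * v) ≠ 0 then 1 else κ.m A_dead v) := by
  have h1 : 1 < W := by omega
  obtain ⟨κ₁, r₁, h, -⟩ := run_for_go (O := O) (ω := ω) hW h1 (x := V_v) (e := 𝓿 V_n)
    (body := updateRegion) (N := n) (κ := κ)
    (fun i τ => (∀ v < i,
        τ.m A_own v = (if κ.m A_T v ≠ 0 then
          (if v / κ.v V_pow % 2 = 1 then κ.m A_own v + κ.v V_pow else κ.m A_own v)
          else if κ.m A_mark (2 * v + 1) ≠ 0 then κ.m A_own v + κ.v V_pow else κ.m A_own v) ∧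
        τ.m A_dead v = (if κ.m A_T v ≠ 0 then κ.m A_dead v
          else if κ.m A_mark (2 * v + 1) ≠ 0 then κ.m A_dead v
          else if κ.m A_mark (2 * v) ≠ 0 then 1 else κ.m A_dead v)) ∧
      ∀ v, i ≤ v → τ.m A_own v = κ.m A_own v ∧ τ.m A_dead v = κ.m A_dead v)
    (by omega) ⟨by simp, by simp⟩
    (fun τ hF => by simp [hF.v V_n (by decide), hn]) (by decide)
    (fun i τ hi hI hF hv => by
      have T₁ : τ.m A_T = κ.m A_T := hF.m _ (by decide)
      have M₁ : τ.m A_mark = κ.m A_mark := hF.m _ (by decide)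
      have P₁ : τ.v V_pow = κ.v V_pow := hF.v _ (by decide)
      obtain ⟨hI1, hI2⟩ := hI
      obtain ⟨o1, o2⟩ := hI2 i le_rfl
      have hoi := hown i hi
      constructor
      · have hdl : i / κ.v V_pow ≤ i := Nat.div_le_self _ _
        simp only [updateRegion, Prog.Safe, Expr.Fits, BinOp.Fits, Expr.val, BinOp.apply, hv, P₁,
          o1, true_and]
        refine ⟨fun _ => ⟨⟨by omega, by omega, by omega⟩, fun _ => hoi, fun _ => trivial⟩,
          fun _ => ⟨⟨⟨by omega, by omega⟩, by omega, by omega⟩, fun _ => hoi, fun _ =>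
            ⟨⟨by omega, by omega⟩, fun _ => by omega, fun _ => trivial⟩⟩⟩
      · have hmod := Nat.mod_two_eq_zero_or_one (i / κ.v V_pow)
        have hgo : updateRegion.go ω τ = if κ.m A_T i ≠ 0 then
            (if i / κ.v V_pow % 2 = 1 then τ.setM A_own i (κ.m A_own i + κ.v V_pow) else τ)
            else if κ.m A_mark (2 * i + 1) ≠ 0 then τ.setM A_own i (κ.m A_own i + κ.v V_pow)
            else if κ.m A_mark (2 * i) ≠ 0 then τ.setM A_dead i 1 else τ := by
          simp only [updateRegion, Prog.go, Expr.val, BinOp.apply, hv, T₁, M₁, P₁, o1]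
          rcases hmod with c | c <;> simp [c]
        have key : ∀ v, ((updateRegion.go ω τ).setV V_v (i + 1)).m A_own v =
            (if v = i then (if κ.m A_T v ≠ 0 then
          (if v / κ.v V_pow % 2 = 1 then κ.m A_own v + κ.v V_pow else κ.m A_own v)
          else if κ.m A_mark (2 * v + 1) ≠ 0 then κ.m A_own v + κ.v V_pow else κ.m A_own v)
            else τ.m A_own v) ∧ ((updateRegion.go ω τ).setV V_v (i + 1)).m A_dead v =
            (if v = i then (if κ.m A_T v ≠ 0 then κ.m A_dead v
          else if κ.m A_mark (2 * v + 1) ≠ 0 then κ.m A_dead v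
          else if κ.m A_mark (2 * v) ≠ 0 then 1 else κ.m A_dead v) else τ.m A_dead v) := by
          intro v
          rw [Cfg.setV_m, hgo]
          by_cases hvi : v = i
          · subst hvi
            rw [if_pos rfl, if_pos rfl]
            split_ifs <;> simp [o1, o2]
          · split_ifs <;> simp [hvi]
        refine ⟨fun v hvi => ?_, fun v hvi => ?_⟩
        · obtain ⟨k1, k2⟩ := key v
          rw [k1, k2]
          by_cases hvi' : v = i
          · simp only [hvi', if_true, and_self]
          · rw [if_neg hvi', if_neg hvi']
            exact hI1 v (by omega)
        · obtain ⟨k1, k2⟩ := key v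
          rw [k1, k2, if_neg (by omega), if_neg (by omega)]
          exact hI2 v (by omega))
  exact ⟨κ₁, r₁.bound 100 (by decide), h.1⟩

/-- Each bit is cut in the whole graph with all terminals, not in the current regions. The regions
are intersected merely by accumulating labels and dead marks. -/
theorem run_splitBit (hW : W ≤ 2 ^ w) (hO : O.Correct) {κ : Cfg} (hG : HasGraph n E src adj κ)
    (hL : EdgeList n E src adj) {j : ℕ} (hp : κ.v V_pow = 2 ^ j) (hpn : 2 ^ j ≤ n)
    (hT : ∀ u ∈ supp n (κ.m A_T), ∀ v ∈ supp n (κ.m A_T), ¬ Nbr E src adj u v)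
    (hR : RegionInv n (Nbr E src adj) (supp n (κ.m A_T)) j (κ.m A_own) (κ.m A_dead))
    (hb : 20 * (n + E + 1) < W) :
    ∃ κ', Run w O ω splitBit κ (5000 * (n + E + 1)) κ' ∧ κ'.v V_pow = 2 ^ (j + 1) ∧
      RegionInv n (Nbr E src adj) (supp n (κ.m A_T)) (j + 1) (κ'.m A_own) (κ'.m A_dead) ∧
      κ'.f ≤ κ.f + 3 * (n + E + 1) := by
  classical
  have h1 : 1 < W := by omega
  obtain ⟨κ₁, r₁, hfA, hfB⟩ := run_flagNeighbours (O := O) (ω := ω) hW hG hL (by omega)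
  have G₁ := hG.frame r₁.frame (by decide) (by decide) (by decide) (by decide)
  have r₂ : Run w O ω (V_M ≔ 𝓬 0) κ₁ 2 (κ₁.setV V_M 0) := run_go hW h1 _ _ (by simp; omega)
  have G₂ := G₁.frame r₂.frame (by decide) (by decide) (by decide) (by decide)
  obtain ⟨κ₃, r₃, e₃⟩ := run_emitInner (O := O) (ω := ω) hW G₂ (by omega) (by simp)
  have G₃ := G₂.frame r₃.frame (by decide) (by decide) (by decide) (by decide)
  have T₂ : (κ₁.setV V_M 0).m A_T = κ.m A_T := r₁.frame.m _ (by decide)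
  rw [T₂] at e₃
  have T₃ : κ₃.m A_T = κ.m A_T := (r₃.frame.m _ (by decide)).trans T₂
  have A₃ : κ₃.m A_fA = κ₁.m A_fA := r₃.frame.m _ (by decide)
  have B₃ : κ₃.m A_fB = κ₁.m A_fB := r₃.frame.m _ (by decide)
  have len₃ : ((List.range E).flatMap (innerEdges src adj (κ.m A_T))).length ≤ E := by
    have : ∀ N, ((List.range N).flatMap (innerEdges src adj (κ.m A_T))).length ≤ N := by
      intro N
      induction N with
      | zero => simp
      | succ N ih =>
        rw [List.range_succ, List.flatMap_append, List.length_append]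
        have : (innerEdges src adj (κ.m A_T) N).length ≤ 1 := by
          unfold innerEdges; split_ifs <;> simp
        simp only [List.flatMap_cons, List.flatMap_nil, List.append_nil]
        omega
    exact this E
  obtain ⟨κ₄, r₄, e₄⟩ := run_emitOuter (O := O) (ω := ω) hW G₃.n e₃ (by omega)
  rw [T₃, A₃, B₃] at e₄
  change EdgesAre κ₄ (splitEdges n E src adj (κ.m A_T) (κ₁.m A_fA) (κ₁.m A_fB)) at e₄
  have G₄ := G₃.frame r₄.frame (by decide) (by decide) (by decide) (by decide)
  have r₅ := run_go (O := O) (ω := ω) hW h1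
    (V_N ≔ 𝓿 V_n +ₑ 𝓬 2 ;; V_s ≔ 𝓿 V_n ;; V_t ≔ 𝓿 V_n +ₑ 𝓬 1) κ₄ (by simp [G₄.n]; omega)
  set κ₅ := (V_N ≔ 𝓿 V_n +ₑ 𝓬 2 ;; V_s ≔ 𝓿 V_n ;; V_t ≔ 𝓿 V_n +ₑ 𝓬 1 : Prog).go ω κ₄ with hκ₅
  have N₅ : κ₅.v V_N = n + 2 := by simp [hκ₅, G₄.n]
  have s₅ : κ₅.v V_s = n := by simp [hκ₅, G₄.n]
  have t₅ : κ₅.v V_t = n + 1 := by simp [hκ₅, G₄.n]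
  have e₅ := e₄.frame r₅.frame (by decide) (by decide) (by decide)
  have M₅ : κ₅.v V_M ≤ E + 2 * n := by
    rw [e₅.len, splitEdges, List.length_append]
    have := length_flatMap_range_le (N := n)
      (g := outerEdges n (κ.m A_T) (κ₁.m A_fA) (κ₁.m A_fB))
      (fun i _ => by unfold outerEdges; split_ifs <;> simp)
    omega
  have hval : κ₅.inst.Valid := by
    have hbd : ∀ p ∈ splitEdges n E src adj (κ.m A_T) (κ₁.m A_fA) (κ₁.m A_fB),
        p.1 < n + 2 ∧ p.2 < n + 2 ∧ p.1 ≠ p.2 ∧ s(p.1, p.2) ≠ s(n, n + 1) := by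
      intro p hp
      rcases mem_splitEdges.1 hp with ⟨e, he, hp⟩ | ⟨c, hc, hp⟩
      · obtain ⟨h2, -, -, rfl⟩ := mem_innerEdges.1 hp
        have := hL.src_lt e he
        have := hL.adj_lt e he
        simp only [ne_eq, Sym2.eq_iff]
        omega
      · obtain ⟨-, ⟨-, rfl⟩ | ⟨-, rfl⟩⟩ := mem_outerEdges.1 hp <;>
        · simp only [ne_eq, Sym2.eq_iff]
          omega
    refine e₅.valid (by omega) (by omega) (by omega) (fun p hp => ?_) (fun p hp => ?_)
      (splitEdges_nodup hL) fun p hp => ?_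
    · rw [N₅]; exact ⟨(hbd p hp).1, (hbd p hp).2.1⟩
    · exact (hbd p hp).2.2.1
    · rw [s₅, t₅]; exact (hbd p hp).2.2.2
  obtain ⟨κ₆, r₆, f₆, Y, C, hcut⟩ := run_minCut (ω := ω) hW hO hval (by omega)
  have F₆ : Frame (flagNeighbours ;; V_M ≔ 𝓬 0 ;;
      forLoop V_e (𝓿 V_E) emitInner ;; forLoop V_v (𝓿 V_n) emitOuter ;;
      (V_N ≔ 𝓿 V_n +ₑ 𝓬 2 ;; V_s ≔ 𝓿 V_n ;; V_t ≔ 𝓿 V_n +ₑ 𝓬 1) ;; minCut).wv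
      (flagNeighbours ;; V_M ≔ 𝓬 0 ;;
      forLoop V_e (𝓿 V_E) emitInner ;; forLoop V_v (𝓿 V_n) emitOuter ;;
      (V_N ≔ 𝓿 V_n +ₑ 𝓬 2 ;; V_s ≔ 𝓿 V_n ;; V_t ≔ 𝓿 V_n +ₑ 𝓬 1) ;; minCut).wa κ κ₆ :=
    (r₁.seq (r₂.seq (r₃.seq (r₄.seq (r₅.seq r₆))))).frame
  have n₆ : κ₆.v V_n = n := (F₆.v _ (by decide)).trans hG.n
  have P₆ : κ₆.v V_pow = 2 ^ j := (F₆.v _ (by decide)).trans hp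
  have O₆ : κ₆.m A_own = κ.m A_own := F₆.m _ (by decide)
  have D₆ : κ₆.m A_dead = κ.m A_dead := F₆.m _ (by decide)
  have T₆ : κ₆.m A_T = κ.m A_T := F₆.m _ (by decide)
  obtain ⟨κ₇, r₇, h₇⟩ := run_updateRegion (O := O) (ω := ω) hW n₆ (by omega) (fun v hv => by
    rw [P₆, O₆]; have := hR.lt v hv; omega)
  have P₇ : κ₇.v V_pow = 2 ^ j := (r₇.frame.v _ (by decide)).trans P₆
  have r₈ := run_go (O := O) (ω := ω) hW h1 (V_pow ≔ 𝓿 V_pow *ₑ 𝓬 2) κ₇ (by simp [P₇]; omega)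
  refine ⟨_, (r₁.seq (r₂.seq (r₃.seq (r₄.seq (r₅.seq (r₆.seq (r₇.seq r₈))))))).mono ?_, ?_, ?_, ?_⟩
  · simp only [Prog.cost, Expr.cost]
    rw [N₅]
    omega
  · simp [P₇, pow_succ]
  · set A := (supp n (κ.m A_T)).filter fun v => v / 2 ^ j % 2 = 1 with hA
    have hAsub : A ⊆ supp n (κ.m A_T) := Finset.filter_subset _ _
    refine hR.succ (A := A) (I := κ₅.inst) (Y := Y) (C := C) s₅ t₅ (by simp [hA])
      (fun v hv => (mem_supp.1 hv).1) hT (fun u v => hL.nbr_lt) (fun u v => hL.nbr_symm)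
      (fun u v => ?_) hcut.separates hcut.min fun v hv => ?_
    · rw [e₅.adj_iff]
      refine splitEdges_adj hL hAsub (fun u hu => ?_) (fun u hu => ?_) u v
      · rw [hfA u hu, hp]
        simp [hA, and_assoc]
      · rw [hfB u hu, hp]
        simp only [hA, Finset.mem_filter, not_and]
        exact ⟨fun ⟨x, h2, h3, h4⟩ => ⟨x, h2, fun _ => h3, h4⟩,
          fun ⟨x, h2, h3, h4⟩ => ⟨x, h2, h3 h2, h4⟩⟩
    · obtain ⟨o, d⟩ := h₇ v hv
      have hvN : v < κ₅.inst.N := by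
        have : κ₅.inst.N = n + 2 := N₅
        omega
      have mY := hcut.mem_Y v hvN
      have mC := hcut.mem_C v hvN
      rw [T₆, P₆, O₆, D₆] at *
      simp only [Prog.go, Cfg.setV_m]
      rw [o, d]
      have hTv : v ∈ supp n (κ.m A_T) ↔ κ.m A_T v ≠ 0 := by simp [mem_supp, hv]
      have hAv : v ∈ A ↔ κ.m A_T v ≠ 0 ∧ v / 2 ^ j % 2 = 1 := by simp [hA, hTv]
      unfold OnSide
      rw [hAv, hTv, ← mY, ← mC]
      by_cases c1 : κ.m A_T v = 0 <;> by_cases c2 : κ₆.m A_mark (2 * v + 1) = 0 <;>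
        by_cases c3 : κ₆.m A_mark (2 * v) = 0 <;> by_cases c4 : v / 2 ^ j % 2 = 1 <;>
        simp [c1, c2, c3, c4]
  · have : κ₅.f = κ.f := by
      rw [r₅.flow (by decide), r₄.flow (by decide), r₃.flow (by decide), r₂.flow (by decide),
        r₁.flow (by decide)]
    simp only [Prog.go, Cfg.setV_f]
    rw [r₇.flow (by decide), f₆, this, N₅]
    omega

end

end RAM

/-! ## Cutting within the regions -/

namespace RAM

/-- The edges of the disjoint union of the pieces that come from entry `e`. -/
def pieceEdges (n : ℕ) (src adj own : ℕ → ℕ) (e : ℕ) : List (ℕ × ℕ) :=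
  if own (adj e) < n then
    if own (src e) = own (adj e) then
      if src e < adj e then [(ctr n (own (adj e)) (src e), ctr n (own (adj e)) (adj e))] else []
    else (if firstEntry src adj own e = e then [(n + 2 + e, n + 1)] else []) ++
      [(ctr n (own (adj e)) (adj e), n + 2 + firstEntry src adj own e)]
  else []

theorem mem_pieceEdges {n : ℕ} {src adj own : ℕ → ℕ} {e : ℕ} {p : ℕ × ℕ} :
    p ∈ pieceEdges n src adj own e ↔ own (adj e) < n ∧
      ((own (src e) = own (adj e) ∧ src e < adj e ∧
          p = (ctr n (own (adj e)) (src e), ctr n (own (adj e)) (adj e))) ∨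
        (own (src e) ≠ own (adj e) ∧ firstEntry src adj own e = e ∧ p = (n + 2 + e, n + 1)) ∨
        (own (src e) ≠ own (adj e) ∧
          p = (ctr n (own (adj e)) (adj e), n + 2 + firstEntry src adj own e))) := by
  unfold pieceEdges
  split_ifs <;> simp_all

section

variable {w W : ℕ} {O : FlowOracle} {ω : ℕ → Bool} {n E : ℕ} {src adj own : ℕ → ℕ}

theorem length_pieceEdges_le (e : ℕ) : (pieceEdges n src adj own e).length ≤ 2 := by
  unfold pieceEdges
  split_ifs <;> simp

theorem ctr_cases (n x c : ℕ) : (c = x ∧ ctr n x c = n) ∨ (c ≠ x ∧ ctr n x c = c) := by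
  unfold ctr; split_ifs <;> simp_all

/-- Contracting centres creates no parallel edges: an edge keeps an end other than n that determines
its region or its copy, and hence its list entry. -/
theorem pieceEdges_nodup (hL : EdgeList n E src adj) :
    (((List.range E).flatMap (pieceEdges n src adj own)).map fun p => s(p.1, p.2)).Nodup := by
  refine nodup_flatMap_range (fun p : ℕ × ℕ => s(p.1, p.2)) (fun e he => ?_) fun e he e' he' p hp q hq h => ?_
  · have := hL.adj_lt e he
    unfold pieceEdges
    split_ifs with h1 h2 h3 h4
    · simp
    · simp
    · simp only [List.cons_append, List.nil_append, List.map_cons, List.map_nil, List.nodup_cons,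
        List.mem_singleton, List.not_mem_nil, not_false_eq_true, List.nodup_nil, and_true,
        Sym2.eq_iff]
      rcases ctr_cases n (own (adj e)) (adj e) with h | h <;> omega
    · simp
    · simp
  · have l1 := hL.adj_lt e he
    have l2 := hL.adj_lt e' he'
    have l3 := hL.src_lt e he
    have l4 := hL.src_lt e' he'
    have n1 := hL.ne e he
    have n2 := hL.ne e' he'
    have f1 := firstEntry_spec (src := src) (adj := adj) (own := own) e
    have f2 := firstEntry_spec (src := src) (adj := adj) (own := own) e'
    rw [mem_pieceEdges] at hp hq
    simp only [Sym2.eq_iff] at h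
    obtain ⟨o1, ⟨h1, h2, rfl⟩ | ⟨h1, h2, rfl⟩ | ⟨h1, rfl⟩⟩ := hp <;>
      obtain ⟨o2, ⟨h3, h4, rfl⟩ | ⟨h3, h4, rfl⟩ | ⟨h3, rfl⟩⟩ := hq
    · have c1 := ctr_cases n (own (adj e)) (src e)
      have c2 := ctr_cases n (own (adj e)) (adj e)
      have c3 := ctr_cases n (own (adj e')) (src e')
      have c4 := ctr_cases n (own (adj e')) (adj e')
      -- Equal pairs share a vertex that was not contracted. Its owner fixes the centre behind n, so
      -- the original ends agree; the order of the ends excludes the reversed entry.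
      have hh := hL.inj e he e' he'
      simp only at h
      grind
    · have c1 := ctr_cases n (own (adj e)) (src e)
      have c2 := ctr_cases n (own (adj e)) (adj e)
      simp only at h
      omega
    · have c1 := ctr_cases n (own (adj e)) (src e)
      have c2 := ctr_cases n (own (adj e)) (adj e)
      have c4 := ctr_cases n (own (adj e')) (adj e')
      simp only at h
      omega
    · have c1 := ctr_cases n (own (adj e')) (src e')
      have c2 := ctr_cases n (own (adj e')) (adj e')
      simp only at h
      omega
    · simp only at h
      omega
    · have c2 := ctr_cases n (own (adj e')) (adj e')
      simp only at h
      omega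
    · have c1 := ctr_cases n (own (adj e)) (adj e)
      have c3 := ctr_cases n (own (adj e')) (src e')
      have c4 := ctr_cases n (own (adj e')) (adj e')
      simp only at h
      omega
    · have c2 := ctr_cases n (own (adj e)) (adj e)
      simp only at h
      omega
    · have c2 := ctr_cases n (own (adj e)) (adj e)
      have c4 := ctr_cases n (own (adj e')) (adj e')
      have hh := hL.inj e he e' he'
      simp only at h
      -- Equal copies force equal sources and equal owners; the owner then also identifies the other
      -- end, even when that end is the contracted centre.
      have hf : firstEntry src adj own e = firstEntry src adj own e' := by omega
      rw [hf] at f1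
      grind

theorem pieceEdges_adj (hL : EdgeList n E src adj) (u v : ℕ) :
    ((u, v) ∈ (List.range E).flatMap (pieceEdges n src adj own) ∨
      (v, u) ∈ (List.range E).flatMap (pieceEdges n src adj own)) ↔
    pieceAdj n E src adj own u v ∨ pieceAdj n E src adj own v u := by
  have fwd : ∀ u v, (u, v) ∈ (List.range E).flatMap (pieceEdges n src adj own) →
      pieceAdj n E src adj own u v := by
    intro u v h
    rw [List.mem_flatMap] at h
    obtain ⟨e, he, h⟩ := h
    rw [mem_pieceEdges] at h
    obtain ⟨h0, ⟨h1, h2, h3⟩ | ⟨h1, h2, h3⟩ | ⟨h1, h3⟩⟩ := h <;> rw [Prod.mk.injEq] at h3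
    · exact ⟨e, by simpa using he, h0, Or.inl ⟨h1, h3⟩⟩
    · exact ⟨e, by simpa using he, h0, Or.inr (Or.inl ⟨h1, by rw [h2]; exact h3⟩)⟩
    · exact ⟨e, by simpa using he, h0, Or.inr (Or.inr ⟨h1, h3⟩)⟩
  have bwd : ∀ u v, pieceAdj n E src adj own u v →
      (u, v) ∈ (List.range E).flatMap (pieceEdges n src adj own) ∨
      (v, u) ∈ (List.range E).flatMap (pieceEdges n src adj own) := by
    rintro u v ⟨e, he, h0, ⟨h1, rfl, rfl⟩ | ⟨h1, rfl, rfl⟩ | ⟨h1, rfl, rfl⟩⟩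
    · rcases lt_or_gt_of_ne (hL.ne e he) with h | h
      · exact Or.inl (List.mem_flatMap.2 ⟨e, by simpa using he,
          mem_pieceEdges.2 ⟨h0, Or.inl ⟨h1, h, rfl⟩⟩⟩)
      · obtain ⟨e', he', h2, h3⟩ := hL.symm e he
        refine Or.inr (List.mem_flatMap.2 ⟨e', by simpa using he',
          mem_pieceEdges.2 ⟨?_, Or.inl ⟨?_, ?_, ?_⟩⟩⟩)
        · rw [h3, h1]; exact h0
        · rw [h3, h2, h1]
        · rw [h3, h2]; exact h
        · rw [h3, h2, h1]
    · obtain ⟨s1, s2⟩ := firstEntry_spec (src := src) (adj := adj) (own := own) e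
      have hle : firstEntry src adj own e ≤ e := firstEntry_le e
      exact Or.inl (List.mem_flatMap.2 ⟨firstEntry src adj own e, by simp; omega,
          mem_pieceEdges.2 ⟨by rw [s2]; exact h0, Or.inr (Or.inl ⟨by rw [s1, s2]; exact h1,
            firstEntry_idem e, rfl⟩)⟩⟩)
    · exact Or.inl (List.mem_flatMap.2 ⟨e, by simpa using he,
          mem_pieceEdges.2 ⟨h0, Or.inr (Or.inr ⟨h1, rfl⟩)⟩⟩)
  constructor
  · rintro (h | h)
    · exact Or.inl (fwd _ _ h)
    · exact Or.inr (fwd _ _ h)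
  · rintro (h | h)
    · exact bwd _ _ h
    · exact (bwd _ _ h).symm

end

/-- Load the ends of an entry and their regions. -/
def loadEntry : Prog :=
  V_x ≔ .read A_own (.read A_adj (𝓿 V_e)) ;; V_y ≔ .read A_own (.read A_src (𝓿 V_e)) ;;
  V_a ≔ .read A_src (𝓿 V_e) ;; V_b ≔ .read A_adj (𝓿 V_e) ;;
  .ite (𝓿 V_a =ₑ 𝓿 V_x) (V_a ≔ 𝓿 V_n) .skip ;; .ite (𝓿 V_b =ₑ 𝓿 V_x) (V_b ≔ 𝓿 V_n) .skip

/-- Entries are sorted by source, so one stamp per region suffices: it remembers the last outside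
source for which the region has received a copy. The shift by 1 lets 0 mean "none", and `A_cid`
holds the name of that copy. -/
def stampCopy : Prog :=
  .ite (.read A_stamp (𝓿 V_x) =ₑ .read A_src (𝓿 V_e) +ₑ 𝓬 1) .skip
    (.store A_stamp (𝓿 V_x) (.read A_src (𝓿 V_e) +ₑ 𝓬 1) ;;
      .store A_cid (𝓿 V_x) (𝓿 V_n +ₑ 𝓬 2 +ₑ 𝓿 V_e) ;;
      addEdge (𝓿 V_n +ₑ 𝓬 2 +ₑ 𝓿 V_e) (𝓿 V_n +ₑ 𝓬 1))

def emitPiece : Prog :=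
  loadEntry ;;
  .ite (𝓿 V_x <ₑ 𝓿 V_n)
    (.ite (𝓿 V_y =ₑ 𝓿 V_x)
      (.ite (.read A_src (𝓿 V_e) <ₑ .read A_adj (𝓿 V_e)) (addEdge (𝓿 V_a) (𝓿 V_b)) .skip)
      (stampCopy ;; addEdge (𝓿 V_b) (.read A_cid (𝓿 V_x))))
    .skip

/-- The invariant of the copies of boundary vertices before entry `i`. -/
structure CopyInv (n : ℕ) (src adj own : ℕ → ℕ) (i : ℕ) (stamp cid : ℕ → ℕ) : Prop where
  lt : ∀ x < n, ∀ e < i, own (adj e) = x → own (src e) ≠ x → src e < stamp x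
  ex : ∀ x < n, stamp x ≠ 0 → ∃ e < i, own (adj e) = x ∧ stamp x = src e + 1 ∧
    cid x = n + 2 + firstEntry src adj own e

section

variable {w W : ℕ} {O : FlowOracle} {ω : ℕ → Bool} {n E : ℕ} {src adj own : ℕ → ℕ}

theorem CopyInv.stamped {i : ℕ} {stamp cid : ℕ → ℕ} (h : CopyInv n src adj own i stamp cid)
    (hx : own (adj i) < n) (hs : stamp (own (adj i)) = src i + 1) :
    firstEntry src adj own i < i ∧ cid (own (adj i)) = n + 2 + firstEntry src adj own i := by
  obtain ⟨e, he, h1, h2, h3⟩ := h.ex _ hx (by omega)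
  have hf := firstEntry_congr (src := src) (adj := adj) (own := own) (e := e) (e' := i) (by omega) h1
  have : firstEntry src adj own e ≤ e := firstEntry_le e
  exact ⟨by omega, by rw [h3, hf]⟩

/-- An earlier entry with the same source and owner would have raised the stamp above `src i`. A
stamp is 1 plus the source of an earlier entry, thus at most `src i + 1`, and this value is
excluded. -/
theorem CopyInv.fresh {i : ℕ} {stamp cid : ℕ → ℕ} (h : CopyInv n src adj own i stamp cid)
    (hL : EdgeList n E src adj) (hi : i < E) (hx : own (adj i) < n) (ho : own (src i) ≠ own (adj i))
    (hs : stamp (own (adj i)) ≠ src i + 1) : firstEntry src adj own i = i := by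
  by_contra hne
  have hle : firstEntry src adj own i ≤ i := firstEntry_le i
  obtain ⟨s1, s2⟩ := firstEntry_spec (src := src) (adj := adj) (own := own) i
  have h1 := h.lt _ hx (firstEntry src adj own i) (by omega) s2 (by rw [s1]; exact ho)
  obtain ⟨e, he, h2, h3, -⟩ := h.ex _ hx (by omega)
  have := hL.mono e i (by omega) hi
  omega

theorem CopyInv.skip {i : ℕ} {stamp cid : ℕ → ℕ} (h : CopyInv n src adj own i stamp cid)
    (hs : own (adj i) < n → own (src i) ≠ own (adj i) → stamp (own (adj i)) = src i + 1) :
    CopyInv n src adj own (i + 1) stamp cid := by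
  refine ⟨fun x hx e he h1 h2 => ?_, fun x hx h0 => ?_⟩
  · by_cases hei : e = i
    · subst hei; subst h1
      rw [hs hx h2]; omega
    · exact h.lt x hx e (by omega) h1 h2
  · obtain ⟨e, he, h'⟩ := h.ex x hx h0
    exact ⟨e, by omega, h'⟩

theorem CopyInv.stamp {i : ℕ} {stamp cid stamp' cid' : ℕ → ℕ}
    (h : CopyInv n src adj own i stamp cid)
    (hL : EdgeList n E src adj) (hi : i < E) (hf : firstEntry src adj own i = i)
    (hs : ∀ x, stamp' x = if x = own (adj i) then src i + 1 else stamp x)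
    (hc : ∀ x, cid' x = if x = own (adj i) then n + 2 + i else cid x) :
    CopyInv n src adj own (i + 1) stamp' cid' := by
  refine ⟨fun x hx e he h1 h2 => ?_, fun x hx h0 => ?_⟩
  · rw [hs]
    split_ifs with hxe
    · have := hL.mono e i (by omega) hi
      omega
    · exact h.lt x hx e (by rcases Nat.lt_succ_iff_lt_or_eq.1 he with h' | rfl
                            · exact h'
                            · exact absurd h1.symm hxe) h1 h2
  · rw [hs] at h0 ⊢
    rw [hc]
    by_cases hxe : x = own (adj i)
    · simp only [hxe, if_true] at *
      exact ⟨i, by omega, rfl, rfl, by rw [hf]⟩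
    · simp only [hxe, if_false] at *
      obtain ⟨e, he, h'⟩ := h.ex x hx h0
      exact ⟨e, by omega, h'⟩

theorem run_emitPiece (hW : W ≤ 2 ^ w) {κ : Cfg} (hG : HasGraph n E src adj κ)
    (hL : EdgeList n E src adj) (hb : n + 2 * E + 4 < W) (hM : κ.v V_M = 0)
    (hst : ∀ x < n, κ.m A_stamp x = 0) :
    ∃ κ', Run w O ω (forLoop V_e (𝓿 V_E) emitPiece) κ (200 * (E + 1)) κ' ∧
      EdgesAre κ' ((List.range E).flatMap (pieceEdges n src adj (κ.m A_own))) := by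
  have h1 : 1 < W := by omega
  obtain ⟨κ₁, r₁, h, -⟩ := run_for_go (O := O) (ω := ω) hW h1 (x := V_e) (e := 𝓿 V_E)
    (body := emitPiece) (N := E) (κ := κ)
    (fun i τ => EdgesAre τ ((List.range i).flatMap (pieceEdges n src adj (κ.m A_own))) ∧
      CopyInv n src adj (κ.m A_own) i (τ.m A_stamp) (τ.m A_cid))
    (by omega) ⟨⟨by simpa using hM, by simp, by simp⟩,
      ⟨by simp, fun x hx h => absurd (by simpa using hst x hx) h⟩⟩
    (fun τ hF => by simp [hF.v V_E (by decide), hG.E]) (by decide)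
    (fun i τ hi hI hF hv => by
      have G₁ := hG.frame hF (by decide) (by decide) (by decide) (by decide)
      have O₁ : τ.m A_own = κ.m A_own := hF.m _ (by decide)
      obtain ⟨hes, hC⟩ := hI
      have hM' : τ.v V_M ≤ 2 * i := by
        rw [hes.len]
        exact length_flatMap_range_le fun j _ => length_pieceEdges_le j
      have la := hL.adj_lt i hi
      have ls := hL.src_lt i hi
      set own := κ.m A_own with hown
      set τ₁ := loadEntry.go ω τ with hτ₁
      have F₁ : Frame [V_x, V_y, V_a, V_b] [] τ τ₁ :=
        (go_frame ω loadEntry τ).mono (by decide) (by decide)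
      have x₁ : τ₁.v V_x = own (adj i) := by simp [hτ₁, loadEntry, hv, G₁.adj, O₁]
      have y₁ : τ₁.v V_y = own (src i) := by simp [hτ₁, loadEntry, hv, G₁.adj, G₁.src, O₁]
      have a₁ : τ₁.v V_a = ctr n (own (adj i)) (src i) := by
        simp [hτ₁, loadEntry, hv, G₁.adj, G₁.src, G₁.n, O₁, ctr]
      have b₁ : τ₁.v V_b = ctr n (own (adj i)) (adj i) := by
        simp [hτ₁, loadEntry, hv, G₁.adj, G₁.src, G₁.n, O₁, ctr]
      have es₁ := hes.frame F₁ (by decide) (by decide) (by decide)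
      have v₁ : τ₁.v V_e = i := (F₁.v _ (by decide)).trans hv
      have n₁ : τ₁.v V_n = n := (F₁.v _ (by decide)).trans G₁.n
      have M₁ : τ₁.v V_M = τ.v V_M := F₁.v _ (by decide)
      have s₁ : τ₁.m A_src = src := (F₁.m _ (by decide)).trans G₁.src
      have d₁ : τ₁.m A_adj = adj := (F₁.m _ (by decide)).trans G₁.adj
      have st₁ : τ₁.m A_stamp = τ.m A_stamp := F₁.m _ (by decide)
      have ci₁ : τ₁.m A_cid = τ.m A_cid := F₁.m _ (by decide)
      set τ₂ := stampCopy.go ω τ₁ with hτ₂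
      have F₂ : Frame [V_M] [A_stamp, A_cid, A_tail, A_head] τ₁ τ₂ :=
        (go_frame ω stampCopy τ₁).mono (by decide) (by decide)
      have hstamp : stampCopy.go ω τ₁ = if τ.m A_stamp (own (adj i)) = src i + 1 then τ₁ else
          (addEdge (𝓿 V_n +ₑ 𝓬 2 +ₑ 𝓿 V_e) (𝓿 V_n +ₑ 𝓬 1)).go ω
            ((τ₁.setM A_stamp (own (adj i)) (src i + 1)).setM A_cid (own (adj i)) (n + 2 + i)) := by
        simp only [stampCopy, Prog.go, Expr.val, BinOp.apply, x₁, v₁, s₁, st₁, n₁, Cfg.setM_v]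
        by_cases c : τ.m A_stamp (own (adj i)) = src i + 1 <;> simp [c]
      refine ⟨⟨by simp [loadEntry], ⟨trivial, trivial, trivial⟩, fun _ => ⟨⟨trivial, trivial, trivial⟩,
        fun _ => ⟨⟨trivial, trivial, trivial⟩, fun _ => addEdge_safe h1 trivial
          (fun _ _ => trivial) (by rw [← hτ₁, M₁]; omega), fun _ => trivial⟩,
        fun _ => ⟨⟨?_, fun _ => trivial, fun _ => ⟨⟨trivial, ?_⟩, ⟨trivial, ?_⟩,
          addEdge_safe h1 ?_ (fun _ _ => ?_) ?_⟩⟩, addEdge_safe h1 trivial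
          (fun _ _ => trivial) ?_⟩⟩, fun _ => trivial⟩, ?_, ?_⟩
      · refine ⟨trivial, ⟨trivial, h1, ?_⟩, trivial⟩
        simp only [BinOp.Fits, Expr.val, ← hτ₁, v₁, s₁]
        omega
      · refine ⟨trivial, h1, ?_⟩
        simp only [BinOp.Fits, Expr.val, ← hτ₁, v₁, s₁]
        omega
      · simp only [Expr.Fits, BinOp.Fits, Expr.val, Prog.go, Cfg.setM_v, BinOp.apply, ← hτ₁, v₁, n₁,
          true_and]
        omega
      · simp only [Expr.Fits, BinOp.Fits, Expr.val, Prog.go, Cfg.setM_v, BinOp.apply, ← hτ₁, v₁, n₁,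
          true_and]
        omega
      · simp only [Expr.Fits, BinOp.Fits, Expr.val, Prog.go, Cfg.setM_v, ← hτ₁, n₁, true_and]
        omega
      · simp only [Prog.go, Cfg.setM_v, ← hτ₁, M₁]
        omega
      · rw [← hτ₁, ← hτ₂, hτ₂, hstamp]
        split_ifs
        · rw [M₁]; omega
        · simp [addEdge, M₁]; omega
      · rw [List.range_succ, List.flatMap_append]
        refine EdgesAre.setV ?_ (by decide)
        simp only [List.flatMap_cons, List.flatMap_nil, List.append_nil]
        simp only [emitPiece, Prog.go, ← hτ₁, ← hτ₂, Expr.val, BinOp.apply, x₁, y₁, v₁, n₁, s₁, d₁,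
          pieceEdges]
        by_cases c1 : own (adj i) < n
        · by_cases c2 : own (src i) = own (adj i)
          · by_cases c3 : src i < adj i
            · have := es₁.addEdge (ω := ω) (a := 𝓿 V_a) (b := 𝓿 V_b) (fun i z => by simp)
              simp only [Expr.val, a₁, b₁] at this
              simpa [c1, c2, c3] using this
            · simpa [c1, c2, c3] using es₁
          · have b₂ : τ₂.v V_b = ctr n (own (adj i)) (adj i) := (F₂.v _ (by decide)).trans b₁
            have x₂ : τ₂.v V_x = own (adj i) := (F₂.v _ (by decide)).trans x₁
            by_cases c3 : τ.m A_stamp (own (adj i)) = src i + 1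
            · obtain ⟨g1, g2⟩ := hC.stamped c1 c3
              have e2 : τ₂ = τ₁ := by rw [hτ₂, hstamp, if_pos c3]
              have := es₁.addEdge (ω := ω) (a := 𝓿 V_b) (b := .read A_cid (𝓿 V_x))
                (fun i z => by simp)
              simp only [Expr.val, x₁, b₁, ci₁, g2] at this
              simpa [c1, c2, g1.ne, e2] using this
            · have g := hC.fresh hL hi c1 c2 c3
              have e2 : EdgesAre τ₂ ((List.range i).flatMap (pieceEdges n src adj own) ++
                  [(n + 2 + i, n + 1)]) := by
                rw [hτ₂, hstamp, if_neg c3]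
                have h3 : EdgesAre ((τ₁.setM A_stamp (own (adj i)) (src i + 1)).setM A_cid
                  (own (adj i)) (n + 2 + i)) ((List.range i).flatMap (pieceEdges n src adj own)) :=
                  ⟨es₁.len, fun i hi => by simpa using es₁.tail i hi,
                    fun i hi => by simpa using es₁.head i hi⟩
                have := h3.addEdge (ω := ω) (a := 𝓿 V_n +ₑ 𝓬 2 +ₑ 𝓿 V_e) (b := 𝓿 V_n +ₑ 𝓬 1)
                  (fun i z => by simp)
                simpa only [Expr.val, BinOp.apply, Cfg.setM_v, n₁, v₁] using this
              have k2 : τ₂.m A_cid (own (adj i)) = n + 2 + i := by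
                rw [hτ₂, hstamp, if_neg c3]
                simp [addEdge]
              have := e2.addEdge (ω := ω) (a := 𝓿 V_b) (b := .read A_cid (𝓿 V_x))
                (fun i z => by simp)
              simp only [Expr.val, x₂, b₂, k2] at this
              simpa [c1, c2, g] using this
        · simpa [c1] using es₁
      · simp only [Cfg.setV_m]
        simp only [emitPiece, Prog.go, ← hτ₁, ← hτ₂, Expr.val, BinOp.apply, x₁, y₁, v₁, n₁, s₁, d₁]
        by_cases c1 : own (adj i) < n
        · by_cases c2 : own (src i) = own (adj i)
          · have hC' := hC.skip fun _ h => absurd c2 h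
            by_cases c3 : src i < adj i
            · have F₃ := go_frame ω (addEdge (𝓿 V_a) (𝓿 V_b)) τ₁
              rw [← st₁, ← ci₁] at hC'
              rw [← F₃.m A_stamp (by decide), ← F₃.m A_cid (by decide)] at hC'
              simpa [c1, c2, c3] using hC'
            · simpa [c1, c2, c3, st₁, ci₁] using hC'
          · have F₃ := go_frame ω (addEdge (𝓿 V_b) (.read A_cid (𝓿 V_x))) τ₂
            have hC' : CopyInv n src adj own (i + 1) (τ₂.m A_stamp) (τ₂.m A_cid) := by
              by_cases c3 : τ.m A_stamp (own (adj i)) = src i + 1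
              · have e2 : τ₂ = τ₁ := by rw [hτ₂, hstamp, if_pos c3]
                rw [e2, st₁, ci₁]
                exact hC.skip fun _ _ => c3
              · refine hC.stamp hL hi (hC.fresh hL hi c1 c2 c3) (fun x => ?_) fun x => ?_
                · rw [hτ₂, hstamp, if_neg c3]
                  simp [addEdge, st₁]
                · rw [hτ₂, hstamp, if_neg c3]
                  simp [addEdge, ci₁]
            rw [← F₃.m A_stamp (by decide), ← F₃.m A_cid (by decide)] at hC'
            simpa [c1, c2] using hC'
        · simpa [c1, st₁, ci₁] using hC.skip fun h => absurd h c1)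
  exact ⟨κ₁, r₁.bound 200 (by decide), h.1⟩

end

/-- A vertex belongs to a region if it is alive and its owner is a terminal. -/
def ownedFlag : Expr :=
  (.read A_dead (𝓿 V_v) =ₑ 𝓬 0) *ₑ (.read A_own (𝓿 V_v) <ₑ 𝓿 V_n) *ₑ
    (𝓬 0 <ₑ .read A_T (.read A_own (𝓿 V_v)))

/-- The owner `n` stands for vertices that belong to no region. -/
def setOwners : Prog :=
  forLoop V_v (𝓿 V_n) (.store A_own (𝓿 V_v)
    (.read A_own (𝓿 V_v) *ₑ ownedFlag +ₑ 𝓿 V_n *ₑ (𝓬 1 -ₑ ownedFlag)))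

/-- Compute a minimum cut in the disjoint union of the pieces. -/
def cutRegions : Prog :=
  setOwners ;; forLoop V_v (𝓿 V_n) (.store A_stamp (𝓿 V_v) (𝓬 0)) ;; V_M ≔ 𝓬 0 ;;
  forLoop V_e (𝓿 V_E) emitPiece ;;
  (V_N ≔ 𝓿 V_n +ₑ 𝓬 2 +ₑ 𝓿 V_E ;; V_s ≔ 𝓿 V_n ;; V_t ≔ 𝓿 V_n +ₑ 𝓬 1) ;; minCut

/-- The owners and the marks in the memory describe a minimum cut of the pieces. -/
structure PiecesCut (n E : ℕ) (src adj : ℕ → ℕ) (T : Finset ℕ) (κ : Cfg) (Y C : Finset ℕ) :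
    Prop where
  terminal : ∀ x ∈ T, κ.m A_own x = x
  edge : ∀ u v, Nbr E src adj u v → κ.m A_own u < n → κ.m A_own v < n → κ.m A_own u = κ.m A_own v
  mem_Y : ∀ v < n + 2 + E, κ.m A_mark (2 * v + 1) ≠ 0 ↔ v ∈ Y
  mem_C : ∀ v < n + 2 + E, (κ.m A_mark (2 * v) ≠ 0 ∧ κ.m A_mark (2 * v + 1) = 0) ↔ v ∈ C
  lower : ∀ x < n, (bdry n (Nbr E src adj) (pieceSide n (κ.m A_own) Y x)).card ≤
    (C ∩ piece n E adj (κ.m A_own) x).card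
  upper : ∀ X x, Isolates n (Nbr E src adj) T X x →
    (C ∩ piece n E adj (κ.m A_own) x).card ≤ (bdry n (Nbr E src adj) X).card

section

variable {w W : ℕ} {O : FlowOracle} {ω : ℕ → Bool} {n E : ℕ} {src adj : ℕ → ℕ}

theorem run_setOwners (hW : W ≤ 2 ^ w) {κ : Cfg} (hn : κ.v V_n = n) (hb : n + 2 < W)
    (ho : ∀ v < n, κ.m A_own v + n < W) :
    ∃ κ', Run w O ω setOwners κ (100 * (n + 1)) κ' ∧ ∀ v < n, κ'.m A_own v =
      if κ.m A_dead v = 0 ∧ κ.m A_own v < n ∧ κ.m A_T (κ.m A_own v) ≠ 0 then κ.m A_own v else n := by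
  have h1 : 1 < W := by omega
  obtain ⟨κ₁, r₁, z₁, -⟩ := run_fill (w := w) (W := W) (O := O) (ω := ω) hW h1 (x := V_v)
    (a := A_own) (e := 𝓿 V_n)
    (r := .read A_own (𝓿 V_v) *ₑ ownedFlag +ₑ 𝓿 V_n *ₑ (𝓬 1 -ₑ ownedFlag)) (κ := κ) (N := n)
    (fun v => if κ.m A_dead v = 0 ∧ κ.m A_own v < n ∧ κ.m A_T (κ.m A_own v) ≠ 0 then
      κ.m A_own v else n) (by omega)
    (fun τ hF => by simp [hF.v V_n (by decide), hn]) (fun i τ hi hF hv ha => by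
      have T₁ : τ.m A_T = κ.m A_T := hF.m _ (by decide)
      have D₁ : τ.m A_dead = κ.m A_dead := hF.m _ (by decide)
      have n₁ : τ.v V_n = n := (hF.v _ (by decide)).trans hn
      have := ho i hi
      have h0 : 0 < W := by omega
      simp only [ownedFlag, Expr.Fits, BinOp.Fits, Expr.val, BinOp.apply, hv, n₁, ha, T₁, D₁]
      by_cases c1 : κ.m A_dead i = 0 <;> by_cases c2 : κ.m A_own i < n <;>
        by_cases c3 : 0 < κ.m A_T (κ.m A_own i) <;> simp [c1, c2, c3, h1, h0] <;> omega)
  exact ⟨κ₁, r₁.bound 100 (by decide), z₁⟩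

/-- An isolating set is first shrunk into the region of its terminal by `RegionInv.shrink`, and then
compared with the minimum cut of the piece by `card_piece_le`. This gives the field `upper`, while
`lower` is `card_bdry_pieceSide_le`. -/
theorem run_cutRegions (hW : W ≤ 2 ^ w) (hO : O.Correct) {κ : Cfg} (hG : HasGraph n E src adj κ)
    (hL : EdgeList n E src adj) {ℓ : ℕ} (hn2 : n ≤ 2 ^ ℓ) (h2n : 2 ^ ℓ ≤ 2 * n)
    (hR : RegionInv n (Nbr E src adj) (supp n (κ.m A_T)) ℓ (κ.m A_own) (κ.m A_dead))
    (hb : 20 * (n + E + 1) < W) :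
    ∃ κ', Run w O ω cutRegions κ (5000 * (n + E + 1)) κ' ∧
      κ'.f ≤ κ.f + 3 * (n + E + 1) ∧
      ∃ Y C, PiecesCut n E src adj (supp n (κ.m A_T)) κ' Y C := by
  have h1 : 1 < W := by omega
  obtain ⟨κ₁, r₁, o₁⟩ := run_setOwners (O := O) (ω := ω) hW hG.n (by omega) (fun v hv => by
    have := hR.lt v hv; omega)
  have G₁ := hG.frame r₁.frame (by decide) (by decide) (by decide) (by decide)
  obtain ⟨κ₂, r₂, z₂, -⟩ := run_fill (w := w) (W := W) (O := O) (ω := ω) hW h1 (x := V_v)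
    (a := A_stamp) (e := 𝓿 V_n) (r := 𝓬 0) (κ := κ₁) (N := n) (fun _ => 0) (by omega)
    (fun τ hF => by simp [hF.v V_n (by decide), G₁.n]) (fun i τ _ _ _ _ => by simp; omega)
  have G₂ := G₁.frame r₂.frame (by decide) (by decide) (by decide) (by decide)
  have r₃ : Run w O ω (V_M ≔ 𝓬 0) κ₂ 2 (κ₂.setV V_M 0) := run_go hW h1 _ _ (by simp; omega)
  have G₃ := G₂.frame r₃.frame (by decide) (by decide) (by decide) (by decide)
  obtain ⟨κ₄, r₄, e₄⟩ := run_emitPiece (O := O) (ω := ω) hW G₃ hL (by omega) (by simp)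
    (by simpa using z₂)
  have G₄ := G₃.frame r₄.frame (by decide) (by decide) (by decide) (by decide)
  have r₅ := run_go (O := O) (ω := ω) hW h1
    (V_N ≔ 𝓿 V_n +ₑ 𝓬 2 +ₑ 𝓿 V_E ;; V_s ≔ 𝓿 V_n ;; V_t ≔ 𝓿 V_n +ₑ 𝓬 1) κ₄
    (by simp [G₄.n, G₄.E]; omega)
  set κ₅ := (V_N ≔ 𝓿 V_n +ₑ 𝓬 2 +ₑ 𝓿 V_E ;; V_s ≔ 𝓿 V_n ;; V_t ≔ 𝓿 V_n +ₑ 𝓬 1 : Prog).go ω κ₄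
    with hκ₅
  have N₅ : κ₅.v V_N = n + 2 + E := by simp [hκ₅, G₄.n, G₄.E]
  have s₅ : κ₅.v V_s = n := by simp [hκ₅, G₄.n]
  have t₅ : κ₅.v V_t = n + 1 := by simp [hκ₅, G₄.n]
  have e₅ := e₄.frame r₅.frame (by decide) (by decide) (by decide)
  have O₃ : (κ₂.setV V_M 0).m A_own = κ₁.m A_own := r₂.frame.m _ (by decide)
  rw [O₃] at e₅
  have M₅ : κ₅.v V_M ≤ 2 * E := by
    rw [e₅.len]
    exact length_flatMap_range_le fun i _ => length_pieceEdges_le i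
  have hval : κ₅.inst.Valid := by
    have hbd : ∀ p ∈ (List.range E).flatMap (pieceEdges n src adj (κ₁.m A_own)),
        p.1 < n + 2 + E ∧ p.2 < n + 2 + E ∧ p.1 ≠ p.2 ∧ s(p.1, p.2) ≠ s(n, n + 1) := by
      intro p hp
      obtain ⟨e, he, hp⟩ := List.mem_flatMap.1 hp
      rw [List.mem_range] at he
      have la := hL.adj_lt e he
      have ls := hL.src_lt e he
      have ln := hL.ne e he
      have hf : firstEntry src adj (κ₁.m A_own) e ≤ e := firstEntry_le e
      have c1 := ctr_cases n (κ₁.m A_own (adj e)) (adj e)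
      have c2 := ctr_cases n (κ₁.m A_own (adj e)) (src e)
      obtain ⟨h0, ⟨h2, h3, rfl⟩ | ⟨h2, h3, rfl⟩ | ⟨h2, rfl⟩⟩ := mem_pieceEdges.1 hp <;>
      · simp only [ne_eq, Sym2.eq_iff]
        omega
    refine e₅.valid (by omega) (by omega) (by omega) (fun p hp => ?_) (fun p hp => ?_)
      (pieceEdges_nodup hL) fun p hp => ?_
    · rw [N₅]; exact ⟨(hbd p hp).1, (hbd p hp).2.1⟩
    · exact (hbd p hp).2.2.1
    · rw [s₅, t₅]; exact (hbd p hp).2.2.2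
  obtain ⟨κ₆, r₆, f₆, Y, C, hcut⟩ := run_minCut (ω := ω) hW hO hval (by omega)
  have O₆ : κ₆.m A_own = κ₁.m A_own := by
    rw [r₆.frame.m _ (by decide), r₅.frame.m _ (by decide), r₄.frame.m _ (by decide), O₃]
  have hadj : ∀ u v, κ₅.inst.Adj u v ↔ pieceAdj n E src adj (κ₁.m A_own) u v ∨
      pieceAdj n E src adj (κ₁.m A_own) v u := fun u v => by
    rw [e₅.adj_iff, pieceEdges_adj hL]
  have hI : κ₅.inst.N = n + 2 + E := N₅
  refine ⟨κ₆, (r₁.seq (r₂.bound 20 (by decide) |>.seq (r₃.seq (r₄.seq (r₅.seq r₆))))).mono ?_,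
    ?_, Y, C, ?_⟩
  · simp only [Prog.cost, Expr.cost]
    rw [N₅]
    omega
  · have : κ₅.f = κ.f := by
      rw [r₅.flow (by decide), r₄.flow (by decide), r₃.flow (by decide), r₂.flow (by decide),
        r₁.flow (by decide)]
    rw [f₆, this, N₅]
    omega
  -- All names are below 2^ℓ, so after ℓ bits a label that belongs to a terminal is its name.
  have hTlt : ∀ x ∈ supp n (κ.m A_T), x % 2 ^ ℓ = x := fun x hx =>
    Nat.mod_eq_of_lt (lt_of_lt_of_le (mem_supp.1 hx).1 hn2)
  have hterm : ∀ x ∈ supp n (κ.m A_T), κ₁.m A_own x = x := by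
    intro x hx
    obtain ⟨g1, g2⟩ := hR.terminal x hx
    rw [hTlt x hx] at g2
    rw [o₁ x (mem_supp.1 hx).1, g2, if_pos ⟨g1, (mem_supp.1 hx)⟩]
  refine ⟨?_, ?_, ?_, ?_, ?_, ?_⟩
  · rw [O₆]; exact hterm
  · rw [O₆]
    intro u v huv hu hv
    obtain ⟨l1, l2⟩ := hL.nbr_lt huv
    rw [o₁ u l1] at hu ⊢
    rw [o₁ v l2] at hv ⊢
    split_ifs at hu hv ⊢ with c1 c2
    · exact hR.edge u v huv c1.1 c2.1
    · omega
    · omega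
    · rfl
  · intro v hv; exact hcut.mem_Y v (hI ▸ hv)
  · intro v hv; exact hcut.mem_C v (hI ▸ hv)
  · rw [O₆]
    intro x hx
    exact card_bdry_pieceSide_le hL s₅ t₅ hadj hcut.separates hx
  · rw [O₆]
    intro X x hX
    obtain ⟨X', g1, g2, g3, g4⟩ := hR.shrink X x hX
    refine (card_piece_le hL s₅ t₅ hadj hcut.separates hcut.min (X := X') (fun v hv => ?_)
      g2.mem).trans g3
    have hv' := g2.lt v hv
    obtain ⟨k1, k2⟩ := g4 v hv
    rw [hTlt x hX.mem_T] at k2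
    refine ⟨hv', ?_⟩
    rw [o₁ v hv', k2, if_pos ⟨k1, mem_supp.1 hX.mem_T⟩]

/-- A loop that adds one to the counter `f i` in each round with `P i`. -/
theorem run_count (hW : W ≤ 2 ^ w) (h1 : 1 < W) {x : ℕ} {e c f : Expr} {N B : ℕ} {κ : Cfg}
    (P : ℕ → Prop) [DecidablePred P] (g : ℕ → ℕ) (hN : N + B < W) (hB : ∀ z < n, κ.m A_cnt z ≤ B)
    (hb : ∀ τ, Frame [x] [A_cnt] κ τ → e.val τ = N ∧ e.Fits W τ)
    (hs : ∀ i τ, i < N → Frame [x] [A_cnt] κ τ → τ.v x = i →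
      c.Fits W τ ∧ (c.val τ ≠ 0 ↔ P i) ∧ (P i → f.Fits W τ ∧ f.val τ = g i ∧ g i < n)) :
    ∃ κ', Run w O ω (forLoop x e
        (.ite c (.store A_cnt f (.read A_cnt f +ₑ 𝓬 1)) .skip)) κ
        ((N + 1) * (c.cost + 2 * f.cost + e.cost + 20)) κ' ∧
      ∀ z < n, κ'.m A_cnt z = κ.m A_cnt z + ((Finset.range N).filter fun i => P i ∧ g i = z).card := by
  have hF' : ∀ τ, Frame (forLoop x e (.ite c (.store A_cnt f (.read A_cnt f +ₑ 𝓬 1)) .skip)).wv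
      (forLoop x e (.ite c (.store A_cnt f (.read A_cnt f +ₑ 𝓬 1)) .skip)).wa κ τ →
      Frame [x] [A_cnt] κ τ := fun τ h => h.mono (by simp [forLoop, Prog.wv])
        (by simp [forLoop, Prog.wa])
  have hcard : ∀ i z, ((Finset.range i).filter fun i => P i ∧ g i = z).card ≤ i := fun i z =>
    (Finset.card_filter_le _ _).trans (by simp)
  obtain ⟨κ₁, r₁, h, -⟩ := run_for_go (O := O) (ω := ω) hW h1 (x := x) (e := e)
    (body := .ite c (.store A_cnt f (.read A_cnt f +ₑ 𝓬 1)) .skip) (N := N) (κ := κ)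
    (fun i τ => ∀ z < n, τ.m A_cnt z = κ.m A_cnt z +
      ((Finset.range i).filter fun i => P i ∧ g i = z).card) (by omega) (by simp)
    (fun τ hF => hb τ (hF' τ hF)) (by simp [Prog.wv]) (fun i τ hi hI hF hv => by
      obtain ⟨f1, f2, f3⟩ := hs i τ hi (hF' τ hF) hv
      constructor
      · refine ⟨f1, fun hc => ?_, fun _ => trivial⟩
        obtain ⟨k1, k2, k3⟩ := f3 (f2.1 hc)
        refine ⟨k1, k1, h1, ?_⟩
        simp only [BinOp.Fits, Expr.val, k2]
        rw [hI _ k3]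
        have := hB _ k3
        have := hcard i (g i)
        omega
      · intro z hz
        have hI' := hI z hz
        rw [Finset.range_add_one, Finset.filter_insert]
        simp only [Prog.go, Cfg.setV_m]
        by_cases hP : P i
        · obtain ⟨k1, k2, k3⟩ := f3 hP
          rw [if_pos (f2.2 hP)]
          simp only [Cfg.setM_m, Expr.val, k2, BinOp.apply, true_and]
          by_cases hz : z = g i
          · rw [if_pos hz, if_pos ⟨hP, hz.symm⟩, Finset.card_insert_of_notMem (by simp), ← hz, hI']
            omega
          · rw [if_neg hz, if_neg (fun h => hz h.2.symm), hI']
        · rw [if_neg (fun h => hP (f2.1 h)), if_neg (fun h => hP h.1), hI'])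
  refine ⟨κ₁, r₁.mono (Nat.mul_le_mul_left _ ?_), h⟩
  simp only [Prog.cost, Expr.cost]
  omega

end

end RAM

/-! ## Reading off a cut -/

/-- The array describes a vertex cut: `1` for the smaller side, `2` for the separator. -/
structure CutArray (n : ℕ) (r : ℕ → ℕ → Prop) (o : ℕ → ℕ) : Prop where
  left : ∃ v < n, o v = 1
  right : ∃ v < n, o v ≠ 1 ∧ o v ≠ 2
  closed : ∀ u v, r u v → o u = 1 → o v = 1 ∨ o v = 2
  card_le : ((Finset.range n).filter fun v => o v = 1).card ≤
    ((Finset.range n).filter fun v => o v ≠ 1 ∧ o v ≠ 2).card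

def sepSize (n : ℕ) (o : ℕ → ℕ) : ℕ := ((Finset.range n).filter fun v => o v = 2).card

namespace RAM

/-- The cut vertices of a piece are counted in two passes: region vertices other than the centre,
and copies of outer boundary vertices. -/
def countPieces : Prog :=
  forLoop V_v (𝓿 V_n) (.store A_cnt (𝓿 V_v) (𝓬 0)) ;;
  forLoop V_v (𝓿 V_n) (.ite
    ((.read A_own (𝓿 V_v) <ₑ 𝓿 V_n) *ₑ ((.read A_own (𝓿 V_v) =ₑ 𝓿 V_v) =ₑ 𝓬 0) *ₑ
      (𝓬 0 <ₑ .read A_mark (𝓬 2 *ₑ 𝓿 V_v)) *ₑ (.read A_mark (𝓬 2 *ₑ 𝓿 V_v +ₑ 𝓬 1) =ₑ 𝓬 0))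
    (.store A_cnt (.read A_own (𝓿 V_v)) (.read A_cnt (.read A_own (𝓿 V_v)) +ₑ 𝓬 1)) .skip) ;;
  forLoop V_e (𝓿 V_E) (.ite
    ((.read A_own (.read A_adj (𝓿 V_e)) <ₑ 𝓿 V_n) *ₑ
      (𝓬 0 <ₑ .read A_mark (𝓬 2 *ₑ (𝓿 V_n +ₑ 𝓬 2 +ₑ 𝓿 V_e))) *ₑ
      (.read A_mark (𝓬 2 *ₑ (𝓿 V_n +ₑ 𝓬 2 +ₑ 𝓿 V_e) +ₑ 𝓬 1) =ₑ 𝓬 0))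
    (.store A_cnt (.read A_own (.read A_adj (𝓿 V_e)))
      (.read A_cnt (.read A_own (.read A_adj (𝓿 V_e))) +ₑ 𝓬 1)) .skip)

/-- The value n of `V_best` stands for "no piece found". -/
def choosePiece : Prog :=
  V_best ≔ 𝓿 V_n ;;
  forLoop V_v (𝓿 V_n) (.ite (.read A_T (𝓿 V_v))
    (.ite (.read A_cnt (𝓿 V_v) <ₑ 𝓿 V_k) (V_best ≔ 𝓿 V_v) .skip) .skip)

/-- Mark the chosen side by `1` and its neighbours by `2`. -/
def markSide : Prog :=
  forLoop V_v (𝓿 V_n) (.store A_z (𝓿 V_v) ((.read A_own (𝓿 V_v) =ₑ 𝓿 V_best) *ₑ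
    (𝓬 0 <ₑ ((𝓿 V_v =ₑ 𝓿 V_best) +ₑ (𝓬 0 <ₑ .read A_mark (𝓬 2 *ₑ 𝓿 V_v +ₑ 𝓬 1)))))) ;;
  forLoop V_e (𝓿 V_E) (.ite (.read A_z (.read A_src (𝓿 V_e)) =ₑ 𝓬 1)
    (.ite (.read A_z (.read A_adj (𝓿 V_e)) =ₑ 𝓬 1) .skip
      (.store A_z (.read A_adj (𝓿 V_e)) (𝓬 2))) .skip)

def countSides : Prog :=
  V_cL ≔ 𝓬 0 ;; V_cR ≔ 𝓬 0 ;;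
  forLoop V_v (𝓿 V_n) (.ite (.read A_z (𝓿 V_v) =ₑ 𝓬 1) (V_cL ≔ 𝓿 V_cL +ₑ 𝓬 1)
    (.ite (.read A_z (𝓿 V_v) =ₑ 𝓬 2) .skip (V_cR ≔ 𝓿 V_cR +ₑ 𝓬 1)))

/-- Copy the marked cut to the output, with the smaller side first. -/
def copyOut : Prog :=
  countSides ;; .ite (𝓿 V_cR)
    (.ite (𝓿 V_cR <ₑ 𝓿 V_cL)
      (forLoop V_v (𝓿 V_n) (.store A_out (𝓿 V_v)
        ((𝓬 1 -ₑ .read A_z (𝓿 V_v)) +ₑ (.read A_z (𝓿 V_v) /ₑ 𝓬 2) *ₑ 𝓬 2)))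
      (forLoop V_v (𝓿 V_n) (.store A_out (𝓿 V_v) (.read A_z (𝓿 V_v)))))
    .skip

def extractCut : Prog :=
  countPieces ;; choosePiece ;; .ite (𝓿 V_best <ₑ 𝓿 V_n) (markSide ;; copyOut) .skip

section

variable {w W : ℕ} {O : FlowOracle} {ω : ℕ → Bool} {n E : ℕ} {src adj : ℕ → ℕ}

theorem run_countPieces (hW : W ≤ 2 ^ w) {κ : Cfg} (hG : HasGraph n E src adj κ)
    {T Y C : Finset ℕ} (hP : PiecesCut n E src adj T κ Y C)
    (hb : 20 * (n + E + 1) < W) :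
    ∃ κ', Run w O ω countPieces κ (200 * (n + E + 1)) κ' ∧
      ∀ x < n, κ'.m A_cnt x = (C ∩ piece n E adj (κ.m A_own) x).card := by
  classical
  have h1 : 1 < W := by omega
  obtain ⟨κ₁, r₁, z₁, -⟩ := run_fill (w := w) (W := W) (O := O) (ω := ω) hW h1 (x := V_v)
    (a := A_cnt) (e := 𝓿 V_n) (r := 𝓬 0) (κ := κ) (N := n) (fun _ => 0) (by omega)
    (fun τ hF => by simp [hF.v V_n (by decide), hG.n]) (fun i τ _ _ _ _ => by simp; omega)
  have G₁ := hG.frame r₁.frame (by decide) (by decide) (by decide) (by decide)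
  have O₁ : κ₁.m A_own = κ.m A_own := r₁.frame.m _ (by decide)
  have m₁ : κ₁.m A_mark = κ.m A_mark := r₁.frame.m _ (by decide)
  have bool3 : ∀ (a b c : Prop) [Decidable a] [Decidable b] [Decidable c],
      ((if a then 1 else 0) * (if b then 1 else 0) < W) ∧
      ((if a then 1 else 0) * (if b then 1 else 0) * (if c then 1 else 0) < W) := by
    intro a b c _ _ _; split_ifs <;> simp <;> omega
  have bool4 : ∀ (a b c d : Prop) [Decidable a] [Decidable b] [Decidable c] [Decidable d],
      ((if a then 1 else 0) * (if b then 1 else 0) * (if c then 1 else 0) *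
        (if d then 1 else 0) < W) := by
    intro a b c d _ _ _ _; split_ifs <;> simp <;> omega
  obtain ⟨κ₂, r₂, z₂⟩ := run_count (O := O) (ω := ω) (n := n) hW h1 (x := V_v) (e := 𝓿 V_n)
    (c := ((.read A_own (𝓿 V_v) <ₑ 𝓿 V_n) *ₑ ((.read A_own (𝓿 V_v) =ₑ 𝓿 V_v) =ₑ 𝓬 0) *ₑ
      (𝓬 0 <ₑ .read A_mark (𝓬 2 *ₑ 𝓿 V_v)) *ₑ (.read A_mark (𝓬 2 *ₑ 𝓿 V_v +ₑ 𝓬 1) =ₑ 𝓬 0)))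
    (f := .read A_own (𝓿 V_v)) (N := n) (B := 0) (κ := κ₁)
    (fun v => κ.m A_own v < n ∧ κ.m A_own v ≠ v ∧ v ∈ C) (κ.m A_own) (by omega)
    (fun z hz => by rw [z₁ z hz]) (fun τ hF => by simp [hF.v V_n (by decide), G₁.n])
    (fun i τ hi hF hv => by
      have n₁ : τ.v V_n = n := (hF.v _ (by decide)).trans G₁.n
      have O₂ : τ.m A_own = κ.m A_own := (hF.m _ (by decide)).trans O₁
      have m₂ : τ.m A_mark = κ.m A_mark := (hF.m _ (by decide)).trans m₁
      simp only [Expr.Fits, BinOp.Fits, Expr.val, BinOp.apply, hv, n₁, O₂, m₂]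
      refine ⟨⟨⟨⟨⟨trivial, trivial, trivial⟩, ⟨⟨trivial, trivial, trivial⟩, by omega, trivial⟩,
        (bool3 _ _ True).1⟩, ⟨by omega, ⟨by omega, trivial, by omega⟩, trivial⟩, (bool3 _ _ _).2⟩,
        ⟨⟨⟨by omega, trivial, by omega⟩, h1, by omega⟩, by omega, trivial⟩, bool4 _ _ _ _⟩, ?_,
        fun h => ⟨trivial, trivial, h.1⟩⟩
      rw [← hP.mem_C i (by omega)]
      by_cases c1 : κ.m A_own i < n <;> by_cases c2 : κ.m A_own i = i <;>
        by_cases c3 : κ.m A_mark (2 * i) = 0 <;> by_cases c4 : κ.m A_mark (2 * i + 1) = 0 <;>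
        simp [c1, c2, c3, c4, Nat.pos_iff_ne_zero])
  have F₂ : Frame [V_v] [A_cnt] κ₁ κ₂ := r₂.frame.mono (by decide) (by decide)
  have G₂ := G₁.frame F₂ (by decide) (by decide) (by decide) (by decide)
  have O₂ : κ₂.m A_own = κ.m A_own := (F₂.m _ (by decide)).trans O₁
  have m₂ : κ₂.m A_mark = κ.m A_mark := (F₂.m _ (by decide)).trans m₁
  have z₂' : ∀ x < n, κ₂.m A_cnt x = ((Finset.range n).filter fun i =>
      (κ.m A_own i < n ∧ κ.m A_own i ≠ i ∧ i ∈ C) ∧ κ.m A_own i = x).card := by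
    intro x hx; rw [z₂ x hx, z₁ x hx, zero_add]
  obtain ⟨κ₃, r₃, z₃⟩ := run_count (O := O) (ω := ω) (n := n) hW h1 (x := V_e) (e := 𝓿 V_E)
    (c := ((.read A_own (.read A_adj (𝓿 V_e)) <ₑ 𝓿 V_n) *ₑ
      (𝓬 0 <ₑ .read A_mark (𝓬 2 *ₑ (𝓿 V_n +ₑ 𝓬 2 +ₑ 𝓿 V_e))) *ₑ
      (.read A_mark (𝓬 2 *ₑ (𝓿 V_n +ₑ 𝓬 2 +ₑ 𝓿 V_e) +ₑ 𝓬 1) =ₑ 𝓬 0)))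
    (f := .read A_own (.read A_adj (𝓿 V_e))) (N := E) (B := n) (κ := κ₂)
    (fun e => κ.m A_own (adj e) < n ∧ n + 2 + e ∈ C) (fun e => κ.m A_own (adj e)) (by omega)
    (fun z hz => by rw [z₂' z hz]; exact (Finset.card_filter_le _ _).trans (by simp))
    (fun τ hF => by simp [hF.v V_E (by decide), G₂.E])
    (fun i τ hi hF hv => by
      have n₁ : τ.v V_n = n := (hF.v _ (by decide)).trans G₂.n
      have a₁ : τ.m A_adj = adj := (hF.m _ (by decide)).trans G₂.adj
      have O₃ : τ.m A_own = κ.m A_own := (hF.m _ (by decide)).trans O₂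
      have m₃ : τ.m A_mark = κ.m A_mark := (hF.m _ (by decide)).trans m₂
      simp only [Expr.Fits, BinOp.Fits, Expr.val, BinOp.apply, hv, n₁, O₃, m₃, a₁]
      refine ⟨⟨⟨⟨trivial, trivial, trivial⟩, ⟨by omega, ⟨by omega,
        ⟨⟨trivial, by omega, by omega⟩, trivial, by omega⟩, by omega⟩, trivial⟩,
        (bool3 _ _ True).1⟩, ⟨⟨⟨by omega,
        ⟨⟨trivial, by omega, by omega⟩, trivial, by omega⟩, by omega⟩, by omega, by omega⟩,
          by omega, trivial⟩, (bool3 _ _ _).2⟩, ?_, fun h => ⟨trivial, trivial, h.1⟩⟩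
      rw [← hP.mem_C (n + 2 + i) (by omega)]
      by_cases c1 : κ.m A_own (adj i) < n <;>
        by_cases c3 : κ.m A_mark (2 * (n + 2 + i)) = 0 <;>
        by_cases c4 : κ.m A_mark (2 * (n + 2 + i) + 1) = 0 <;>
        simp [c1, c3, c4, Nat.pos_iff_ne_zero])
  refine ⟨κ₃, ((r₁.bound 20 (by decide)).seq ((r₂.bound 60 (by decide)).seq
    (r₃.bound 60 (by decide)))).mono (by omega), fun x hx => ?_⟩
  rw [z₃ x hx, z₂' x hx]
  have e1 : C ∩ piece n E adj (κ.m A_own) x = ((Finset.range n).filter fun i =>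
      (κ.m A_own i < n ∧ κ.m A_own i ≠ i ∧ i ∈ C) ∧ κ.m A_own i = x) ∪
      ((Finset.range E).filter fun e => (κ.m A_own (adj e) < n ∧ n + 2 + e ∈ C) ∧
        κ.m A_own (adj e) = x).image (n + 2 + ·) := by
    ext v
    simp only [Finset.mem_inter, mem_piece, Finset.mem_union, Finset.mem_filter, Finset.mem_range,
      Finset.mem_image]
    constructor
    · rintro ⟨hC, ⟨h2, h3, h4⟩ | ⟨e, h2, h3, rfl⟩⟩
      · exact Or.inl ⟨h2, ⟨by omega, by omega, hC⟩, h3⟩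
      · exact Or.inr ⟨e, ⟨h2, ⟨by omega, hC⟩, h3⟩, rfl⟩
    · rintro (⟨h2, ⟨h3, h4, h5⟩, h6⟩ | ⟨e, ⟨h2, ⟨h3, h4⟩, h5⟩, rfl⟩)
      · exact ⟨h5, Or.inl ⟨h2, h6, by omega⟩⟩
      · exact ⟨h4, Or.inr ⟨e, h2, h5, rfl⟩⟩
  rw [e1, Finset.card_union_of_disjoint, Finset.card_image_of_injective]
  · exact fun a b hab => by simpa using hab
  · rw [Finset.disjoint_left]
    intro v hv hv'
    simp only [Finset.mem_filter, Finset.mem_range, Finset.mem_image] at hv hv'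
    obtain ⟨e, -, rfl⟩ := hv'
    omega

theorem run_choosePiece (hW : W ≤ 2 ^ w) {κ : Cfg} (hn : κ.v V_n = n) (hb : n + 1 < W) :
    ∃ κ', Run w O ω choosePiece κ (100 * (n + 1)) κ' ∧
      ((κ'.v V_best = n ∧ ∀ v < n, κ.m A_T v ≠ 0 → κ.v V_k ≤ κ.m A_cnt v) ∨
        (κ'.v V_best < n ∧ κ.m A_T (κ'.v V_best) ≠ 0 ∧ κ.m A_cnt (κ'.v V_best) < κ.v V_k)) := by
  by_cases h1 : 1 < W
  swap
  · omega
  have r₁ : Run w O ω (V_best ≔ 𝓿 V_n) κ 2 (κ.setV V_best n) := by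
    have := run_go (O := O) (ω := ω) hW h1 (V_best ≔ 𝓿 V_n) κ trivial
    simpa [hn, Prog.cost, Expr.cost] using this
  obtain ⟨κ₂, r₂, h, -⟩ := run_for_go (O := O) (ω := ω) hW h1 (x := V_v) (e := 𝓿 V_n)
    (body := .ite (.read A_T (𝓿 V_v))
      (.ite (.read A_cnt (𝓿 V_v) <ₑ 𝓿 V_k) (V_best ≔ 𝓿 V_v) .skip) .skip)
    (N := n) (κ := κ.setV V_best n)
    (fun i τ => (τ.v V_best = n ∧ ∀ v < i, κ.m A_T v ≠ 0 → κ.v V_k ≤ κ.m A_cnt v) ∨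
        (τ.v V_best < n ∧ κ.m A_T (τ.v V_best) ≠ 0 ∧ κ.m A_cnt (τ.v V_best) < κ.v V_k)) (by omega)
    (by simp) (fun τ hF => by simp [hF.v V_n (by decide), hn]) (by decide)
    (fun i τ hi hI hF hv => by
      have T₁ : τ.m A_T = κ.m A_T := hF.m _ (by decide)
      have c₁ : τ.m A_cnt = κ.m A_cnt := hF.m _ (by decide)
      have k₁ : τ.v V_k = κ.v V_k := hF.v _ (by decide)
      refine ⟨⟨trivial, fun _ => ⟨⟨trivial, trivial, trivial⟩, fun _ => trivial, fun _ => trivial⟩,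
        fun _ => trivial⟩, ?_⟩
      simp only [Prog.go, Expr.val, BinOp.apply, hv, T₁, c₁, k₁]
      by_cases c1 : κ.m A_T i = 0
      · simp only [c1, ne_eq, not_true_eq_false, if_false, Cfg.setV_v]
        refine hI.imp (fun h => ⟨h.1, fun v hvi hT => ?_⟩) id
        by_cases hvi' : v = i
        · exact absurd (hvi' ▸ c1) hT
        · exact h.2 v (by omega) hT
      · by_cases c2 : κ.m A_cnt i < κ.v V_k
        · right
          simp [c1, c2, hi]
        · simp only [c1, c2, ne_eq, not_true_eq_false, not_false_eq_true, if_false, if_true,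
            Cfg.setV_v]
          refine hI.imp (fun h => ⟨h.1, fun v hvi hT => ?_⟩) id
          by_cases hvi' : v = i
          · subst hvi'; omega
          · exact h.2 v (by omega) hT)
  exact ⟨κ₂, (r₁.seq (r₂.bound 50 (by decide))).mono (by omega), h⟩

/-- Entries equal to 1 are never overwritten and an entry 2 is never taken for the side, so the
order of the edges does not matter. -/
theorem run_markSide (hW : W ≤ 2 ^ w) {κ : Cfg} (hG : HasGraph n E src adj κ)
    (hL : EdgeList n E src adj) {X : Finset ℕ}
    (hX : ∀ v < n, v ∈ X ↔ κ.m A_own v = κ.v V_best ∧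
      (v = κ.v V_best ∨ κ.m A_mark (2 * v + 1) ≠ 0))
    (hb : 20 * (n + E + 1) < W) :
    ∃ κ', Run w O ω markSide κ (200 * (n + E + 1)) κ' ∧
      ∀ v < n, (κ'.m A_z v = 1 ∧ v ∈ X) ∨ (κ'.m A_z v = 2 ∧ v ∈ bdry n (Nbr E src adj) X) ∨
        (κ'.m A_z v = 0 ∧ v ∉ X ∧ v ∉ bdry n (Nbr E src adj) X) := by
  classical
  have h1 : 1 < W := by omega
  obtain ⟨κ₁, r₁, z₁, -⟩ := run_fill (w := w) (W := W) (O := O) (ω := ω) hW h1 (x := V_v)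
    (a := A_z) (e := 𝓿 V_n) (r := ((.read A_own (𝓿 V_v) =ₑ 𝓿 V_best) *ₑ
    (𝓬 0 <ₑ ((𝓿 V_v =ₑ 𝓿 V_best) +ₑ (𝓬 0 <ₑ .read A_mark (𝓬 2 *ₑ 𝓿 V_v +ₑ 𝓬 1))))))
    (κ := κ) (N := n) (fun v => if v ∈ X then 1 else 0) (by omega)
    (fun τ hF => by simp [hF.v V_n (by decide), hG.n]) (fun i τ hi hF hv _ => by
      have O₁ : τ.m A_own = κ.m A_own := hF.m _ (by decide)
      have m₁ : τ.m A_mark = κ.m A_mark := hF.m _ (by decide)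
      have b₁ : τ.v V_best = κ.v V_best := hF.v _ (by decide)
      have hXi := hX i hi
      simp only [Expr.Fits, BinOp.Fits, Expr.val, BinOp.apply, hv, O₁, m₁, b₁, hXi]
      by_cases c1 : κ.m A_own i = κ.v V_best <;> by_cases c2 : i = κ.v V_best <;>
        by_cases c3 : κ.m A_mark (2 * i + 1) = 0 <;> simp [c1, c2, c3, Nat.pos_iff_ne_zero] <;>
        (try split_ifs) <;> omega)
  have G₁ := hG.frame r₁.frame (by decide) (by decide) (by decide) (by decide)
  obtain ⟨κ₂, r₂, h, -⟩ := run_for_go (O := O) (ω := ω) hW h1 (x := V_e) (e := 𝓿 V_E)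
    (body := .ite (.read A_z (.read A_src (𝓿 V_e)) =ₑ 𝓬 1)
      (.ite (.read A_z (.read A_adj (𝓿 V_e)) =ₑ 𝓬 1) .skip
        (.store A_z (.read A_adj (𝓿 V_e)) (𝓬 2))) .skip)
    (N := E) (κ := κ₁)
    (fun i τ => ∀ v < n, τ.m A_z v = if v ∈ X then 1 else
      if ∃ e < i, src e ∈ X ∧ adj e = v then 2 else 0) (by omega)
    (by simpa using z₁) (fun τ hF => by simp [hF.v V_E (by decide), G₁.E]) (by decide)
    (fun i τ hi hI hF hv => by
      have G₂ := G₁.frame hF (by decide) (by decide) (by decide) (by decide)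
      have la := hL.adj_lt i hi
      have ls := hL.src_lt i hi
      refine ⟨⟨⟨trivial, h1, trivial⟩, fun _ => ⟨⟨trivial, h1, trivial⟩, fun _ => trivial,
        fun _ => ⟨trivial, by simp only [Expr.Fits]; omega⟩⟩, fun _ => trivial⟩, fun v hvn => ?_⟩
      have is := hI _ ls
      have ia := hI _ la
      have iv := hI v hvn
      have e1 : τ.m A_z (src i) = 1 ↔ src i ∈ X := by rw [is]; split_ifs <;> simp_all
      have e2 : τ.m A_z (adj i) = 1 ↔ adj i ∈ X := by rw [ia]; split_ifs <;> simp_all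
      simp only [Prog.go, Expr.val, BinOp.apply, hv, G₂.src, G₂.adj, Cfg.setV_m, e1, e2]
      simp only [Nat.lt_succ_iff_lt_or_eq, or_and_right, exists_or, exists_eq_left]
      by_cases c1 : src i ∈ X
      · by_cases c2 : adj i ∈ X
        · simp only [c1, c2, if_true, ne_eq, one_ne_zero, not_false_eq_true, true_and, iv]
          by_cases c3 : v ∈ X
          · simp [c3]
          · have : adj i ≠ v := fun h => c3 (h ▸ c2)
            simp [c3, this]
        · by_cases c3 : v = adj i
          · subst c3
            simp [c1, c2]
          · simp [c1, c2, c3, Ne.symm c3, iv]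
      · simp [c1, iv])
  refine ⟨κ₂, ((r₁.bound 60 (by decide)).seq (r₂.bound 60 (by decide))).mono (by omega),
    fun v hv => ?_⟩
  have hbd : v ∈ bdry n (Nbr E src adj) X ↔ v ∉ X ∧ ∃ e < E, src e ∈ X ∧ adj e = v := by
    rw [mem_bdry]
    constructor
    · rintro ⟨-, h2, u, hu, e, he, rfl, rfl⟩
      exact ⟨h2, e, he, hu, rfl⟩
    · rintro ⟨h2, e, he, hu, rfl⟩
      exact ⟨hv, h2, _, hu, e, he, rfl, rfl⟩
  rw [h v hv, hbd]
  by_cases c1 : v ∈ X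
  · simp [c1]
  · by_cases c2 : ∃ e < E, src e ∈ X ∧ adj e = v <;> simp [c1, c2]

theorem run_countSides (hW : W ≤ 2 ^ w) {κ : Cfg} (hn : κ.v V_n = n) (hb : n + 3 < W) :
    ∃ κ', Run w O ω countSides κ (100 * (n + 1)) κ' ∧
      κ'.v V_cL = ((Finset.range n).filter fun v => κ.m A_z v = 1).card ∧
      κ'.v V_cR = ((Finset.range n).filter fun v => κ.m A_z v ≠ 1 ∧ κ.m A_z v ≠ 2).card := by
  have h1 : 1 < W := by omega
  have r₁ : Run w O ω (V_cL ≔ 𝓬 0) κ 2 (κ.setV V_cL 0) := run_go hW h1 _ _ (by simp; omega)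
  have r₂ : Run w O ω (V_cR ≔ 𝓬 0) (κ.setV V_cL 0) 2 ((κ.setV V_cL 0).setV V_cR 0) :=
    run_go hW h1 _ _ (by simp; omega)
  obtain ⟨κ₃, r₃, ⟨h3, h4⟩, -⟩ := run_for_go (O := O) (ω := ω) hW h1 (x := V_v) (e := 𝓿 V_n)
    (body := .ite (.read A_z (𝓿 V_v) =ₑ 𝓬 1) (V_cL ≔ 𝓿 V_cL +ₑ 𝓬 1)
    (.ite (.read A_z (𝓿 V_v) =ₑ 𝓬 2) .skip (V_cR ≔ 𝓿 V_cR +ₑ 𝓬 1)))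
    (N := n) (κ := (κ.setV V_cL 0).setV V_cR 0)
    (fun i τ => τ.v V_cL = ((Finset.range i).filter fun v => κ.m A_z v = 1).card ∧
      τ.v V_cR = ((Finset.range i).filter fun v => κ.m A_z v ≠ 1 ∧ κ.m A_z v ≠ 2).card) (by omega)
    (by simp) (fun τ hF => by simp [hF.v V_n (by decide), hn]) (by decide)
    (fun i τ hi hI hF hv => by
      have z₁ : τ.m A_z = κ.m A_z := hF.m _ (by decide)
      obtain ⟨i1, i2⟩ := hI
      have b1 : τ.v V_cL ≤ i := by rw [i1]; exact (Finset.card_filter_le _ _).trans (by simp)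
      have b2 : τ.v V_cR ≤ i := by rw [i2]; exact (Finset.card_filter_le _ _).trans (by simp)
      refine ⟨⟨⟨trivial, h1, trivial⟩, fun _ => ⟨trivial, h1, ?_⟩,
        fun _ => ⟨⟨trivial, ?_, trivial⟩, fun _ => trivial, fun _ => ⟨trivial, h1, ?_⟩⟩⟩, ?_⟩
      · simp only [BinOp.Fits, Expr.val]; omega
      · simp only [Expr.Fits]; omega
      · simp only [BinOp.Fits, Expr.val]; omega
      · simp only [Prog.go, Expr.val, BinOp.apply, hv, z₁, Finset.range_add_one,
          Finset.filter_insert]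
        by_cases c1 : κ.m A_z i = 1
        · simp [c1, i1, i2]
        · by_cases c2 : κ.m A_z i = 2 <;> simp [c1, c2, i1, i2])
  exact ⟨κ₃, (r₁.seq (r₂.seq (r₃.bound 50 (by decide)))).mono (by omega), h3, h4⟩

/-- If the side and its boundary exhaust the graph, there is no other side and the old output is
kept. Otherwise the two sides are named by size; an exchange keeps the separator, since adjacency is
symmetric. -/
theorem run_copyOut (hW : W ≤ 2 ^ w) {κ : Cfg} (hG : HasGraph n E src adj κ)
    (hL : EdgeList n E src adj) {X : Finset ℕ} (hXn : ∀ v ∈ X, v < n) (hX0 : X.Nonempty)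
    (hz : ∀ v < n, (κ.m A_z v = 1 ∧ v ∈ X) ∨ (κ.m A_z v = 2 ∧ v ∈ bdry n (Nbr E src adj) X) ∨
        (κ.m A_z v = 0 ∧ v ∉ X ∧ v ∉ bdry n (Nbr E src adj) X))
    (hb : n + 3 < W) :
    ∃ κ', Run w O ω copyOut κ (300 * (n + 1)) κ' ∧
      ((κ'.m A_out = κ.m A_out ∧ ∀ y < n, y ∈ X ∨ y ∈ bdry n (Nbr E src adj) X) ∨
        (CutArray n (Nbr E src adj) (κ'.m A_out) ∧
          sepSize n (κ'.m A_out) = (bdry n (Nbr E src adj) X).card)) := by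
  classical
  have h1 : 1 < W := by omega
  obtain ⟨κ₁, r₁, hl, hr⟩ := run_countSides (O := O) (ω := ω) hW hG.n hb
  have G₁ := hG.frame r₁.frame (by decide) (by decide) (by decide) (by decide)
  have z₁ : κ₁.m A_z = κ.m A_z := r₁.frame.m _ (by decide)
  have o₁ : κ₁.m A_out = κ.m A_out := r₁.frame.m _ (by decide)
  have hdisj : ∀ v ∈ X, v ∉ bdry n (Nbr E src adj) X := fun v hv h => (mem_bdry.1 h).2.1 hv
  have hS : (Finset.range n).filter (fun v => κ.m A_z v = 2) = bdry n (Nbr E src adj) X := by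
    ext v
    simp only [Finset.mem_filter, Finset.mem_range]
    constructor
    · rintro ⟨hv, h2⟩
      rcases hz v hv with h | h | h
      · omega
      · exact h.2
      · omega
    · intro h
      have hv := (mem_bdry.1 h).1
      refine ⟨hv, ?_⟩
      rcases hz v hv with h' | h' | h'
      · exact absurd h (hdisj v h'.2)
      · exact h'.1
      · exact absurd h h'.2.2
  obtain ⟨x, hx⟩ := hX0
  have hx1 : κ.m A_z x = 1 := by
    rcases hz x (hXn x hx) with h | h | h
    · exact h.1
    · exact absurd h.2 (hdisj x hx)
    · exact absurd hx h.2.1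
  have hclosed : ∀ u v, Nbr E src adj u v → κ.m A_z u = 1 → κ.m A_z v = 1 ∨ κ.m A_z v = 2 := by
    intro u v huv hu
    obtain ⟨l1, l2⟩ := hL.nbr_lt huv
    have huX : u ∈ X := by rcases hz u l1 with h | h | h <;> first | exact h.2 | omega
    by_cases hvX : v ∈ X
    · rcases hz v l2 with h | h | h
      · exact Or.inl h.1
      · exact Or.inr h.1
      · exact absurd hvX h.2.1
    · have : v ∈ bdry n (Nbr E src adj) X := mem_bdry.2 ⟨l2, hvX, u, huX, huv⟩
      rcases hz v l2 with h | h | h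
      · exact Or.inl h.1
      · exact Or.inr h.1
      · exact absurd this h.2.2
  by_cases hR : κ₁.v V_cR = 0
  · refine ⟨κ₁, (r₁.seq (run_ite (t := 0) (e := 𝓿 V_cR) hW h1 trivial (fun h => absurd hR h)
      fun _ => run_skip κ₁)).mono (by simp only [Expr.cost]; omega), Or.inl ⟨o₁, fun y hy => ?_⟩⟩
    rw [hr, Finset.card_eq_zero, Finset.filter_eq_empty_iff] at hR
    rcases hz y hy with h | h | h
    · exact Or.inl h.2
    · exact Or.inr h.2
    · exact absurd ⟨by omega, by omega⟩ (hR (by simpa using hy))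
  have hyR : ∃ y < n, κ.m A_z y ≠ 1 ∧ κ.m A_z y ≠ 2 := by
    rw [hr] at hR
    obtain ⟨y, hy⟩ := Finset.card_pos.1 (Nat.pos_of_ne_zero hR)
    simp only [Finset.mem_filter, Finset.mem_range] at hy
    exact ⟨y, hy⟩
  by_cases hlr : κ₁.v V_cR < κ₁.v V_cL
  · obtain ⟨κ₂, r₂, z₂, -⟩ := run_fill (w := w) (W := W) (O := O) (ω := ω) hW h1 (x := V_v)
      (a := A_out) (e := 𝓿 V_n)
      -- With truncated subtraction and integer division this exchanges 0 and 1 and fixes 2.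
      (r := ((𝓬 1 -ₑ .read A_z (𝓿 V_v)) +ₑ (.read A_z (𝓿 V_v) /ₑ 𝓬 2) *ₑ 𝓬 2)) (κ := κ₁) (N := n)
      (fun v => if κ.m A_z v = 1 then 0 else if κ.m A_z v = 2 then 2 else 1) (by omega)
      (fun τ hF => by simp [hF.v V_n (by decide), G₁.n]) (fun i τ hi hF hv _ => by
        have z₂ : τ.m A_z = κ.m A_z := (hF.m _ (by decide)).trans z₁
        simp only [Expr.Fits, BinOp.Fits, Expr.val, BinOp.apply, hv, z₂]
        rcases hz i hi with h | h | h <;> simp [h.1] <;> omega)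
    refine ⟨κ₂, (r₁.seq (run_ite (e := 𝓿 V_cR) hW h1 trivial
      (fun _ => run_ite (e := 𝓿 V_cR <ₑ 𝓿 V_cL) hW h1 ⟨trivial, trivial, trivial⟩
      (fun _ => r₂.bound 50 (by decide)) fun h => ?_) fun h => absurd h hR)).mono
      (by simp only [Expr.cost]; omega), Or.inr ⟨⟨?_, ?_, ?_, ?_⟩, ?_⟩⟩
    · simp [hlr] at h
    · obtain ⟨y, hy, h2, h3⟩ := hyR
      exact ⟨y, hy, by rw [z₂ y hy, if_neg h2, if_neg h3]⟩
    · exact ⟨x, hXn x hx, by rw [z₂ x (hXn x hx), if_pos hx1]; simp⟩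
    · intro u v huv hu
      obtain ⟨l1, l2⟩ := hL.nbr_lt huv
      have := hclosed v u (hL.nbr_symm huv)
      rw [z₂ u l1] at hu
      rw [z₂ v l2]
      split_ifs at hu ⊢ <;> simp_all
    · rw [hl, hr] at hlr
      refine le_trans (le_of_eq ?_) (hlr.le.trans (le_of_eq ?_))
      · congr 1
        ext v
        simp only [Finset.mem_filter, Finset.mem_range]
        refine and_congr_right fun hv => ?_
        rw [z₂ v hv]
        split_ifs <;> simp_all
      · congr 1
        ext v
        simp only [Finset.mem_filter, Finset.mem_range]
        refine and_congr_right fun hv => ?_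
        rw [z₂ v hv]
        split_ifs <;> simp_all
    · rw [sepSize, ← hS]
      congr 1
      ext v
      simp only [Finset.mem_filter, Finset.mem_range]
      refine and_congr_right fun hv => ?_
      rw [z₂ v hv]
      split_ifs <;> simp_all
  · obtain ⟨κ₂, r₂, z₂, -⟩ := run_fill (w := w) (W := W) (O := O) (ω := ω) hW h1 (x := V_v)
      (a := A_out) (e := 𝓿 V_n) (r := .read A_z (𝓿 V_v)) (κ := κ₁) (N := n)
      (κ.m A_z) (by omega)
      (fun τ hF => by simp [hF.v V_n (by decide), G₁.n]) (fun i τ hi hF hv _ => by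
        have z₂ : τ.m A_z = κ.m A_z := (hF.m _ (by decide)).trans z₁
        simp [hv, z₂])
    have hf : ∀ (P : ℕ → Prop) [DecidablePred P], (Finset.range n).filter (fun v => P (κ₂.m A_out v)) =
        (Finset.range n).filter (fun v => P (κ.m A_z v)) := by
      intro P _
      ext v
      simp only [Finset.mem_filter, Finset.mem_range]
      exact and_congr_right fun hv => by rw [z₂ v hv]
    refine ⟨κ₂, (r₁.seq (run_ite (e := 𝓿 V_cR) hW h1 trivial
      (fun _ => run_ite (e := 𝓿 V_cR <ₑ 𝓿 V_cL) hW h1 ⟨trivial, trivial, trivial⟩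
      (fun h => ?_) fun _ => r₂.bound 50 (by decide)) fun h => absurd h hR)).mono
      (by simp only [Expr.cost]; omega), Or.inr ⟨⟨?_, ?_, ?_, ?_⟩, ?_⟩⟩
    · simp [hlr] at h
    · exact ⟨x, hXn x hx, by rw [z₂ x (hXn x hx), hx1]⟩
    · obtain ⟨y, hy, h⟩ := hyR
      exact ⟨y, hy, by rw [z₂ y hy]; exact h⟩
    · intro u v huv
      obtain ⟨l1, l2⟩ := hL.nbr_lt huv
      rw [z₂ u l1, z₂ v l2]
      exact hclosed u v huv
    · rw [hl, hr] at hlr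
      rw [hf (· = 1), hf fun t => t ≠ 1 ∧ t ≠ 2]
      omega
    · rw [sepSize, hf (· = 2), hS]

/-- An isolating set with boundary below k makes some count small, by `upper`. Any piece with a
small count has a side with a small boundary, by `lower`, so the piece chosen need not be that of
the isolating set. -/
theorem run_extractCut (hW : W ≤ 2 ^ w) {κ : Cfg} (hG : HasGraph n E src adj κ)
    (hL : EdgeList n E src adj) {Y C : Finset ℕ}
    (hP : PiecesCut n E src adj (supp n (κ.m A_T)) κ Y C) (hb : 20 * (n + E + 1) < W) :
    ∃ κ', Run w O ω extractCut κ (1000 * (n + E + 1)) κ' ∧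
      (κ'.m A_out = κ.m A_out ∨
        (CutArray n (Nbr E src adj) (κ'.m A_out) ∧ sepSize n (κ'.m A_out) < κ.v V_k)) ∧
      ((∃ X x, Isolates n (Nbr E src adj) (supp n (κ.m A_T)) X x ∧
          (bdry n (Nbr E src adj) X).card < κ.v V_k ∧ ∃ y ∈ supp n (κ.m A_T), y ≠ x) →
        CutArray n (Nbr E src adj) (κ'.m A_out) ∧ sepSize n (κ'.m A_out) < κ.v V_k) := by
  have h1 : 1 < W := by omega
  obtain ⟨κ₁, r₁, c₁⟩ := run_countPieces (O := O) (ω := ω) hW hG hP hb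
  have G₁ := hG.frame r₁.frame (by decide) (by decide) (by decide) (by decide)
  have T₁ : κ₁.m A_T = κ.m A_T := r₁.frame.m _ (by decide)
  have k₁ : κ₁.v V_k = κ.v V_k := r₁.frame.v _ (by decide)
  obtain ⟨κ₂, r₂, h₂⟩ := run_choosePiece (O := O) (ω := ω) hW G₁.n (by omega)
  have G₂ := G₁.frame r₂.frame (by decide) (by decide) (by decide) (by decide)
  have out₂ : κ₂.m A_out = κ.m A_out :=
    (r₂.frame.m _ (by decide)).trans (r₁.frame.m _ (by decide))
  rw [T₁, k₁] at h₂
  rcases h₂ with ⟨hbest, hno⟩ | ⟨hbest, hT, hk⟩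
  · refine ⟨κ₂, (r₁.seq (r₂.seq (run_ite (t := 0) (e := 𝓿 V_best <ₑ 𝓿 V_n) hW h1
      ⟨trivial, trivial, trivial⟩ (fun h => ?_)
      fun _ => run_skip κ₂))).mono (by simp only [Expr.cost]; omega), Or.inl out₂, ?_⟩
    · simp [hbest, G₂.n] at h
    · rintro ⟨X, x, hX, hXk, -⟩
      have hx := mem_supp.1 hX.mem_T
      have := hno x hx.1 hx.2
      rw [c₁ x hx.1] at this
      have := hP.upper X x hX
      omega
  · set b := κ₂.v V_best with hb'
    have O₂ : κ₂.m A_own = κ.m A_own :=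
      (r₂.frame.m _ (by decide)).trans (r₁.frame.m _ (by decide))
    have m₂ : κ₂.m A_mark = κ.m A_mark :=
      (r₂.frame.m _ (by decide)).trans (r₁.frame.m _ (by decide))
    have hbT : b ∈ supp n (κ.m A_T) := mem_supp.2 ⟨hbest, hT⟩
    have hXn : ∀ v ∈ pieceSide n (κ.m A_own) Y b, v < n := fun v hv => (mem_pieceSide.1 hv).1
    obtain ⟨κ₃, r₃, z₃⟩ := run_markSide (O := O) (ω := ω) hW G₂ hL
      (X := pieceSide n (κ.m A_own) Y b)
      (fun v hv => by rw [mem_pieceSide, O₂, m₂, hP.mem_Y v (by omega), ← hb']; simp [hv]) hb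
    have G₃ := G₂.frame r₃.frame (by decide) (by decide) (by decide) (by decide)
    obtain ⟨κ₄, r₄, h₄⟩ := run_copyOut (O := O) (ω := ω) hW G₃ hL
      (X := pieceSide n (κ.m A_own) Y b) hXn
      ⟨b, mem_pieceSide.2 ⟨hbest, hP.terminal b hbT, Or.inl rfl⟩⟩ z₃ (by omega)
    have out₃ : κ₃.m A_out = κ.m A_out := (r₃.frame.m _ (by decide)).trans out₂
    rw [out₃] at h₄
    have hlow := hP.lower b hbest
    rw [c₁ b hbest] at hk
    refine ⟨κ₄, (r₁.seq (r₂.seq (run_ite (e := 𝓿 V_best <ₑ 𝓿 V_n) hW h1 ⟨trivial, trivial, trivial⟩ (fun _ => r₃.seq r₄)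
      fun h => ?_))).mono (by simp only [Expr.cost]; omega), ?_, ?_⟩
    · simp [G₂.n] at h
      omega
    · refine h₄.imp (fun h => h.1) fun h => ⟨h.1, by rw [h.2]; omega⟩
    · rintro ⟨X, x, hX, hXk, y, hy, hyx⟩
      rcases h₄ with ⟨-, h⟩ | h
      -- A terminal z other than the centre owns itself. It is not in the side of b, and not in its
      -- boundary either, because no edge joins two different regions. So something is left for the
      -- other side.
      · exfalso
        obtain ⟨z, hz, hzb⟩ : ∃ z ∈ supp n (κ.m A_T), z ≠ b := by
          by_cases hxb : x = b
          · exact ⟨y, hy, hxb ▸ hyx⟩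
          · exact ⟨x, hX.mem_T, hxb⟩
        have hzo := hP.terminal z hz
        have hzn := (mem_supp.1 hz).1
        rcases h z hzn with h' | h'
        · exact hzb (hzo ▸ (mem_pieceSide.1 h').2.1)
        · obtain ⟨-, -, u, hu, huz⟩ := mem_bdry.1 h'
          have huo := (mem_pieceSide.1 hu).2.1
          have := hP.edge u z huz (by omega) (by omega)
          omega
      · exact ⟨h.1, by rw [h.2]; omega⟩

end

end RAM

/-! ## One round -/

namespace RAM

/-- Start with all vertices, or with those of low degree. -/
def initTerminals : Prog :=
  forLoop V_v (𝓿 V_n) (.store A_T (𝓿 V_v) (𝓬 0 <ₑ ((𝓿 V_typ =ₑ 𝓬 0) +ₑ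
    ((.read A_off (𝓿 V_v +ₑ 𝓬 1) -ₑ .read A_off (𝓿 V_v)) <ₑ 𝓬 8 *ₑ 𝓿 V_k +ₑ 𝓬 1))))

/-- Flip `q` coins for each vertex, and keep it if the first `lev` of them show heads. -/
def sampleTerminals : Prog :=
  forLoop V_e (𝓿 V_n *ₑ 𝓿 V_q) (.flip V_coin ;; .ite (𝓿 V_coin) .skip
    (.ite (𝓿 V_e %ₑ 𝓿 V_q <ₑ 𝓿 V_lev) (.store A_T (𝓿 V_e /ₑ 𝓿 V_q) (𝓬 0)) .skip))

/-- Remove terminals until no two of them are neighbours. -/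
def thinTerminals : Prog :=
  forLoop V_e (𝓿 V_E) (.ite (.read A_T (.read A_src (𝓿 V_e)))
    (.ite (.read A_T (.read A_adj (𝓿 V_e))) (.store A_T (.read A_src (𝓿 V_e)) (𝓬 0)) .skip) .skip)

def splitRegions : Prog :=
  forLoop V_v (𝓿 V_n) (.store A_own (𝓿 V_v) (𝓬 0)) ;;
  forLoop V_v (𝓿 V_n) (.store A_dead (𝓿 V_v) (𝓬 0)) ;; V_pow ≔ 𝓬 1 ;;
  forLoop V_bit (𝓿 V_ℓ) splitBit

def oneRound : Prog :=
  initTerminals ;; sampleTerminals ;; thinTerminals ;; splitRegions ;; cutRegions ;; extractCut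

/-- The coins of vertex `v` that count at level `lev` all show heads. -/
def Sampled (ω : ℕ → Bool) (c q lev v : ℕ) : Prop := ∀ i < lev, ω (c + v * q + i) = true

/-- The sampled vertices include exactly one of `X` and its boundary, which is in `X`, and one of the
other side. -/
def GoodSample (n : ℕ) (r : ℕ → ℕ → Prop) (T : Set ℕ) (X : Finset ℕ) : Prop :=
  ∃ x ∈ X, x ∈ T ∧ (∀ v ∈ X, v ∈ T → v = x) ∧ (∀ v ∈ bdry n r X, v ∉ T) ∧
    ∃ y < n, y ∈ T ∧ y ∉ X ∧ y ∉ bdry n r X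

section

variable {w W : ℕ} {O : FlowOracle} {ω : ℕ → Bool} {n E : ℕ} {src adj : ℕ → ℕ}

theorem run_initTerminals (hW : W ≤ 2 ^ w) {κ : Cfg} (hn : κ.v V_n = n) (hb : n + 2 < W)
    (hk : 8 * κ.v V_k + 10 < W) (hoff : ∀ v ≤ n, κ.m A_off v < W) :
    ∃ κ', Run w O ω initTerminals κ (100 * (n + 1)) κ' ∧ ∀ v < n, κ'.m A_T v ≠ 0 ↔
      κ.v V_typ = 0 ∨ κ.m A_off (v + 1) - κ.m A_off v ≤ 8 * κ.v V_k := by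
  have h1 : 1 < W := by omega
  obtain ⟨κ₁, r₁, z₁, -⟩ := run_fill (w := w) (W := W) (O := O) (ω := ω) hW h1 (x := V_v)
    (a := A_T) (e := 𝓿 V_n) (r := (𝓬 0 <ₑ ((𝓿 V_typ =ₑ 𝓬 0) +ₑ
    ((.read A_off (𝓿 V_v +ₑ 𝓬 1) -ₑ .read A_off (𝓿 V_v)) <ₑ 𝓬 8 *ₑ 𝓿 V_k +ₑ 𝓬 1))))
    (κ := κ) (N := n) (fun v => if κ.v V_typ = 0 ∨
      κ.m A_off (v + 1) - κ.m A_off v ≤ 8 * κ.v V_k then 1 else 0) (by omega)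
    (fun τ hF => by simp [hF.v V_n (by decide), hn]) (fun i τ hi hF hv _ => by
      have o₁ : τ.m A_off = κ.m A_off := hF.m _ (by decide)
      have t₁ : τ.v V_typ = κ.v V_typ := hF.v _ (by decide)
      have k₁ : τ.v V_k = κ.v V_k := hF.v _ (by decide)
      have := hoff (i + 1) hi
      simp only [Expr.Fits, BinOp.Fits, Expr.val, BinOp.apply, hv, o₁, t₁, k₁, Nat.lt_succ_iff]
      by_cases c1 : κ.v V_typ = 0 <;>
        by_cases c2 : κ.m A_off (i + 1) - κ.m A_off i ≤ 8 * κ.v V_k <;> simp [c1, c2] <;> omega)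
  refine ⟨κ₁, r₁.bound 100 (by decide), fun v hv => ?_⟩
  rw [z₁ v hv]
  split_ifs with h
  · exact iff_of_true one_ne_zero h
  · exact iff_of_false (by simp) h

/-- All nq coins are flipped at every level, and the coins beyond the first `lev` of a vertex are
ignored. Therefore the coins of a round start at a position that depends on its number only. -/
theorem run_sampleTerminals (hW : W ≤ 2 ^ w) {κ : Cfg} {q lev : ℕ} (hn : κ.v V_n = n)
    (hq : κ.v V_q = q) (hlev : κ.v V_lev = lev) (hlq : lev ≤ q) (hb : n * q + 2 < W) :
    ∃ κ', Run w O ω sampleTerminals κ (100 * (n * q + 1)) κ' ∧ κ'.c = κ.c + n * q ∧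
      ∀ v < n, κ'.m A_T v ≠ 0 ↔ κ.m A_T v ≠ 0 ∧ Sampled ω κ.c q lev v := by
  have h1 : 1 < W := by omega
  obtain ⟨κ₁, r₁, ⟨hc, h⟩, -⟩ := run_for_go (O := O) (ω := ω) hW h1 (x := V_e)
    (e := 𝓿 V_n *ₑ 𝓿 V_q) (body := .flip V_coin ;; .ite (𝓿 V_coin) .skip
    (.ite (𝓿 V_e %ₑ 𝓿 V_q <ₑ 𝓿 V_lev) (.store A_T (𝓿 V_e /ₑ 𝓿 V_q) (𝓬 0)) .skip))
    (N := n * q) (κ := κ)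
    (fun i τ => τ.c = κ.c + i ∧ ∀ v < n, τ.m A_T v ≠ 0 ↔ κ.m A_T v ≠ 0 ∧
      ∀ z < i, z / q = v → z % q < lev → ω (κ.c + z) = true) (by omega)
    ⟨by simp, by simp⟩
    (fun τ hF => by
      simp [hF.v V_n (by decide), hF.v V_q (by decide), hn, hq]; omega) (by decide)
    (fun i τ hi hI hF hv => by
      have q₁ : τ.v V_q = q := (hF.v _ (by decide)).trans hq
      have l₁ : τ.v V_lev = lev := (hF.v _ (by decide)).trans hlev
      obtain ⟨i1, i2⟩ := hI
      refine ⟨⟨trivial, trivial, fun _ => trivial, fun _ => ⟨⟨⟨trivial, trivial, ?_⟩, trivial,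
        trivial⟩, fun _ => ⟨⟨trivial, trivial, ?_⟩, ?_⟩, fun _ => trivial⟩⟩, ?_, ?_⟩
      · simp [hv]; omega
      · simp [hv]; omega
      · simp only [Expr.Fits]; omega
      · simp only [Prog.go, Cfg.setV_c]
        split_ifs <;> simp [i1, add_assoc]
      · intro v hvn
        have i3 := i2 v hvn
        simp only [Nat.lt_succ_iff_lt_or_eq, or_imp, forall_and, forall_eq]
        by_cases c1 : ω (κ.c + i) = true
        · have : (τ.toss ω V_coin).v V_coin = 1 := by simp [i1, c1]
          simp only [Prog.go, Expr.val, this]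
          simp [c1, i3]
        · have : (τ.toss ω V_coin).v V_coin = 0 := by simp [i1, c1]
          simp only [Prog.go, Expr.val, this]
          by_cases c2 : i % q < lev
          · by_cases c3 : v = i / q
            · simp [hv, q₁, l₁, c2, c3, c1]
            · simp [hv, q₁, l₁, c2, c3, Ne.symm c3, i3]
          · simp [hv, q₁, l₁, c2, i3])
  refine ⟨κ₁, r₁.bound 100 (by decide), hc, fun v hv => ?_⟩
  rw [h v hv]
  refine and_congr_right fun _ => ⟨fun h i hi => ?_, fun h z hz h2 h3 => ?_⟩
  · have hq0 : 0 < q := by omega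
    have hiq : i < q := by omega
    have e1 : (v * q + i) / q = v := by
      rw [mul_comm, Nat.mul_add_div hq0, Nat.div_eq_of_lt hiq, add_zero]
    have e2 : (v * q + i) % q = i := by
      rw [mul_comm, Nat.mul_add_mod, Nat.mod_eq_of_lt hiq]
    rw [add_assoc]
    refine h _ ?_ e1 (by omega)
    have : (v + 1) * q ≤ n * q := Nat.mul_le_mul_right _ hv
    rw [add_mul] at this
    omega
  · have := h (z % q) h3
    have e := Nat.div_add_mod z q
    rw [h2, mul_comm] at e
    rwa [add_assoc, e] at this

/-- The last clause records that thinning never empties a set that is closed under adjacency of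
terminals: a terminal is dropped only in favour of a neighbour that is still present. -/
theorem run_thinTerminals (hW : W ≤ 2 ^ w) {κ : Cfg} (hG : HasGraph n E src adj κ)
    (hL : EdgeList n E src adj) (hb : E + 2 < W) :
    ∃ κ', Run w O ω thinTerminals κ (100 * (E + 1)) κ' ∧
      (∀ v < n, κ'.m A_T v ≠ 0 → κ.m A_T v ≠ 0) ∧
      (∀ e < E, κ'.m A_T (src e) ≠ 0 → κ'.m A_T (adj e) = 0) ∧
      (∀ x < n, κ.m A_T x ≠ 0 → (∀ v, Nbr E src adj x v → κ.m A_T v = 0) → κ'.m A_T x ≠ 0) ∧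
      ∀ R : Set ℕ, (∀ u ∈ R, ∀ v, Nbr E src adj u v → κ.m A_T u ≠ 0 → κ.m A_T v ≠ 0 → v ∈ R) →
        (∃ u < n, u ∈ R ∧ κ.m A_T u ≠ 0) → ∃ u < n, u ∈ R ∧ κ'.m A_T u ≠ 0 := by
  have h1 : 1 < W := by omega
  obtain ⟨κ₁, r₁, h, -⟩ := run_for_go (O := O) (ω := ω) hW h1 (x := V_e) (e := 𝓿 V_E)
    (body := .ite (.read A_T (.read A_src (𝓿 V_e)))
    (.ite (.read A_T (.read A_adj (𝓿 V_e))) (.store A_T (.read A_src (𝓿 V_e)) (𝓬 0)) .skip) .skip)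
    (N := E) (κ := κ)
    (fun i τ => (∀ v < n, τ.m A_T v ≠ 0 → κ.m A_T v ≠ 0) ∧
      (∀ e < i, τ.m A_T (src e) ≠ 0 → τ.m A_T (adj e) = 0) ∧
      (∀ x < n, κ.m A_T x ≠ 0 → (∀ v, Nbr E src adj x v → κ.m A_T v = 0) → τ.m A_T x ≠ 0) ∧
      ∀ R : Set ℕ, (∀ u ∈ R, ∀ v, Nbr E src adj u v → κ.m A_T u ≠ 0 → κ.m A_T v ≠ 0 → v ∈ R) →
        (∃ u < n, u ∈ R ∧ κ.m A_T u ≠ 0) → ∃ u < n, u ∈ R ∧ τ.m A_T u ≠ 0) (by omega)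
    ⟨by simp, by simp, by simp +contextual, by simp⟩
    (fun τ hF => by simp [hF.v V_E (by decide), hG.E]) (by decide)
    (fun i τ hi hI hF hv => by
      have G₁ := hG.frame hF (by decide) (by decide) (by decide) (by decide)
      have la := hL.adj_lt i hi
      have ls := hL.src_lt i hi
      obtain ⟨i1, i2, i3, i4⟩ := hI
      refine ⟨⟨trivial, fun _ => ⟨trivial, fun _ => ⟨trivial, by simp only [Expr.Fits]; omega⟩,
        fun _ => trivial⟩, fun _ => trivial⟩, ?_⟩
      simp only [Prog.go, Expr.val, hv, G₁.src, G₁.adj]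
      by_cases c : τ.m A_T (src i) ≠ 0 ∧ τ.m A_T (adj i) ≠ 0
      · rw [if_pos c.1, if_pos c.2]
        simp only [Cfg.setV_m, Cfg.setM_m, true_and]
        have hnb : Nbr E src adj (src i) (adj i) := ⟨i, hi, rfl, rfl⟩
        refine ⟨fun v hv h => ?_, fun e he h => ?_, fun x hx h2 h3 => ?_, fun R hR hne => ?_⟩
        · split_ifs at h
          · exact absurd rfl h
          · exact i1 v hv h
        · by_cases h4 : src e = src i
          · rw [if_pos h4] at h
            exact absurd rfl h
          · rw [if_neg h4] at h
            split_ifs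
            · rfl
            · exact i2 e (lt_of_le_of_ne (by omega) fun h' => h4 (by rw [h'])) h
        · split_ifs with h4
          · subst h4
            exact absurd (h3 _ hnb) (i1 _ la c.2)
          · exact i3 x hx h2 h3
        · obtain ⟨u, hu, huR, huT⟩ := i4 R hR hne
          by_cases hus : u = src i
          · subst hus
            -- If the witness itself is removed, the neighbour that caused the removal takes its
            -- place.
            refine ⟨adj i, la, hR _ huR _ hnb (i1 _ ls c.1) (i1 _ la c.2), ?_⟩
            rw [if_neg (hL.ne i hi).symm]
            exact c.2
          · exact ⟨u, hu, huR, by rw [if_neg hus]; exact huT⟩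
      · have e1 : (if τ.m A_T (src i) ≠ 0 then if τ.m A_T (adj i) ≠ 0 then
            τ.setM A_T (src i) 0 else τ else τ) = τ := by
          split_ifs <;> tauto
        rw [e1]
        simp only [Cfg.setV_m]
        refine ⟨i1, fun e he h => ?_, i3, i4⟩
        by_cases hei : e = i
        · subst hei; by_contra h'; exact c ⟨h, h'⟩
        · exact i2 e (by omega) h)
  exact ⟨κ₁, r₁.bound 100 (by decide), h⟩

theorem run_splitRegions (hW : W ≤ 2 ^ w) (hO : O.Correct) {κ : Cfg} (hG : HasGraph n E src adj κ)
    (hL : EdgeList n E src adj) {ℓ : ℕ} (hℓ : κ.v V_ℓ = ℓ) (hpn : ∀ j < ℓ, 2 ^ j ≤ n)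
    (hT : ∀ u ∈ supp n (κ.m A_T), ∀ v ∈ supp n (κ.m A_T), ¬ Nbr E src adj u v)
    (hb : 20 * (n + E + 1) < W) (hℓW : ℓ < W) :
    ∃ κ', Run w O ω splitRegions κ (10000 * (ℓ + 1) * (n + E + 1)) κ' ∧
      RegionInv n (Nbr E src adj) (supp n (κ.m A_T)) ℓ (κ'.m A_own) (κ'.m A_dead) ∧
      κ'.f ≤ κ.f + 3 * ℓ * (n + E + 1) := by
  have h1 : 1 < W := by omega
  obtain ⟨κ₁, r₁, z₁, -⟩ := run_fill (w := w) (W := W) (O := O) (ω := ω) hW h1 (x := V_v)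
    (a := A_own) (e := 𝓿 V_n) (r := 𝓬 0) (κ := κ) (N := n) (fun _ => 0) (by omega)
    (fun τ hF => by simp [hF.v V_n (by decide), hG.n]) (fun i τ _ _ _ _ => by simp; omega)
  have G₁ := hG.frame r₁.frame (by decide) (by decide) (by decide) (by decide)
  obtain ⟨κ₂, r₂, z₂, -⟩ := run_fill (w := w) (W := W) (O := O) (ω := ω) hW h1 (x := V_v)
    (a := A_dead) (e := 𝓿 V_n) (r := 𝓬 0) (κ := κ₁) (N := n) (fun _ => 0) (by omega)
    (fun τ hF => by simp [hF.v V_n (by decide), G₁.n]) (fun i τ _ _ _ _ => by simp; omega)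
  have G₂ := G₁.frame r₂.frame (by decide) (by decide) (by decide) (by decide)
  have r₃ : Run w O ω (V_pow ≔ 𝓬 1) κ₂ 2 (κ₂.setV V_pow 1) := run_go hW h1 _ _ (by simp; omega)
  have F₃ : Frame [V_v, V_pow] [A_own, A_dead] κ (κ₂.setV V_pow 1) :=
    (r₁.seq (r₂.seq r₃)).frame.mono (by decide) (by decide)
  have G₃ := hG.frame F₃ (by decide) (by decide) (by decide) (by decide)
  have T₃ : (κ₂.setV V_pow 1).m A_T = κ.m A_T := F₃.m _ (by decide)
  have f₃ : (κ₂.setV V_pow 1).f = κ.f := by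
    rw [Cfg.setV_f, r₂.flow (by decide), r₁.flow (by decide)]
  have O₃ : κ₂.m A_own = κ₁.m A_own := r₂.frame.m _ (by decide)
  obtain ⟨κ₄, r₄, ⟨-, hR, hf⟩, -⟩ := run_for (O := O) (ω := ω) hW h1 (x := V_bit) (e := 𝓿 V_ℓ)
    (body := splitBit) (N := ℓ) (κ := κ₂.setV V_pow 1) (c := 5000 * (n + E + 1))
    (fun j τ => τ.v V_pow = 2 ^ j ∧
      RegionInv n (Nbr E src adj) (supp n (κ.m A_T)) j (τ.m A_own) (τ.m A_dead) ∧
      τ.f ≤ κ.f + 3 * j * (n + E + 1)) hℓW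
    ⟨by simp, RegionInv.zero.congr (fun v hv => (mem_supp.1 hv).1) (fun u v h => hL.nbr_lt h)
      (fun v hv => by simpa [O₃] using z₁ v hv) (fun v hv => by simpa using z₂ v hv),
      by simp only [Cfg.setV_f] at f₃ ⊢; omega⟩
    (fun i τ hI hF hv => by
      have : τ.v V_ℓ = ℓ := (hF.v _ (by decide)).trans ((F₃.v _ (by decide)).trans hℓ)
      simp [this]) (by decide) (fun j τ hj hI hF hv => by
      have G₄ := G₃.frame hF (by decide) (by decide) (by decide) (by decide)
      have T₄ : τ.m A_T = κ.m A_T := (hF.m _ (by decide)).trans T₃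
      obtain ⟨i1, i2, i3⟩ := hI
      obtain ⟨τ', s1, s2, s3, s4⟩ := run_splitBit (ω := ω) hW hO G₄ hL i1 (hpn j hj)
        (by rw [T₄]; exact hT) (by rw [T₄]; exact i2) hb
      rw [T₄] at s3
      refine ⟨τ', s1, by simpa using s2, s3, ?_⟩
      rw [Cfg.setV_f]
      have : 3 * (j + 1) * (n + E + 1) = 3 * j * (n + E + 1) + 3 * (n + E + 1) := by ring
      omega)
  refine ⟨κ₄, ((r₁.bound 20 (by decide)).seq ((r₂.bound 20 (by decide)).seq
    (r₃.seq r₄))).mono ?_, hR, hf⟩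
  simp only [Expr.cost]
  have : (ℓ + 1) * (5000 * (n + E + 1) + 1 + 9) ≤ (ℓ + 1) * (5010 * (n + E + 1)) :=
    Nat.mul_le_mul_left _ (by omega)
  nlinarith

/-- What a round needs to know about the memory. -/
structure RoundReady (n E k q lev typ ℓ : ℕ) (src adj off : ℕ → ℕ) (κ : Cfg) : Prop where
  graph : HasGraph n E src adj κ
  k : κ.v V_k = k
  q : κ.v V_q = q
  lev : κ.v V_lev = lev
  typ : κ.v V_typ = typ
  ℓ : κ.v V_ℓ = ℓ
  off : κ.m A_off = off

theorem RoundReady.frame {k q lev typ ℓ : ℕ} {off : ℕ → ℕ} {κ κ' : Cfg} {vs as : List ℕ}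
    (h : RoundReady n E k q lev typ ℓ src adj off κ) (hF : Frame vs as κ κ')
    (hv : ∀ x ∈ [V_n, V_E, V_k, V_q, V_lev, V_typ, V_ℓ], x ∉ vs)
    (ha : ∀ x ∈ [A_src, A_adj, A_off], x ∉ as) : RoundReady n E k q lev typ ℓ src adj off κ' :=
  ⟨h.graph.frame hF (hv _ (by simp)) (hv _ (by simp)) (ha _ (by simp)) (ha _ (by simp)),
    (hF.v _ (hv _ (by simp))).trans h.k, (hF.v _ (hv _ (by simp))).trans h.q,
    (hF.v _ (hv _ (by simp))).trans h.lev, (hF.v _ (hv _ (by simp))).trans h.typ,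
    (hF.v _ (hv _ (by simp))).trans h.ℓ, (hF.m _ (ha _ (by simp))).trans h.off⟩

/-- In a good sample the neighbours of x are in X or in its boundary, so none of them is a terminal
and x survives the thinning. Then X isolates x among the thinned terminals. -/
theorem run_oneRound (hW : W ≤ 2 ^ w) (hO : O.Correct) {κ : Cfg} {k q lev typ ℓ : ℕ} {off : ℕ → ℕ}
    (hκ : RoundReady n E k q lev typ ℓ src adj off κ) (hL : EdgeList n E src adj)
    (hpn : ∀ j < ℓ, 2 ^ j ≤ n) (hn2 : n ≤ 2 ^ ℓ) (h2n : 2 ^ ℓ ≤ 2 * n) (hlq : lev ≤ q)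
    (hoff : ∀ v ≤ n, off v < W) (hb : 20 * (n + E + 1) < W) (hℓW : ℓ < W) (hqW : n * q + 2 < W)
    (hkW : 8 * k + 10 < W) :
    ∃ κ', Run w O ω oneRound κ (30000 * (ℓ + 1) * (n + E + 1) + 100 * (n * q + 1)) κ' ∧
      κ'.c = κ.c + n * q ∧ κ'.f ≤ κ.f + 3 * (ℓ + 1) * (n + E + 1) ∧
      (κ'.m A_out = κ.m A_out ∨
        (CutArray n (Nbr E src adj) (κ'.m A_out) ∧ sepSize n (κ'.m A_out) < k)) ∧
      ((∃ X : Finset ℕ, (∀ v ∈ X, v < n) ∧ (bdry n (Nbr E src adj) X).card < k ∧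
          GoodSample n (Nbr E src adj) {v | v < n ∧ (typ = 0 ∨ off (v + 1) - off v ≤ 8 * k) ∧
            Sampled ω κ.c q lev v} X) →
        CutArray n (Nbr E src adj) (κ'.m A_out) ∧ sepSize n (κ'.m A_out) < k) := by
  have h1 : 1 < W := by omega
  obtain ⟨κ₁, r₁, t₁⟩ := run_initTerminals (O := O) (ω := ω) hW hκ.graph.n (by omega)
    (by rw [hκ.k]; omega) (by rw [hκ.off]; exact hoff)
  rw [hκ.off, hκ.typ, hκ.k] at t₁
  have H₁ := hκ.frame r₁.frame (by decide) (by decide)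
  obtain ⟨κ₂, r₂, c₂, t₂⟩ := run_sampleTerminals (O := O) (ω := ω) hW H₁.graph.n H₁.q H₁.lev hlq hqW
  rw [r₁.coins (by decide)] at c₂ t₂
  have H₂ := H₁.frame r₂.frame (by decide) (by decide)
  obtain ⟨κ₃, r₃, t₃, ind, keep, other⟩ := run_thinTerminals (O := O) (ω := ω) hW H₂.graph hL
    (by omega)
  have H₃ := H₂.frame r₃.frame (by decide) (by decide)
  obtain ⟨κ₄, r₄, R₄, f₄⟩ := run_splitRegions (ω := ω) hW hO H₃.graph hL H₃.ℓ hpn (by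
    rintro u hu v hv ⟨e, he, rfl, rfl⟩
    exact (mem_supp.1 hv).2 (ind e he (mem_supp.1 hu).2)) hb hℓW
  have H₄ := H₃.frame r₄.frame (by decide) (by decide)
  have T₄ : κ₄.m A_T = κ₃.m A_T := r₄.frame.m _ (by decide)
  obtain ⟨κ₅, r₅, f₅, Y, C, P₅⟩ := run_cutRegions (ω := ω) hW hO H₄.graph hL hn2 h2n
    (by rw [T₄]; exact R₄) hb
  have H₅ := H₄.frame r₅.frame (by decide) (by decide)
  have T₅ : κ₅.m A_T = κ₃.m A_T := (r₅.frame.m _ (by decide)).trans T₄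
  obtain ⟨κ₆, r₆, o₆, g₆⟩ := run_extractCut (O := O) (ω := ω) hW H₅.graph hL
    (by rw [T₅, ← T₄]; exact P₅) hb
  rw [H₅.k] at o₆ g₆
  have out₅ : κ₅.m A_out = κ.m A_out := by
    rw [r₅.frame.m _ (by decide), r₄.frame.m _ (by decide), r₃.frame.m _ (by decide),
      r₂.frame.m _ (by decide), r₁.frame.m _ (by decide)]
  rw [out₅] at o₆
  refine ⟨κ₆, (r₁.seq (r₂.seq (r₃.seq (r₄.seq (r₅.seq r₆))))).mono ?_, ?_, ?_, o₆, ?_⟩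
  · nlinarith
  · rw [r₆.coins (by decide), r₅.coins (by decide), r₄.coins (by decide), r₃.coins (by decide), c₂]
  · have f₃ : κ₃.f = κ.f := by
      rw [r₃.flow (by decide), r₂.flow (by decide), r₁.flow (by decide)]
    rw [r₆.flow (by decide)]
    nlinarith
  · rintro ⟨X, hXn, hXk, x, hx, hxT, hX1, hX2, y, hy, hyT, hyX, hyB⟩
    have hT₂ : ∀ v < n, κ₂.m A_T v ≠ 0 ↔ v ∈ {v | v < n ∧ (typ = 0 ∨ off (v + 1) - off v ≤ 8 * k) ∧
            Sampled ω κ.c q lev v} := fun v hv => by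
      rw [t₂ v hv, t₁ v hv]
      simp [hv]
    have hxn := hXn x hx
    refine g₆ ⟨X, x, ⟨hXn, hx, ?_, ?_, ?_⟩, hXk, ?_⟩
    · rw [T₅, mem_supp]
      refine ⟨hxn, keep x hxn ((hT₂ x hxn).2 hxT) fun v hv => ?_⟩
      obtain ⟨e, he, rfl, rfl⟩ := hv
      have la := hL.adj_lt e he
      by_contra hT
      have hT' := (hT₂ _ la).1 hT
      by_cases hvX : adj e ∈ X
      · exact hL.ne e he (hX1 _ hvX hT').symm
      · exact hX2 _ (mem_bdry.2 ⟨la, hvX, _, hx, e, he, rfl, rfl⟩) hT'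
    · intro v hv hvT
      rw [T₅, mem_supp] at hvT
      exact hX1 v hv ((hT₂ v hvT.1).1 (t₃ v hvT.1 hvT.2))
    · intro v hv hvT
      rw [T₅, mem_supp] at hvT
      exact hX2 v hv ((hT₂ v hvT.1).1 (t₃ v hvT.1 hvT.2))
    -- The far side is closed under adjacency of terminals, because between it and X lies the
    -- boundary, which has none. So one of its terminals survives.
    · obtain ⟨z, hz, ⟨hz1, hz2⟩, hz3⟩ := other {v | v ∉ X ∧ v ∉ bdry n (Nbr E src adj) X}
        (fun u ⟨hu1, hu2⟩ v huv hu hv => by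
          obtain ⟨l1, l2⟩ := hL.nbr_lt huv
          refine ⟨fun h => hu2 (mem_bdry.2 ⟨l1, hu1, v, h, hL.nbr_symm huv⟩), fun h => ?_⟩
          exact hX2 v h ((hT₂ v l2).1 hv)) ⟨y, hy, ⟨hyX, hyB⟩, (hT₂ y hy).2 hyT⟩
      exact ⟨z, by rw [T₅]; exact mem_supp.2 ⟨hz, hz3⟩, fun h => hz1 (h ▸ hx)⟩

end

end RAM

/-! ## The algorithm -/

/-- Adjacency of the vertices with given numbers. -/
def relOf {n : ℕ} (G : SimpleGraph (Fin n)) (u v : ℕ) : Prop :=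
  ∃ (hu : u < n) (hv : v < n), G.Adj ⟨u, hu⟩ ⟨v, hv⟩

namespace RAM

section

variable {n : ℕ} {G : SimpleGraph (Fin n)} {off adj : ℕ → ℕ}

theorem IsAdjacencyList.off_le (h : IsAdjacencyList G off adj) {u v : ℕ} (huv : u ≤ v)
    (hv : v ≤ n) : off u ≤ off v := by
  induction v, huv using Nat.le_induction with
  | base => exact le_rfl
  | succ v _ ih => exact (ih (by omega)).trans (h.off_mono ⟨v, by omega⟩)

/-- The entry `e` belongs to the list of `src e`. -/
def InBlock (n : ℕ) (off : ℕ → ℕ) (e u : ℕ) : Prop := u < n ∧ off u ≤ e ∧ e < off (u + 1)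

theorem IsAdjacencyList.block_mono (h : IsAdjacencyList G off adj) {e e' u u' : ℕ}
    (hu : InBlock n off e u) (hu' : InBlock n off e' u') (hee : e ≤ e') : u ≤ u' := by
  by_contra hlt
  have := h.off_le (u := u' + 1) (v := u) (by omega) hu.1.le
  have := hu.2.1
  have := hu'.2.2
  omega

theorem IsAdjacencyList.edgeList (h : IsAdjacencyList G off adj) {src : ℕ → ℕ}
    (hs : ∀ e < off n, InBlock n off e (src e)) :
    EdgeList n (off n) src adj ∧ Nbr (off n) src adj = relOf G := by
  have hlt : ∀ {e u}, InBlock n off e u → e < off n := fun {e u} hu =>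
    hu.2.2.trans_le (h.off_le hu.1 le_rfl)
  have hadj : ∀ e (he : e < off n), G.Adj ⟨src e, (hs e he).1⟩ ⟨adj e, h.entry_lt e he⟩ :=
    fun e he => (h.mem_iff _ _).2 ⟨e, (hs e he).2.1, (hs e he).2.2, rfl⟩
  have hex : ∀ u v, G.Adj u v → ∃ e < off n, src e = u ∧ adj e = v := by
    intro u v huv
    obtain ⟨e, h1, h2, h3⟩ := (h.mem_iff u v).1 huv
    have hb : InBlock n off e u := ⟨u.2, h1, h2⟩
    have he := hlt hb
    exact ⟨e, he, le_antisymm (h.block_mono (hs e he) hb le_rfl)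
      (h.block_mono hb (hs e he) le_rfl), h3⟩
  refine ⟨⟨fun e he => (hs e he).1, h.entry_lt, fun e he heq => ?_, fun e he => ?_,
    fun e he e' he' h1 h2 => ?_, fun e e' hee he' => ?_⟩, ?_⟩
  · exact (hadj e he).ne (Fin.ext heq)
  · obtain ⟨e', he', h1, h2⟩ := hex _ _ (hadj e he).symm
    exact ⟨e', he', h1, h2⟩
  · have hb := hs e he
    have hb' := hs e' he'
    rw [← h1] at hb'
    exact h.entry_inj ⟨src e, hb.1⟩ e e' hb.2.1 hb.2.2 hb'.2.1 hb'.2.2 h2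
  · exact h.block_mono (hs e (by omega)) (hs e' he') hee
  · funext u v
    refine propext ⟨?_, ?_⟩
    · rintro ⟨e, he, rfl, rfl⟩
      exact ⟨_, _, hadj e he⟩
    · rintro ⟨hu, hv, huv⟩
      obtain ⟨e, he, h1, h2⟩ := hex _ _ huv
      exact ⟨e, he, h1, h2⟩

end

/-- Look for a vertex without neighbours. -/
def scanIsolated : Prog :=
  V_v ≔ 𝓬 0 ;; .loop ((𝓿 V_v <ₑ 𝓿 V_n) *ₑ
    ((.read A_off (𝓿 V_v) =ₑ .read A_off (𝓿 V_v +ₑ 𝓬 1)) =ₑ 𝓬 0)) (V_v ≔ 𝓿 V_v +ₑ 𝓬 1)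

def computeLog : Prog :=
  V_ℓ ≔ 𝓬 0 ;; V_pow ≔ 𝓬 1 ;;
  .loop (𝓿 V_pow <ₑ 𝓿 V_n) (V_pow ≔ 𝓬 2 *ₑ 𝓿 V_pow ;; V_ℓ ≔ 𝓿 V_ℓ +ₑ 𝓬 1)

def buildSrc : Prog :=
  V_v ≔ 𝓬 0 ;;
  forLoop V_e (𝓿 V_E) (.ite (𝓿 V_e <ₑ .read A_off (𝓿 V_v +ₑ 𝓬 1)) .skip (V_v ≔ 𝓿 V_v +ₑ 𝓬 1) ;;
    .store A_src (𝓿 V_e) (𝓿 V_v))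

/-- Cut off a vertex that is not adjacent to all others. -/
def fallback : Prog :=
  V_best ≔ 𝓿 V_n ;;
  forLoop V_v (𝓿 V_n) (.ite ((.read A_off (𝓿 V_v +ₑ 𝓬 1) -ₑ .read A_off (𝓿 V_v)) +ₑ 𝓬 1 <ₑ 𝓿 V_n)
    (V_best ≔ 𝓿 V_v) .skip) ;;
  .ite (𝓿 V_best <ₑ 𝓿 V_n) (.store A_own (𝓿 V_best) (𝓿 V_best) ;; markSide ;; copyOut) .skip

/-- There are 14ℓ levels and two vertex sets to sample from, and each of these 28ℓ combinations is
tried cℓ³ times. -/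
def setParams (c : ℕ) : Prog :=
  V_q ≔ 𝓬 14 *ₑ 𝓿 V_ℓ ;; V_rounds ≔ 𝓬 (28 * c) *ₑ 𝓿 V_ℓ *ₑ 𝓿 V_ℓ *ₑ 𝓿 V_ℓ *ₑ 𝓿 V_ℓ

/-- Level and kind of the terminals are digits of the round number, so every combination recurs with
period 2q. -/
def allRounds : Prog :=
  forLoop V_round (𝓿 V_rounds) (V_lev ≔ 𝓿 V_round %ₑ 𝓿 V_q ;;
    V_typ ≔ 𝓿 V_round /ₑ 𝓿 V_q %ₑ 𝓬 2 ;; oneRound)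

def algorithm (c : ℕ) : Prog :=
  scanIsolated ;; .ite (𝓿 V_v <ₑ 𝓿 V_n) (.store A_out (𝓿 V_v) (𝓬 1))
    (V_E ≔ .read A_off (𝓿 V_n) ;; computeLog ;; setParams c ;; buildSrc ;; fallback ;; allRounds)

section

variable {w W : ℕ} {O : FlowOracle} {ω : ℕ → Bool} {n : ℕ} {G : SimpleGraph (Fin n)}
  {off adj : ℕ → ℕ}

/-- The time has to be O(m + 1) even if n is much larger than m. While no isolated vertex has been
met, each vertex passed accounts for at least one list entry, so v ≤ `off v` and the scan takes at
most `off n` rounds. -/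
theorem run_scanIsolated (hW : W ≤ 2 ^ w) {κ : Cfg} (hn : κ.v V_n = n) (hoff : κ.m A_off = off)
    (hA : IsAdjacencyList G off adj) (hb : n + off n + 2 < W) :
    ∃ κ', Run w O ω scanIsolated κ (100 * (off n + 1)) κ' ∧ κ'.v V_v ≤ n ∧
      (∀ u < κ'.v V_v, off u < off (u + 1)) ∧
      (κ'.v V_v < n → off (κ'.v V_v) = off (κ'.v V_v + 1)) := by
  have h1 : 1 < W := by omega
  have r₁ : Run w O ω (V_v ≔ 𝓬 0) κ 2 (κ.setV V_v 0) := run_go hW h1 _ _ (by simp; omega)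
  obtain ⟨κ₂, j, r₂, ⟨-, i2, i3, -⟩, h⟩ := run_loop (O := O) (ω := ω) hW h1
    (e := (𝓿 V_v <ₑ 𝓿 V_n) *ₑ
      ((.read A_off (𝓿 V_v) =ₑ .read A_off (𝓿 V_v +ₑ 𝓬 1)) =ₑ 𝓬 0))
    (p := V_v ≔ 𝓿 V_v +ₑ 𝓬 1) (c := 4) (κ := κ.setV V_v 0)
    (fun j τ => j + τ.v V_v = off n ∧ τ.v V_v ≤ n ∧ (∀ u < τ.v V_v, off u < off (u + 1)) ∧
      τ.v V_v ≤ off (τ.v V_v))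
    (fun j τ hI hF => by
      have := hI.2.1
      refine ⟨⟨trivial, trivial, trivial⟩, ⟨⟨trivial, ⟨trivial, h1, ?_⟩, trivial⟩, ?_, trivial⟩, ?_⟩
      · simp only [BinOp.Fits, Expr.val]; omega
      · simp only [Expr.Fits]; omega
      · have key : ∀ (p q : Prop) [Decidable p] [Decidable q],
            (if p then 1 else 0) * (if q then 1 else 0) < W := by
          intro p q _ _; split_ifs <;> simp <;> omega
        exact key _ _)
    (fun j τ hI hF hc => by
      have n₁ : τ.v V_n = n := (hF.v _ (by decide)).trans hn
      have o₁ : τ.m A_off = off := (hF.m _ (by decide)).trans hoff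
      obtain ⟨i1, i2, i3, i4⟩ := hI
      simp only [Expr.val, BinOp.apply, n₁, o₁, ne_eq, mul_eq_zero, not_or, ite_eq_right_iff,
        one_ne_zero, imp_false, not_not] at hc
      have hlt := hc.1
      have hne : off (τ.v V_v) ≠ off (τ.v V_v + 1) := by simpa using hc.2
      have hle := hA.off_mono ⟨τ.v V_v, hlt⟩
      have hle' := hA.off_le (u := τ.v V_v + 1) hlt le_rfl
      simp only at hle
      refine ⟨τ.setV V_v (τ.v V_v + 1), j - 1, by omega,
        run_go hW h1 (V_v ≔ 𝓿 V_v +ₑ 𝓬 1) τ ⟨trivial, h1, by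
          simp only [BinOp.Fits, Expr.val]; omega⟩, ?_, ?_, ?_, ?_⟩
      · simp; omega
      · simp; omega
      · simp only [Cfg.setV_v, if_true]
        intro u hu
        by_cases hu' : u = τ.v V_v
        · subst hu'; omega
        · exact i3 u (by omega)
      · simp only [Cfg.setV_v, if_true]
        omega) (off n) (by simp)
  refine ⟨κ₂, (r₁.seq (r₂.bound 50 (by decide))).mono (by omega), i2, i3, fun hlt => ?_⟩
  have F₂ := r₂.frame
  have n₂ : κ₂.v V_n = n := (F₂.v _ (by decide)).trans hn
  have o₂ : κ₂.m A_off = off := (F₂.m _ (by decide)).trans hoff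
  simpa [n₂, o₂, hlt] using h

theorem run_computeLog (hW : W ≤ 2 ^ w) {κ : Cfg} (hn : κ.v V_n = n) (hb : 4 * n + 4 < W) :
    ∃ κ', Run w O ω computeLog κ (100 * (n + 1)) κ' ∧ n ≤ 2 ^ κ'.v V_ℓ ∧
      ∀ j < κ'.v V_ℓ, 2 ^ j < n := by
  have h1 : 1 < W := by omega
  have r₁ : Run w O ω (V_ℓ ≔ 𝓬 0) κ 2 (κ.setV V_ℓ 0) := run_go hW h1 _ _ (by simp; omega)
  have r₂ : Run w O ω (V_pow ≔ 𝓬 1) (κ.setV V_ℓ 0) 2 ((κ.setV V_ℓ 0).setV V_pow 1) :=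
    run_go hW h1 _ _ (by simp; omega)
  obtain ⟨κ₃, j, r₃, ⟨-, i2, i3⟩, h⟩ := run_loop (O := O) (ω := ω) hW h1
    (e := 𝓿 V_pow <ₑ 𝓿 V_n)
    (p := V_pow ≔ 𝓬 2 *ₑ 𝓿 V_pow ;; V_ℓ ≔ 𝓿 V_ℓ +ₑ 𝓬 1) (c := 8)
    (κ := (κ.setV V_ℓ 0).setV V_pow 1)
    (fun j τ => j = n - τ.v V_pow ∧ τ.v V_pow = 2 ^ τ.v V_ℓ ∧ ∀ i < τ.v V_ℓ, 2 ^ i < n)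
    (fun j τ hI hF => ⟨trivial, trivial, trivial⟩)
    (fun j τ hI hF hc => by
      have n₁ : τ.v V_n = n := (hF.v _ (by decide)).trans hn
      obtain ⟨i1, i2, i3⟩ := hI
      have hlt : τ.v V_pow < n := by simpa [n₁] using hc
      have hpos : 0 < τ.v V_pow := by rw [i2]; positivity
      have hle : τ.v V_ℓ < 2 ^ τ.v V_ℓ := Nat.lt_two_pow_self
      have r := run_go (O := O) (ω := ω) hW h1 (V_pow ≔ 𝓬 2 *ₑ 𝓿 V_pow ;; V_ℓ ≔ 𝓿 V_ℓ +ₑ 𝓬 1) τ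
        (by simp; omega)
      refine ⟨_, _, ?_, r, rfl, ?_, ?_⟩
      · simp; omega
      · simp [i2, pow_succ, mul_comm]
      · intro i hi
        have hi : i < τ.v V_ℓ + 1 := by simpa using hi
        by_cases hi' : i = τ.v V_ℓ
        · rw [hi', ← i2]; exact hlt
        · exact i3 i (by omega)) (n - 1) (by simp)
  have n₃ : κ₃.v V_n = n := (r₃.frame.v _ (by decide)).trans hn
  refine ⟨κ₃, (r₁.seq (r₂.seq (r₃.bound 50 (by decide)))).mono (by omega), ?_, i3⟩
  rw [← i2]
  simpa [n₃] using h

/-- No block is empty, so the next entry belongs to the current vertex or to the following one, and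
a single comparison per entry suffices. -/
theorem run_buildSrc (hW : W ≤ 2 ^ w) {κ : Cfg} (hn0 : 0 < n) (hE : κ.v V_E = off n)
    (hoff : κ.m A_off = off) (hA : IsAdjacencyList G off adj)
    (hpos : ∀ u < n, off u < off (u + 1)) (hb : n + off n + 2 < W) :
    ∃ κ', Run w O ω buildSrc κ (100 * (off n + 1)) κ' ∧
      ∀ e < off n, InBlock n off e (κ'.m A_src e) := by
  have h1 : 1 < W := by omega
  have r₁ : Run w O ω (V_v ≔ 𝓬 0) κ 2 (κ.setV V_v 0) := run_go hW h1 _ _ (by simp; omega)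
  obtain ⟨κ₂, r₂, ⟨-, -, -, h⟩, -⟩ := run_for_go (O := O) (ω := ω) hW h1 (x := V_e) (e := 𝓿 V_E)
    (body := .ite (𝓿 V_e <ₑ .read A_off (𝓿 V_v +ₑ 𝓬 1)) .skip (V_v ≔ 𝓿 V_v +ₑ 𝓬 1) ;;
      .store A_src (𝓿 V_e) (𝓿 V_v))
    (N := off n) (κ := κ.setV V_v 0)
    (fun i τ => τ.v V_v < n ∧ off (τ.v V_v) ≤ i ∧ i ≤ off (τ.v V_v + 1) ∧
      ∀ e < i, InBlock n off e (τ.m A_src e)) (by omega)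
    ⟨by simpa using hn0, by simp [hA.off_zero], by simp, by simp⟩
    (fun τ hF => by simp [hF.v V_E (by decide), hE]) (by decide)
    (fun i τ hi hI hF hv => by
      have o₁ : τ.m A_off = off := (hF.m _ (by decide)).trans hoff
      obtain ⟨i1, i2, i3, i4⟩ := hI
      have hgo : (Prog.ite (𝓿 V_e <ₑ .read A_off (𝓿 V_v +ₑ 𝓬 1)) .skip
          (V_v ≔ 𝓿 V_v +ₑ 𝓬 1)).go ω τ =
          if i < off (τ.v V_v + 1) then τ else τ.setV V_v (τ.v V_v + 1) := by
        simp only [Prog.go, Expr.val, BinOp.apply, hv, o₁]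
        split_ifs <;> simp_all
      refine ⟨⟨⟨⟨trivial, ⟨trivial, h1, ?_⟩, trivial⟩, fun _ => trivial, fun _ =>
        ⟨trivial, h1, ?_⟩⟩, trivial, trivial⟩, ?_⟩
      · simp only [BinOp.Fits, Expr.val]; omega
      · simp only [BinOp.Fits, Expr.val]; omega
      · simp only [Prog.go] at hgo
        simp only [Prog.go]
        rw [hgo]
        have key : ∀ u, InBlock n off i u → ∀ e < i + 1,
            InBlock n off e (if e = i then u else τ.m A_src e) := by
          intro u hu e he
          split_ifs with h'
          · rw [h']; exact hu
          · exact i4 e (by omega)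
        by_cases c : i < off (τ.v V_v + 1)
        · rw [if_pos c]
          simp only [Cfg.setV_v, Cfg.setM_v, Cfg.setV_m, Cfg.setM_m, Expr.val, hv, true_and]
          exact ⟨i1, by simpa using i2.trans (Nat.le_succ i), by simpa using c,
            by simpa using key _ ⟨i1, i2, c⟩⟩
        · rw [if_neg c]
          have hlt : τ.v V_v + 1 < n := by
            rcases Nat.lt_or_ge (τ.v V_v + 1) n with h | h
            · exact h
            · have : τ.v V_v + 1 = n := by omega
              rw [this] at i3 c
              omega
          have := hpos _ hlt
          simp only [Cfg.setV_v, Cfg.setM_v, Cfg.setV_m, Cfg.setM_m, Expr.val, hv, true_and]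
          refine ⟨by simpa using hlt, ?_, ?_, by
            simpa [hv] using key (τ.v V_v + 1) ⟨hlt, by omega, by omega⟩⟩
          · simp; omega
          · simp; omega)
  exact ⟨κ₂, (r₁.seq (r₂.bound 50 (by decide))).mono (by omega), h⟩

/-- A vertex with fewer than n - 1 neighbours is a side by itself: together with its neighbours it
does not fill the graph. As all marks are still 0, `markSide` selects this vertex alone. -/
theorem run_fallback (hW : W ≤ 2 ^ w) {κ : Cfg} {E : ℕ} {src : ℕ → ℕ}
    (hG : HasGraph n E src adj κ) (hL : EdgeList n E src adj) (hoff : κ.m A_off = off)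
    (hs : ∀ e < E, InBlock n off e (src e)) (hoE : ∀ v ≤ n, off v ≤ E)
    (hmark : ∀ v, κ.m A_mark v = 0)
    (hb : 20 * (n + E + 1) < W) :
    ∃ κ', Run w O ω fallback κ (1000 * (n + E + 1)) κ' ∧
      ((∃ u < n, off (u + 1) - off u + 1 < n) → CutArray n (Nbr E src adj) (κ'.m A_out)) := by
  classical
  have h1 : 1 < W := by omega
  have r₁ : Run w O ω (V_best ≔ 𝓿 V_n) κ 2 (κ.setV V_best n) := by
    have := run_go (O := O) (ω := ω) hW h1 (V_best ≔ 𝓿 V_n) κ trivial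
    simpa [hG.n, Prog.cost, Expr.cost] using this
  obtain ⟨κ₂, r₂, h₂, -⟩ := run_for_go (O := O) (ω := ω) hW h1 (x := V_v) (e := 𝓿 V_n)
    (body := .ite ((.read A_off (𝓿 V_v +ₑ 𝓬 1) -ₑ .read A_off (𝓿 V_v)) +ₑ 𝓬 1 <ₑ 𝓿 V_n)
      (V_best ≔ 𝓿 V_v) .skip)
    (N := n) (κ := κ.setV V_best n)
    (fun i τ => (τ.v V_best = n ∧ ∀ v < i, ¬ off (v + 1) - off v + 1 < n) ∨
        (τ.v V_best < n ∧ off (τ.v V_best + 1) - off (τ.v V_best) + 1 < n)) (by omega)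
    (by simp) (fun τ hF => by simp [hF.v V_n (by decide), hG.n]) (by decide)
    (fun i τ hi hI hF hv => by
      have o₁ : τ.m A_off = off := (hF.m _ (by decide)).trans hoff
      have n₁ : τ.v V_n = n := (hF.v _ (by decide)).trans hG.n
      have := hoE (i + 1) hi
      refine ⟨⟨⟨⟨⟨⟨trivial, h1, ?_⟩, trivial, ?_⟩, h1, ?_⟩, trivial, trivial⟩, fun _ => trivial,
        fun _ => trivial⟩, ?_⟩
      · simp only [BinOp.Fits, Expr.val]; omega
      · simp only [BinOp.Fits, Expr.val, BinOp.apply, hv, o₁]; omega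
      · simp only [BinOp.Fits, Expr.val, BinOp.apply, hv, o₁]; omega
      · simp only [Prog.go, Expr.val, BinOp.apply, hv, o₁, n₁]
        by_cases c : off (i + 1) - off i + 1 < n
        · right
          simp [c, hi]
        · simp only [c, if_false, ne_eq, not_true_eq_false, Cfg.setV_v]
          refine hI.imp (fun h => ⟨h.1, fun v hvi => ?_⟩) id
          by_cases hvi' : v = i
          · subst hvi'; exact c
          · exact h.2 v (by omega))
  have F₂ : Frame [V_best, V_v] [] κ κ₂ := (r₁.seq r₂).frame.mono (by decide) (by decide)
  have G₂ := hG.frame F₂ (by decide) (by decide) (by decide) (by decide)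
  rcases h₂ with ⟨hbest, hno⟩ | ⟨hbest, hdeg⟩
  · refine ⟨κ₂, (r₁.seq ((r₂.bound 50 (by decide)).seq (run_ite (t := 0)
      (e := 𝓿 V_best <ₑ 𝓿 V_n) hW h1 ⟨trivial, trivial, trivial⟩ (fun h => ?_)
      fun _ => run_skip κ₂))).mono (by simp only [Expr.cost]; omega), ?_⟩
    · simp [hbest, G₂.n] at h
    · rintro ⟨u, hu, h⟩
      exact absurd h (hno u hu)
  · set b := κ₂.v V_best with hb'
    have r₃ : Run w O ω (.store A_own (𝓿 V_best) (𝓿 V_best)) κ₂ 3 (κ₂.setM A_own b b) :=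
      run_go hW h1 (.store A_own (𝓿 V_best) (𝓿 V_best)) κ₂ ⟨trivial, trivial⟩
    have G₃ := G₂.frame r₃.frame (by decide) (by decide) (by decide) (by decide)
    obtain ⟨κ₄, r₄, z₄⟩ := run_markSide (O := O) (ω := ω) hW G₃ hL (X := {b}) (fun v hv => by
      have : κ₂.m A_mark = κ.m A_mark := F₂.m _ (by decide)
      have hbb : (κ₂.setM A_own b b).v V_best = b := rfl
      rw [hbb]
      by_cases hvb : v = b
      · simp [hvb]
      · simp [hvb, this, hmark]) hb
    have G₄ := G₃.frame r₄.frame (by decide) (by decide) (by decide) (by decide)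
    obtain ⟨κ₅, r₅, h₅⟩ := run_copyOut (O := O) (ω := ω) hW G₄ hL (X := {b}) (by simpa using hbest)
      ⟨b, by simp⟩ z₄ (by omega)
    refine ⟨κ₅, (r₁.seq ((r₂.bound 50 (by decide)).seq (run_ite
      (e := 𝓿 V_best <ₑ 𝓿 V_n) hW h1 ⟨trivial, trivial, trivial⟩ (fun _ => r₃.seq (r₄.seq r₅))
      fun h => ?_))).mono (by simp only [Expr.cost]; omega), fun _ => ?_⟩
    · simp only [Expr.val, BinOp.apply, G₂.n, ← hb', hbest, if_true, one_ne_zero] at h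
    · rcases h₅ with ⟨-, h⟩ | h
      · exfalso
        have hsub : bdry n (Nbr E src adj) {b} ⊆ (Finset.Ico (off b) (off (b + 1))).image adj := by
          intro v hv
          obtain ⟨-, -, u, hu, e, he, rfl, rfl⟩ := mem_bdry.1 hv
          have hbe := hs e he
          rw [Finset.mem_singleton.1 hu] at hbe
          exact Finset.mem_image.2 ⟨e, Finset.mem_Ico.2 ⟨hbe.2.1, hbe.2.2⟩, rfl⟩
        have c1 := (Finset.card_le_card hsub).trans Finset.card_image_le
        rw [Nat.card_Ico] at c1
        have hall : Finset.range n ⊆ insert b (bdry n (Nbr E src adj) {b}) := by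
          intro y hy
          have := h y (by simpa using hy)
          simpa using this
        have c2 := (Finset.card_le_card hall).trans (Finset.card_insert_le _ _)
        rw [Finset.card_range] at c2
        omega
      · exact h.1

/-- Round `i` samples a good set of terminals. -/
def GoodRound (n k q : ℕ) (r : ℕ → ℕ → Prop) (off : ℕ → ℕ) (ω : ℕ → Bool) (i : ℕ) : Prop :=
  ∃ X : Finset ℕ, (∀ v ∈ X, v < n) ∧ (bdry n r X).card < k ∧
    GoodSample n r {v | v < n ∧ (i / q % 2 = 0 ∨ off (v + 1) - off v ≤ 8 * k) ∧
      Sampled ω (i * (n * q)) q (i % q) v} X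

/-- The output changes only to cuts of size below k, so one good round suffices and later rounds do
no harm. Round i uses the coins from position i·nq on. -/
theorem run_allRounds (hW : W ≤ 2 ^ w) (hO : O.Correct) {κ : Cfg} {E k q ℓ rounds : ℕ}
    {src : ℕ → ℕ} (hG : HasGraph n E src adj κ) (hL : EdgeList n E src adj)
    (hk : κ.v V_k = k) (hq : κ.v V_q = q) (hℓ : κ.v V_ℓ = ℓ) (hoff : κ.m A_off = off)
    (hr : κ.v V_rounds = rounds) (hc : κ.c = 0) (hq0 : 0 < q)
    (hpn : ∀ j < ℓ, 2 ^ j < n) (hn2 : n ≤ 2 ^ ℓ) (h2n : 2 ^ ℓ ≤ 2 * n)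
    (hoffW : ∀ v ≤ n, off v < W) (hb : 20 * (n + E + 1) < W) (hqW : n * q + 2 < W)
    (hkW : 8 * k + 10 < W) (hrW : rounds + q + 2 < W) :
    ∃ κ', Run w O ω allRounds κ
        ((rounds + 1) * (30000 * (ℓ + 1) * (n + E + 1) + 100 * (n * q + 1) + 100)) κ' ∧
      κ'.f ≤ κ.f + rounds * (3 * (ℓ + 1) * (n + E + 1)) ∧
      (CutArray n (Nbr E src adj) (κ.m A_out) → CutArray n (Nbr E src adj) (κ'.m A_out)) ∧
      ((∃ i < rounds, GoodRound n k q (Nbr E src adj) off ω i) →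
        sepSize n (κ'.m A_out) < k) := by
  have h1 : 1 < W := by omega
  have hℓW : ℓ < W := by have : ℓ < 2 ^ ℓ := Nat.lt_two_pow_self; omega
  obtain ⟨κ₁, r₁, ⟨-, i2, i3, i4⟩, -⟩ := run_for (O := O) (ω := ω) hW h1 (x := V_round)
    (e := 𝓿 V_rounds) (body := V_lev ≔ 𝓿 V_round %ₑ 𝓿 V_q ;;
      V_typ ≔ 𝓿 V_round /ₑ 𝓿 V_q %ₑ 𝓬 2 ;; oneRound) (N := rounds) (κ := κ)
    (c := 30000 * (ℓ + 1) * (n + E + 1) + 100 * (n * q + 1) + 10)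
    (fun i τ => τ.c = i * (n * q) ∧ τ.f ≤ κ.f + i * (3 * (ℓ + 1) * (n + E + 1)) ∧
      (CutArray n (Nbr E src adj) (κ.m A_out) → CutArray n (Nbr E src adj) (τ.m A_out)) ∧
      ((∃ j < i, GoodRound n k q (Nbr E src adj) off ω j) →
        sepSize n (τ.m A_out) < k)) (by omega) (by simp [hc])
    (fun i τ _ hF _ => by simp [hF.v V_rounds (by decide), hr]) (by decide)
    (fun i τ hi hI hF hv => by
      obtain ⟨i1, i2, i3, i4⟩ := hI
      have G₁ := hG.frame hF (by decide) (by decide) (by decide) (by decide)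
      have q₁ : τ.v V_q = q := (hF.v _ (by decide)).trans hq
      have hdiv : i / q ≤ i := Nat.div_le_self _ _
      have s1 : Run w O ω (V_lev ≔ 𝓿 V_round %ₑ 𝓿 V_q) τ 4 (τ.setV V_lev (i % q)) := by
        have := run_go (O := O) (ω := ω) hW h1 (V_lev ≔ 𝓿 V_round %ₑ 𝓿 V_q) τ
          (by simp [hv]; omega)
        simpa [hv, q₁, Prog.cost, Expr.cost] using this
      have s2 : Run w O ω (V_typ ≔ 𝓿 V_round /ₑ 𝓿 V_q %ₑ 𝓬 2) (τ.setV V_lev (i % q)) 6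
          ((τ.setV V_lev (i % q)).setV V_typ (i / q % 2)) := by
        have := run_go (O := O) (ω := ω) hW h1 (V_typ ≔ 𝓿 V_round /ₑ 𝓿 V_q %ₑ 𝓬 2)
          (τ.setV V_lev (i % q)) (by simp [hv, q₁]; omega)
        simpa [hv, q₁, Prog.cost, Expr.cost] using this
      have hready : RoundReady n E k q (i % q) (i / q % 2) ℓ src adj off
          ((τ.setV V_lev (i % q)).setV V_typ (i / q % 2)) := by
        refine ⟨G₁.frame (s1.seq s2).frame (by decide) (by decide) (by decide) (by decide),
          ?_, ?_, ?_, ?_, ?_, ?_⟩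
        · simp [hF.v V_k (by decide), hk]
        · simp [q₁]
        · simp
        · simp
        · simp [hF.v V_ℓ (by decide), hℓ]
        · simp [hF.m A_off (by decide), hoff]
      obtain ⟨τ', s3, c3, f3, o3, g3⟩ := run_oneRound (ω := ω) hW hO hready hL
        (fun j hj => (hpn j hj).le) hn2 h2n (Nat.mod_lt _ hq0).le hoffW hb hℓW hqW hkW
      simp only [Cfg.setV_c, Cfg.setV_f, Cfg.setV_m] at c3 f3 o3 g3
      refine ⟨τ', (s1.seq (s2.seq s3)).mono (by omega), ?_, ?_, ?_, ?_⟩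
      · rw [Cfg.setV_c, c3, i1]; ring
      · rw [Cfg.setV_f, add_mul, one_mul]; omega
      · intro h
        rcases o3 with h' | h'
        · rw [Cfg.setV_m, h']; exact i3 h
        · exact h'.1
      · rintro ⟨j, hj, hgood⟩
        rw [Cfg.setV_m]
        by_cases hji : j = i
        · subst hji
          rw [i1] at g3
          exact (g3 hgood).2
        · rcases o3 with h' | h'
          · rw [h']; exact i4 ⟨j, by omega, hgood⟩
          · exact h'.2)
  exact ⟨κ₁, r₁.mono (Nat.mul_le_mul_left _ (by simp only [Expr.cost]; omega)), i2, i3, i4⟩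

end

/-- The initial state without the clock. -/
def initCfg (n k : ℕ) (off adj : ℕ → ℕ) : Cfg :=
  ⟨(initState n k off adj).vars, (initState n k off adj).mem, 0, 0⟩

section

variable {w W : ℕ} {O : FlowOracle} {ω : ℕ → Bool} {n k : ℕ} {G : SimpleGraph (Fin n)}
  {off adj : ℕ → ℕ}

theorem cutArray_isolated {u : ℕ} (hn : 2 ≤ n) (hu : u < n) (hA : IsAdjacencyList G off adj)
    (hiso : off u = off (u + 1)) {o : ℕ → ℕ} (ho : ∀ v, o v = if v = u then 1 else 0) :
    CutArray n (relOf G) o ∧ sepSize n o = 0 := by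
  have hne : ∃ y < n, y ≠ u := by
    by_cases h : u = 0
    · exact ⟨1, by omega, by omega⟩
    · exact ⟨0, by omega, by omega⟩
  obtain ⟨y, hy, hyu⟩ := hne
  refine ⟨⟨⟨u, hu, by simp [ho]⟩, ⟨y, hy, by simp [ho, hyu]⟩, ?_, ?_⟩, ?_⟩
  · rintro a b ⟨ha, hb, hab⟩ h1
    have : a = u := by by_contra h; simp [ho, h] at h1
    subst this
    obtain ⟨e, h2, h3, -⟩ := (hA.mem_iff _ _).1 hab
    simp only at h2 h3
    omega
  · have e1 : (Finset.range n).filter (fun v => o v = 1) ⊆ {u} := by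
      intro v hv
      simp only [Finset.mem_filter, ho] at hv
      by_contra h
      simp only [Finset.mem_singleton] at h
      simp [h] at hv
    refine (Finset.card_le_card e1).trans ?_
    rw [Finset.card_singleton, Nat.succ_le_iff, Finset.card_pos]
    exact ⟨y, by simp [hy, ho, hyu]⟩
  · rw [sepSize, Finset.card_eq_zero, Finset.filter_eq_empty_iff]
    intro v _
    rw [ho]
    split_ifs <;> simp

theorem run_setParams (hW : W ≤ 2 ^ w) {κ : Cfg} {ℓ c : ℕ} (hℓ : κ.v V_ℓ = ℓ) (hℓ0 : 0 < ℓ)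
    (hb : 28 * c * ℓ ^ 4 + 14 * ℓ + 28 * c + 20 < W) :
    ∃ κ', Run w O ω (setParams c) κ 50 κ' ∧ κ'.v V_q = 14 * ℓ ∧
      κ'.v V_rounds = 28 * c * ℓ ^ 4 := by
  have h1 : 1 < W := by omega
  -- The partial products must not overflow either.
  have hle : ∀ i ≤ 4, 28 * c * ℓ ^ i ≤ 28 * c * ℓ ^ 4 := fun i hi =>
    Nat.mul_le_mul_left _ (Nat.pow_le_pow_right hℓ0 hi)
  have e1 := hle 1 (by omega)
  have e2 := hle 2 (by omega)
  have e3 := hle 3 (by omega)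
  have p2 : 28 * c * ℓ ^ 2 = 28 * c * ℓ * ℓ := by ring
  have p3 : 28 * c * ℓ ^ 3 = 28 * c * ℓ * ℓ * ℓ := by ring
  have p4 : 28 * c * ℓ ^ 4 = 28 * c * ℓ * ℓ * ℓ * ℓ := by ring
  rw [pow_one] at e1
  rw [p2] at e2
  rw [p3] at e3
  have r := run_go (O := O) (ω := ω) hW h1 (setParams c) κ (by
    simp [setParams, hℓ]
    omega)
  exact ⟨_, r.mono (by simp [setParams, Prog.cost, Expr.cost]), by simp [setParams, hℓ],
    by simp [setParams, hℓ, p4]⟩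

/-- Without isolated vertices n ≤ E, so one round costs O(ℓE) and cℓ⁴ rounds cost O(cℓ⁵E). -/
theorem algorithm_time_le {c ℓ E n : ℕ} (hc : 0 < c) (hℓ : 0 < ℓ) (hE : n ≤ E) (hn : 0 < n) :
    (28 * c * ℓ ^ 4 + 1) *
      (30000 * (ℓ + 1) * (n + E + 1) + 100 * (n * (14 * ℓ) + 1) + 100) + 2000 * (n + E + 1) + 2000
      ≤ 6000000 * c * ℓ ^ 5 * (E + 1) := by
  obtain ⟨x, hx⟩ : ∃ x, x = c * ℓ ^ 4 := ⟨_, rfl⟩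
  have hx0 : 0 < x := by rw [hx]; positivity
  obtain ⟨y, hy⟩ : ∃ y, y = ℓ * E := ⟨_, rfl⟩
  have a1 : (ℓ + 1) * (n + E + 1) ≤ 6 * y :=
    (Nat.mul_le_mul (show ℓ + 1 ≤ 2 * ℓ by omega) (show n + E + 1 ≤ 3 * E by omega)).trans
      (le_of_eq (by rw [hy]; ring))
  have a2 : n * (14 * ℓ) ≤ 14 * y :=
    (Nat.mul_le_mul_right _ hE).trans (le_of_eq (by rw [hy]; ring))
  have a3 : E ≤ y := hy ▸ Nat.le_mul_of_pos_left _ hℓ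
  have h2 : 30000 * (ℓ + 1) * (n + E + 1) + 100 * (n * (14 * ℓ) + 1) + 100 ≤ 181600 * y := by
    rw [mul_assoc 30000]; omega
  have h3 := Nat.mul_le_mul (show 28 * x + 1 ≤ 29 * x by omega) h2
  have h5 : y ≤ x * y := Nat.le_mul_of_pos_left _ hx0
  have h6 : 0 < x * ℓ := by positivity
  have h4 : 29 * x * (181600 * y) = 5266400 * (x * y) := by ring
  have e1 : 28 * c * ℓ ^ 4 = 28 * x := by rw [hx]; ring
  have e3 : 6000000 * c * ℓ ^ 5 * (E + 1) = 6000000 * (x * y) + 6000000 * (x * ℓ) := by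
    rw [hx, hy]; ring
  rw [e1, e3]
  rw [h4] at h3
  linarith

/-- An isolated vertex gives an empty separator, which settles every k > 0 in time O(m + 1).
Otherwise n is at most the number of list entries, which turns all bounds in n and m into bounds in
m. -/
theorem run_algorithm (hW : W ≤ 2 ^ w) (hO : O.Correct) (hn : 2 ≤ n)
    (hA : IsAdjacencyList G off adj) {c : ℕ} (hc : 0 < c)
    (hb : 28 * c * Nat.clog 2 n ^ 4 + 28 * c + 14 * Nat.clog 2 n * (n + 1) +
      20 * (n + off n + 1) + 8 * k + 20 < W) :
    ∃ κ', Run w O ω (algorithm c) (initCfg n k off adj)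
        (6000000 * c * Nat.clog 2 n ^ 5 * (off n + 1)) κ' ∧
      κ'.f ≤ 504 * c * Nat.clog 2 n ^ 5 * off n ∧
      ((∃ u < n, off (u + 1) - off u + 1 < n) → CutArray n (relOf G) (κ'.m A_out)) ∧
      (0 < k → ((∀ u < n, off u < off (u + 1)) →
          ∃ i < 28 * c * Nat.clog 2 n ^ 4,
            GoodRound n k (14 * Nat.clog 2 n) (relOf G) off ω i) →
        sepSize n (κ'.m A_out) < k) := by
  have h1 : 1 < W := by omega
  have hℓ0 : 0 < Nat.clog 2 n := Nat.clog_pos (by omega) hn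
  have hoffE : ∀ v ≤ n, off v ≤ off n := fun v hv => hA.off_le hv le_rfl
  obtain ⟨κ₁, r₁, hle, hpos, hiso⟩ := run_scanIsolated (O := O) (ω := ω) hW
    (κ := initCfg n k off adj) (n := n) (off := off) rfl rfl hA (by omega)
  have F₁ : Frame [V_v] [] (initCfg n k off adj) κ₁ := r₁.frame.mono (by decide) (by decide)
  have n₁ : κ₁.v V_n = n := F₁.v _ (by decide)
  rcases Nat.lt_or_ge (κ₁.v V_v) n with hlt | hge
  · have r₂ : Run w O ω (.store A_out (𝓿 V_v) (𝓬 1)) κ₁ 3 (κ₁.setM A_out (κ₁.v V_v) 1) :=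
      run_go hW h1 (.store A_out (𝓿 V_v) (𝓬 1)) κ₁ ⟨trivial, h1⟩
    obtain ⟨g1, g2⟩ := cutArray_isolated hn hlt hA (hiso hlt)
      (o := (κ₁.setM A_out (κ₁.v V_v) 1).m A_out) (fun v => by
        simp only [Cfg.setM_m, true_and]
        rw [F₁.m A_out (by decide)]
        rfl)
    refine ⟨_, (r₁.seq (run_ite (e := 𝓿 V_v <ₑ 𝓿 V_n) hW h1 ⟨trivial, trivial, trivial⟩
      (fun _ => r₂) fun h => ?_)).mono ?_, ?_, fun _ => g1, fun hk _ => by rw [g2]; exact hk⟩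
    · simp [n₁] at h
      omega
    · simp only [Expr.cost]
      have : 0 < c * Nat.clog 2 n ^ 5 := by positivity
      nlinarith
    · rw [Cfg.setM_f, r₁.flow (by decide)]
      exact Nat.zero_le _
  have hpos' : ∀ u < n, off u < off (u + 1) := fun u hu => hpos u (by omega)
  have hnE : n ≤ off n := by
    have : ∀ u ≤ n, u ≤ off u := by
      intro u
      induction u with
      | zero => simp
      | succ u ih => intro hu; have := ih (by omega); have := hpos' u (by omega); omega
    exact this n le_rfl
  have r₂ : Run w O ω (V_E ≔ .read A_off (𝓿 V_n)) κ₁ 3 (κ₁.setV V_E (off n)) := by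
    have := run_go (O := O) (ω := ω) hW h1 (V_E ≔ .read A_off (𝓿 V_n)) κ₁ trivial
    have hv : κ₁.m A_off n = off n := by rw [F₁.m _ (by decide)]; rfl
    simpa [n₁, hv, Prog.cost, Expr.cost] using this
  obtain ⟨κ₃, r₃, l1, l2⟩ := run_computeLog (O := O) (ω := ω) hW (κ := κ₁.setV V_E (off n)) (n := n)
    (by simpa using n₁) (by omega)
  have hℓ : κ₃.v V_ℓ = Nat.clog 2 n := by
    refine le_antisymm ?_ (Nat.clog_le_of_le_pow l1)
    by_contra hlt
    have := l2 (Nat.clog 2 n) (by omega)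
    have := Nat.le_pow_clog (b := 2) (by omega) n
    omega
  rw [hℓ] at l1 l2
  have hℓn : 14 * Nat.clog 2 n ≤ 14 * Nat.clog 2 n * (n + 1) := Nat.le_mul_of_pos_right _ (by omega)
  obtain ⟨κ₄, r₄, q₄, R₄⟩ := run_setParams (O := O) (ω := ω) hW hℓ hℓ0 (c := c) (by omega)
  have F₄ : Frame [V_v, V_E, V_ℓ, V_pow, V_q, V_rounds] [] (initCfg n k off adj) κ₄ :=
    (r₁.seq (r₂.seq (r₃.seq r₄))).frame.mono (by
      simp [Prog.wv, scanIsolated, computeLog, setParams]) (by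
      simp [Prog.wa, scanIsolated, computeLog, setParams])
  have E₄ : κ₄.v V_E = off n := by
    rw [r₄.frame.v _ (by simp [Prog.wv, setParams]), r₃.frame.v _ (by decide)]
    simp
  obtain ⟨κ₅, r₅, hs⟩ := run_buildSrc (O := O) (ω := ω) hW (by omega) E₄ (F₄.m _ (by decide)) hA
    hpos' (by omega)
  obtain ⟨hL, hrel⟩ := hA.edgeList hs
  have F₅ : Frame [V_v, V_E, V_ℓ, V_pow, V_q, V_rounds, V_e] [A_src] (initCfg n k off adj) κ₅ :=
    (F₄.mono (by decide) (by decide)).trans (r₅.frame.mono (by decide) (by decide))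
  have G₅ : HasGraph n (off n) (κ₅.m A_src) adj κ₅ :=
    ⟨F₅.v _ (by decide), (r₅.frame.v _ (by decide)).trans E₄, rfl, F₅.m _ (by decide)⟩
  obtain ⟨κ₆, r₆, hcut⟩ := run_fallback (O := O) (ω := ω) hW G₅ hL (F₅.m A_off (by decide)) hs hoffE
    (fun v => by rw [F₅.m A_mark (by decide)]; rfl) (by omega)
  have G₆ := G₅.frame r₆.frame (by decide) (by decide) (by decide) (by decide)
  have k₆ : κ₆.v V_k = k := by
    rw [r₆.frame.v _ (by decide), F₅.v _ (by decide)]; rfl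
  have q₆ : κ₆.v V_q = 14 * Nat.clog 2 n := by
    rw [r₆.frame.v _ (by decide), r₅.frame.v _ (by decide), q₄]
  have R₆ : κ₆.v V_rounds = 28 * c * Nat.clog 2 n ^ 4 := by
    rw [r₆.frame.v _ (by decide), r₅.frame.v _ (by decide), R₄]
  have ℓ₆ : κ₆.v V_ℓ = Nat.clog 2 n := by
    rw [r₆.frame.v _ (by decide), r₅.frame.v _ (by decide),
      r₄.frame.v _ (by simp [Prog.wv, setParams]), hℓ]
  have o₆ : κ₆.m A_off = off := by
    rw [r₆.frame.m _ (by decide), F₅.m _ (by decide)]; rfl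
  have c₆ : κ₆.c = 0 := by
    rw [r₆.coins (by decide), r₅.coins (by decide), r₄.coins (by simp [setParams, Prog.noFlip]),
      r₃.coins (by decide), r₂.coins (by decide), r₁.coins (by decide)]
    rfl
  have f₆ : κ₆.f = 0 := by
    rw [r₆.flow (by decide), r₅.flow (by decide), r₄.flow (by simp [setParams, Prog.noFlow]),
      r₃.flow (by decide), r₂.flow (by decide), r₁.flow (by decide)]
    rfl
  have h2n : 2 ^ Nat.clog 2 n ≤ 2 * n := by
    have := l2 (Nat.clog 2 n - 1) (by omega)
    have e : 2 ^ Nat.clog 2 n = 2 * 2 ^ (Nat.clog 2 n - 1) := by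
      rw [← pow_succ']; congr 1; omega
    omega
  have hnq : n * (14 * Nat.clog 2 n) + 14 * Nat.clog 2 n = 14 * Nat.clog 2 n * (n + 1) := by ring
  obtain ⟨κ₇, r₇, f₇, cut₇, good₇⟩ := run_allRounds (ω := ω) hW hO G₆ hL k₆ q₆ ℓ₆ o₆ R₆ c₆
    (by omega) l2 l1 h2n (fun v hv => by have := hoffE v hv; omega) (by omega) (by omega) (by omega)
    (by omega)
  rw [hrel] at hcut cut₇ good₇
  refine ⟨κ₇, (r₁.seq (run_ite (e := 𝓿 V_v <ₑ 𝓿 V_n) hW h1 ⟨trivial, trivial, trivial⟩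
    (fun h => ?_) fun _ => r₂.seq (r₃.seq (r₄.seq (r₅.seq (r₆.seq r₇)))))).mono ?_, ?_,
    fun h => cut₇ (hcut h), fun _ h => good₇ (h hpos')⟩
  · simp [n₁] at h
    omega
  · have := algorithm_time_le (n := n) (E := off n) hc hℓ0 hnE (by omega)
    simp only [Expr.cost]
    omega
  · rw [f₆, zero_add] at f₇
    refine f₇.trans ?_
    have a1 : (Nat.clog 2 n + 1) * (n + off n + 1) ≤ (2 * Nat.clog 2 n) * (3 * off n) :=
      Nat.mul_le_mul (by omega) (by omega)
    calc 28 * c * Nat.clog 2 n ^ 4 * (3 * (Nat.clog 2 n + 1) * (n + off n + 1))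
        = 84 * c * Nat.clog 2 n ^ 4 * ((Nat.clog 2 n + 1) * (n + off n + 1)) := by ring
      _ ≤ 84 * c * Nat.clog 2 n ^ 4 * ((2 * Nat.clog 2 n) * (3 * off n)) :=
          Nat.mul_le_mul_left _ a1
      _ = 504 * c * Nat.clog 2 n ^ 5 * off n := by ring

end

end RAM

/-! ### Independent blocks of coins and isolating samples -/

open MeasureTheory

namespace RAM

noncomputable def blockMeasure (ι : Type*) : Measure (ι → Bool) :=
  Measure.infinitePi fun _ => (PMF.uniformOfFintype Bool).toMeasure

instance : IsProbabilityMeasure coinMeasure := by unfold coinMeasure; infer_instance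

instance (ι : Type*) : IsProbabilityMeasure (blockMeasure ι) := by
  unfold blockMeasure; infer_instance

theorem blockMeasure_cylinder {ι : Type*} (J : Finset ι) :
    (blockMeasure ι).real {b | ∀ i ∈ J, b i = true} = (1 / 2) ^ J.card := by
  have h : {b : ι → Bool | ∀ i ∈ J, b i = true} = Set.pi (J : Set ι) fun _ => {true} := by
    ext b; simp
  rw [measureReal_def, blockMeasure, h, Measure.infinitePi_pi _ (fun _ _ => measurableSet_singleton _)]
  simp

/-- The blocks of coins picked out by an injection are independent and uniform. -/
theorem coinMeasure_blocks {ι : Type*} [Countable ι] {φ : ℕ × ι → ℕ} (hφ : φ.Injective)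
    {B : Set (ι → Bool)} (hB : MeasurableSet B) (m : ℕ) :
    coinMeasure.real {ω | ∀ t < m, (fun i => ω (φ (t, i))) ∈ B} = (blockMeasure ι).real B ^ m := by
  have h₁ : coinMeasure.map (fun ω (p : ℕ × ι) => ω (φ p)) = blockMeasure (ℕ × ι) := by
    have := Measure.map_infinitePi_infinitePi_of_inj
      (P := fun _ : ℕ => (PMF.uniformOfFintype Bool).toMeasure) hφ
    exact this
  have h₂ : (blockMeasure (ℕ × ι)).map (MeasurableEquiv.curry ℕ ι Bool) =
      Measure.infinitePi fun _ : ℕ => blockMeasure ι :=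
    Measure.infinitePi_map_curry fun _ _ => (PMF.uniformOfFintype Bool).toMeasure
  have hf : Measurable fun (ω : ℕ → Bool) (p : ℕ × ι) => ω (φ p) := by fun_prop
  rw [← h₁, Measure.map_map (MeasurableEquiv.measurable _) hf] at h₂
  have hset : MeasurableSet (Set.pi (Finset.range m : Set ℕ) fun _ => B) :=
    MeasurableSet.pi (Finset.countable_toSet _) fun _ _ => hB
  have h₃ : {ω : ℕ → Bool | ∀ t < m, (fun i => ω (φ (t, i))) ∈ B} =
      (MeasurableEquiv.curry ℕ ι Bool ∘ fun ω p => ω (φ p)) ⁻¹'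
        Set.pi (Finset.range m : Set ℕ) fun _ => B := by
    ext ω
    simp only [Set.mem_preimage, Set.mem_pi, Finset.coe_range, Set.mem_Iio]
    rfl
  rw [measureReal_def, h₃, ← Measure.map_apply ((MeasurableEquiv.measurable _).comp hf) hset, h₂,
    Measure.infinitePi_pi _ (fun _ _ => hB)]
  simp [measureReal_def]

section

variable {V : Type*} {lev : ℕ}

/-- Among the vertices of `Z`, exactly one of `A` and one of `D` are sampled. -/
def isolating (A D Z : Finset V) (lev : ℕ) : Set (V × Fin lev → Bool) :=
  {b | ∃ x ∈ A, ∃ y ∈ D, (∀ j, b (x, j) = true) ∧ (∀ j, b (y, j) = true) ∧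
    ∀ z ∈ Z, (∀ j, b (z, j) = true) → z = x ∨ z = y}

theorem blockMeasure_sampled (A : Finset V) :
    (blockMeasure (V × Fin lev)).real {b | ∀ v ∈ A, ∀ j, b (v, j) = true} =
      ((1 / 2) ^ lev) ^ A.card := by
  have h : {b : V × Fin lev → Bool | ∀ v ∈ A, ∀ j, b (v, j) = true} =
      {b | ∀ i ∈ A ×ˢ (Finset.univ : Finset (Fin lev)), b i = true} := by
    ext b
    exact ⟨fun h i hi => h i.1 (Finset.mem_product.1 hi).1 i.2,
      fun h v hv j => h (v, j) (by simp [hv])⟩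
  rw [h, blockMeasure_cylinder]
  simp [mul_comm A.card, pow_mul]

/-- For fixed x and y, both are sampled with probability p², and a third element of Z joins them
with probability at most |Z|p³ ≤ p²/2. The events of the |A||D| pairs are disjoint, so their
probabilities add up. -/
theorem le_blockMeasure_isolating [Fintype V] {A D Z : Finset V} (hAD : Disjoint A D) (hA : A ⊆ Z) (hD : D ⊆ Z)
    (hZ : 2 * Z.card ≤ 2 ^ lev) :
    (A.card * D.card : ℝ) * (((1 / 2) ^ lev) ^ 2 / 2) ≤
      (blockMeasure (V × Fin lev)).real (isolating A D Z lev) := by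
  classical
  set p : ℝ := (1 / 2) ^ lev with hp
  set μ := blockMeasure (V × Fin lev)
  have hp0 : 0 < p := by positivity
  have hZp : 2 * (Z.card : ℝ) * p ≤ 1 := by
    have : (2 * Z.card : ℝ) ≤ 2 ^ lev := by exact_mod_cast hZ
    calc 2 * (Z.card : ℝ) * p ≤ 2 ^ lev * p := by gcongr
      _ = 1 := by rw [hp, ← mul_pow]; norm_num
  let S : Finset V → Set (V × Fin lev → Bool) := fun B => {b | ∀ v ∈ B, ∀ j, b (v, j) = true}
  -- Both elements of the pair are sampled and no further element of Z.
  let F : V × V → Set (V × Fin lev → Bool) := fun e =>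
    S {e.1, e.2} \ ⋃ z ∈ (Z.erase e.1).erase e.2, S {e.1, e.2, z}
  have hmeas : ∀ s : Set (V × Fin lev → Bool), MeasurableSet s := fun s => s.toFinite.measurableSet
  have hF : ∀ e ∈ A ×ˢ D, p ^ 2 / 2 ≤ μ.real (F e) := by
    rintro ⟨x, y⟩ he
    rw [Finset.mem_product] at he
    have hxy : x ≠ y := fun h => Finset.disjoint_left.1 hAD he.1 (by simpa [h] using he.2)
    have h₁ : μ.real (S {x, y}) = p ^ 2 := by
      rw [blockMeasure_sampled, Finset.card_pair hxy]
    have h₂ : μ.real (⋃ z ∈ (Z.erase x).erase y, S {x, y, z}) ≤ Z.card * p ^ 3 := by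
      refine (measureReal_biUnion_finset_le _ _).trans ?_
      calc ∑ z ∈ (Z.erase x).erase y, μ.real (S {x, y, z})
          = ∑ z ∈ (Z.erase x).erase y, p ^ 3 := Finset.sum_congr rfl fun z hz => by
            simp only [Finset.mem_erase] at hz
            rw [blockMeasure_sampled, Finset.card_eq_three.2 ⟨x, y, z, hxy, Ne.symm hz.2.1,
              Ne.symm hz.1, rfl⟩]
        _ = ((Z.erase x).erase y).card * p ^ 3 := by simp
        _ ≤ Z.card * p ^ 3 := by
            gcongr
            exact (Finset.erase_subset _ _).trans (Finset.erase_subset _ _)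
    have h₃ : μ.real (S {x, y}) - μ.real (⋃ z ∈ (Z.erase x).erase y, S {x, y, z}) ≤ μ.real (F (x, y)) :=
      le_measureReal_sdiff (measure_ne_top _ _)
    nlinarith [mul_le_mul_of_nonneg_right hZp (sq_nonneg p)]
  have hmem : ∀ e b, b ∈ F e → (∀ j, b (e.1, j) = true) ∧ (∀ j, b (e.2, j) = true) ∧
      ∀ z ∈ Z, (∀ j, b (z, j) = true) → z = e.1 ∨ z = e.2 := by
    rintro ⟨x, y⟩ b ⟨h, h'⟩
    have hx := h x (by simp)
    have hy := h y (by simp)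
    refine ⟨hx, hy, fun z hz hb => ?_⟩
    by_contra! hne
    refine h' (Set.mem_biUnion (x := z) (by simp [hne, hz]) ?_)
    intro v hv
    simp only [Finset.mem_insert, Finset.mem_singleton] at hv
    rcases hv with rfl | rfl | rfl
    exacts [hx, hy, hb]
  -- On such an event the pair can be read off, because A and D are disjoint parts of Z.
  have hdis : Set.PairwiseDisjoint (↑(A ×ˢ D)) F := by
    rintro ⟨x, y⟩ he ⟨x', y'⟩ he' hne
    refine Set.disjoint_left.2 fun b hb hb' => hne ?_
    rw [Finset.mem_coe, Finset.mem_product] at he he'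
    obtain ⟨h₁, h₂, h₃⟩ := hmem _ _ hb
    obtain ⟨h₁', h₂', -⟩ := hmem _ _ hb'
    have hx : x' = x := (h₃ x' (hA he'.1) h₁').resolve_right fun h =>
      Finset.disjoint_left.1 hAD he'.1 (by simpa [h] using he.2)
    have hy : y' = y := (h₃ y' (hD he'.2) h₂').resolve_left fun h =>
      Finset.disjoint_left.1 hAD he.1 (by simpa [← show y' = x from h] using he'.2)
    rw [hx, hy]
  calc (A.card * D.card : ℝ) * (p ^ 2 / 2) = ∑ e ∈ A ×ˢ D, p ^ 2 / 2 := by simp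
    _ ≤ ∑ e ∈ A ×ˢ D, μ.real (F e) := Finset.sum_le_sum hF
    _ = μ.real (⋃ e ∈ A ×ˢ D, F e) :=
        (measureReal_biUnion_finset hdis fun _ _ => hmeas _).symm
    _ ≤ μ.real (isolating A D Z lev) := by
        refine measureReal_mono (Set.iUnion₂_subset fun e he b hb => ?_)
        rw [Finset.mem_product] at he
        exact ⟨e.1, he.1, e.2, he.2, hmem e b hb⟩

end

/-- If the coins of the trials `t < m` are disjoint blocks, then it is unlikely that none of the
trials samples exactly one vertex of `A`, one of `D` and no other one of `Z`. -/
theorem coinMeasure_isolating_compl {n q lev m : ℕ} {A D Z : Finset (Fin n)} {c : ℕ → ℕ} {δ : ℝ}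
    (hAD : Disjoint A D) (hA : A ⊆ Z) (hD : D ⊆ Z) (hZ : 2 * Z.card ≤ 2 ^ lev) (hlev : lev ≤ q)
    (hc : ∀ t, c t + n * q ≤ c (t + 1))
    (hδ : δ ≤ (A.card * D.card : ℝ) * (((1 / 2) ^ lev) ^ 2 / 2)) :
    coinMeasure.real {ω | ∀ t < m, ¬ ∃ x ∈ A, ∃ y ∈ D, Sampled ω (c t) q lev x ∧
      Sampled ω (c t) q lev y ∧ ∀ z ∈ Z, Sampled ω (c t) q lev z → z = x ∨ z = y} ≤
      Real.exp (-(δ * m)) := by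
  -- The position of coin j of vertex v in trial t. It is injective as the trials are at least nq
  -- apart and the levels are at most q.
  let φ : ℕ × (Fin n × Fin lev) → ℕ := fun p => c p.1 + p.2.1 * q + p.2.2
  have hmono : ∀ t t', t < t' → c t + n * q ≤ c t' := by
    intro t t' h
    induction t', h using Nat.le_induction with
    | base => exact hc t
    | succ t' _ ih => have := hc t'; omega
  have hin : ∀ (v : Fin n) (j : Fin lev), (v : ℕ) * q + j < n * q := fun v j => by
    have : ((v : ℕ) + 1) * q ≤ n * q := Nat.mul_le_mul_right _ v.2
    have := j.2
    rw [add_mul] at *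
    omega
  have hφ : φ.Injective := by
    rintro ⟨t, v, j⟩ ⟨t', v', j'⟩ h
    simp only [φ] at h
    have ht : t = t' := by
      have h₁ := hin v j
      have h₂ := hin v' j'
      rcases lt_trichotomy t t' with h' | h' | h'
      · have := hmono _ _ h'; omega
      · exact h'
      · have := hmono _ _ h'; omega
    subst ht
    have h' : (v : ℕ) * q + j = v' * q + j' := by omega
    have hj : (j : ℕ) < q := j.2.trans_le hlev
    have hj' : (j' : ℕ) < q := j'.2.trans_le hlev
    have e₁ : (v : ℕ) = v' := by
      have := congrArg (· / q) h'
      simpa [mul_comm _ q, Nat.mul_add_div (by omega : 0 < q), Nat.div_eq_of_lt hj,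
        Nat.div_eq_of_lt hj'] using this
    have e₂ : (j : ℕ) = j' := by rw [e₁] at h'; omega
    rw [Fin.ext e₁, Fin.ext e₂]
  have hS : ∀ ω t (v : Fin n), Sampled ω (c t) q lev v ↔ ∀ j : Fin lev, ω (φ (t, v, j)) = true :=
    fun ω t v => ⟨fun h j => h j j.2, fun h i hi => h ⟨i, hi⟩⟩
  have hset : {ω : ℕ → Bool | ∀ t < m, ¬ ∃ x ∈ A, ∃ y ∈ D, Sampled ω (c t) q lev x ∧
      Sampled ω (c t) q lev y ∧ ∀ z ∈ Z, Sampled ω (c t) q lev z → z = x ∨ z = y} =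
      {ω | ∀ t < m, (fun i => ω (φ (t, i))) ∈ (isolating A D Z lev)ᶜ} := by
    ext ω
    simp only [hS]
    rfl
  rw [hset, coinMeasure_blocks hφ (Set.toFinite _).measurableSet,
    probReal_compl_eq_one_sub (Set.toFinite _).measurableSet]
  have h := hδ.trans (le_blockMeasure_isolating hAD hA hD hZ)
  have hle : (blockMeasure (Fin n × Fin lev)).real (isolating A D Z lev) ≤ 1 := measureReal_le_one
  calc (1 - (blockMeasure (Fin n × Fin lev)).real (isolating A D Z lev)) ^ m
      ≤ Real.exp (-δ) ^ m := by
        refine pow_le_pow_left₀ (by linarith) ?_ m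
        have := Real.add_one_le_exp (-δ)
        linarith
    _ = Real.exp (-(δ * m)) := by rw [← Real.exp_nat_mul]; ring_nf

end RAM

/-! ### Adjacency lists, degrees and the output arrays -/

theorem Fin.card_filter_val (n : ℕ) (p : ℕ → Prop) [DecidablePred p] :
    ((Finset.univ : Finset (Fin n)).filter fun v : Fin n => p v).card = ((Finset.range n).filter p).card := by
  rw [← Finset.card_map Fin.valEmbedding]
  congr 1
  ext v
  simp only [Finset.mem_map, Finset.mem_filter, Finset.mem_univ, true_and, Finset.mem_range,
    Fin.valEmbedding_apply]
  exact ⟨fun ⟨x, hx, e⟩ => e ▸ ⟨x.2, hx⟩, fun h => ⟨⟨v, h.1⟩, h.2, rfl⟩⟩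

/-- A vertex of L is adjacent neither to itself nor to a vertex of R. This is what makes `fallback`
succeed on every graph that has a vertex cut. -/
theorem IsVertexCut.degree_lt {V : Type*} [Fintype V] [DecidableEq V] {G : SimpleGraph V}
    [DecidableRel G.Adj] {L S R : Finset V} (h : IsVertexCut G L S R) :
    ∃ u, G.degree u + 1 < Fintype.card V := by
  obtain ⟨x, hx⟩ := h.nonempty_L
  obtain ⟨y, hy⟩ := h.nonempty_R
  have hxy : x ≠ y := fun e => Finset.disjoint_left.1 h.disjoint_LR hx (e ▸ hy)
  refine ⟨x, ?_⟩
  have hd : Disjoint (G.neighborFinset x) {x, y} := by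
    rw [Finset.disjoint_right]
    intro z hz
    simp only [Finset.mem_insert, Finset.mem_singleton] at hz
    rcases hz with rfl | rfl
    · simp
    · simpa using h.no_edge x hx z hy
  have := Finset.card_le_univ (G.neighborFinset x ∪ {x, y})
  rw [Finset.card_union_of_disjoint hd, Finset.card_pair hxy, G.card_neighborFinset_eq_degree] at this
  omega

namespace RAM

section

variable {n : ℕ} {G : SimpleGraph (Fin n)} {off adj : ℕ → ℕ}

theorem IsAdjacencyList.degree_eq [DecidableRel G.Adj] (h : IsAdjacencyList G off adj) (v : Fin n) :
    G.degree v = off (v + 1) - off v := by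
  have hlt : ∀ {i}, i ∈ Finset.Ico (off v) (off (v + 1)) → i < off n := fun {i} hi =>
    (Finset.mem_Ico.1 hi).2.trans_le (h.off_le (Nat.succ_le_of_lt v.2) le_rfl)
  rw [← Nat.card_Ico, ← G.card_neighborFinset_eq_degree]
  symm
  refine Finset.card_bij (fun i hi => ⟨adj i, h.entry_lt i (hlt hi)⟩) ?_ ?_ ?_
  · intro i hi
    rw [SimpleGraph.mem_neighborFinset, h.mem_iff]
    exact ⟨i, (Finset.mem_Ico.1 hi).1, (Finset.mem_Ico.1 hi).2, rfl⟩
  · intro i hi j hj e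
    rw [Finset.mem_Ico] at hi hj
    exact h.entry_inj v i j hi.1 hi.2 hj.1 hj.2 (congrArg Fin.val e)
  · intro u hu
    rw [SimpleGraph.mem_neighborFinset, h.mem_iff] at hu
    obtain ⟨i, h₁, h₂, h₃⟩ := hu
    exact ⟨i, Finset.mem_Ico.2 ⟨h₁, h₂⟩, Fin.ext h₃⟩

theorem IsAdjacencyList.off_card [DecidableRel G.Adj] (h : IsAdjacencyList G off adj) :
    off n = 2 * G.edgeFinset.card := by
  have hs : ∀ u ≤ n, ∑ v ∈ Finset.range u, (off (v + 1) - off v) = off u := by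
    intro u hu
    induction u with
    | zero => simp [h.off_zero]
    | succ u ih =>
      rw [Finset.sum_range_succ, ih (by omega)]
      have := h.off_mono ⟨u, hu⟩
      simp only at this
      omega
  rw [← G.sum_degrees_eq_twice_card_edges, ← hs n le_rfl,
    ← Fin.sum_univ_eq_sum_range (fun v => off (v + 1) - off v)]
  exact Finset.sum_congr rfl fun v _ => (h.degree_eq v).symm

end

theorem isVertexCut_of_cutArray {n : ℕ} {G : SimpleGraph (Fin n)} {σ : State}
    (h : CutArray n (relOf G) (σ.mem 2)) :
    IsVertexCut G (σ.outL n) (σ.outS n) (σ.outR n) where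
  disjoint_LS := Finset.disjoint_filter.2 fun v _ h₁ h₂ => by omega
  disjoint_LR := Finset.disjoint_filter.2 fun v _ h₁ h₂ => by omega
  disjoint_SR := Finset.disjoint_filter.2 fun v _ h₁ h₂ => by omega
  cover := by
    ext v
    simp only [State.outL, State.outS, State.outR, Finset.mem_union, Finset.mem_filter,
      Finset.mem_univ, true_and, iff_true]
    tauto
  nonempty_L := by
    obtain ⟨v, hv, h⟩ := h.left
    exact ⟨⟨v, hv⟩, by simp [State.outL, h]⟩
  nonempty_R := by
    obtain ⟨v, hv, h⟩ := h.right
    exact ⟨⟨v, hv⟩, by simp [State.outR, h]⟩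
  no_edge := fun x hx y hy hxy => by
    simp only [State.outL, State.outR, Finset.mem_filter, Finset.mem_univ, true_and] at hx hy
    rcases h.closed x y ⟨x.2, y.2, hxy⟩ hx with h | h
    exacts [hy.1 h, hy.2 h]
  card_le := by
    have := h.card_le
    rw [← Fin.card_filter_val, ← Fin.card_filter_val] at this
    exact this

theorem card_outS (n : ℕ) (σ : State) : (σ.outS n).card = sepSize n (σ.mem 2) :=
  Fin.card_filter_val n fun v => σ.mem 2 v = 2

end RAM

/-! ### Balance of non-scratches and the choice of a sampling level -/

section Cases

variable {n k : ℕ} {G : SimpleGraph (Fin n)} [DecidableRel G.Adj] {L S R : Finset (Fin n)}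

theorem logb_le_clog (hn : 2 ≤ n) : Real.logb 2 n ≤ Nat.clog 2 n := by
  have h : (n : ℝ) ≤ 2 ^ Nat.clog 2 n := by exact_mod_cast Nat.le_pow_clog (by norm_num) n
  rw [Real.logb_le_iff_le_rpow (by norm_num) (by positivity), Real.rpow_natCast]
  exact h

theorem log_le_clog (hn : 2 ≤ n) : Real.log n ≤ Nat.clog 2 n := by
  have h := logb_le_clog hn
  have h2 := Real.log_two_lt_d9
  have h0 : 0 < Real.log 2 := Real.log_pos (by norm_num)
  have h1 : 0 ≤ Real.log n := Real.log_nonneg (by exact_mod_cast (by omega : 1 ≤ n))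
  rw [Real.logb, div_le_iff₀ h0] at h
  have : (0 : ℝ) ≤ Nat.clog 2 n := Nat.cast_nonneg _
  nlinarith

theorem clog_le_two_logb (hn : 2 ≤ n) : (Nat.clog 2 n : ℝ) ≤ 2 * Real.logb 2 n := by
  have h1 : 1 ≤ Real.logb 2 n := by
    rw [Real.le_logb_iff_rpow_le (by norm_num) (by positivity)]
    simpa using (by exact_mod_cast hn : (2 : ℝ) ≤ n)
  have h2 : 2 ^ (Nat.clog 2 n - 1) < n := Nat.pow_pred_clog_lt_self (by norm_num) (by omega)
  have h3 : ((Nat.clog 2 n - 1 : ℕ) : ℝ) ≤ Real.logb 2 n := by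
    rw [Real.le_logb_iff_rpow_le (by norm_num) (by positivity), Real.rpow_natCast]
    exact_mod_cast h2.le
  have h4 : 1 ≤ Nat.clog 2 n := Nat.clog_pos (by norm_num) hn
  rw [Nat.cast_sub h4] at h3
  push_cast at h3
  linarith

/-- Few vertices have a large degree. -/
theorem three_mul_lt_card_lowDegree (hk : 0 < k) (hm : G.edgeFinset.card ≤ n * k) :
    3 * n ≤ 4 * (lowDegree G k).card := by
  have h1 : ∑ v ∈ (lowDegree G k)ᶜ, 8 * k ≤ ∑ v, G.degree v := by
    refine (Finset.sum_le_sum fun v hv => ?_).trans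
      (Finset.sum_le_sum_of_subset (Finset.subset_univ _))
    simp only [lowDegree, Finset.mem_compl, Finset.mem_filter, Finset.mem_univ, true_and] at hv
    omega
  rw [G.sum_degrees_eq_twice_card_edges, Finset.sum_const, smul_eq_mul, Finset.card_compl,
    Fintype.card_fin] at h1
  have h2 : (n - (lowDegree G k).card) * 8 * k ≤ 2 * n * k := by nlinarith
  have := Nat.le_of_mul_le_mul_right h2 hk
  omega

/-- A non-scratch is balanced with respect to all vertices or to those of low degree. -/
theorem IsNonScratch.cases (hn : 2 ≤ n) (hm : G.edgeFinset.card ≤ n * k)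
    (h : IsNonScratch G k L S R) :
    S.card ≤ 300 * Nat.clog 2 n * L.card ∨
    (L ⊆ lowDegree G k ∧ (S ∩ lowDegree G k).card ≤ 300 * Nat.clog 2 n * L.card ∧
      L.card ≤ (R ∩ lowDegree G k).card) := by
  obtain ⟨hc, hS, hns⟩ := h
  have hk : 0 < k := by omega
  set ℓ := Nat.clog 2 n with hℓ
  have hℓ1 : 1 ≤ ℓ := Nat.clog_pos (by norm_num) hn
  have hlogb := logb_le_clog hn
  have hlog := log_le_clog hn
  have hlb0 : 0 < Real.logb 2 n := by
    have := clog_le_two_logb hn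
    have : (1 : ℝ) ≤ ℓ := by exact_mod_cast hℓ1
    linarith
  have hlogn : Real.log n ≤ Real.logb 2 n := by
    rw [Real.logb, le_div_iff₀ (Real.log_pos (by norm_num))]
    have h2 := Real.log_two_lt_d9
    have h1 : 0 ≤ Real.log n := Real.log_nonneg (by exact_mod_cast (by omega : 1 ≤ n))
    nlinarith
  have hSk : (S.card : ℝ) < k := by exact_mod_cast hS
  have hL0 : (0 : ℝ) ≤ L.card := Nat.cast_nonneg _
  by_cases hL : (L.card : ℝ) ≤ k / (100 * Real.logb 2 n)
  · right
    have hlow : ((S ∩ lowDegree G k).card : ℝ) < 300 * L.card * Real.log n := by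
      by_contra! hcon
      exact hns ⟨hc, hS, by simpa using hL, by simpa using hcon⟩
    rw [le_div_iff₀ (by positivity)] at hL
    have hLk : 100 * L.card ≤ k := by
      have h1 : 1 ≤ Real.logb 2 n := by
        rw [Real.le_logb_iff_rpow_le (by norm_num) (by positivity)]
        simpa using (by exact_mod_cast hn : (2 : ℝ) ≤ n)
      have : (100 * L.card : ℝ) ≤ k := by nlinarith
      exact_mod_cast this
    have hcardn : L.card + S.card + R.card = n := by
      rw [← Finset.card_union_of_disjoint hc.disjoint_LS, ← Finset.card_union_of_disjoint
        (Finset.disjoint_union_left.2 ⟨hc.disjoint_LR, hc.disjoint_SR⟩), hc.cover]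
      simp
    refine ⟨fun v hv => ?_, ?_, ?_⟩
    -- The degree is at most |L| + |S| ≤ 2k.
    · have hsub : G.neighborFinset v ⊆ L ∪ S := fun u hu => by
        have hu' := Finset.mem_univ u
        rw [← hc.cover, Finset.mem_union] at hu'
        exact hu'.resolve_right fun hR => hc.no_edge v hv u hR (by simpa using hu)
      have := (Finset.card_le_card hsub).trans (Finset.card_union_le _ _)
      rw [G.card_neighborFinset_eq_degree] at this
      simp only [lowDegree, Finset.mem_filter, Finset.mem_univ, true_and]
      omega
    · have : ((S ∩ lowDegree G k).card : ℝ) ≤ 300 * ℓ * L.card := by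
        nlinarith [mul_le_mul_of_nonneg_left hlog hL0]
      exact_mod_cast this
    · by_contra! hR
      have hsum : (lowDegree G k).card ≤ L.card + (S ∩ lowDegree G k).card +
          (R ∩ lowDegree G k).card := by
        have : lowDegree G k ⊆ L ∪ (S ∩ lowDegree G k) ∪ (R ∩ lowDegree G k) := fun v hv => by
          have hv' := Finset.mem_univ v
          rw [← hc.cover] at hv'
          simp only [Finset.mem_union, Finset.mem_inter] at hv' ⊢
          tauto
        refine (Finset.card_le_card this).trans ((Finset.card_union_le _ _).trans ?_)
        have := Finset.card_union_le L (S ∩ lowDegree G k)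
        omega
      -- In a graph with at most 8k vertices all degrees are low, so |L| ≤ |R| decides.
      by_cases hnk : n ≤ 8 * k
      · have : R ∩ lowDegree G k = R := by
          refine Finset.inter_eq_left.2 fun v _ => ?_
          have := G.degree_lt_card_verts v
          rw [Fintype.card_fin] at this
          simp only [lowDegree, Finset.mem_filter, Finset.mem_univ, true_and]
          omega
        rw [this] at hR
        exact absurd hc.card_le (by omega)
      · have h3 := three_mul_lt_card_lowDegree hk hm
        have h4 : 6 * k < (lowDegree G k).card := by omega
        -- Now more than 6k vertices have low degree. But L and the low part of R have at most k/100
        -- of them each, and S has fewer than 300|L| ln n ≤ 3k.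
        have h5 : ((S ∩ lowDegree G k).card : ℝ) < 3 * k := by
          nlinarith [mul_le_mul_of_nonneg_left hlogn hL0]
        have h6 : (S ∩ lowDegree G k).card < 3 * k := by exact_mod_cast h5
        omega
  · left
    rw [not_le, div_lt_iff₀ (by positivity)] at hL
    -- Here |S| < k < 100|L| log₂ n.
    have : (S.card : ℝ) ≤ 300 * ℓ * L.card := by
      nlinarith [mul_le_mul_of_nonneg_left hlogb hL0]
    exact_mod_cast this

end Cases

/-- A sampling rate that fits a set of size about `302 * ℓ * x`. -/
theorem exists_level {n x : ℕ} (hn : 2 ≤ n) (hx : 0 < x) (hxn : x ≤ n) :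
    ∃ lev < 14 * Nat.clog 2 n, 2 * (302 * Nat.clog 2 n * x) ≤ 2 ^ lev ∧
      2 ^ lev ≤ 4 * (302 * Nat.clog 2 n * x) := by
  set ℓ := Nat.clog 2 n
  have hℓ1 : 1 ≤ ℓ := Nat.clog_pos (by norm_num) hn
  have hnℓ : n ≤ 2 ^ ℓ := Nat.le_pow_clog (by norm_num) n
  have hpos : 0 < ℓ * x := Nat.mul_pos hℓ1 hx
  have hlt : 2 ^ (Nat.clog 2 (2 * (302 * ℓ * x)) - 1) < 2 * (302 * ℓ * x) :=
    Nat.pow_pred_clog_lt_self (by norm_num) (by rw [mul_assoc 302]; omega)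
  have hcl : 1 ≤ Nat.clog 2 (2 * (302 * ℓ * x)) :=
    Nat.clog_pos (by norm_num) (by rw [mul_assoc 302]; omega)
  have hup : 2 ^ Nat.clog 2 (2 * (302 * ℓ * x)) ≤ 4 * (302 * ℓ * x) := by
    rw [← Nat.sub_add_cancel hcl, pow_succ]
    omega
  refine ⟨_, ?_, Nat.le_pow_clog (by norm_num) _, hup⟩
  -- As ℓ and x are at most 2^ℓ, the power is below 2^(11 + 2ℓ), and 11 + 2ℓ ≤ 14ℓ. This is the
  -- reason for 14ℓ levels.
  have h1 : ℓ * x ≤ 2 ^ ℓ * 2 ^ ℓ := Nat.mul_le_mul Nat.lt_two_pow_self.le (hxn.trans hnℓ)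
  have h2 : 2 ^ Nat.clog 2 (2 * (302 * ℓ * x)) < 2 ^ (11 + 2 * ℓ) := by
    refine hup.trans_lt ?_
    rw [pow_add, two_mul, pow_add]
    have : 0 < 2 ^ ℓ * 2 ^ ℓ := by positivity
    rw [mul_assoc 302]
    norm_num
    omega
  have := (Nat.pow_lt_pow_iff_right (by norm_num)).1 h2
  omega

/-! ### The probability that some round is good -/

namespace RAM

section

variable {n k : ℕ} {G : SimpleGraph (Fin n)} {off : ℕ → ℕ} {L S R : Finset (Fin n)}

/-- The set X of the good round is L, with boundary inside S. Sampled vertices of R outside D are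
harmless: only L and S must be free of further terminals, and y is a terminal on the other side. -/
theorem goodRound_of_isolating {D Z : Finset (Fin n)} {ω : ℕ → Bool} {q typ lev t : ℕ}
    {W : Fin n → Prop} (hc : IsVertexCut G L S R) (hS : S.card < k)
    (hW : ∀ v, W v ↔ (typ = 0 ∨ off (v + 1) - off v ≤ 8 * k)) (htyp : typ < 2) (hlev : lev < q)
    (hLW : ∀ v ∈ L, W v) (hD : ∀ v ∈ D, v ∈ R ∧ W v) (hLZ : L ⊆ Z) (hSZ : ∀ v ∈ S, W v → v ∈ Z)
    (h : ∃ x ∈ L, ∃ y ∈ D, Sampled ω ((t * (2 * q) + typ * q + lev) * (n * q)) q lev x ∧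
      Sampled ω ((t * (2 * q) + typ * q + lev) * (n * q)) q lev y ∧
      ∀ z ∈ Z, Sampled ω ((t * (2 * q) + typ * q + lev) * (n * q)) q lev z → z = x ∨ z = y) :
    GoodRound n k q (relOf G) off ω (t * (2 * q) + typ * q + lev) := by
  obtain ⟨x, hx, y, hy, hsx, hsy, hz⟩ := h
  have hform : t * (2 * q) + typ * q + lev = q * (t * 2 + typ) + lev := by ring
  have hmod : (t * (2 * q) + typ * q + lev) % q = lev := by
    rw [hform, Nat.mul_add_mod, Nat.mod_eq_of_lt hlev]
  have hdiv : (t * (2 * q) + typ * q + lev) / q % 2 = typ := by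
    rw [hform, Nat.mul_add_div (by omega), Nat.div_eq_of_lt hlev]
    omega
  have hmem : ∀ v : Fin n, (v : ℕ) ∈ L.map Fin.valEmbedding ↔ v ∈ L := fun v => by
    simp [Fin.val_inj]
  have hb : ∀ v : Fin n, (v : ℕ) ∈ bdry n (relOf G) (L.map Fin.valEmbedding) → v ∈ S := by
    intro v hv
    obtain ⟨-, hvL, u, hu, hu', hv', huv⟩ := mem_bdry.1 hv
    rw [hmem] at hvL
    have huL : (⟨u, hu'⟩ : Fin n) ∈ L := (hmem ⟨u, hu'⟩).1 hu
    have := Finset.mem_univ v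
    rw [← hc.cover, Finset.mem_union, Finset.mem_union] at this
    rcases this with (h | h) | h
    · exact absurd h hvL
    · exact h
    · exact absurd huv (hc.no_edge _ huL _ h)
  have hyR := (hD y hy).1
  have hyL : y ∉ L := fun h => Finset.disjoint_left.1 hc.disjoint_LR h hyR
  have hyS : y ∉ S := fun h => Finset.disjoint_left.1 hc.disjoint_SR h hyR
  refine ⟨L.map Fin.valEmbedding, fun v hv => ?_, ?_, x, (hmem x).2 hx, ?_, ?_, ?_, y, y.2, ?_,
    fun h => hyL ((hmem y).1 h), fun h => hyS (hb y h)⟩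
  · obtain ⟨u, -, rfl⟩ := Finset.mem_map.1 hv
    exact u.2
  · refine lt_of_le_of_lt ?_ hS
    rw [← Finset.card_map Fin.valEmbedding]
    refine Finset.card_le_card fun v hv => ?_
    have hvn := (mem_bdry.1 hv).1
    exact Finset.mem_map.2 ⟨⟨v, hvn⟩, hb ⟨v, hvn⟩ hv, rfl⟩
  · exact ⟨x.2, by rw [hdiv]; exact (hW x).1 (hLW x hx), by rw [hmod]; exact hsx⟩
  · rintro v hv ⟨-, -, hs⟩
    obtain ⟨u, hu, rfl⟩ := Finset.mem_map.1 hv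
    rw [hmod] at hs
    rcases hz u (hLZ hu) hs with rfl | rfl
    · rfl
    · exact absurd hu hyL
  · rintro v hv ⟨hvn, hw, hs⟩
    rw [hmod] at hs
    rw [hdiv] at hw
    have hvS := hb ⟨v, hvn⟩ hv
    rcases hz ⟨v, hvn⟩ (hSZ _ hvS ((hW _).2 hw)) hs with h | h
    · exact Finset.disjoint_left.1 hc.disjoint_LS hx (h ▸ hvS)
    · exact hyS (h ▸ hvS)
  · exact ⟨y.2, by rw [hdiv]; exact (hW y).1 (hD y hy).2, by rw [hmod]; exact hsy⟩

/-- Among the rounds of the right kind and level each trial succeeds with probability at least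
1/(2918528ℓ²), independently of the others, and there are 2918528(a+1)ℓ³ of them. -/
theorem coinMeasure_goodRound_of_balanced {typ a : ℕ} {W : Finset (Fin n)} (hn : 2 ≤ n)
    (hc : IsVertexCut G L S R) (hS : S.card < k)
    (hW : ∀ v, v ∈ W ↔ (typ = 0 ∨ off (v + 1) - off v ≤ 8 * k)) (htyp : typ < 2)
    (hLW : L ⊆ W) (hSW : (S ∩ W).card ≤ 300 * Nat.clog 2 n * L.card)
    (hRW : L.card ≤ (R ∩ W).card) :
    coinMeasure.real {ω | ∀ i < 28 * (2918528 * (a + 1)) * Nat.clog 2 n ^ 4,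
      ¬ GoodRound n k (14 * Nat.clog 2 n) (relOf G) off ω i} ≤ 1 / (n : ℝ) ^ a := by
  set ℓ := Nat.clog 2 n with hℓ
  have hℓ1 : 1 ≤ ℓ := Nat.clog_pos (by norm_num) hn
  -- R ∩ W may be too large for the sampling rate, so only |L| of its vertices are controlled.
  obtain ⟨D, hDR, hDc⟩ := Finset.exists_subset_card_eq hRW
  have hL0 : 0 < L.card := hc.nonempty_L.card_pos
  obtain ⟨lev, hlev, hlo, hhi⟩ := exists_level hn hL0
    ((Finset.card_le_univ L).trans_eq (Fintype.card_fin n))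
  have hD : ∀ v ∈ D, v ∈ R ∧ v ∈ W := fun v hv => Finset.mem_inter.1 (hDR hv)
  have hLD : Disjoint L D := hc.disjoint_LR.mono_right fun v hv => (hD v hv).1
  set Z := L ∪ (S ∩ W) ∪ D with hZdef
  have hZ : Z.card ≤ 302 * ℓ * L.card := by
    have h1 := Finset.card_union_le (L ∪ (S ∩ W)) D
    have h2 := Finset.card_union_le L (S ∩ W)
    have h3 : L.card ≤ ℓ * L.card := Nat.le_mul_of_pos_left _ hℓ1
    rw [← hZdef] at h1
    rw [mul_assoc] at hSW ⊢
    omega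
  -- Since 2^lev ≤ 1208ℓ|L| and |D| = |L|, the bound is at least 1/(2·1208²ℓ²), and 2·1208² =
  -- 2918528.
  have hδ : (1 : ℝ) / (2918528 * ℓ ^ 2) ≤
      (L.card * D.card : ℝ) * (((1 / 2) ^ lev) ^ 2 / 2) := by
    have hhi' : (2 : ℝ) ^ lev ≤ 4 * (302 * ℓ * L.card) := by exact_mod_cast hhi
    have hpos : (0 : ℝ) < 2 ^ lev := by positivity
    have hℓ0 : (0 : ℝ) < ℓ := by exact_mod_cast hℓ1
    have hsq : ((2 : ℝ) ^ lev) ^ 2 ≤ (4 * (302 * ℓ * L.card)) ^ 2 := by gcongr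
    rw [hDc, one_div_pow, one_div_pow, div_div, mul_one_div, div_le_div_iff₀ (by positivity)
      (by positivity)]
    nlinarith
  have hbad := coinMeasure_isolating_compl (m := 2918528 * (a + 1) * ℓ ^ 3)
    (c := fun t => (t * (2 * (14 * ℓ)) + typ * (14 * ℓ) + lev) * (n * (14 * ℓ))) hLD
    (Finset.subset_union_left.trans Finset.subset_union_left) Finset.subset_union_right
    ((Nat.mul_le_mul_left 2 hZ).trans hlo) hlev.le
    -- Consecutive trials are 28ℓ rounds apart, and a single round already covers the nq coins of a
    -- block.
    (fun t => by
      have : 1 * (n * (14 * ℓ)) ≤ (2 * (14 * ℓ)) * (n * (14 * ℓ)) :=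
        Nat.mul_le_mul_right _ (by omega)
      nlinarith) hδ
  refine (measureReal_mono ?_).trans (hbad.trans ?_)
  · intro ω hω t ht hiso
    refine hω _ ?_ (goodRound_of_isolating (W := fun v => v ∈ W) hc hS hW htyp hlev hLW hD
      (Finset.subset_union_left.trans Finset.subset_union_left)
      (fun v hv hw => Finset.mem_union_left _ (Finset.mem_union_right _ (Finset.mem_inter.2 ⟨hv, hw⟩)))
      hiso)
    have h1 : typ * (14 * ℓ) ≤ 1 * (14 * ℓ) := Nat.mul_le_mul_right _ (by omega)
    have h2 : (t + 1) * (28 * ℓ) ≤ 2918528 * (a + 1) * ℓ ^ 3 * (28 * ℓ) :=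
      Nat.mul_le_mul_right _ ht
    calc t * (2 * (14 * ℓ)) + typ * (14 * ℓ) + lev < (t + 1) * (28 * ℓ) := by nlinarith
      _ ≤ _ := h2
      _ = _ := by ring
  · have hn0 : (0 : ℝ) < n := by exact_mod_cast (by omega : 0 < n)
    have hℓ0 : (ℓ : ℝ) ≠ 0 := by
      have : ℓ ≠ 0 := by omega
      exact_mod_cast this
    have hlog := log_le_clog hn
    -- The exponent is (a+1)ℓ, and ℓ ≥ ln n gives the failure bound n^(-a).
    have e : (1 : ℝ) / (2918528 * ℓ ^ 2) * ((2918528 * (a + 1) * ℓ ^ 3 : ℕ) : ℝ) = (a + 1) * ℓ := by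
      push_cast
      field_simp
    have hexp : 1 / (n : ℝ) ^ a = Real.exp (-(a * Real.log n)) := by
      rw [Real.exp_neg, Real.exp_nat_mul, Real.exp_log hn0, one_div]
    rw [e, hexp, Real.exp_le_exp, neg_le_neg_iff]
    have h1 : (a : ℝ) * Real.log n ≤ a * ℓ := mul_le_mul_of_nonneg_left hlog (Nat.cast_nonneg _)
    have : (0 : ℝ) ≤ ℓ := Nat.cast_nonneg _
    nlinarith

theorem coinMeasure_goodRound [DecidableRel G.Adj] {a : ℕ} {adj : ℕ → ℕ} (hn : 2 ≤ n)
    (hm : G.edgeFinset.card ≤ n * k) (hA : IsAdjacencyList G off adj) (h : IsNonScratch G k L S R) :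
    coinMeasure.real {ω | ∀ i < 28 * (2918528 * (a + 1)) * Nat.clog 2 n ^ 4,
      ¬ GoodRound n k (14 * Nat.clog 2 n) (relOf G) off ω i} ≤ 1 / (n : ℝ) ^ a := by
  rcases h.cases hn hm with hS | ⟨h1, h2, h3⟩
  · refine coinMeasure_goodRound_of_balanced (typ := 0) (W := Finset.univ) hn h.1 h.2.1 (by simp)
      (by norm_num) (Finset.subset_univ _) (by simpa using hS) (by simpa using h.1.card_le)
  · refine coinMeasure_goodRound_of_balanced (typ := 1) hn h.1 h.2.1 (fun v => ?_) (by norm_num)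
      h1 h2 h3
    simp [lowDegree, hA.degree_eq]

end

end RAM

/-! ### Word length and the final assembly -/

theorem word_length_bound {n k c E w : ℕ} (hn : 2 ≤ n) (hE : E ≤ 2 * (n * k))
    (hw : (56 * c + 204) * Nat.clog 2 (n + k + 2) ≤ w) :
    28 * c * Nat.clog 2 n ^ 4 + 28 * c + 14 * Nat.clog 2 n * (n + 1) + 20 * (n + E + 1) + 8 * k + 20
      < 2 ^ w := by
  set N := n + k + 2 with hN
  have hℓ : Nat.clog 2 n ≤ N :=
    (Nat.clog_le_of_le_pow (Nat.lt_two_pow_self (n := n)).le).trans (by omega)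
  have hNN : N ≤ N ^ 4 := Nat.le_self_pow (by norm_num) N
  have hN2 : N * N ≤ N ^ 4 := by
    rw [← pow_two]; exact Nat.pow_le_pow_right (by omega) (by norm_num)
  have h1 : 28 * c * Nat.clog 2 n ^ 4 ≤ 28 * c * N ^ 4 :=
    Nat.mul_le_mul_left _ (Nat.pow_le_pow_left hℓ 4)
  have h2 : 28 * c ≤ 28 * c * N ^ 4 := Nat.le_mul_of_pos_right _ (by positivity)
  have h3 : Nat.clog 2 n * (n + 1) ≤ N * N := Nat.mul_le_mul hℓ (by omega)
  have h4 : n * k ≤ N * N := Nat.mul_le_mul (by omega) (by omega)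
  -- All quantities are polynomial in N with constants depending on c; because N ≥ 2, such a
  -- constant is absorbed by a further power of N, which is a multiple of the logarithm of N in
  -- bits.
  have h5 : (56 * c + 200) * N ^ 4 < 2 ^ w := by
    calc (56 * c + 200) * N ^ 4 < 2 ^ (56 * c + 200) * N ^ 4 :=
          Nat.mul_lt_mul_of_pos_right Nat.lt_two_pow_self (by positivity)
      _ ≤ N ^ (56 * c + 200) * N ^ 4 :=
          Nat.mul_le_mul_right _ (Nat.pow_le_pow_left (by omega) _)
      _ = N ^ (56 * c + 204) := by rw [← pow_add]
      _ ≤ (2 ^ Nat.clog 2 N) ^ (56 * c + 204) :=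
          Nat.pow_le_pow_left (Nat.le_pow_clog (by norm_num) _) _
      _ ≤ 2 ^ w := by
          rw [← pow_mul, mul_comm]
          exact Nat.pow_le_pow_right (by norm_num) hw
  refine lt_of_le_of_lt ?_ h5
  rw [add_mul, show 56 * c * N ^ 4 = 28 * c * N ^ 4 + 28 * c * N ^ 4 by ring, mul_assoc 14]
  omega

theorem lemma4p1 (a : ℕ) :
    ∃ (P : RAM.Prog) (b C d : ℕ),
      ∀ (n k : ℕ) (G : SimpleGraph (Fin n)) [DecidableRel G.Adj],
        2 ≤ n → G.edgeFinset.card ≤ n * k →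
      ∀ (off adj : ℕ → ℕ), RAM.IsAdjacencyList G off adj →
      ∀ (O : FlowOracle), O.Correct →
      ∀ (w : ℕ), b * Nat.clog 2 (n + k + 2) ≤ w →
        (∀ ω : ℕ → Bool, ∃ σ : RAM.State,
          RAM.Exec w O ω P (RAM.initState n k off adj) σ ∧
          ((∃ L S R, IsVertexCut G L S R) →
            IsVertexCut G (σ.outL n) (σ.outS n) (σ.outR n)) ∧
          (σ.flowSize : ℝ) ≤ C * G.edgeFinset.card * Real.logb 2 n ^ 5 ∧
          (σ.time : ℝ) ≤ C * (G.edgeFinset.card + 1) * Real.logb 2 n ^ d) ∧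
        ((∃ L S R, IsNonScratch G k L S R) →
          1 - 1 / (n : ℝ) ^ a ≤
            RAM.coinMeasure.real {ω | ∃ σ : RAM.State,
              RAM.Exec w O ω P (RAM.initState n k off adj) σ ∧ (σ.outS n).card < k}) := by
  set c := 2918528 * (a + 1) with hc
  -- The time constant is 6000000c, times 32 for replacing the rounded logarithm by twice log₂ n in
  -- the fifth power, times 2 for the two list entries per edge. It also exceeds the flow constant
  -- 32256c.
  refine ⟨RAM.algorithm c, 56 * c + 204, 384000000 * c, 5, ?_⟩
  intro n k G _ hn hm off adj hA O hO w hw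
  have hE := hA.off_card
  have hrun := fun ω => RAM.run_algorithm (ω := ω) le_rfl hO hn hA (c := c) (by omega)
    (word_length_bound hn (by omega) hw)
  have hℓ : (Nat.clog 2 n : ℝ) ^ 5 ≤ 32 * Real.logb 2 n ^ 5 := by
    calc (Nat.clog 2 n : ℝ) ^ 5 ≤ (2 * Real.logb 2 n) ^ 5 := by
          gcongr
          exact clog_le_two_logb hn
      _ = 32 * Real.logb 2 n ^ 5 := by ring
  have hlog0 : 0 ≤ Real.logb 2 n := Real.logb_nonneg (by norm_num)
    (by exact_mod_cast (by omega : 1 ≤ n))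
  have hE' : (off n : ℝ) = 2 * G.edgeFinset.card := by exact_mod_cast hE
  refine ⟨fun ω => ?_, ?_⟩
  · obtain ⟨κ, hR, hf, hcut, -⟩ := hrun ω
    obtain ⟨T, hT, hx⟩ := hR 0
    refine ⟨κ.st T, hx, ?_, ?_, ?_⟩
    · rintro ⟨L, S, R, h⟩
      obtain ⟨u, hu⟩ := h.degree_lt
      rw [hA.degree_eq, Fintype.card_fin] at hu
      exact RAM.isVertexCut_of_cutArray (hcut ⟨u, u.2, hu⟩)
    · have hf' : (κ.f : ℝ) ≤ 504 * c * Nat.clog 2 n ^ 5 * off n := by exact_mod_cast hf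
      calc (κ.f : ℝ) ≤ 504 * c * Nat.clog 2 n ^ 5 * off n := hf'
        _ ≤ 504 * c * (32 * Real.logb 2 n ^ 5) * off n := by gcongr
        _ = 32256 * (c * G.edgeFinset.card * Real.logb 2 n ^ 5) := by rw [hE']; ring
        _ ≤ 384000000 * (c * G.edgeFinset.card * Real.logb 2 n ^ 5) := by
            gcongr
            norm_num
        _ = _ := by push_cast; ring
    · have hT' : (T : ℝ) ≤ 6000000 * c * Nat.clog 2 n ^ 5 * (off n + 1) := by
        rw [zero_add] at hT
        exact_mod_cast hT
      calc (T : ℝ) ≤ 6000000 * c * Nat.clog 2 n ^ 5 * (off n + 1) := hT'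
        _ ≤ 6000000 * c * (32 * Real.logb 2 n ^ 5) * (2 * (G.edgeFinset.card + 1)) := by
            gcongr
            rw [hE']; linarith
        _ = _ := by push_cast; ring
  · rintro ⟨L, S, R, h⟩
    have hk : 0 < k := (Nat.zero_le _).trans_lt h.2.1
    have hbad := RAM.coinMeasure_goodRound (a := a) hn hm hA h
    set B := {ω | ∀ i < 28 * c * Nat.clog 2 n ^ 4,
      ¬ RAM.GoodRound n k (14 * Nat.clog 2 n) (relOf G) off ω i} with hB
    set A := {ω | ∃ σ : RAM.State, RAM.Exec w O ω (RAM.algorithm c) (RAM.initState n k off adj) σ ∧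
      (σ.outS n).card < k} with hAdef
    -- Subadditivity of the measure needs no measurability, so only a covering of the space by
    -- success and bad coins is required.
    have hcov : Set.univ ⊆ A ∪ B := fun ω _ => by
      by_cases hω : ω ∈ B
      · exact Or.inr hω
      · left
        obtain ⟨κ, hR, -, -, hsmall⟩ := hrun ω
        obtain ⟨T, -, hx⟩ := hR 0
        refine ⟨κ.st T, hx, ?_⟩
        rw [RAM.card_outS]
        refine hsmall hk fun _ => ?_
        by_contra! hcon
        exact hω hcon
    have h1 : (1 : ℝ) ≤ RAM.coinMeasure.real A + RAM.coinMeasure.real B := by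
      rw [← probReal_univ (μ := RAM.coinMeasure)]
      exact (measureReal_mono hcov).trans (measureReal_union_le _ _)
    linarith
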